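/- **Setting.** Near a point $s$, a *front* $S\subset\mathbb R^3$ is the image of a smooth map $x$ of a neighbourhood of a point of the plane, with a smooth nonvanishing conormal $n$ (so $n\cdot dx=0$), such that $p\mapsto(x(p),[n(p)])$ is a Legendrian immersion into the manifold of contact elements of $\mathbb R^3$. Its dual surface $S^\vee\subset(\mathbb{RP}^3)^\vee$ is the set of its tangent planes. Let $s$ be a swallowtail point of $S$ (the germ of $x$ is equivalent, under local diffeomorphisms of source and target, to $(u,v)\mapsto(3u^4+u^2v,\,4u^3+2uv,\,v)$), and let $S$ be in general position at $s$: $S^\vee$ is a smooth surface near the point $g$ corresponding to $s$ (no parabolic curve of $S$ passes through $s$). At regular points, a point is *elliptic*, *parabolic* or *hyperbolic* if $0$, $1$ or $2$ tangent lines, respectively, have at least $3$-point contact with the surface. The *flecnodal curve* is the closure of the set of regular points at which some tangent line has at least $4$-point contact; its left (right) part consists of the points where that line is a left (right) asymptotic line, that is, a direction along which the tangent plane twists negatively (positively). The *conodal curve* is the closure of the set of contact points of planes tangent at two distinct points. On $S$ write $F$ for the flecnodal curve, $\Sigma$ for the cuspidal edge and $D^\vee$ for the self-intersection line. The swallowtail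 $s$ is *elliptic* (*hyperbolic*) if $D^\vee\setminus\{s\}$ lies locally in the elliptic (hyperbolic) domain. The *cr-invariant* $\rho=\rho(s)$ is the cross-ratio $(\ell_F,\ell_P,\ell_D,\ell_g)$ of the tangent lines, in the contact plane, of the Legendrian curves of contact elements of $S^\vee$ tangent to its flecnodal curve, to its parabolic curve, to its conodal curve, and to the point $g$; for lines of slopes $k_1,k_2,k_3,\infty$ the cross-ratio is $(k_1-k_3)/(k_2-k_3)$. A *semi-cubic cusp* is a curve $\gamma$ with $\gamma'(0)=0$ and $\gamma''(0),\gamma'''(0)$ linearly independent; two cusps point in the same (opposite) direction if their second derivatives at $0$ are positive (negative) multiples of each other. Separation is understood locally on the front $S$, sides are local and strict away from $s$. **Theorem.** The cr-invariant $\rho$ of $s$ is defined and unique, and $\rho\ne1$; $s$ is elliptic if and only if $\rho>1$ and hyperbolic if and only if $\rho<1$. Near $s$, the sets $F$, $\Sigma$, $D^\vee$ are the images of regular smooth curves of the parameter plane through the point of $s$, and $s$ separates $F$ into its left and right branches. If $\rho\neq0,-\frac12$, then $F$ and $\Sigma$ have semi-cubic cusps at $s$ with the same tangent line. Moreover: *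 if $\rho>1$, then $F$ points in the same direction as $\Sigma$ and lies in the domain bounded by $\Sigma$ that does not contain $D^\vee$ ($\Sigma$ separates $F$ from $D^\vee$); * if $0<\rho<1$, then $F$ separates $\Sigma$ from $D^\vee$; * if $-\frac12<\rho<0$, then $D^\vee$ lies between the two branches of $F$ and separates $F$ from $\Sigma$, and $F$ and $\Sigma$ point in the same direction; * if $\rho<-\frac12$, then $F$ and $\Sigma$ point in opposite directions. Let $T$ be the tangent plane of $S$ at $s$. If $\rho<\frac43$, $\rho\ne0,1$, then $T$ intersects $S$ near $s$ along two semi-cubic cusps $C_-^\vee$, $C_+^\vee$ that meet only at $s$, and $C_-^\vee$ points in the same direction as $\Sigma$. If $s$ is elliptic ($1<\rho<\frac43$), $C_+^\vee$ also points in that direction, and, away from $s$, $C_-^\vee$ lies in the elliptic and $C_+^\vee$ in the hyperbolic domain. If $s$ is hyperbolic ($\rho<1$), $C_+^\vee$ points in the opposite direction, and both cusps lie, away from $s$, in the hyperbolic domain. There are seven generic configurations of $F$, $\Sigma$ and $D^\vee$ with respect to $T$: * $(e_1)$ $\rho>\frac43$: $S$ lies locally on one side of $T$, meeting $T$ only at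 $s$. * $(e_2)$ $\frac{\sqrt7}2<\rho<\frac43$: $C_+^\vee$ separates $\Sigma$ from $F$, and $C_-^\vee$ separates $\Sigma$ from $D^\vee$; $F$ and $D^\vee$ lie on one side of $T$, $\Sigma$ on the other. * $(e_3)$ $1<\rho<\frac{\sqrt7}2$: $F$ separates $\Sigma$ from $C_+^\vee$, and $C_-^\vee$ separates $\Sigma$ from $D^\vee$; $F$ and $\Sigma$ lie on one side of $T$, $D^\vee$ on the other. * $(h_1)$ $0<\rho<1$: $C_-^\vee$ separates $F$ from $D^\vee$; $F$ and $\Sigma$ lie on one side of $T$, $D^\vee$ on the other. * $(h_2)$ $-\frac12<\rho<0$: $C_-^\vee$ separates $F$ from $D^\vee$; $\Sigma$ and $D^\vee$ lie on one side of $T$, $F$ on the other. * $(h_{3,1})$ $-\frac{\sqrt7}2<\rho<-\frac12$: $T$ separates $F$ from $\Sigma$ and $D^\vee$, which lie on the same side of $T$. * $(h_{3,2})$ $\rho<-\frac{\sqrt7}2$: $F$, $\Sigma$ and $D^\vee$ lie on the same side of $T$. Every real value $\rho\neq1$ is the cr-invariant of such a swallowtail, so that all seven configurations occur. -/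

import Mathlib

open Set Filter Topology Asymptotics
open scoped ContDiff Matrix

/-! Local differential geometry of wave fronts in `ℝ³` at a swallowtail point, and of the dual
surface. A point of projective space is given by homogeneous coordinates in `ℝ³ × ℝ`. -/

namespace Swallowtail

/-- The parameter plane. -/
abbrev Par : Type := ℝ × ℝ

/-- The ambient affine space `ℝ³`; covectors are given by their coordinates in the same space. -/
abbrev Space : Type := Fin 3 → ℝ

/-- Homogeneous coordinates of a projective 3-space. -/
abbrev Hom : Type := Space × ℝ

/-- Smoothness in a neighbourhood of a point. -/
def SmoothNear {A B : Type*} [NormedAddCommGroup A] [NormedSpace ℝ A]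
    [NormedAddCommGroup B] [NormedSpace ℝ B] (f : A → B) (a : A) : Prop :=
  ∀ᶠ y in 𝓝 a, ContDiffAt ℝ ∞ f y

/-! ### Surfaces in projective space: contact with lines, bitangent planes -/

/-- The surface `[δ]` is immersed at the parameter `p`. -/
def RegularAt (δ : Par → Hom) (p : Par) : Prop :=
  δ p ≠ 0 ∧ ∀ v : Par, fderiv ℝ δ p v ∈ Submodule.span ℝ {δ p} → v = 0

/-- The tangent plane of the surface at `p`, as a linear subspace of the space of
homogeneous coordinates. -/
noncomputable def tangentPlane (δ : Par → Hom) (p : Par) : Submodule ℝ Hom :=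
  Submodule.span ℝ {δ p} ⊔ LinearMap.range (fderiv ℝ δ p).toLinearMap

/-- The tangent line at `p` in the direction `v` has at least `k`-point contact with the surface:
some smooth curve on the surface, with velocity `v` at `p`, stays within `O(t ^ k)` of it. -/
def HasContact (δ : Par → Hom) (p v : Par) (k : ℕ) : Prop :=
  ∃ u : ℝ → Par, SmoothNear u 0 ∧ u 0 = p ∧ deriv u 0 = v ∧
    ∃ α β : ℝ → ℝ,
      (fun t => δ (u t) - α t • δ p - β t • fderiv ℝ δ p v) =O[𝓝 0] (fun t : ℝ => t ^ k)

/-- No tangent line exceeds 2-point contact. -/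
def EllipticAt (δ : Par → Hom) (p : Par) : Prop :=
  RegularAt δ p ∧ ∀ v : Par, v ≠ 0 → ¬ HasContact δ p v 3

/-- Exactly two tangent lines exceed 2-point contact. -/
def HyperbolicAt (δ : Par → Hom) (p : Par) : Prop :=
  RegularAt δ p ∧ ∃ v w : Par, LinearIndependent ℝ ![v, w] ∧
    ∀ u : Par, u ≠ 0 →
      (HasContact δ p u 3 ↔ u ∈ Submodule.span ℝ {v} ∨ u ∈ Submodule.span ℝ {w})

/-- Exactly one tangent line exceeds 2-point contact. -/
def ParabolicAt (δ : Par → Hom) (p : Par) : Prop :=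
  RegularAt δ p ∧ ∃ v : Par, v ≠ 0 ∧
    ∀ u : Par, u ≠ 0 → (HasContact δ p u 3 ↔ u ∈ Submodule.span ℝ {v})

/-- The parabolic curve. -/
def parabolicSet (δ : Par → Hom) : Set Par := {p | ParabolicAt δ p}

/-- The flecnodal curve: the closure of the set of regular points at which some tangent line
exceeds 3-point contact. -/
def flecnodalSet (δ : Par → Hom) : Set Par :=
  closure {p | RegularAt δ p ∧ ∃ v : Par, v ≠ 0 ∧ HasContact δ p v 4}

/-- The conodal curve of the piece of surface over `W`: the closure of the set of points of
contact with planes that are tangent at two distinct points. -/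
def conodalSet (δ : Par → Hom) (W : Set Par) : Set Par :=
  closure {p | p ∈ W ∧ ∃ q ∈ W, q ≠ p ∧ tangentPlane δ q = tangentPlane δ p}

/-- The regular smooth curve `c` parametrizes, as a germ at `s`, the set `A W` for all
sufficiently small neighbourhoods `W` of `s`. -/
def ParametrizesGerm (c : ℝ → Par) (s : Par) (A : Set Par → Set Par) : Prop :=
  SmoothNear c 0 ∧ c 0 = s ∧ deriv c 0 ≠ 0 ∧
    ∃ V ∈ 𝓝 s, ∀ W ∈ 𝓝 s, W ⊆ V →
      ∀ᶠ ε in 𝓝[>] (0 : ℝ), ∀ᶠ p in 𝓝 s, (p ∈ A W ↔ p ∈ c '' Ioo (-ε) ε)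

/-! ### The cr-invariant of a godron -/

/-- The determinant of two vectors of a plane. -/
def det2 (a b : ℝ × ℝ) : ℝ := a.1 * b.2 - a.2 * b.1

/-- The cross-ratio of the four lines spanned by `a`, `b`, `c`, `d` in a plane; for lines of
slopes `k₁, k₂, k₃, ∞` it is `(k₁ - k₃) / (k₂ - k₃)`. -/
noncomputable def crossRatio (a b c d : ℝ × ℝ) : ℝ :=
  (det2 a c * det2 b d) / (det2 b c * det2 a d)

/-- The curve of contact elements tangent to the curve `c`, in the coordinates
`(x, y, p = dy/dx)`, where `(x, y)` are the linear coordinates `e` of the parameter plane. -/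
noncomputable def legendrianLift (e : Par ≃L[ℝ] ℝ × ℝ) (c : ℝ → Par) (t : ℝ) : ℝ × ℝ × ℝ :=
  ((e (c t)).1, (e (c t)).2,
    deriv (fun τ => (e (c τ)).2) t / deriv (fun τ => (e (c τ)).1) t)

/-- The tangent vector at `t = 0` of the Legendrian lift of a curve tangent to the `x`-axis. It
lies in the contact plane `dy = 0`, whose coordinates are `(x, p)`. -/
noncomputable def legendrianTangent (e : Par ≃L[ℝ] ℝ × ℝ) (c : ℝ → Par) : ℝ × ℝ :=
  ((deriv (legendrianLift e c) 0).1, (deriv (legendrianLift e c) 0).2.2)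

/-- The surface `[δ]` has at `s` mutually tangent smooth flecnodal, parabolic and conodal curves,
and `ρ` is the cross-ratio of the tangent lines of their Legendrian lifts and of the fibre of the
contact elements at `s` (which is spanned by `(0, 1)` in the contact plane). -/
def HasCrInvariant (δ : Par → Hom) (s : Par) (ρ : ℝ) : Prop :=
  ∃ (e : Par ≃L[ℝ] ℝ × ℝ) (cF cP cD : ℝ → Par),
    ParametrizesGerm cF s (fun _ => flecnodalSet δ) ∧
    ParametrizesGerm cP s (fun _ => parabolicSet δ) ∧
    ParametrizesGerm cD s (conodalSet δ) ∧
    (e (deriv cF 0)).2 = 0 ∧ (e (deriv cP 0)).2 = 0 ∧ (e (deriv cD 0)).2 = 0 ∧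
    ρ = crossRatio (legendrianTangent e cF) (legendrianTangent e cP)
          (legendrianTangent e cD) (0, 1)

/-! ### Fronts and swallowtails -/

/-- `x` is a front near `s`, with conormal `n`: the map `p ↦ (x p, [n p])` is a Legendrian
immersion into the manifold of contact elements of `ℝ³`. -/
def IsFront (x n : Par → Space) (s : Par) : Prop :=
  SmoothNear x s ∧ SmoothNear n s ∧
    ∀ᶠ p in 𝓝 s, n p ≠ 0 ∧ (∀ v : Par, n p ⬝ᵥ fderiv ℝ x p v = 0) ∧
      ∀ v : Par, fderiv ℝ x p v = 0 → fderiv ℝ n p v ∈ Submodule.span ℝ {n p} → v = 0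

/-- The standard swallowtail. -/
noncomputable def standardSwallowtail (q : Par) : Space :=
  ![3 * q.1 ^ 4 + q.1 ^ 2 * q.2, 4 * q.1 ^ 3 + 2 * q.1 * q.2, q.2]

/-- The germ of `x` at `s` is the standard swallowtail up to local diffeomorphisms of the source
and of the target. -/
def IsSwallowtailAt (x : Par → Space) (s : Par) : Prop :=
  ∃ (φ : Par → Par) (Ψ : Space → Space),
    SmoothNear φ 0 ∧ φ 0 = s ∧ Function.Bijective (fderiv ℝ φ 0) ∧
    SmoothNear Ψ 0 ∧ Function.Bijective (fderiv ℝ Ψ 0) ∧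
    ∀ᶠ q in 𝓝 (0 : Par), x (φ q) = Ψ (standardSwallowtail q)

/-- The front itself, in homogeneous coordinates. -/
def homog (x : Par → Space) (p : Par) : Hom := (x p, 1)

/-- The dual surface (the image of the tangential map): the tangent plane `n · X = n · x`
of the front has homogeneous coordinates `(n, - n · x)`. -/
def dualSurface (x n : Par → Space) (p : Par) : Hom := (n p, -(n p ⬝ᵥ x p))

/-- A swallowtail point of a front in general position: the dual surface is smooth there (no
parabolic curve passes through the swallowtail point). -/
def IsGenericSwallowtail (x n : Par → Space) (s : Par) : Prop :=
  IsFront x n s ∧ IsSwallowtailAt x s ∧ RegularAt (dualSurface x n) s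

/-- The cr-invariant of a swallowtail point: that of the godron of the dual surface. -/
def IsCrInvariant (x n : Par → Space) (s : Par) (ρ : ℝ) : Prop :=
  HasCrInvariant (dualSurface x n) s ρ

/-- The (preimage of the) cuspidal edge, swallowtail point included. -/
def cuspidalEdge (x : Par → Space) : Set Par := {p | ¬ RegularAt (homog x) p}

/-- The (preimage of the) self-intersection line of the piece of front over `W`. -/
def selfIntersection (x : Par → Space) (W : Set Par) : Set Par :=
  closure {p | p ∈ W ∧ ∃ q ∈ W, q ≠ p ∧ x q = x p}

/-- The self-intersection line is locally contained in the elliptic domain. -/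
def IsEllipticSwallowtail (x : Par → Space) (s : Par) : Prop :=
  ∃ V ∈ 𝓝 s, ∀ p ∈ V, ∀ q ∈ V, q ≠ p → x q = x p → EllipticAt (homog x) p

/-- The self-intersection line is locally contained in the hyperbolic domain. -/
def IsHyperbolicSwallowtail (x : Par → Space) (s : Par) : Prop :=
  ∃ V ∈ 𝓝 s, ∀ p ∈ V, ∀ q ∈ V, q ≠ p → x q = x p → HyperbolicAt (homog x) p

/-! ### Left and right flecnodal points -/

/-- The twisting of the tangent plane along the direction `v`; for an asymptotic curve its sign
is that of the torsion of the curve. -/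
noncomputable def twist (x n : Par → Space) (p v : Par) : ℝ :=
  Matrix.det (Matrix.of ![fderiv ℝ x p v, n p, fderiv ℝ n p v])

/-- A flecnodal point at which a left asymptotic line exceeds 3-point contact. -/
def IsLeftFlecnodal (x n : Par → Space) (p : Par) : Prop :=
  RegularAt (homog x) p ∧ ∃ v : Par, v ≠ 0 ∧ HasContact (homog x) p v 4 ∧ twist x n p v < 0

/-- A flecnodal point at which a right asymptotic line exceeds 3-point contact. -/
def IsRightFlecnodal (x n : Par → Space) (p : Par) : Prop :=
  RegularAt (homog x) p ∧ ∃ v : Par, v ≠ 0 ∧ HasContact (homog x) p v 4 ∧ 0 < twist x n p v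

/-- One of the two branches of the flecnodal curve `c`, cut at `t = 0`, is its left part and the
other one is its right part. -/
def SeparatesLeftRight (x n : Par → Space) (c : ℝ → Par) : Prop :=
  let L : ℝ → Prop := fun t => IsLeftFlecnodal x n (c t) ∧ ¬ IsRightFlecnodal x n (c t)
  let R : ℝ → Prop := fun t => IsRightFlecnodal x n (c t) ∧ ¬ IsLeftFlecnodal x n (c t)
  ((∀ᶠ t in 𝓝[<] (0 : ℝ), L t) ∧ ∀ᶠ t in 𝓝[>] (0 : ℝ), R t) ∨
    ((∀ᶠ t in 𝓝[<] (0 : ℝ), R t) ∧ ∀ᶠ t in 𝓝[>] (0 : ℝ), L t)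

/-! ### Cusps, sides of the tangent plane, local separation -/

/-- The space curve `γ` has a semi-cubic cusp at `t = 0`. -/
def IsSemicubicCusp (γ : ℝ → Space) : Prop :=
  SmoothNear γ 0 ∧ deriv γ 0 = 0 ∧
    LinearIndependent ℝ ![iteratedDeriv 2 γ 0, iteratedDeriv 3 γ 0]

/-- The cusps `γ₁` and `γ₂` point in the same direction. -/
def SameDirection (γ₁ γ₂ : ℝ → Space) : Prop :=
  ∃ k : ℝ, 0 < k ∧ iteratedDeriv 2 γ₁ 0 = k • iteratedDeriv 2 γ₂ 0

/-- The cusps `γ₁` and `γ₂` point in opposite directions. -/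
def OppositeDirection (γ₁ γ₂ : ℝ → Space) : Prop :=
  ∃ k : ℝ, k < 0 ∧ iteratedDeriv 2 γ₁ 0 = k • iteratedDeriv 2 γ₂ 0

/-- The affine function whose zero set is the tangent plane of the front at `s`. -/
def height (x n : Par → Space) (s p : Par) : ℝ := n s ⬝ᵥ (x p - x s)

/-- Off `s`, the images of `c₁` and `c₂` lie locally strictly on the same side of the tangent
plane at `s`. -/
def SameSide (x n : Par → Space) (s : Par) (c₁ c₂ : ℝ → Par) : Prop :=
  ∃ ε > 0, ∀ t₁ t₂ : ℝ, t₁ ≠ 0 → |t₁| < ε → t₂ ≠ 0 → |t₂| < ε →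
    0 < height x n s (c₁ t₁) * height x n s (c₂ t₂)

/-- Off `s`, the images of `c₁` and `c₂` lie locally strictly on opposite sides of the tangent
plane at `s`. -/
def OppositeSides (x n : Par → Space) (s : Par) (c₁ c₂ : ℝ → Par) : Prop :=
  ∃ ε > 0, ∀ t₁ t₂ : ℝ, t₁ ≠ 0 → |t₁| < ε → t₂ ≠ 0 → |t₂| < ε →
    height x n s (c₁ t₁) * height x n s (c₂ t₂) < 0

/-- On the front, the image of `c` separates locally the image of `a` from the image of `b`:
those images meet the image of `c` only at `x s`, and every connected part of a small piece of
front that meets both of them off `x s` also meets the image of `c`. -/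
def SeparatesLocally (x : Par → Space) (s : Par) (c a b : ℝ → Par) : Prop :=
  ∀ᶠ ε in 𝓝[>] (0 : ℝ),
    (∀ t τ : ℝ, t ≠ 0 → |t| < ε → |τ| < ε → x (a t) ≠ x (c τ) ∧ x (b t) ≠ x (c τ)) ∧
    ∃ W ∈ 𝓝 s, ∀ K : Set Space, K ⊆ x '' W → IsPreconnected K →
      (∃ t : ℝ, t ≠ 0 ∧ |t| < ε ∧ x (a t) ∈ K) → (∃ t : ℝ, t ≠ 0 ∧ |t| < ε ∧ x (b t) ∈ K) →
        ∃ t : ℝ, |t| < ε ∧ x (c t) ∈ K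

/-- The curve `d`, off `t = 0`, lies locally between the two branches of the cusp `γ`: for any
two linear coordinates, `η` transverse to the limit tangent of the cusp and `ξ` along which the
cusp opens, both branches of `γ` cross the level of `η` of each point of `d`, and they do it on
different sides of this point with respect to `ξ`. -/
def LiesBetweenBranches (d γ : ℝ → Space) : Prop :=
  ∀ ξ η : Space →ₗ[ℝ] ℝ, ξ (iteratedDeriv 2 γ 0) = 0 → ξ (iteratedDeriv 3 γ 0) ≠ 0 →
    η (iteratedDeriv 2 γ 0) ≠ 0 →
    ∀ᶠ ε in 𝓝[>] (0 : ℝ), ∀ᶠ t in 𝓝[≠] (0 : ℝ),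
      (∃ τ ∈ Ioo (-ε) 0, η (γ τ) = η (d t)) ∧ (∃ τ ∈ Ioo 0 ε, η (γ τ) = η (d t)) ∧
      ∀ τ₁ ∈ Ioo (-ε) 0, ∀ τ₂ ∈ Ioo 0 ε, η (γ τ₁) = η (d t) → η (γ τ₂) = η (d t) →
        (ξ (γ τ₁) - ξ (d t)) * (ξ (γ τ₂) - ξ (d t)) < 0

/-- The section of the front by its tangent plane at `s` consists locally of the images of the
two regular curves `c₁` and `c₂` of the parameter plane, and these images are semi-cubic cusps
that meet only at `x s`. -/
def TangentSectionIsTwoCusps (x n : Par → Space) (s : Par) (c₁ c₂ : ℝ → Par) : Prop :=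
  (SmoothNear c₁ 0 ∧ c₁ 0 = s ∧ deriv c₁ 0 ≠ 0) ∧ (SmoothNear c₂ 0 ∧ c₂ 0 = s ∧ deriv c₂ 0 ≠ 0) ∧
    (∀ᶠ ε in 𝓝[>] (0 : ℝ), ∀ᶠ p in 𝓝 s,
      (height x n s p = 0 ↔ p ∈ c₁ '' Ioo (-ε) ε ∪ c₂ '' Ioo (-ε) ε)) ∧
    (∃ ε > 0, ∀ t τ : ℝ, |t| < ε → |τ| < ε → x (c₁ t) = x (c₂ τ) → t = 0 ∧ τ = 0) ∧
    IsSemicubicCusp (x ∘ c₁) ∧ IsSemicubicCusp (x ∘ c₂)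

end Swallowtail

/-! Since the dual surface is smooth at the point corresponding to `s`, the front is parametrized
near `s` by its conormals `(a, b, 1)`. In affine coordinates adapted to the limit tangent plane it
is the Legendre front `(f_a, f_b, f - a f_a - b f_b)` of a support function `f`, and the dual
surface is the graph of `-f` (`exists_chart`). Being a swallowtail restricts the 4-jet of `f`, and a
diagonal scaling brings it to `b² / 2 - a² b + ρ a⁴ / 2` plus terms of higher weight, where `a` has
weight 1, `b` has weight 2 and `ρ ≠ 1` (`jets_of_swallowtail`,
`IsGenericSwallowtail.exists_godronForm`).

Every curve of the theorem is then a smooth curve `b = κ a² + O(a³)`, and the substitution `b = t²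
w`, `a = t` reads `κ` off the quasi-homogeneous part. The Hessian determinant gives `κ = 3ρ - 2` for
the cuspidal edge, which is the parabolic curve of the dual surface. The common zeros of the second
and third differentials of `f` give `κ = 2ρ² - ρ` for the flecnodal curve, which is the same for the
front and its dual because the Legendre transform preserves the second differential and changes the
sign of the third one along corresponding directions (`contact_front`). Two parameters of a double
point have, to first order, opposite values of `a`, whereas `f_a ~ 2(ρ - κ) a³` takes the same value
at both; hence `κ = ρ` for the self-intersection line, which is the conodal curve of the dual
surface. The third coordinate of the front gives `κ = 2 ± √(4 - 3ρ)` for the section by the tangent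
plane. The slopes of the Legendrian lifts are affine functions of `κ`, so the cross-ratio is `(2ρ² -
2ρ) / (2ρ - 2) = ρ` (`isCrInvariant_iff`).

Everything else is a comparison of these numbers. A curve of coefficient `κ` has image `(2(ρ - κ)
t³, (κ - 1) t², O(t⁴))` to leading order, so it is a cusp pointing according to the sign of `κ - 1`.
It is elliptic or hyperbolic according to the sign of `6ρ - 4 - 2κ`, and lies on a side of the
tangent plane determined by the sign of `κ² - 4κ + 3ρ`. On the front, separation follows the order
of the coefficients, because the only points identified by the front lie on the self-intersection
line (`separatesLocally_curve`). The inequalities are collected in `configuration` and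
`tangent_configuration`. The quasi-homogeneous polynomial itself realizes every `ρ ≠ 1`. -/

namespace Swallowtail

/-! ### Smooth functions near a point, Hadamard's lemma, inverse and implicit functions -/

section Calculus

variable {A B C : Type} [NormedAddCommGroup A] [NormedSpace ℝ A]
  [NormedAddCommGroup B] [NormedSpace ℝ B] [NormedAddCommGroup C] [NormedSpace ℝ C]

theorem SmoothNear.contDiffAt {f : A → B} {a : A} (h : SmoothNear f a) : ContDiffAt ℝ ∞ f a :=
  h.self_of_nhds

theorem SmoothNear.continuousAt {f : A → B} {a : A} (h : SmoothNear f a) : ContinuousAt f a :=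
  h.contDiffAt.continuousAt

theorem SmoothNear.differentiableAt {f : A → B} {a : A} (h : SmoothNear f a) :
    DifferentiableAt ℝ f a :=
  h.contDiffAt.differentiableAt (by simp)

theorem SmoothNear.eventually {f : A → B} {a : A} (h : SmoothNear f a) :
    ∀ᶠ y in 𝓝 a, SmoothNear f y :=
  eventually_eventually_nhds.2 h

theorem _root_.ContDiff.smoothNear {f : A → B} (h : ContDiff ℝ ∞ f) (a : A) : SmoothNear f a :=
  Eventually.of_forall fun _ => h.contDiffAt

theorem SmoothNear.congr {f g : A → B} {a : A} (h : SmoothNear f a) (hfg : g =ᶠ[𝓝 a] f) :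
    SmoothNear g a := by
  filter_upwards [h, hfg.eventuallyEq_nhds] with y hy hy'
  exact hy.congr_of_eventuallyEq hy'

theorem SmoothNear.comp {g : B → C} {f : A → B} {a : A} (hg : SmoothNear g (f a))
    (hf : SmoothNear f a) : SmoothNear (fun y => g (f y)) a := by
  filter_upwards [hf, hf.continuousAt.eventually hg] with y h1 h2
  exact h2.comp y h1

theorem SmoothNear.prodMk {g : A → C} {f : A → B} {a : A} (hf : SmoothNear f a)
    (hg : SmoothNear g a) : SmoothNear (fun y => (f y, g y)) a := by
  filter_upwards [hf, hg] with y h1 h2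
  exact h1.prodMk h2

/-- The germ of a smooth function is the germ of a globally smooth one. -/
theorem SmoothNear.exists_contDiff [FiniteDimensional ℝ A] {f : A → B} {a : A}
    (h : SmoothNear f a) : ∃ g : A → B, ContDiff ℝ ∞ g ∧ g =ᶠ[𝓝 a] f := by
  obtain ⟨r, hr, hball⟩ := Metric.eventually_nhds_iff_ball.1 h
  -- The bump is 1 near `a` and vanishes outside a closed ball strictly inside the ball where `f` is
  -- smooth, so extending the product by zero is harmless.
  let φ : ContDiffBump a := ⟨r / 3, r / 2, by positivity, by linarith⟩
  refine ⟨fun y => φ y • f y, ?_, ?_⟩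
  · rw [contDiff_iff_contDiffAt]
    intro y
    by_cases hy : y ∈ Metric.ball a r
    · exact φ.contDiff.contDiffAt.smul (hball y hy)
    · have : (fun y => φ y • f y) =ᶠ[𝓝 y] fun _ => 0 := by
        have h1 : (Metric.closedBall a (r / 2))ᶜ ∈ 𝓝 y := by
          apply Metric.isClosed_closedBall.isOpen_compl.mem_nhds
          simp only [Metric.mem_ball, not_lt, mem_compl_iff, Metric.mem_closedBall, not_le] at hy ⊢
          linarith
        filter_upwards [h1] with z hz
        simp only [mem_compl_iff, Metric.mem_closedBall, not_le] at hz
        simp [φ.zero_of_le_dist hz.le]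
      exact contDiffAt_const.congr_of_eventuallyEq this
  · filter_upwards [φ.eventuallyEq_one] with y hy
    simp [hy]

theorem SmoothNear.fderiv_right {f : A → B} {a : A} (h : SmoothNear f a) :
    SmoothNear (fderiv ℝ f) a := by
  filter_upwards [h] with y hy
  exact hy.fderiv_right (by simp)

/-- The inverse function theorem for smooth functions. -/
theorem SmoothNear.exists_local_inverse [CompleteSpace A] {f : A → B} {a : A} {f' : A ≃L[ℝ] B}
    (hf : SmoothNear f a) (hf' : HasFDerivAt f (f' : A →L[ℝ] B) a) :
    ∃ g : B → A, SmoothNear g (f a) ∧ g (f a) = a ∧ (∀ᶠ y in 𝓝 a, g (f y) = y) ∧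
      ∀ᶠ z in 𝓝 (f a), f (g z) = z := by
  set e := hf.contDiffAt.toOpenPartialHomeomorph f hf' (by simp) with he
  have ha : a ∈ e.source := hf.contDiffAt.mem_toOpenPartialHomeomorph_source hf' (by simp)
  have hea : e a = f a := rfl
  have hfa : f a ∈ e.target := hea ▸ e.map_source ha
  have hga : e.symm (f a) = a := by rw [← hea, e.left_inv ha]
  refine ⟨e.symm, ?_, hga, ?_, ?_⟩
  · have hc : ContinuousAt e.symm (f a) := e.symm.continuousAt hfa
    -- Smoothness of the inverse is needed at all nearby points, not only at `f a`; it holds because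
    -- invertible operators form an open set.
    have h1 : ∀ᶠ y in 𝓝 a, ContDiffAt ℝ ∞ f y ∧
        fderiv ℝ f y ∈ range ((↑) : (A ≃L[ℝ] B) → A →L[ℝ] B) := by
      refine hf.and (hf.fderiv_right.continuousAt.eventually ?_)
      rw [hf'.fderiv]
      exact ContinuousLinearEquiv.nhds f'
    have h2 := hc.eventually (hga.symm ▸ h1)
    filter_upwards [h2, e.open_target.mem_nhds hfa] with z ⟨hz1, L, hL⟩ hz2
    refine e.contDiffAt_symm (f₀' := L) hz2 ?_ hz1
    rw [hL]
    exact (hz1.differentiableAt (by simp)).hasFDerivAt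
  · filter_upwards [e.open_source.mem_nhds ha] with y hy
    exact e.left_inv hy
  · filter_upwards [e.open_target.mem_nhds hfa] with y hy
    exact e.right_inv hy

/-- The implicit function theorem for one smooth equation in one unknown. -/
theorem exists_implicit [FiniteDimensional ℝ A] {G : A × ℝ → ℝ} {a : A} {w c : ℝ}
    (hG : SmoothNear G (a, w)) (h0 : G (a, w) = 0)
    (hc : HasDerivAt (fun z => G (a, z)) c w) (hc0 : c ≠ 0) :
    ∃ g : A → ℝ, ContDiff ℝ ∞ g ∧ g a = w ∧
      ∀ᶠ q in 𝓝 (a, w), G q = 0 ↔ q.2 = g q.1 := by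
  have : CompleteSpace A := FiniteDimensional.complete ℝ A
  -- The implicit function is the last coordinate of the inverse of `(x, z) ↦ (x, G (x, z))`,
  -- restricted to the hyperplane where the second entry is zero.
  let Φ : A × ℝ → A × ℝ := fun q => (q.1, G q)
  have hΦ : SmoothNear Φ (a, w) := (contDiff_fst.smoothNear _).prodMk hG
  have hGd : HasFDerivAt G (fderiv ℝ G (a, w)) (a, w) := hG.differentiableAt.hasFDerivAt
  have hcc : fderiv ℝ G (a, w) (0, 1) = c := by
    have h1 : HasDerivAt (fun z : ℝ => (a, z)) (0, 1) w :=
      (hasDerivAt_const w a).prodMk (hasDerivAt_id w)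
    exact (hGd.comp_hasDerivAt w h1).unique hc
  let L : A × ℝ →L[ℝ] A × ℝ := (ContinuousLinearMap.fst ℝ A ℝ).prod (fderiv ℝ G (a, w))
  have hL : HasFDerivAt Φ L (a, w) := hasFDerivAt_fst.prodMk hGd
  have hinj : Function.Injective L := by
    rw [injective_iff_map_eq_zero]
    rintro ⟨x, y⟩ h
    have h1 : x = 0 := congrArg Prod.fst h
    have h2 : fderiv ℝ G (a, w) (x, y) = 0 := congrArg Prod.snd h
    subst h1
    have h3 : ((0 : A), y) = y • ((0 : A), (1 : ℝ)) := by simp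
    rw [h3, map_smul, hcc, smul_eq_mul] at h2
    have : y = 0 := by simpa [hc0] using h2
    simp [this]
  let L' : (A × ℝ) ≃L[ℝ] A × ℝ :=
    (LinearEquiv.ofInjectiveEndo (L : A × ℝ →ₗ[ℝ] A × ℝ) hinj).toContinuousLinearEquiv
  have hLL : (L' : (A × ℝ) →L[ℝ] A × ℝ) = L := by ext x <;> rfl
  obtain ⟨g, hg, hg0, hgl, hgr⟩ := hΦ.exists_local_inverse (f' := L') (hLL ▸ hL)
  have hΦ0 : Φ (a, w) = (a, 0) := by simp [Φ, h0]
  rw [hΦ0] at hg hg0 hgr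
  have hs : SmoothNear (fun x : A => (g (x, 0)).2) a :=
    SmoothNear.comp (g := Prod.snd) (contDiff_snd.smoothNear _)
      (SmoothNear.comp (g := g) (f := fun x : A => (x, (0 : ℝ))) hg
        ((contDiff_id.prodMk contDiff_const).smoothNear a))
  obtain ⟨k, hk, hkg⟩ := hs.exists_contDiff
  refine ⟨k, hk, by simpa [hg0] using hkg.self_of_nhds, ?_⟩
  have t1 : Tendsto (fun q : A × ℝ => (q.1, (0 : ℝ))) (𝓝 (a, w)) (𝓝 (a, 0)) :=
    (Continuous.prodMk continuous_fst continuous_const).tendsto' _ _ rfl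
  have t2 : Tendsto (fun q : A × ℝ => q.1) (𝓝 (a, w)) (𝓝 a) := continuous_fst.tendsto' _ _ rfl
  filter_upwards [hgl, t1.eventually hgr, t2.eventually hkg] with q h1 h2 h3
  constructor
  · intro h
    rw [h3, ← h]
    have : (q.1, G q) = Φ q := rfl
    rw [this, h1]
  · intro h
    rw [h3] at h
    have h4 : (Φ (g (q.1, 0))).1 = q.1 := by rw [h2]
    have h5 : g (q.1, 0) = q := Prod.ext h4 h.symm
    have h6 := congrArg Prod.snd h2
    simpa [h5, Φ] using h6

/-- An integral depending smoothly on a parameter. -/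
theorem contDiff_parametric_integral [FiniteDimensional ℝ A] {F : A × ℝ → B}
    (hF : ContDiff ℝ ∞ F) : ContDiff ℝ ∞ fun p => ∫ s in (0 : ℝ)..1, F (p, s) := by
  -- The codomain is generalized here and in `main`: the derivative is again a parametric integral,
  -- but of an operator-valued function, and the induction hypothesis is applied to that one.
  have key : ∀ {B : Type} [NormedAddCommGroup B] [NormedSpace ℝ B] {F : A × ℝ → B},
      ContDiff ℝ ∞ F → ∀ p, HasFDerivAt (fun p => ∫ s in (0 : ℝ)..1, F (p, s))
        (∫ s in (0 : ℝ)..1, (fderiv ℝ F (p, s)).comp (ContinuousLinearMap.inl ℝ A ℝ)) p := by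
    intro B _ _ F hF p
    have hF' : Continuous fun q : A × ℝ =>
        (fderiv ℝ F q).comp (ContinuousLinearMap.inl ℝ A ℝ) :=
      (hF.continuous_fderiv (by simp)).clm_comp continuous_const
    obtain ⟨C, hC⟩ := ((isCompact_closedBall p 1).prod (isCompact_Icc (a := (0 : ℝ)) (b := 1))
      ).exists_bound_of_continuousOn hF'.continuousOn
    refine intervalIntegral.hasFDerivAt_integral_of_dominated_of_fderiv_le
      (bound := fun _ => C) (F := fun p s => F (p, s))
      (F' := fun p s => (fderiv ℝ F (p, s)).comp (ContinuousLinearMap.inl ℝ A ℝ))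
      (Metric.closedBall_mem_nhds p one_pos) ?_ ?_ ?_ ?_ ?_ ?_
    · exact Eventually.of_forall fun q =>
        (hF.continuous.comp (Continuous.prodMk_right q)).aestronglyMeasurable
    · exact (hF.continuous.comp (Continuous.prodMk_right p)).intervalIntegrable _ _
    · exact (hF'.comp (Continuous.prodMk_right p)).aestronglyMeasurable
    · refine Eventually.of_forall fun t ht x hx => hC (x, t) ⟨hx, ?_⟩
      rw [uIoc_of_le zero_le_one] at ht
      exact ⟨ht.1.le, ht.2⟩
    · exact intervalIntegrable_const
    · refine Eventually.of_forall fun t _ x _ => ?_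
      have h1 : HasFDerivAt F (fderiv ℝ F (x, t)) (x, t) :=
        (hF.differentiable (by simp) _).hasFDerivAt
      have h2 : HasFDerivAt (fun y : A => (y, t)) (ContinuousLinearMap.inl ℝ A ℝ) x :=
        hasFDerivAt_prodMk_left x t
      exact h1.comp x h2
  have main : ∀ n : ℕ, ∀ {B : Type} [NormedAddCommGroup B] [NormedSpace ℝ B] {F : A × ℝ → B},
      ContDiff ℝ ∞ F → ContDiff ℝ n fun p => ∫ s in (0 : ℝ)..1, F (p, s) := by
    intro n
    induction n with
    | zero =>
      intro B _ _ F hF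
      exact contDiff_zero.2 (continuous_iff_continuousAt.2 fun p => (key hF p).continuousAt)
    | succ n ih =>
      intro B _ _ F hF
      push_cast
      rw [contDiff_succ_iff_hasFDerivAt]
      refine ⟨_, ih (F := fun q => (fderiv ℝ F q).comp (ContinuousLinearMap.inl ℝ A ℝ)) ?_,
        fun p => key hF p⟩
      exact (hF.fderiv_right (by simp)).clm_comp contDiff_const
  exact contDiff_infty.2 fun n => main n hF

/-- Hadamard's lemma. -/
theorem exists_eq_mul_of_zero [FiniteDimensional ℝ A] {F : ℝ × A → ℝ} (hF : ContDiff ℝ ∞ F)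
    (h0 : ∀ w, F (0, w) = 0) :
    ∃ G : ℝ × A → ℝ, ContDiff ℝ ∞ G ∧ ∀ t w, F (t, w) = t * G (t, w) := by
  -- The quotient is the mean of the first partial derivative over the segment from `(0, w)` to `(t,
  -- w)`.
  refine ⟨fun q => ∫ s in (0 : ℝ)..1, fderiv ℝ F (s * q.1, q.2) (1, 0), ?_, fun t w => ?_⟩
  · refine contDiff_parametric_integral (A := ℝ × A)
      (F := fun r => fderiv ℝ F (r.2 * r.1.1, r.1.2) (1, 0)) ?_
    have h1 : ContDiff ℝ ∞ (fderiv ℝ F) := hF.fderiv_right (by simp)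
    exact (h1.comp (f := fun r : (ℝ × A) × ℝ => (r.2 * r.1.1, r.1.2)) (by fun_prop)).clm_apply
      contDiff_const
  · have h1 : Continuous fun s : ℝ => fderiv ℝ F (s * t, w) (1, 0) :=
      ((hF.continuous_fderiv (by simp)).comp (f := fun s : ℝ => (s * t, w))
        (by fun_prop)).clm_apply continuous_const
    have h2 : ∀ s ∈ uIcc (0 : ℝ) 1,
        HasDerivAt (fun s : ℝ => F (s * t, w)) (t * fderiv ℝ F (s * t, w) (1, 0)) s := by
      intro s _
      have h3 : HasFDerivAt F (fderiv ℝ F (s * t, w)) (s * t, w) :=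
        (hF.differentiable (by simp) _).hasFDerivAt
      have h4 : HasDerivAt (fun s : ℝ => (s * t, w)) (1 * t, 0) s :=
        ((hasDerivAt_id s).mul_const t).prodMk (hasDerivAt_const s w)
      have h5 := h3.comp_hasDerivAt s h4
      have h6 : ((1 : ℝ) * t, (0 : A)) = t • ((1 : ℝ), (0 : A)) := by simp
      rw [h6, map_smul] at h5
      exact h5
    have h3 := intervalIntegral.integral_eq_sub_of_hasDerivAt h2
      ((continuous_const.mul h1).intervalIntegrable _ _)
    simp only [one_mul, zero_mul, h0, sub_zero] at h3
    rw [← h3, intervalIntegral.integral_const_mul]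

end Calculus

/-! ### Partial derivatives of functions of two variables -/

section Partial

/-- The partial derivative with respect to the first coordinate. -/
noncomputable def pa (F : ℝ × ℝ → ℝ) (q : ℝ × ℝ) : ℝ := fderiv ℝ F q (1, 0)

/-- The partial derivative with respect to the second coordinate. -/
noncomputable def pb (F : ℝ × ℝ → ℝ) (q : ℝ × ℝ) : ℝ := fderiv ℝ F q (0, 1)

variable {F G : ℝ × ℝ → ℝ}

theorem fderiv_eq_partials (F : ℝ × ℝ → ℝ) (q v : ℝ × ℝ) :
    fderiv ℝ F q v = pa F q * v.1 + pb F q * v.2 := by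
  have h : v = v.1 • ((1 : ℝ), (0 : ℝ)) + v.2 • ((0 : ℝ), (1 : ℝ)) := by ext <;> simp
  conv_lhs => rw [h, map_add, map_smul, map_smul]
  simp only [pa, pb, smul_eq_mul]
  ring

theorem contDiff_pa (hF : ContDiff ℝ ∞ F) : ContDiff ℝ ∞ (pa F) :=
  ContDiff.clm_apply (hF.fderiv_right (by simp)) contDiff_const

theorem contDiff_pb (hF : ContDiff ℝ ∞ F) : ContDiff ℝ ∞ (pb F) :=
  ContDiff.clm_apply (hF.fderiv_right (by simp)) contDiff_const

theorem differentiableAt_of_smooth (hF : ContDiff ℝ ∞ F) (q : ℝ × ℝ) : DifferentiableAt ℝ F q :=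
  hF.differentiable (by simp) q

theorem hasFDerivAt_of_smooth (hF : ContDiff ℝ ∞ F) (q : ℝ × ℝ) :
    HasFDerivAt F (fderiv ℝ F q) q :=
  (differentiableAt_of_smooth hF q).hasFDerivAt

/-- The chain rule along a curve. -/
theorem hasDerivAt_comp_curve (hF : DifferentiableAt ℝ F q) {a b : ℝ → ℝ} {a' b' t : ℝ}
    (hq : q = (a t, b t)) (ha : HasDerivAt a a' t) (hb : HasDerivAt b b' t) :
    HasDerivAt (fun t => F (a t, b t)) (pa F q * a' + pb F q * b') t := by
  subst hq
  have h := hF.hasFDerivAt.comp_hasDerivAt t (ha.prodMk hb)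
  rwa [fderiv_eq_partials] at h

theorem pb_pa (hF : ContDiff ℝ ∞ F) : pb (pa F) = pa (pb F) := by
  funext q
  have hd : DifferentiableAt ℝ (fderiv ℝ F) q :=
    (hF.fderiv_right (m := ∞) (by simp)).differentiable (by simp) q
  have h1 : ∀ v w : ℝ × ℝ, fderiv ℝ (fun q => fderiv ℝ F q v) q w = fderiv ℝ (fderiv ℝ F) q w v := by
    intro v w
    rw [fderiv_clm_apply hd (differentiableAt_const v)]
    simp
  have hs : IsSymmSndFDerivAt ℝ F q := hF.contDiffAt.isSymmSndFDerivAt (by simpa using ENat.LEInfty.out)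
  change fderiv ℝ (fun q => fderiv ℝ F q (1, 0)) q (0, 1) =
    fderiv ℝ (fun q => fderiv ℝ F q (0, 1)) q (1, 0)
  rw [h1, h1, hs.eq]

theorem pa_add (hF : ContDiff ℝ ∞ F) (hG : ContDiff ℝ ∞ G) :
    pa (fun q => F q + G q) = fun q => pa F q + pa G q := by
  funext q
  simp only [pa]
  rw [fderiv_fun_add (differentiableAt_of_smooth hF q) (differentiableAt_of_smooth hG q)]
  rfl

theorem pa_mul (hF : ContDiff ℝ ∞ F) (hG : ContDiff ℝ ∞ G) :
    pa (fun q => F q * G q) = fun q => F q * pa G q + G q * pa F q := by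
  funext q
  simp only [pa]
  rw [fderiv_fun_mul (differentiableAt_of_smooth hF q) (differentiableAt_of_smooth hG q)]
  rfl

theorem pa_eq_of_hasFDerivAt {L : ℝ × ℝ →L[ℝ] ℝ} {q : ℝ × ℝ} (h : HasFDerivAt F L q) :
    pa F q = L (1, 0) := by
  rw [pa, h.fderiv]

theorem pb_eq_of_hasFDerivAt {L : ℝ × ℝ →L[ℝ] ℝ} {q : ℝ × ℝ} (h : HasFDerivAt F L q) :
    pb F q = L (0, 1) := by
  rw [pb, h.fderiv]

theorem pa_fst : pa (fun q => q.1) = fun _ => 1 := by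
  funext q; rw [pa_eq_of_hasFDerivAt hasFDerivAt_fst]; rfl

theorem pa_snd : pa (fun q => q.2) = fun _ => 0 := by
  funext q; rw [pa_eq_of_hasFDerivAt hasFDerivAt_snd]; rfl

theorem pa_const (c : ℝ) : pa (fun _ => c) = fun _ => 0 := by
  funext q; rw [pa_eq_of_hasFDerivAt (hasFDerivAt_const c q)]; rfl

theorem contDiff_iterate_pa (hF : ContDiff ℝ ∞ F) (n : ℕ) : ContDiff ℝ ∞ (pa^[n] F) := by
  induction n with
  | zero => exact hF
  | succ n ih => rw [Function.iterate_succ_apply']; exact contDiff_pa ih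

/-- Leibniz's rule stops after two terms when one factor is affine in the first variable. The
truncated exponent `n - 1` at `n = 0` is harmless, being multiplied by `n`. -/
theorem iterate_pa_mul_of_pa_pa_eq_zero {c : ℝ × ℝ → ℝ} (hc : ContDiff ℝ ∞ c)
    (hcc : pa (pa c) = fun _ => 0) (hF : ContDiff ℝ ∞ F) (n : ℕ) :
    pa^[n] (fun q => c q * F q) =
      fun q => c q * pa^[n] F q + n * (pa c q * pa^[n - 1] F q) := by
  induction n with
  | zero => simp
  | succ n ih =>
    have h1 := contDiff_iterate_pa hF
    have h2 := contDiff_pa hc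
    rw [Function.iterate_succ_apply', ih, pa_add (hc.mul (h1 n))
      (contDiff_const.mul (h2.mul (h1 _))), pa_mul hc (h1 n),
      pa_mul contDiff_const (h2.mul (h1 _)), pa_mul h2 (h1 _), hcc, pa_const]
    funext q
    simp only [← Function.iterate_succ_apply' (f := pa)]
    rcases n with _ | n
    · simp [mul_comm]
    · simp only [Nat.succ_eq_add_one, Nat.add_sub_cancel]
      push_cast
      ring

/-- Hadamard's lemma for a function that vanishes to order `n` in the first variable. -/
theorem exists_eq_pow_mul (n : ℕ) (hF : ContDiff ℝ ∞ F)
    (h0 : ∀ i < n, ∀ w, pa^[i] F (0, w) = 0) :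
    ∃ G : ℝ × ℝ → ℝ, ContDiff ℝ ∞ G ∧ (∀ t w, F (t, w) = t ^ n * G (t, w)) ∧
      ∀ w, n.factorial * G (0, w) = pa^[n] F (0, w) := by
  induction n generalizing F with
  | zero => exact ⟨F, hF, by simp, by simp⟩
  | succ n ih =>
    obtain ⟨H, hH, hFH⟩ := exists_eq_mul_of_zero hF (h0 0 n.succ_pos)
    have hF' : F = fun q => q.1 * H q := by funext q; exact hFH q.1 q.2
    -- Differentiating `t * H` at `t = 0` lowers the order by one, so that the vanishing hypotheses
    -- pass from `F` to `H`.
    have key : ∀ i w, pa^[i + 1] F (0, w) = (i + 1) * pa^[i] H (0, w) := by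
      intro i w
      rw [hF', iterate_pa_mul_of_pa_pa_eq_zero contDiff_fst (by rw [pa_fst, pa_const]) hH, pa_fst]
      simp
    obtain ⟨G, hG, hHG, hG0⟩ := ih hH fun i hi w => by
      have h1 := h0 (i + 1) (by omega) w
      rw [key] at h1
      exact (mul_eq_zero.1 h1).resolve_left (by positivity)
    refine ⟨G, hG, fun t w => by rw [hFH, hHG]; ring, fun w => ?_⟩
    rw [key, ← hG0, Nat.factorial_succ]
    push_cast
    ring

/-- The substitution `(a, b) = (t, t ^ 2 * w)`. -/
def blow (g : ℝ × ℝ → ℝ) (q : ℝ × ℝ) : ℝ := g (q.1, q.1 ^ 2 * q.2)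

theorem blow_zero_left (g : ℝ × ℝ → ℝ) (w : ℝ) : blow g (0, w) = g 0 := by
  simp [blow, Prod.zero_eq_mk]

theorem contDiff_blow {g : ℝ × ℝ → ℝ} (hg : ContDiff ℝ ∞ g) : ContDiff ℝ ∞ (blow g) :=
  hg.comp (f := fun q : ℝ × ℝ => (q.1, q.1 ^ 2 * q.2)) (by fun_prop)

theorem pa_blow {g : ℝ × ℝ → ℝ} (hg : ContDiff ℝ ∞ g) :
    pa (blow g) = fun q => blow (pa g) q + (2 * q.1 * q.2) * blow (pb g) q := by
  funext q
  have h1 : HasDerivAt (fun t : ℝ => (t, q.2)) (1, 0) q.1 :=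
    (hasDerivAt_id _).prodMk (hasDerivAt_const _ _)
  have h2 := (hasFDerivAt_of_smooth (contDiff_blow hg) q).comp_hasDerivAt q.1 h1
  have h3 : HasDerivAt (fun t : ℝ => t ^ 2 * q.2) (2 * q.1 * q.2) q.1 := by
    simpa using (hasDerivAt_pow 2 q.1).mul_const q.2
  have h4 := hasDerivAt_comp_curve (differentiableAt_of_smooth hg _) rfl (hasDerivAt_id q.1) h3
  rw [pa, h2.unique h4]
  simp only [blow, id]
  ring

/-- The chain rule multiplies the derivative in `b` by `2 t w`, of which only the first
`t`-derivative survives at `t = 0`. A derivative in `b` thus costs two derivatives in `t`: iterating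
this recursion computes Taylor coefficients graded by the weights 1 and 2. -/
theorem iterate_pa_blow_zero {g : ℝ × ℝ → ℝ} (hg : ContDiff ℝ ∞ g) (n : ℕ) (w : ℝ) :
    pa^[n + 1] (blow g) (0, w) =
      pa^[n] (blow (pa g)) (0, w) + 2 * n * w * pa^[n - 1] (blow (pb g)) (0, w) := by
  have hc : ContDiff ℝ ∞ fun q : ℝ × ℝ => 2 * q.1 * q.2 := by fun_prop
  have h1 : pa (fun q : ℝ × ℝ => 2 * q.1 * q.2) = fun q => 2 * q.2 := by
    rw [pa_mul (by fun_prop) (by fun_prop), pa_mul (by fun_prop) (by fun_prop), pa_fst, pa_snd,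
      pa_const]
    funext q; ring
  have h2 : pa (fun q : ℝ × ℝ => 2 * q.2) = fun _ => 0 := by
    rw [pa_mul (by fun_prop) (by fun_prop), pa_snd, pa_const]
    funext q; ring
  have hadd : ∀ (m : ℕ) {F G : ℝ × ℝ → ℝ}, ContDiff ℝ ∞ F → ContDiff ℝ ∞ G →
      pa^[m] (fun q => F q + G q) = fun q => pa^[m] F q + pa^[m] G q := by
    intro m F G hF hG
    induction m with
    | zero => rfl
    | succ m ih =>
      rw [Function.iterate_succ_apply', ih, pa_add (contDiff_iterate_pa hF m)
        (contDiff_iterate_pa hG m)]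
      simp only [← Function.iterate_succ_apply' (f := pa)]
  have hb := contDiff_blow (contDiff_pb hg)
  rw [Function.iterate_succ_apply, pa_blow hg, hadd n (contDiff_blow (contDiff_pa hg)) (hc.mul hb),
    iterate_pa_mul_of_pa_pa_eq_zero hc (by rw [h1, h2]) hb, h1]
  simp only
  ring

variable {g : ℝ × ℝ → ℝ}

/-- In this lemma and the next three, the hypotheses say that all Taylor coefficients of weight less
than `m = 1, 2, 3, 4` vanish. Then `g (t, t² w)` is divisible by `t ^ m` as a smooth function of
`(t, w)`, and the quotient at `t = 0` is the part of weight `m` evaluated at `(1, w)`. Smoothness of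
the quotient replaces all estimates of remainders. -/
theorem exists_blow_one (hg : ContDiff ℝ ∞ g) (h0 : g 0 = 0) :
    ∃ Φ : ℝ × ℝ → ℝ, ContDiff ℝ ∞ Φ ∧ (∀ t w, g (t, t ^ 2 * w) = t * Φ (t, w)) ∧
      ∀ w, Φ (0, w) = pa g 0 := by
  obtain ⟨Φ, h1, h2, h3⟩ := exists_eq_pow_mul 1 (contDiff_blow hg) fun i hi w => by
    obtain rfl : i = 0 := by omega
    simpa [blow_zero_left] using h0
  refine ⟨Φ, h1, fun t w => by simpa [blow] using h2 t w, fun w => ?_⟩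
  have := h3 w
  rw [iterate_pa_blow_zero hg] at this
  simpa [blow_zero_left] using this

theorem exists_blow_two (hg : ContDiff ℝ ∞ g) (h0 : g 0 = 0) (ha : pa g 0 = 0) :
    ∃ Φ : ℝ × ℝ → ℝ, ContDiff ℝ ∞ Φ ∧ (∀ t w, g (t, t ^ 2 * w) = t ^ 2 * Φ (t, w)) ∧
      ∀ w, Φ (0, w) = pa (pa g) 0 / 2 + w * pb g 0 := by
  obtain ⟨Φ, h1, h2, h3⟩ := exists_eq_pow_mul 2 (contDiff_blow hg) fun i hi w => by
    interval_cases i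
    · simpa [blow_zero_left] using h0
    · rw [iterate_pa_blow_zero hg]; simpa [blow_zero_left] using ha
  refine ⟨Φ, h1, fun t w => by simpa [blow] using h2 t w, fun w => ?_⟩
  have := h3 w
  rw [iterate_pa_blow_zero hg, iterate_pa_blow_zero (contDiff_pa hg)] at this
  simp [blow_zero_left] at this
  linarith

theorem exists_blow_three (hg : ContDiff ℝ ∞ g) (h0 : g 0 = 0) (ha : pa g 0 = 0)
    (hb : pb g 0 = 0) (haa : pa (pa g) 0 = 0) :
    ∃ Φ : ℝ × ℝ → ℝ, ContDiff ℝ ∞ Φ ∧ (∀ t w, g (t, t ^ 2 * w) = t ^ 3 * Φ (t, w)) ∧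
      ∀ w, Φ (0, w) = pa (pa (pa g)) 0 / 6 + w * pa (pb g) 0 := by
  obtain ⟨Φ, h1, h2, h3⟩ := exists_eq_pow_mul 3 (contDiff_blow hg) fun i hi w => by
    interval_cases i
    · simpa [blow_zero_left] using h0
    · rw [iterate_pa_blow_zero hg]; simpa [blow_zero_left] using ha
    · rw [iterate_pa_blow_zero hg, iterate_pa_blow_zero (contDiff_pa hg)]
      simp [blow_zero_left, haa, hb]
  refine ⟨Φ, h1, fun t w => by simpa [blow] using h2 t w, fun w => ?_⟩
  have := h3 w
  rw [iterate_pa_blow_zero hg, iterate_pa_blow_zero (contDiff_pa hg),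
    iterate_pa_blow_zero (contDiff_pa (contDiff_pa hg)),
    iterate_pa_blow_zero (contDiff_pb hg), pb_pa hg] at this
  simp [blow_zero_left, Nat.factorial] at this
  linarith

theorem exists_blow_four (hg : ContDiff ℝ ∞ g) (h0 : g 0 = 0) (ha : pa g 0 = 0)
    (hb : pb g 0 = 0) (haa : pa (pa g) 0 = 0) (hab : pa (pb g) 0 = 0)
    (haaa : pa (pa (pa g)) 0 = 0) :
    ∃ Φ : ℝ × ℝ → ℝ, ContDiff ℝ ∞ Φ ∧ (∀ t w, g (t, t ^ 2 * w) = t ^ 4 * Φ (t, w)) ∧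
      ∀ w, Φ (0, w) = pa (pa (pa (pa g))) 0 / 24 + w * pa (pa (pb g)) 0 / 2
        + w ^ 2 * pb (pb g) 0 / 2 := by
  have ca := contDiff_pa hg
  have cb := contDiff_pb hg
  obtain ⟨Φ, h1, h2, h3⟩ := exists_eq_pow_mul 4 (contDiff_blow hg) fun i hi w => by
    interval_cases i
    · simpa [blow_zero_left] using h0
    · rw [iterate_pa_blow_zero hg]; simpa [blow_zero_left] using ha
    · rw [iterate_pa_blow_zero hg, iterate_pa_blow_zero ca]
      simp [blow_zero_left, haa, hb]
    · rw [iterate_pa_blow_zero hg, iterate_pa_blow_zero ca, iterate_pa_blow_zero (contDiff_pa ca),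
        iterate_pa_blow_zero cb, pb_pa hg]
      simp [blow_zero_left, haaa, hab]
  refine ⟨Φ, h1, fun t w => by simpa [blow] using h2 t w, fun w => ?_⟩
  have := h3 w
  rw [iterate_pa_blow_zero hg, iterate_pa_blow_zero ca,
    iterate_pa_blow_zero (contDiff_pa ca), iterate_pa_blow_zero (contDiff_pa (contDiff_pa ca)),
    iterate_pa_blow_zero cb, iterate_pa_blow_zero (contDiff_pb ca),
    iterate_pa_blow_zero (contDiff_pa cb),
    pb_pa ca, pb_pa hg] at this
  simp [blow_zero_left, Nat.factorial] at this
  linarith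

end Partial

/-! ### Invariance of contact under changes of parameters and of homogeneous coordinates -/

section Invariance

/-- Near `q`, the surface `δ` is the image of the surface `δ'` under the projective map induced
by `L`, up to the change of parameters `σ` (with inverse `τ`). -/
structure SameSurface (δ δ' : Par → Hom) (σ τ : Par → Par) (m : Par → ℝ) (L : Hom ≃L[ℝ] Hom)
    (q : Par) : Prop where
  smooth_σ : SmoothNear σ q
  smooth_τ : SmoothNear τ (σ q)
  left_inv : ∀ᶠ y in 𝓝 q, τ (σ y) = y
  right_inv : ∀ᶠ p in 𝓝 (σ q), σ (τ p) = p
  smooth_m : SmoothNear m q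
  ne_zero : m q ≠ 0
  smooth : SmoothNear δ' q
  eq : ∀ᶠ y in 𝓝 q, δ (σ y) = m y • L (δ' y)

variable {δ δ' : Par → Hom} {σ τ : Par → Par} {m : Par → ℝ} {L : Hom ≃L[ℝ] Hom} {q : Par}

namespace SameSurface

theorem eq' (h : SameSurface δ δ' σ τ m L q) :
    ∀ᶠ p in 𝓝 (σ q), δ p = m (τ p) • L (δ' (τ p)) := by
  have hc : Tendsto τ (𝓝 (σ q)) (𝓝 q) := by
    simpa only [ContinuousAt, h.left_inv.self_of_nhds] using h.smooth_τ.continuousAt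
  filter_upwards [h.right_inv, hc.eventually h.eq] with p h1 h2
  rw [← h2, h1]

theorem smooth' (h : SameSurface δ δ' σ τ m L q) : SmoothNear δ (σ q) := by
  have hc : Tendsto τ (𝓝 (σ q)) (𝓝 q) := by
    simpa only [ContinuousAt, h.left_inv.self_of_nhds] using h.smooth_τ.continuousAt
  filter_upwards [h.eq'.eventually_nhds, h.smooth_τ, hc.eventually h.smooth_m,
    hc.eventually h.smooth] with p h1 h2 h3 h4
  exact ((h3.comp p h2).smul (L.contDiff.contDiffAt.comp p (h4.comp p h2))).congr_of_eventuallyEq h1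

theorem symm (h : SameSurface δ δ' σ τ m L q) :
    SameSurface δ' δ τ σ (fun p => (m (τ p))⁻¹) L.symm (σ q) := by
  have h0 : τ (σ q) = q := h.left_inv.self_of_nhds
  have hc : Tendsto τ (𝓝 (σ q)) (𝓝 q) := by
    simpa only [ContinuousAt, h0] using h.smooth_τ.continuousAt
  have hm : ∀ᶠ p in 𝓝 (σ q), m (τ p) ≠ 0 :=
    hc.eventually (h.smooth_m.continuousAt.eventually_ne h.ne_zero)
  refine ⟨h.smooth_τ, by rw [h0]; exact h.smooth_σ, h.right_inv, by rw [h0]; exact h.left_inv,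
    ?_, by simpa [h0] using h.ne_zero, h.smooth', ?_⟩
  · filter_upwards [h.smooth_τ, hc.eventually h.smooth_m, hm] with p h2 h3 h4
    exact (h3.comp p h2).inv h4
  · filter_upwards [h.eq', hm] with p h1 h2
    rw [h1, map_smul, L.symm_apply_apply, smul_smul, inv_mul_cancel₀ h2, one_smul]

/-- The last term, coming from the derivative of the factor `m`, is a multiple of the point itself;
this is why immersion and contact are formulated modulo that point. -/
theorem fderiv_comp (h : SameSurface δ δ' σ τ m L q) (v : Par) :
    fderiv ℝ δ (σ q) (fderiv ℝ σ q v) =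
      m q • L (fderiv ℝ δ' q v) + (fderiv ℝ m q v) • L (δ' q) := by
  have h1 : HasFDerivAt (fun y => δ (σ y)) ((fderiv ℝ δ (σ q)).comp (fderiv ℝ σ q)) q :=
    h.smooth'.differentiableAt.hasFDerivAt.comp q h.smooth_σ.differentiableAt.hasFDerivAt
  have h2 : HasFDerivAt (fun y => L (δ' y)) ((L : Hom →L[ℝ] Hom).comp (fderiv ℝ δ' q)) q :=
    L.hasFDerivAt.comp q h.smooth.differentiableAt.hasFDerivAt
  have h3 := h.smooth_m.differentiableAt.hasFDerivAt.smul h2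
  have h4 := h1.unique (h3.congr_of_eventuallyEq h.eq)
  have h5 := congrArg (fun T : Par →L[ℝ] Hom => T v) h4
  simpa using h5

theorem hasContact (h : SameSurface δ δ' σ τ m L q) {v : Par} {k : ℕ}
    (hc : HasContact δ' q v k) : HasContact δ (σ q) (fderiv ℝ σ q v) k := by
  obtain ⟨u, hu, hu0, hu1, α, β, hO⟩ := hc
  have huc : Tendsto u (𝓝 0) (𝓝 q) := by simpa only [ContinuousAt, hu0] using hu.continuousAt
  refine ⟨fun t => σ (u t), SmoothNear.comp (by rw [hu0]; exact h.smooth_σ) hu, by simp [hu0], ?_,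
    -- These are the coefficients of `m (u t) • L (α t • δ' q + β t • dδ' v)` in the frame formed by
    -- the image point and the image of the tangent vector; the correction undoes the extra term of
    -- `fderiv_comp`.
    fun t => (m (u t) * α t - m (u t) * β t / m q * fderiv ℝ m q v) / m q,
    fun t => m (u t) * β t / m q, ?_⟩
  · have h1 : HasFDerivAt σ (fderiv ℝ σ q) (u 0) := by
      rw [hu0]; exact h.smooth_σ.differentiableAt.hasFDerivAt
    have h2 := h1.comp_hasDerivAt 0 hu.differentiableAt.hasDerivAt
    rw [hu1] at h2
    exact h2.deriv
  · have hm := h.ne_zero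
    have e : (fun t => δ (σ (u t)) -
        ((m (u t) * α t - m (u t) * β t / m q * fderiv ℝ m q v) / m q) • δ (σ q) -
        (m (u t) * β t / m q) • fderiv ℝ δ (σ q) (fderiv ℝ σ q v)) =ᶠ[𝓝 0]
        fun t => m (u t) • L (δ' (u t) - α t • δ' q - β t • fderiv ℝ δ' q v) := by
      filter_upwards [huc.eventually h.eq] with t ht
      rw [ht, h.fderiv_comp, h.eq.self_of_nhds]
      simp only [map_sub, map_smul, smul_sub, smul_add, smul_smul]
      have e1 : (m (u t) * α t - m (u t) * β t / m q * fderiv ℝ m q v) / m q * m q =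
          m (u t) * α t - m (u t) * β t / m q * fderiv ℝ m q v := by field_simp
      have e2 : m (u t) * β t / m q * m q = m (u t) * β t := by field_simp
      rw [e1, e2, sub_smul]
      abel
    refine IsBigO.congr' ?_ e.symm EventuallyEq.rfl
    have h1 : (fun t => m (u t)) =O[𝓝 0] fun _ => (1 : ℝ) :=
      (h.smooth_m.continuousAt.tendsto.comp huc).isBigO_one ℝ
    have h2 : (fun t => L (δ' (u t) - α t • δ' q - β t • fderiv ℝ δ' q v)) =O[𝓝 0]
        fun t : ℝ => t ^ k :=
      ((L : Hom →L[ℝ] Hom).isBigO_comp _ _).trans hO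
    simpa using h1.smul h2

theorem fderiv_left_inv (h : SameSurface δ δ' σ τ m L q) (v : Par) :
    fderiv ℝ τ (σ q) (fderiv ℝ σ q v) = v := by
  have h1 : HasFDerivAt (fun y => τ (σ y)) ((fderiv ℝ τ (σ q)).comp (fderiv ℝ σ q)) q :=
    h.smooth_τ.differentiableAt.hasFDerivAt.comp q h.smooth_σ.differentiableAt.hasFDerivAt
  have h2 := h1.unique ((hasFDerivAt_id q).congr_of_eventuallyEq h.left_inv)
  exact congrArg (fun T : Par →L[ℝ] Par => T v) h2

theorem hasContact_iff (h : SameSurface δ δ' σ τ m L q) {v : Par} {k : ℕ} :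
    HasContact δ (σ q) (fderiv ℝ σ q v) k ↔ HasContact δ' q v k := by
  refine ⟨fun hc => ?_, h.hasContact⟩
  have h1 := h.symm.hasContact hc
  rwa [h.fderiv_left_inv, h.left_inv.self_of_nhds] at h1

theorem regularAt (h : SameSurface δ δ' σ τ m L q) (hr : RegularAt δ' q) :
    RegularAt δ (σ q) := by
  have h0 : τ (σ q) = q := h.left_inv.self_of_nhds
  refine ⟨?_, fun v hv => ?_⟩
  · rw [h.eq.self_of_nhds]
    exact smul_ne_zero h.ne_zero (L.map_ne_zero_iff.2 hr.1)
  · have hv' : fderiv ℝ σ q (fderiv ℝ τ (σ q) v) = v := by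
      have := h.symm.fderiv_left_inv v
      rwa [h0] at this
    obtain ⟨c, hc⟩ := Submodule.mem_span_singleton.1 hv
    rw [← hv', h.fderiv_comp, h.eq.self_of_nhds] at hc
    have h2 : L (fderiv ℝ δ' q (fderiv ℝ τ (σ q) v)) =
        L ((c - fderiv ℝ m q (fderiv ℝ τ (σ q) v) / m q) • δ' q) := by
      have hm := h.ne_zero
      apply smul_right_injective Hom hm
      simp only
      rw [eq_sub_of_add_eq hc.symm, map_smul, smul_smul, smul_smul, ← sub_smul]
      congr 1
      field_simp
    have h3 := hr.2 _ (Submodule.mem_span_singleton.2 ⟨_, (L.injective h2).symm⟩)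
    rw [← hv', h3, map_zero]

end SameSurface

end Invariance

/-! ### Contact with lines of the surface with equation `z = g` -/

section Graph

/-- Hadamard's lemma in one variable, to order `n`. -/
theorem exists_eq_pow_mul_one {ψ : ℝ → ℝ} (hψ : ContDiff ℝ ∞ ψ) (n : ℕ)
    (h0 : ∀ i < n, deriv^[i] ψ 0 = 0) :
    ∃ G : ℝ → ℝ, ContDiff ℝ ∞ G ∧ (∀ t, ψ t = t ^ n * G t) ∧
      n.factorial * G 0 = deriv^[n] ψ 0 := by
  have hd : ∀ i, ContDiff ℝ ∞ (deriv^[i] ψ) := by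
    intro i
    induction i with
    | zero => exact hψ
    | succ i ih =>
      rw [Function.iterate_succ_apply']
      exact ((contDiff_infty_iff_deriv).1 ih).2
  have h1 : ∀ i, pa^[i] (fun q => ψ q.1) = fun q => deriv^[i] ψ q.1 := by
    intro i
    induction i with
    | zero => rfl
    | succ i ih =>
      rw [Function.iterate_succ_apply', ih]
      funext q
      have h2 : HasFDerivAt (fun q : ℝ × ℝ => deriv^[i] ψ q.1) _ q :=
        ((hd i).differentiable (by simp) q.1).hasDerivAt.comp_hasFDerivAt q
          (hasFDerivAt_fst (𝕜 := ℝ) (E := ℝ) (F := ℝ) (p := q))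
      rw [pa_eq_of_hasFDerivAt h2, Function.iterate_succ_apply']
      simp
  obtain ⟨G, hG, h2, h3⟩ := exists_eq_pow_mul n (F := fun q => ψ q.1) (hψ.comp contDiff_fst)
    fun i hi w => by rw [h1]; exact h0 i hi
  refine ⟨fun t => G (t, 0), hG.comp (contDiff_id.prodMk contDiff_const), fun t => h2 t 0, ?_⟩
  rw [h3 0, h1]

/-- After division by `t ^ k` the left side tends to `G 0`, since `β t ~ t`, and the right side is
`O(t)`. The filter is punctured because nothing is known about `β 0`. -/
theorem eq_zero_of_isBigO_pow {β G : ℝ → ℝ} {k : ℕ} (hβ : Tendsto (fun t => β t / t) (𝓝[≠] 0) (𝓝 1))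
    (hG : ContinuousAt G 0)
    (h : (fun t => β t ^ k * G (β t)) =O[𝓝[≠] 0] fun t : ℝ => t ^ (k + 1)) : G 0 = 0 := by
  have h1 : Tendsto (fun t : ℝ => t) (𝓝[≠] 0) (𝓝 0) := tendsto_id.mono_left nhdsWithin_le_nhds
  have hb : Tendsto β (𝓝[≠] 0) (𝓝 0) := by
    have := hβ.mul h1
    rw [one_mul] at this
    refine this.congr' ?_
    filter_upwards [self_mem_nhdsWithin] with t ht
    exact div_mul_cancel₀ _ ht
  have h2 : Tendsto (fun t => (β t / t) ^ k * G (β t)) (𝓝[≠] 0) (𝓝 (1 ^ k * G 0)) :=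
    (hβ.pow k).mul (hG.tendsto.comp hb)
  have h3 : (fun t => (β t / t) ^ k * G (β t)) =O[𝓝[≠] 0] fun t : ℝ => t := by
    obtain ⟨c, hc⟩ := h.bound
    refine IsBigO.of_bound c ?_
    filter_upwards [hc, self_mem_nhdsWithin] with t ht ht0
    have ht0' : (t : ℝ) ≠ 0 := ht0
    have e : (β t / t) ^ k * G (β t) = (β t ^ k * G (β t)) / t ^ k := by
      rw [div_pow]; ring
    rw [e, norm_div, div_le_iff₀ (norm_pos_iff.2 (pow_ne_zero k ht0'))]
    refine ht.trans (le_of_eq ?_)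
    rw [norm_pow, norm_pow]
    ring
  have h4 := tendsto_nhds_unique h2 (h3.trans_tendsto h1)
  simpa using h4

/-- In homogeneous coordinates, the graph of `-g`, which is also the surface dual to the front
of the tangent planes of the graph of `g`. -/
def dualGraph (g : Par → ℝ) (p : Par) : Hom := (![p.1, p.2, 1], -g p)

variable {g : Par → ℝ} {p v : Par}

theorem smoothNear_dualGraph (hg : SmoothNear g p) : SmoothNear (dualGraph g) p := by
  filter_upwards [hg] with y hy
  refine ContDiffAt.prodMk ?_ hy.neg
  rw [contDiffAt_pi]
  intro i
  fin_cases i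
  · exact contDiffAt_fst
  · exact contDiffAt_snd
  · exact contDiffAt_const

theorem fderiv_dualGraph (hg : DifferentiableAt ℝ g p) (v : Par) :
    fderiv ℝ (dualGraph g) p v = (![v.1, v.2, 0], -fderiv ℝ g p v) := by
  have h1 : HasFDerivAt (fun p : Par => (![p.1, p.2, 1] : Space))
      (ContinuousLinearMap.pi ![ContinuousLinearMap.fst ℝ ℝ ℝ, ContinuousLinearMap.snd ℝ ℝ ℝ, 0])
      p := by
    rw [hasFDerivAt_pi']
    intro i
    fin_cases i
    · exact hasFDerivAt_fst
    · exact hasFDerivAt_snd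
    · exact hasFDerivAt_const _ _
  have h2 : HasFDerivAt (dualGraph g) _ p := h1.prodMk hg.hasFDerivAt.neg
  rw [h2.fderiv]
  ext i
  · fin_cases i <;> simp
  · simp

theorem regularAt_dualGraph (hg : DifferentiableAt ℝ g p) : RegularAt (dualGraph g) p := by
  refine ⟨fun h => ?_, fun v hv => ?_⟩
  · have := congrArg (fun X : Hom => X.1 2) h
    simp [dualGraph] at this
  · obtain ⟨c, hc⟩ := Submodule.mem_span_singleton.1 hv
    rw [fderiv_dualGraph hg] at hc
    have h0 := congrArg (fun X : Hom => X.1 0) hc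
    have h1 := congrArg (fun X : Hom => X.1 1) hc
    have h2 := congrArg (fun X : Hom => X.1 2) hc
    simp [dualGraph] at h0 h1 h2
    subst h2
    rw [zero_mul] at h0 h1
    exact Prod.ext h0.symm h1.symm

/-- The contact curve need not project to a straight line. The constant coordinate 1 forces `α = 1 +
O(t ^ k)`, hence `u t = p + β t • v + O(t ^ k)`. As `g` is Lipschitz near `p`, replacing `u t` by a
point of the line costs only `O(t ^ k)`, and contact is measured by `g` along the line. -/
theorem exists_of_hasContact_dualGraph (hg : SmoothNear g p) (hv : v ≠ 0) {k : ℕ} (hk : 2 ≤ k)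
    (h : HasContact (dualGraph g) p v k) :
    ∃ β : ℝ → ℝ, Tendsto (fun t => β t / t) (𝓝[≠] 0) (𝓝 1) ∧
      (fun t => g (p + β t • v) - g p - β t * fderiv ℝ g p v) =O[𝓝 0] fun t : ℝ => t ^ k := by
  obtain ⟨u, hu, hu0, hu1, α, β, hO⟩ := h
  have hpow : Tendsto (fun t : ℝ => t ^ k) (𝓝 0) (𝓝 0) := by
    have := (continuous_pow (M := ℝ) k).tendsto 0
    rwa [zero_pow (by omega)] at this
  have comp : ∀ T : Hom →L[ℝ] ℝ, (fun t => T (dualGraph g (u t)) - α t * T (dualGraph g p) -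
      β t * T (fderiv ℝ (dualGraph g) p v)) =O[𝓝 0] fun t : ℝ => t ^ k := by
    intro T
    refine ((T.isBigO_comp _ _).trans hO).congr_left fun t => ?_
    simp
  let pr : Fin 3 → Hom →L[ℝ] ℝ := fun i =>
    (ContinuousLinearMap.proj i).comp (ContinuousLinearMap.fst ℝ Space ℝ)
  have c0 := comp (pr 0)
  have c1 := comp (pr 1)
  have c2 := comp (pr 2)
  have c3 := comp (ContinuousLinearMap.snd ℝ Space ℝ)
  rw [fderiv_dualGraph hg.differentiableAt] at c0 c1 c2 c3
  simp [pr, dualGraph] at c0 c1 c2 c3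
  have hr : (fun t => u t - (p + β t • v)) =O[𝓝 0] fun t : ℝ => t ^ k := by
    refine IsBigO.prod_left ?_ ?_
    · refine (c0.sub (c2.const_mul_left p.1)).congr_left fun t => ?_
      simp; ring
    · refine (c1.sub (c2.const_mul_left p.2)).congr_left fun t => ?_
      simp; ring
  have hu' : HasDerivAt u v 0 := hu1 ▸ hu.differentiableAt.hasDerivAt
  have hrt : Tendsto (fun t => t⁻¹ • (u t - (p + β t • v))) (𝓝[≠] 0) (𝓝 0) := by
    have h1 : (fun t : ℝ => t⁻¹ • (u t - (p + β t • v))) =O[𝓝[≠] 0] fun t : ℝ => t ^ (k - 1) := by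
      obtain ⟨c, hc⟩ := (hr.mono (nhdsWithin_le_nhds (s := {0}ᶜ))).bound
      refine IsBigO.of_bound c ?_
      filter_upwards [hc, self_mem_nhdsWithin] with t ht ht0
      have ht0' : 0 < ‖t‖ := norm_pos_iff.2 ht0
      rw [norm_smul, norm_inv, inv_mul_le_iff₀ ht0']
      refine ht.trans (le_of_eq ?_)
      rw [norm_pow, norm_pow]
      obtain ⟨j, rfl⟩ : ∃ j, k = j + 1 := ⟨k - 1, by omega⟩
      simp; ring
    refine h1.trans_tendsto ?_
    have := ((continuous_pow (M := ℝ) (k - 1)).tendsto 0).mono_left (nhdsWithin_le_nhds (s := {0}ᶜ))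
    rwa [zero_pow (by omega)] at this
  have hβv : Tendsto (fun t => (β t / t) • v) (𝓝[≠] 0) (𝓝 v) := by
    have h1 := (hasDerivAt_iff_tendsto_slope.1 hu').sub hrt
    rw [sub_zero] at h1
    refine h1.congr fun t => ?_
    rw [slope_def_module, hu0, sub_zero, ← smul_sub]
    have : u t - p - (u t - (p + β t • v)) = β t • v := by abel
    rw [this, smul_smul]
    congr 1
    ring
  have hβ : Tendsto (fun t => β t / t) (𝓝[≠] 0) (𝓝 1) := by
    have key : ∀ T : Par →L[ℝ] ℝ, T v ≠ 0 → Tendsto (fun t => β t / t) (𝓝[≠] 0) (𝓝 1) := by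
      intro T hT
      have h1 := ((T.continuous.tendsto v).comp hβv).div_const (T v)
      rw [div_self hT] at h1
      refine h1.congr fun t => ?_
      simp [hT]
    by_cases h1 : v.1 = 0
    · have h2 : v.2 ≠ 0 := fun h2 => hv (Prod.ext h1 h2)
      exact key (ContinuousLinearMap.snd ℝ ℝ ℝ) h2
    · exact key (ContinuousLinearMap.fst ℝ ℝ ℝ) h1
  refine ⟨β, hβ, ?_⟩
  have ht1 : Tendsto u (𝓝 0) (𝓝 p) := by simpa only [ContinuousAt, hu0] using hu.continuousAt
  have ht2 : Tendsto (fun t => p + β t • v) (𝓝 0) (𝓝 p) := by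
    have := ht1.sub (hr.trans_tendsto hpow)
    rw [sub_zero] at this
    exact this.congr fun t => by abel
  have hL := (hg.contDiffAt.hasStrictFDerivAt (by simp)).isBigO_sub.comp_tendsto
    (ht1.prodMk_nhds ht2)
  have hL' : (fun t => g (u t) - g (p + β t • v)) =O[𝓝 0] fun t : ℝ => t ^ k := hL.trans hr
  refine ((c3.neg_left.sub hL').sub (c2.const_mul_left (g p))).congr_left fun t => ?_
  ring

theorem hasContact_dualGraph_of_isBigO (hg : SmoothNear g p) {k : ℕ}
    (h : (fun t : ℝ => g (p + t • v) - g p - t * fderiv ℝ g p v) =O[𝓝 0] fun t : ℝ => t ^ k) :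
    HasContact (dualGraph g) p v k := by
  have hd : HasDerivAt (fun t : ℝ => p + t • v) v 0 := by
    simpa using ((hasDerivAt_id (0 : ℝ)).smul_const v).const_add p
  refine ⟨fun t => p + t • v, ContDiff.smoothNear (by fun_prop) 0, by simp, hd.deriv,
    fun _ => 1, fun t => t, ?_⟩
  rw [fderiv_dualGraph hg.differentiableAt]
  refine IsBigO.prod_left ?_ ?_
  · refine (isBigO_zero _ _).congr_left fun t => ?_
    ext i
    fin_cases i <;> simp [dualGraph]
  · refine h.neg_left.congr_left fun t => ?_
    simp [dualGraph]
    ring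

/-- Contact of the surface with a tangent line in terms of the restriction of `g` to the line. -/
theorem hasContact_dualGraph_iff (hg : SmoothNear g p) (hv : v ≠ 0) :
    (HasContact (dualGraph g) p v 3 ↔ deriv (deriv fun s : ℝ => g (p + s • v)) 0 = 0) ∧
    (HasContact (dualGraph g) p v 4 ↔ deriv (deriv fun s : ℝ => g (p + s • v)) 0 = 0 ∧
      deriv (deriv (deriv fun s : ℝ => g (p + s • v))) 0 = 0) := by
  have hline : Tendsto (fun s : ℝ => p + s • v) (𝓝 0) (𝓝 p) :=
    Continuous.tendsto' (by fun_prop) _ _ (by simp)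
  have hφ : SmoothNear (fun s : ℝ => g (p + s • v)) 0 :=
    SmoothNear.comp (f := fun s : ℝ => p + s • v) (by simpa using hg)
      (ContDiff.smoothNear (by fun_prop) 0)
  have hφ' : HasDerivAt (fun s : ℝ => g (p + s • v)) (fderiv ℝ g p v) 0 := by
    have hd : HasDerivAt (fun t : ℝ => p + t • v) v 0 := by
      simpa using ((hasDerivAt_id (0 : ℝ)).smul_const v).const_add p
    have h1 : HasFDerivAt g (fderiv ℝ g p) (p + (0 : ℝ) • v) := by
      simpa using hg.differentiableAt.hasFDerivAt
    exact h1.comp_hasDerivAt 0 hd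
  obtain ⟨φ, hφs, hφe⟩ := hφ.exists_contDiff
  have hd2 : deriv (deriv fun s : ℝ => g (p + s • v)) 0 = deriv (deriv φ) 0 :=
    (hφe.deriv.deriv_eq).symm
  have hd3 : deriv (deriv (deriv fun s : ℝ => g (p + s • v))) 0 = deriv (deriv (deriv φ)) 0 :=
    (hφe.deriv.deriv.deriv_eq).symm
  rw [hd2, hd3]
  -- The restriction of `g` to the line minus its tangent: the value and the first derivative vanish
  -- at 0, and contact of order `k` means that all derivatives of order less than `k` do.
  let R : ℝ → ℝ := fun s => φ s - g p - s * fderiv ℝ g p v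
  have hφd : ∀ s, HasDerivAt φ (deriv φ s) s := fun s =>
    (hφs.differentiable (by simp) s).hasDerivAt
  have hR : ContDiff ℝ ∞ R := by fun_prop
  have hR1 : deriv R = fun s => deriv φ s - fderiv ℝ g p v := by
    funext s
    have := ((hφd s).sub_const (g p)).sub ((hasDerivAt_id s).mul_const (fderiv ℝ g p v))
    rw [one_mul] at this
    exact this.deriv
  have hR2 : deriv (deriv R) = deriv (deriv φ) := by
    rw [hR1]; funext s; exact deriv_sub_const _
  have hφ0 : φ 0 = g p := by simpa using hφe.self_of_nhds
  have hφ1 : deriv φ 0 = fderiv ℝ g p v := by rw [hφe.deriv_eq]; exact hφ'.deriv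
  have hR0 : R 0 = 0 := by simp [R, hφ0]
  have hR10 : deriv R 0 = 0 := by simp [hR1, hφ1]
  have hRe : ∀ {β : ℝ → ℝ} {l : Filter ℝ}, Tendsto β l (𝓝 0) →
      (fun t => g (p + β t • v) - g p - β t * fderiv ℝ g p v) =ᶠ[l] fun t => R (β t) := by
    intro β l hβ
    filter_upwards [hβ.eventually hφe] with t ht
    simp only [R]
    rw [ht]
  obtain ⟨G2, hG2, hRG2, hG20⟩ := exists_eq_pow_mul_one hR 2 fun i hi => by
    interval_cases i
    · exact hR0
    · exact hR10
  have hG20' : 2 * G2 0 = deriv (deriv φ) 0 := by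
    rw [← hR2]; simpa using hG20
  have necc : ∀ k, 3 ≤ k → HasContact (dualGraph g) p v k → ∃ β : ℝ → ℝ,
      Tendsto (fun t => β t / t) (𝓝[≠] 0) (𝓝 1) ∧
        (fun t => R (β t)) =O[𝓝[≠] 0] fun t : ℝ => t ^ k := by
    intro k hk hc
    obtain ⟨β, hβ, hO⟩ := exists_of_hasContact_dualGraph hg hv (by omega) hc
    have h1 : Tendsto (fun t : ℝ => t) (𝓝[≠] 0) (𝓝 0) := tendsto_id.mono_left nhdsWithin_le_nhds
    have hb : Tendsto β (𝓝[≠] 0) (𝓝 0) := by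
      have := hβ.mul h1
      rw [one_mul] at this
      refine this.congr' ?_
      filter_upwards [self_mem_nhdsWithin] with t ht
      exact div_mul_cancel₀ _ ht
    exact ⟨β, hβ, (hO.mono nhdsWithin_le_nhds).congr' (hRe hb) EventuallyEq.rfl⟩
  have suff : ∀ k, (∀ i < k, deriv^[i] R 0 = 0) → HasContact (dualGraph g) p v k := by
    intro k hk
    obtain ⟨G, hG, hRG, -⟩ := exists_eq_pow_mul_one hR k hk
    refine hasContact_dualGraph_of_isBigO hg ?_
    refine IsBigO.congr' ?_ (hRe (β := fun t => t) tendsto_id).symm EventuallyEq.rfl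
    have h1 : (fun t => t ^ k * G t) =O[𝓝 0] fun t : ℝ => t ^ k * 1 :=
      (isBigO_refl _ _).mul (hG.continuous.continuousAt.isBigO_one ℝ)
    simpa [hRG] using h1
  have h3 : ∀ k, 3 ≤ k → HasContact (dualGraph g) p v k → G2 0 = 0 := by
    intro k hk hc
    obtain ⟨β, hβ, hO⟩ := necc k hk hc
    refine eq_zero_of_isBigO_pow (k := 2) hβ hG2.continuous.continuousAt ?_
    simp only [hRG2] at hO
    refine hO.trans ?_
    have h1 : (fun t : ℝ => t ^ 3 * t ^ (k - 3)) =O[𝓝[≠] 0] fun t : ℝ => t ^ 3 * 1 :=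
      (isBigO_refl _ _).mul
        (((continuous_pow (k - 3)).continuousAt.isBigO_one ℝ).mono nhdsWithin_le_nhds)
    simpa [← pow_add, Nat.add_sub_cancel' hk] using h1
  refine ⟨⟨fun hc => ?_, fun h => ?_⟩, fun hc => ?_, fun h => ?_⟩
  · rw [← hG20', h3 3 le_rfl hc, mul_zero]
  · refine suff 3 fun i hi => ?_
    interval_cases i
    · exact hR0
    · exact hR10
    · simpa [hR2] using h
  · have h4 := h3 4 (by norm_num) hc
    have h5 : deriv (deriv R) 0 = 0 := by rw [hR2, ← hG20', h4, mul_zero]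
    obtain ⟨G3, hG3, hRG3, hG30⟩ := exists_eq_pow_mul_one hR 3 fun i hi => by
      interval_cases i
      · exact hR0
      · exact hR10
      · exact h5
    obtain ⟨β, hβ, hO⟩ := necc 4 (by norm_num) hc
    have h6 : G3 0 = 0 := by
      refine eq_zero_of_isBigO_pow (k := 3) hβ hG3.continuous.continuousAt ?_
      simpa only [hRG3] using hO
    refine ⟨by rw [← hR2, h5], ?_⟩
    rw [h6, mul_zero] at hG30
    rw [← hR2]
    exact hG30.symm
  · refine suff 4 fun i hi => ?_
    interval_cases i
    · exact hR0
    · exact hR10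
    · simpa [hR2] using h.1
    · simpa [hR2] using h.2

end Graph

/-! ### Fronts as Legendre transforms -/

section Legendre

/-- The last coordinate of the front of the tangent planes of the graph of `f`. -/
noncomputable def legendreHeight (f : Par → ℝ) (q : Par) : ℝ := f q - q.1 * pa f q - q.2 * pb f q

/-- The front with conormals `(a, b, 1)` and support function `f (a, b)`. -/
noncomputable def legendreFront (f : Par → ℝ) (q : Par) : Space :=
  ![pa f q, pb f q, legendreHeight f q]

/-- The second derivative of `f`, as a quadratic form. -/
noncomputable def hess (f : Par → ℝ) (q v : Par) : ℝ :=
  pa (pa f) q * v.1 ^ 2 + 2 * pa (pb f) q * (v.1 * v.2) + pb (pb f) q * v.2 ^ 2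

/-- The third derivative of `f`, as a cubic form. -/
noncomputable def cub (f : Par → ℝ) (q v : Par) : ℝ :=
  pa (pa (pa f)) q * v.1 ^ 3 + 3 * pa (pa (pb f)) q * (v.1 ^ 2 * v.2) +
    3 * pa (pb (pb f)) q * (v.1 * v.2 ^ 2) + pb (pb (pb f)) q * v.2 ^ 3

/-- The Hessian determinant. -/
noncomputable def hessDet (f : Par → ℝ) (q : Par) : ℝ :=
  pa (pa f) q * pb (pb f) q - pa (pb f) q ^ 2

variable {f : Par → ℝ}

theorem contDiff_legendreHeight (hf : ContDiff ℝ ∞ f) : ContDiff ℝ ∞ (legendreHeight f) := by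
  have := contDiff_pa hf
  have := contDiff_pb hf
  unfold legendreHeight
  fun_prop

theorem contDiff_hessDet (hf : ContDiff ℝ ∞ f) : ContDiff ℝ ∞ (hessDet f) := by
  have := contDiff_pa (contDiff_pa hf)
  have := contDiff_pa (contDiff_pb hf)
  have := contDiff_pb (contDiff_pb hf)
  unfold hessDet
  fun_prop

theorem contDiff_legendreFront (hf : ContDiff ℝ ∞ f) : ContDiff ℝ ∞ (legendreFront f) := by
  rw [contDiff_pi]
  intro i
  fin_cases i
  · exact contDiff_pa hf
  · exact contDiff_pb hf
  · exact contDiff_legendreHeight hf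

theorem hasDerivAt_line (hf : ContDiff ℝ ∞ f) (p v : Par) (s : ℝ) :
    HasDerivAt (fun s : ℝ => f (p + s • v)) (pa f (p + s • v) * v.1 + pb f (p + s • v) * v.2) s := by
  have hd : HasDerivAt (fun t : ℝ => p + t • v) v s := by
    simpa using ((hasDerivAt_id s).smul_const v).const_add p
  rw [← fderiv_eq_partials]
  exact (hasFDerivAt_of_smooth hf _).comp_hasDerivAt s hd

theorem deriv_deriv_line (hf : ContDiff ℝ ∞ f) (p v : Par) :
    deriv (deriv fun s : ℝ => f (p + s • v)) = fun s => hess f (p + s • v) v := by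
  rw [funext fun s => (hasDerivAt_line hf p v s).deriv]
  funext s
  refine (((hasDerivAt_line (contDiff_pa hf) p v s).mul_const v.1).add
    ((hasDerivAt_line (contDiff_pb hf) p v s).mul_const v.2)).deriv.trans ?_
  rw [pb_pa hf, hess]
  ring

theorem deriv_deriv_deriv_line (hf : ContDiff ℝ ∞ f) (p v : Par) :
    deriv (deriv (deriv fun s : ℝ => f (p + s • v))) = fun s => cub f (p + s • v) v := by
  rw [deriv_deriv_line hf]
  funext s
  have ca := contDiff_pa hf
  have cb := contDiff_pb hf
  refine ((((hasDerivAt_line (contDiff_pa ca) p v s).mul_const _).add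
    (((hasDerivAt_line (contDiff_pa cb) p v s).const_mul 2).mul_const _)).add
    ((hasDerivAt_line (contDiff_pb cb) p v s).mul_const _)).deriv.trans ?_
  rw [pb_pa ca, pb_pa hf, pb_pa cb, cub]
  ring

theorem hasContact_dualGraph_hess (hf : ContDiff ℝ ∞ f) (p : Par) {v : Par} (hv : v ≠ 0) :
    (HasContact (dualGraph f) p v 3 ↔ hess f p v = 0) ∧
    (HasContact (dualGraph f) p v 4 ↔ hess f p v = 0 ∧ cub f p v = 0) := by
  have h := hasContact_dualGraph_iff (hf.smoothNear p) hv
  rw [deriv_deriv_deriv_line hf, deriv_deriv_line hf] at h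
  simpa using h

/-- The first two entries are the Hessian applied to `v`, and the third is then imposed by the
conormal `(q.1, q.2, 1)`. Hence the front is singular exactly where the Hessian is degenerate. -/
theorem fderiv_legendreFront (hf : ContDiff ℝ ∞ f) (q v : Par) :
    fderiv ℝ (legendreFront f) q v =
      ![pa (pa f) q * v.1 + pa (pb f) q * v.2, pa (pb f) q * v.1 + pb (pb f) q * v.2,
        -q.1 * (pa (pa f) q * v.1 + pa (pb f) q * v.2) -
          q.2 * (pa (pb f) q * v.1 + pb (pb f) q * v.2)] := by
  have ca := contDiff_pa hf
  have cb := contDiff_pb hf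
  have h1 : HasFDerivAt (legendreFront f) _ q :=
    (contDiff_legendreFront hf).differentiable (by simp) q |>.hasFDerivAt
  have h2 := hasFDerivAt_pi'.1 h1
  have e : ∀ i, fderiv ℝ (legendreFront f) q v i = fderiv ℝ (fun y => legendreFront f y i) q v := by
    intro i
    rw [(h2 i).fderiv]
    rfl
  ext i
  rw [e i]
  fin_cases i
  · exact (fderiv_eq_partials (pa f) q v).trans (by rw [pb_pa hf]; rfl)
  · exact fderiv_eq_partials (pb f) q v
  · have h3 : HasFDerivAt (legendreHeight f) _ q :=
      ((hasFDerivAt_of_smooth hf q).sub (hasFDerivAt_fst.mul (hasFDerivAt_of_smooth ca q))).sub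
        (hasFDerivAt_snd.mul (hasFDerivAt_of_smooth cb q))
    change fderiv ℝ (legendreHeight f) q v = _
    rw [h3.fderiv]
    simp [fderiv_eq_partials, pb_pa hf]
    ring

/-- The third derivatives of the Legendre transform. -/
theorem legendre_transform_derivs (hf : ContDiff ℝ ∞ f) {q v : Par} {ψ : Par → Par}
    {P w : Par}
    (hw : w = (pa (pa f) q * v.1 + pa (pb f) q * v.2, pa (pb f) q * v.1 + pb (pb f) q * v.2))
    (hψ : SmoothNear ψ P) (hψP : ψ P = q) (hψv : fderiv ℝ ψ P w = v)
    (hr : ∀ᶠ y in 𝓝 P, (pa f (ψ y), pb f (ψ y)) = y) :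
    deriv (deriv fun s : ℝ => (P + s • w).1 * (ψ (P + s • w)).1 +
      (P + s • w).2 * (ψ (P + s • w)).2 - f (ψ (P + s • w))) 0 = hess f q v ∧
    deriv (deriv (deriv fun s : ℝ => (P + s • w).1 * (ψ (P + s • w)).1 +
      (P + s • w).2 * (ψ (P + s • w)).2 - f (ψ (P + s • w)))) 0 = -cub f q v := by
  have ca := contDiff_pa hf
  have cb := contDiff_pb hf
  have hline : Tendsto (fun s : ℝ => P + s • w) (𝓝 0) (𝓝 P) :=
    Continuous.tendsto' (by fun_prop) _ _ (by simp)
  have hz : SmoothNear (fun s : ℝ => ψ (P + s • w)) 0 :=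
    SmoothNear.comp (f := fun s : ℝ => P + s • w) (by simpa using hψ)
      (ContDiff.smoothNear (by fun_prop) 0)
  obtain ⟨z, hzs, hze⟩ := hz.exists_contDiff
  have hz0 : z 0 = q := by simpa [hψP] using hze.self_of_nhds
  have hz1 : HasDerivAt z v 0 := by
    have h1 : HasFDerivAt ψ (fderiv ℝ ψ P) (P + (0 : ℝ) • w) := by
      simpa using hψ.differentiableAt.hasFDerivAt
    have h2 : HasDerivAt (fun s : ℝ => P + s • w) w 0 := by
      simpa using ((hasDerivAt_id (0 : ℝ)).smul_const w).const_add P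
    have h3 := h1.comp_hasDerivAt 0 h2
    rw [hψv] at h3
    exact h3.congr_of_eventuallyEq hze
  let a : ℝ → ℝ := fun s => (z s).1
  let b : ℝ → ℝ := fun s => (z s).2
  have has : ContDiff ℝ ∞ a := contDiff_fst.comp hzs
  have hbs : ContDiff ℝ ∞ b := contDiff_snd.comp hzs
  have ha : ∀ s, HasDerivAt a (deriv a s) s := fun s => (has.differentiable (by simp) s).hasDerivAt
  have hb : ∀ s, HasDerivAt b (deriv b s) s := fun s => (hbs.differentiable (by simp) s).hasDerivAt
  have ha' : ∀ s, HasDerivAt (deriv a) (deriv (deriv a) s) s := fun s =>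
    (((contDiff_infty_iff_deriv).1 has).2.differentiable (by simp) s).hasDerivAt
  have hb' : ∀ s, HasDerivAt (deriv b) (deriv (deriv b) s) s := fun s =>
    (((contDiff_infty_iff_deriv).1 hbs).2.differentiable (by simp) s).hasDerivAt
  have ha1 : deriv a 0 = v.1 := ((hasFDerivAt_fst (𝕜 := ℝ) (E := ℝ) (F := ℝ) (p := z 0)).comp_hasDerivAt 0 hz1).deriv
  have hb1 : deriv b 0 = v.2 := ((hasFDerivAt_snd (𝕜 := ℝ) (E := ℝ) (F := ℝ) (p := z 0)).comp_hasDerivAt 0 hz1).deriv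
  have e0 : ∀ᶠ s in 𝓝 (0 : ℝ), pa f (a s, b s) = P.1 + s * w.1 ∧
      pb f (a s, b s) = P.2 + s * w.2 := by
    filter_upwards [hline.eventually hr, hze] with s h1 h2
    rw [← h2] at h1
    exact ⟨congrArg Prod.fst h1, congrArg Prod.snd h1⟩
  have cd : ∀ {g : Par → ℝ}, ContDiff ℝ ∞ g → ∀ s, HasDerivAt (fun s => g (a s, b s))
      (pa g (a s, b s) * deriv a s + pb g (a s, b s) * deriv b s) s := fun hg s =>
    hasDerivAt_comp_curve (differentiableAt_of_smooth hg _) rfl (ha s) (hb s)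
  have lin : ∀ c d s : ℝ, HasDerivAt (fun s : ℝ => c + s * d) d s := fun c d s => by
    simpa using ((hasDerivAt_id s).mul_const d).const_add c
  have e1 : ∀ᶠ s in 𝓝 (0 : ℝ),
      pa (pa f) (a s, b s) * deriv a s + pa (pb f) (a s, b s) * deriv b s = w.1 ∧
      pa (pb f) (a s, b s) * deriv a s + pb (pb f) (a s, b s) * deriv b s = w.2 := by
    filter_upwards [e0.eventually_nhds] with s hs
    constructor
    · have := (cd ca s).unique ((lin P.1 w.1 s).congr_of_eventuallyEq (hs.mono fun _ h => h.1))
      rwa [pb_pa hf] at this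
    · exact (cd cb s).unique ((lin P.2 w.2 s).congr_of_eventuallyEq (hs.mono fun _ h => h.2))
  have hab0 : (a 0, b 0) = q := hz0
  -- Differentiating the identity `grad f (ψ y) = y` twice along the line expresses the Hessian
  -- applied to `z''` by third derivatives of `f` at `(v, v)`; the second derivative of the inverse
  -- map is never computed.
  have e2 := (((cd (contDiff_pa ca) 0).mul (ha' 0)).add ((cd (contDiff_pa cb) 0).mul (hb' 0))).unique
    ((hasDerivAt_const 0 w.1).congr_of_eventuallyEq (e1.mono fun _ h => h.1))
  have e3 := (((cd (contDiff_pa cb) 0).mul (ha' 0)).add ((cd (contDiff_pb cb) 0).mul (hb' 0))).unique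
    ((hasDerivAt_const 0 w.2).congr_of_eventuallyEq (e1.mono fun _ h => h.2))
  rw [pb_pa ca, pb_pa hf, pb_pa cb, hab0, ha1, hb1] at e2
  rw [pb_pa cb, hab0, ha1, hb1] at e3
  have hφ : (fun s : ℝ => (P + s • w).1 * (ψ (P + s • w)).1 +
      (P + s • w).2 * (ψ (P + s • w)).2 - f (ψ (P + s • w))) =ᶠ[𝓝 0]
      fun s => (P.1 + s * w.1) * a s + (P.2 + s * w.2) * b s - f (a s, b s) := by
    filter_upwards [hze] with s hs
    rw [← hs]
    rfl
  -- The terms containing `z'` cancel, as always for a Legendre transform: its gradient is the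
  -- inverse of the gradient of `f`.
  have hφ1 : deriv (fun s => (P.1 + s * w.1) * a s + (P.2 + s * w.2) * b s - f (a s, b s)) =ᶠ[𝓝 0]
      fun s => w.1 * a s + w.2 * b s := by
    filter_upwards [e0] with s hs
    refine ((((lin P.1 w.1 s).mul (ha s)).add ((lin P.2 w.2 s).mul (hb s))).sub
      (cd hf s)).deriv.trans ?_
    rw [hs.1, hs.2]
    ring
  have hφ2 : deriv (fun s => w.1 * a s + w.2 * b s) =
      fun s => w.1 * deriv a s + w.2 * deriv b s :=
    funext fun s => (((ha s).const_mul w.1).add ((hb s).const_mul w.2)).deriv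
  have hφ3 : deriv (fun s => w.1 * deriv a s + w.2 * deriv b s) 0 =
      w.1 * deriv (deriv a) 0 + w.2 * deriv (deriv b) 0 :=
    (((ha' 0).const_mul w.1).add ((hb' 0).const_mul w.2)).deriv
  have hw1 : w.1 = pa (pa f) q * v.1 + pa (pb f) q * v.2 := by rw [hw]
  have hw2 : w.2 = pa (pb f) q * v.1 + pb (pb f) q * v.2 := by rw [hw]
  constructor
  · rw [(hφ.deriv.trans hφ1).deriv_eq, hφ2]
    simp only
    rw [ha1, hb1, hw1, hw2, hess]
    ring
  · rw [(hφ.deriv.trans hφ1).deriv.deriv_eq, hφ2, hφ3, hw1, hw2, cub]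
    linear_combination v.1 * e2 + v.2 * e3

end Legendre

/-! ### Legendre charts -/

/-- A chart of the front `x` with conormal `n` near `s`: up to a change of parameters and an affine
change of coordinates of the space, `x` is the front of support function `f`. -/
structure LegendreChart (x n : Par → Space) (s : Par) (f : Par → ℝ) where
  /-- the change of parameters -/
  σ : Par → Par
  /-- the inverse change of parameters -/
  τ : Par → Par
  /-- the linear change of coordinates -/
  A : Space ≃L[ℝ] Space
  /-- the contragredient change of coordinates -/
  B : Space ≃L[ℝ] Space
  /-- the scaling factor of the conormals -/
  μ : Par → ℝ
  contDiff : ContDiff ℝ ∞ f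
  smooth_σ : SmoothNear σ 0
  σ_zero : σ 0 = s
  smooth_τ : SmoothNear τ s
  left_inv : ∀ᶠ q in 𝓝 0, τ (σ q) = q
  right_inv : ∀ᶠ p in 𝓝 s, σ (τ p) = p
  dual : ∀ y z, B y ⬝ᵥ A z = y ⬝ᵥ z
  smooth_μ : SmoothNear μ 0
  μ_zero : μ 0 ≠ 0
  x_eq : ∀ᶠ q in 𝓝 0, x (σ q) = x s + A (legendreFront f q)
  n_eq : ∀ᶠ q in 𝓝 0, n (σ q) = μ q • B ![q.1, q.2, 1]

namespace LegendreChart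

variable {x n : Par → Space} {s : Par} {f : Par → ℝ}

theorem τ_s (c : LegendreChart x n s f) : c.τ s = 0 := by
  have h := c.left_inv.self_of_nhds
  rwa [c.σ_zero] at h

theorem tendsto_σ (c : LegendreChart x n s f) : Tendsto c.σ (𝓝 0) (𝓝 s) := by
  simpa only [ContinuousAt, c.σ_zero] using c.smooth_σ.continuousAt

theorem tendsto_τ (c : LegendreChart x n s f) : Tendsto c.τ (𝓝 s) (𝓝 0) := by
  simpa only [ContinuousAt, c.τ_s] using c.smooth_τ.continuousAt

theorem eventually_iff (c : LegendreChart x n s f) {P : Par → Prop} :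
    (∀ᶠ p in 𝓝 s, P p) ↔ ∀ᶠ q in 𝓝 0, P (c.σ q) := by
  refine ⟨fun h => c.tendsto_σ.eventually h, fun h => ?_⟩
  filter_upwards [c.tendsto_τ.eventually h, c.right_inv] with p h1 h2
  rwa [h2] at h1

theorem smooth_τ_σ (c : LegendreChart x n s f) : ∀ᶠ q in 𝓝 0, SmoothNear c.τ (c.σ q) :=
  c.tendsto_σ.eventually c.smooth_τ.eventually

theorem right_inv_σ (c : LegendreChart x n s f) :
    ∀ᶠ q in 𝓝 0, ∀ᶠ p in 𝓝 (c.σ q), c.σ (c.τ p) = p :=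
  c.tendsto_σ.eventually c.right_inv.eventually_nhds

/-- The projective coordinate change for the dual surface. -/
noncomputable def dualMap (c : LegendreChart x n s f) : Hom ≃L[ℝ] Hom :=
  LinearEquiv.toContinuousLinearEquiv
    { toFun := fun X => (c.B X.1, X.2 - c.B X.1 ⬝ᵥ x s)
      invFun := fun X => (c.B.symm X.1, X.2 + X.1 ⬝ᵥ x s)
      map_add' := fun X Y => by
        refine Prod.ext (by simp) ?_
        simp [add_dotProduct]
        ring
      map_smul' := fun r X => by
        refine Prod.ext (by simp) ?_
        simp [smul_dotProduct]
        ring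
      left_inv := fun X => by simp
      right_inv := fun X => by simp }

theorem dualMap_apply (c : LegendreChart x n s f) (X : Hom) :
    c.dualMap X = (c.B X.1, X.2 - c.B X.1 ⬝ᵥ x s) := rfl

/-- The projective coordinate change for the front, as the dual surface of its dual surface. -/
noncomputable def frontMap (c : LegendreChart x n s f) : Hom ≃L[ℝ] Hom :=
  LinearEquiv.toContinuousLinearEquiv
    { toFun := fun X => (c.A ![X.1 0, X.1 1, X.2] + X.1 2 • x s, X.1 2)
      invFun := fun X => (![c.A.symm (X.1 - X.2 • x s) 0, c.A.symm (X.1 - X.2 • x s) 1, X.2],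
        c.A.symm (X.1 - X.2 • x s) 2)
      map_add' := fun X Y => by
        have h : (![(X + Y).1 0, (X + Y).1 1, (X + Y).2] : Space) =
            ![X.1 0, X.1 1, X.2] + ![Y.1 0, Y.1 1, Y.2] := by
          ext i; fin_cases i <;> simp
        refine Prod.ext ?_ (by simp)
        simp only [h, map_add]
        simp [add_smul]
        abel
      map_smul' := fun r X => by
        have h : (![(r • X).1 0, (r • X).1 1, (r • X).2] : Space) =
            r • ![X.1 0, X.1 1, X.2] := by
          ext i; fin_cases i <;> simp
        refine Prod.ext ?_ (by simp)
        simp only [h, map_smul]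
        simp [smul_smul]
      left_inv := fun X => by
        refine Prod.ext ?_ (by simp)
        ext i; fin_cases i <;> simp
      right_inv := fun X => by
        refine Prod.ext ?_ (by simp)
        simp only [Matrix.cons_val_zero, Matrix.cons_val_one, Matrix.cons_val]
        have h : ∀ y : Space, (![y 0, y 1, y 2] : Space) = y := fun y => by
          ext i; fin_cases i <;> rfl
        rw [h]
        simp }

theorem frontMap_apply (c : LegendreChart x n s f) (X : Hom) :
    c.frontMap X = (c.A ![X.1 0, X.1 1, X.2] + X.1 2 • x s, X.1 2) := rfl

/-- The conormal `(a, b, 1)` pairs with the Legendre front to give `f`, and contragredient maps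
preserve the pairing, so the last coordinate of the dual surface is `-f` up to the affine change
`dualMap`. -/
theorem sameSurface_dual (c : LegendreChart x n s f) :
    ∀ᶠ q in 𝓝 0, SameSurface (dualSurface x n) (dualGraph f) c.σ c.τ c.μ c.dualMap q := by
  filter_upwards [c.smooth_σ.eventually, c.smooth_τ_σ, c.left_inv.eventually_nhds, c.right_inv_σ,
    c.smooth_μ.eventually, c.smooth_μ.continuousAt.eventually_ne c.μ_zero,
    c.x_eq.eventually_nhds, c.n_eq.eventually_nhds] with q h1 h2 h3 h4 h5 h6 h7 h8
  refine ⟨h1, h2, h3, h4, h5, h6, smoothNear_dualGraph (c.contDiff.smoothNear q), ?_⟩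
  filter_upwards [h7, h8] with y hx hn
  rw [dualSurface, hx, hn, c.dualMap_apply]
  refine Prod.ext rfl ?_
  have e : (![y.1, y.2, 1] : Space) ⬝ᵥ legendreFront f y = f y := by
    simp [legendreFront, legendreHeight, dotProduct, Fin.sum_univ_three]
  simp only [dualGraph, smul_dotProduct, dotProduct_add, c.dual, e, Prod.smul_snd, smul_eq_mul]
  ring

theorem bijective_fderiv_σ (c : LegendreChart x n s f) :
    ∀ᶠ q in 𝓝 0, Function.Bijective (fderiv ℝ c.σ q) := by
  filter_upwards [c.sameSurface_dual, c.left_inv] with q h h0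
  refine ⟨Function.LeftInverse.injective h.fderiv_left_inv,
    fun v => ⟨fderiv ℝ c.τ (c.σ q) v, ?_⟩⟩
  · have := h.symm.fderiv_left_inv v
    rwa [h0] at this

theorem regularAt_dual (c : LegendreChart x n s f) :
    ∀ᶠ q in 𝓝 0, RegularAt (dualSurface x n) (c.σ q) := by
  filter_upwards [c.sameSurface_dual] with q h
  exact h.regularAt (regularAt_dualGraph (differentiableAt_of_smooth c.contDiff q))

theorem hasContact_dual (c : LegendreChart x n s f) :
    ∀ᶠ q in 𝓝 0, ∀ v ≠ 0,
      (HasContact (dualSurface x n) (c.σ q) (fderiv ℝ c.σ q v) 3 ↔ hess f q v = 0) ∧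
      (HasContact (dualSurface x n) (c.σ q) (fderiv ℝ c.σ q v) 4 ↔
        hess f q v = 0 ∧ cub f q v = 0) := by
  filter_upwards [c.sameSurface_dual] with q h v hv
  rw [h.hasContact_iff, h.hasContact_iff]
  exact hasContact_dualGraph_hess c.contDiff q hv

theorem not_regularAt_front (c : LegendreChart x n s f) :
    ∀ᶠ q in 𝓝 0, hessDet f q = 0 → ¬ RegularAt (homog x) (c.σ q) := by
  filter_upwards [c.x_eq.eventually_nhds, c.bijective_fderiv_σ, c.smooth_σ.eventually,
    c.right_inv_σ, c.smooth_τ_σ, c.left_inv]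
    with q hx hb hσ hr hτ hl h0 hreg
  obtain ⟨v, hv, hv1, hv2⟩ : ∃ v : Par, v ≠ 0 ∧ pa (pa f) q * v.1 + pa (pb f) q * v.2 = 0 ∧
      pa (pb f) q * v.1 + pb (pb f) q * v.2 = 0 := by
    unfold hessDet at h0
    -- A kernel vector of the Hessian: its first row rotated by a right angle, or any first axis
    -- vector when that row is zero.
    by_cases h1 : pa (pa f) q = 0 ∧ pa (pb f) q = 0
    · exact ⟨(1, 0), by simp, by simp [h1.1], by simp [h1.2]⟩
    · refine ⟨(-pa (pb f) q, pa (pa f) q), fun h => ?_, by ring, by linear_combination h0⟩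
      simp only [Prod.mk_eq_zero, neg_eq_zero] at h
      exact h1 ⟨h.2, h.1⟩
  have hcomp : HasFDerivAt (fun y => (x s + c.A (legendreFront f y), (1 : ℝ)))
      (((c.A : Space →L[ℝ] Space).comp (fderiv ℝ (legendreFront f) q)).prod 0) q := by
    refine HasFDerivAt.prodMk ?_ (hasFDerivAt_const _ _)
    have h1 : HasFDerivAt (legendreFront f) _ q :=
      ((contDiff_legendreFront c.contDiff).differentiable (by simp) q).hasFDerivAt
    exact (c.A.hasFDerivAt.comp q h1).const_add _
  have hcomp' : HasFDerivAt (fun y => homog x (c.σ y))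
      (((c.A : Space →L[ℝ] Space).comp (fderiv ℝ (legendreFront f) q)).prod 0) q := by
    refine hcomp.congr_of_eventuallyEq ?_
    filter_upwards [hx] with y hy
    rw [homog, hy]
  have hxd : DifferentiableAt ℝ (homog x) (c.σ q) := by
    have h1 : HasFDerivAt c.τ (fderiv ℝ c.τ (c.σ q)) (c.σ q) := hτ.differentiableAt.hasFDerivAt
    have h2 := (hl.symm ▸ hcomp').comp (c.σ q) h1
    refine (h2.congr_of_eventuallyEq ?_).differentiableAt
    filter_upwards [hr] with p hp
    simp [hp]
  have h2 := hxd.hasFDerivAt.comp q hσ.differentiableAt.hasFDerivAt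
  have h3 := congrArg (fun T : Par →L[ℝ] Hom => T v) (h2.unique hcomp')
  have h4 : fderiv ℝ (homog x) (c.σ q) (fderiv ℝ c.σ q v) = 0 := by
    refine h3.trans ?_
    have : fderiv ℝ (legendreFront f) q v = 0 := by
      rw [fderiv_legendreFront c.contDiff, hv1, hv2]
      ext i; fin_cases i <;> simp
    simp [this]
  have h5 := hreg.2 (fderiv ℝ c.σ q v) (by rw [h4]; exact Submodule.zero_mem _)
  exact hv (hb.1 (h5.trans (map_zero _).symm))

/-- Where the Hessian is nondegenerate the gradient is a local diffeomorphism, and in the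
coordinates `(f_a, f_b)` the front is the graph of minus the Legendre transform of `f`. By
`legendre_transform_derivs` the second and third derivatives of that transform along the image of
`v` are `hess` and `-cub`. Asymptotic and flecnodal directions of the front and of its dual
therefore correspond. -/
theorem contact_front (c : LegendreChart x n s f) :
    ∀ᶠ q in 𝓝 0, hessDet f q ≠ 0 → RegularAt (homog x) (c.σ q) ∧ ∀ v ≠ 0,
      (HasContact (homog x) (c.σ q) (fderiv ℝ c.σ q v) 3 ↔ hess f q v = 0) ∧
      (HasContact (homog x) (c.σ q) (fderiv ℝ c.σ q v) 4 ↔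
        hess f q v = 0 ∧ cub f q v = 0) := by
  filter_upwards [c.smooth_σ.eventually, c.smooth_τ_σ, c.left_inv.eventually_nhds, c.right_inv_σ,
    c.x_eq.eventually_nhds] with q h1 h2 h3 h4 h7 hdet
  have hf := c.contDiff
  have ca := contDiff_pa hf
  have cb := contDiff_pb hf
  let G : Par → Par := fun y => (pa f y, pb f y)
  have hG : ContDiff ℝ ∞ G := ca.prodMk cb
  have hG' : HasFDerivAt G ((fderiv ℝ (pa f) q).prod (fderiv ℝ (pb f) q)) q :=
    (hasFDerivAt_of_smooth ca q).prodMk (hasFDerivAt_of_smooth cb q)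
  have hGv : ∀ v : Par, ((fderiv ℝ (pa f) q).prod (fderiv ℝ (pb f) q)) v =
      (pa (pa f) q * v.1 + pa (pb f) q * v.2, pa (pb f) q * v.1 + pb (pb f) q * v.2) := by
    intro v
    refine Prod.ext ?_ ?_
    · exact (fderiv_eq_partials _ _ _).trans (by rw [pb_pa hf])
    · exact fderiv_eq_partials _ _ _
  have hinj : Function.Injective
      ((fderiv ℝ (pa f) q).prod (fderiv ℝ (pb f) q) : Par →ₗ[ℝ] Par) := by
    rw [injective_iff_map_eq_zero]
    intro v hv
    have hv' := (hGv v).symm.trans hv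
    have e1 := congrArg Prod.fst hv'
    have e2 := congrArg Prod.snd hv'
    simp only [Prod.fst_zero, Prod.snd_zero] at e1 e2
    unfold hessDet at hdet
    refine Prod.ext (mul_left_cancel₀ hdet ?_) (mul_left_cancel₀ hdet ?_)
    · simp only [Prod.fst_zero, mul_zero]
      linear_combination pb (pb f) q * e1 - pa (pb f) q * e2
    · simp only [Prod.snd_zero, mul_zero]
      linear_combination pa (pa f) q * e2 - pa (pb f) q * e1
  let G' : Par ≃L[ℝ] Par := (LinearEquiv.ofInjectiveEndo _ hinj).toContinuousLinearEquiv
  have hGG : (G' : Par →L[ℝ] Par) = (fderiv ℝ (pa f) q).prod (fderiv ℝ (pb f) q) := by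
    ext <;> rfl
  obtain ⟨ψ, hψ, hψP, hψl, hψr⟩ := (hG.smoothNear q).exists_local_inverse (hGG ▸ hG')
  have hψc : Tendsto ψ (𝓝 (G q)) (𝓝 q) := by
    simpa only [ContinuousAt, hψP] using hψ.continuousAt
  have hl0 : c.τ (c.σ q) = q := h3.self_of_nhds
  have hτc : Tendsto c.τ (𝓝 (c.σ q)) (𝓝 q) := by
    simpa only [ContinuousAt, hl0] using h2.continuousAt
  let g : Par → ℝ := fun y => y.1 * (ψ y).1 + y.2 * (ψ y).2 - f (ψ y)
  have hg : SmoothNear g (G q) := by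
    filter_upwards [hψ] with y hy
    exact ((contDiffAt_fst.mul (contDiffAt_fst.comp y hy)).add
      (contDiffAt_snd.mul (contDiffAt_snd.comp y hy))).sub (hf.contDiffAt.comp y hy)
  have hS : SameSurface (homog x) (dualGraph g) (fun y => c.σ (ψ y)) (fun p => G (c.τ p))
      (fun _ => 1) c.frontMap (G q) := by
    refine ⟨SmoothNear.comp (by rw [hψP]; exact h1) hψ, ?_, ?_, ?_, contDiff_const.smoothNear _,
      one_ne_zero, smoothNear_dualGraph hg, ?_⟩
    · rw [hψP]
      exact SmoothNear.comp (hG.smoothNear _) h2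
    · filter_upwards [hψc.eventually h3, hψr] with y e1 e2
      rw [e1, e2]
    · rw [hψP]
      filter_upwards [h4, hτc.eventually hψl] with p e1 e2
      rw [e2, e1]
    · filter_upwards [hψc.eventually h7, hψr] with y e1 e2
      have e3 : pa f (ψ y) = y.1 := congrArg Prod.fst e2
      have e4 : pb f (ψ y) = y.2 := congrArg Prod.snd e2
      rw [homog, e1, c.frontMap_apply, one_smul]
      refine Prod.ext ?_ (by simp [dualGraph])
      have e5 : legendreFront f (ψ y) = ![y.1, y.2, -g y] := by
        simp only [legendreFront, legendreHeight, e3, e4, g]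
        congr 3
        ring_nf
      simp only [e5, dualGraph]
      simp [add_comm]
  have hreg := hS.regularAt (regularAt_dualGraph hg.differentiableAt)
  simp only [hψP] at hreg
  refine ⟨hreg, fun v hv => ?_⟩
  have hw0 : G' v ≠ 0 := fun h => hv (G'.map_eq_zero_iff.1 h)
  have hw : G' v = (pa (pa f) q * v.1 + pa (pb f) q * v.2,
      pa (pb f) q * v.1 + pb (pb f) q * v.2) := hGv v
  have hψv : fderiv ℝ ψ (G q) (G' v) = v := by
    have e1 : HasFDerivAt ψ (fderiv ℝ ψ (G q)) (G q) := hψ.differentiableAt.hasFDerivAt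
    have e2 := e1.comp q (hGG ▸ hG' : HasFDerivAt G (G' : Par →L[ℝ] Par) q)
    have e3 := e2.unique ((hasFDerivAt_id q).congr_of_eventuallyEq hψl)
    exact congrArg (fun T : Par →L[ℝ] Par => T v) e3
  have hσψ : fderiv ℝ (fun y => c.σ (ψ y)) (G q) (G' v) = fderiv ℝ c.σ q v := by
    have e1 : HasFDerivAt c.σ (fderiv ℝ c.σ q) (ψ (G q)) := by
      rw [hψP]; exact h1.differentiableAt.hasFDerivAt
    have e2 := e1.comp (G q) hψ.differentiableAt.hasFDerivAt
    rw [show (fun y => c.σ (ψ y)) = c.σ ∘ ψ from rfl, e2.fderiv]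
    simp [hψv]
  have k3 := hS.hasContact_iff (v := G' v) (k := 3)
  have k4 := hS.hasContact_iff (v := G' v) (k := 4)
  have hd := legendre_transform_derivs hf (P := G q) hw hψ hψP hψv hψr
  have hc := hasContact_dualGraph_iff hg hw0
  simp only [hσψ, hψP] at k3 k4
  rw [k3, k4, hc.1, hc.2]
  simp only [g, hd.1, hd.2, neg_eq_zero, and_self]

end LegendreChart

/-! ### Elliptic, parabolic and hyperbolic points in terms of the Hessian -/

section Types

variable {δ : Par → Hom} {p : Par} {ℓ : Par →L[ℝ] Par} {a b c : ℝ}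

/-- In this lemma and the next two the form multiplied by `c > 0` is `(c v₂ + b v₁)² + (a c - b²)
v₁²`, which decides the number of its zero directions. -/
theorem ellipticAt_of_pos (hℓ : Function.Bijective ℓ) (hr : RegularAt δ p) (hc : 0 < c)
    (h : ∀ v ≠ 0, HasContact δ p (ℓ v) 3 ↔ a * v.1 ^ 2 + 2 * b * (v.1 * v.2) + c * v.2 ^ 2 = 0)
    (hd : 0 < a * c - b ^ 2) : EllipticAt δ p := by
  refine ⟨hr, fun u hu hu3 => ?_⟩
  obtain ⟨v, rfl⟩ := hℓ.2 u
  have hv : v ≠ 0 := fun h => hu (by rw [h, map_zero])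
  have h1 := (h v hv).1 hu3
  have h2 : (c * v.2 + b * v.1) ^ 2 + (a * c - b ^ 2) * v.1 ^ 2 = 0 := by
    linear_combination c * h1
  have h3 : v.1 ^ 2 = 0 := by
    have := mul_nonneg hd.le (sq_nonneg v.1)
    have h4 : (a * c - b ^ 2) * v.1 ^ 2 = 0 := by nlinarith [sq_nonneg (c * v.2 + b * v.1)]
    exact (mul_eq_zero.1 h4).resolve_left hd.ne'
  have h4 : v.1 = 0 := by simpa using h3
  rw [h4] at h1
  have h5 : v.2 = 0 := by simpa [hc.ne'] using h1
  exact hv (Prod.ext h4 h5)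

theorem hyperbolicAt_of_neg (hℓ : Function.Bijective ℓ) (hr : RegularAt δ p) (hc : 0 < c)
    (h : ∀ v ≠ 0, HasContact δ p (ℓ v) 3 ↔ a * v.1 ^ 2 + 2 * b * (v.1 * v.2) + c * v.2 ^ 2 = 0)
    (hd : a * c - b ^ 2 < 0) : HyperbolicAt δ p := by
  set r := √(b ^ 2 - a * c) with hrd
  have hr2 : r ^ 2 = b ^ 2 - a * c := Real.sq_sqrt (by linarith)
  have hr0 : 0 < r := Real.sqrt_pos.2 (by linarith)
  have hspan : ∀ (v : Par) (k : ℝ), ℓ v ∈ Submodule.span ℝ {ℓ (c, k)} ↔ c * v.2 = k * v.1 := by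
    intro v k
    rw [Submodule.mem_span_singleton]
    constructor
    · rintro ⟨m, hm⟩
      rw [← map_smul] at hm
      have := hℓ.1 hm
      rw [← this]
      simp
      ring
    · intro hk
      refine ⟨v.1 / c, ?_⟩
      rw [← map_smul]
      congr 1
      ext
      · simp [hc.ne']
      · simp
        field_simp
        linarith
  refine ⟨hr, ℓ (c, -b + r), ℓ (c, -b - r), ?_, fun u hu => ?_⟩
  · rw [LinearIndependent.pair_iff]
    intro m k hmk
    rw [← map_smul, ← map_smul, ← map_add, ← map_zero ℓ] at hmk
    have h1 := hℓ.1 hmk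
    have e1 := congrArg Prod.fst h1
    have e2 := congrArg Prod.snd h1
    simp at e1 e2
    have e3 : c * (m + k) = 0 := by linarith
    have e4 : m + k = 0 := (mul_eq_zero.1 e3).resolve_left hc.ne'
    have e5 : r * (m - k) = 0 := by linear_combination e2 + b * e4
    have e6 := (mul_eq_zero.1 e5).resolve_left hr0.ne'
    constructor <;> linarith
  · obtain ⟨v, rfl⟩ := hℓ.2 u
    have hv : v ≠ 0 := fun h => hu (by rw [h, map_zero])
    rw [h v hv, hspan, hspan]
    have e : c * (a * v.1 ^ 2 + 2 * b * (v.1 * v.2) + c * v.2 ^ 2) =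
        (c * v.2 - (-b + r) * v.1) * (c * v.2 - (-b - r) * v.1) := by
      linear_combination v.1 ^ 2 * hr2
    rw [← sub_eq_zero (a := c * v.2), ← sub_eq_zero (a := c * v.2) (b := (-b - r) * v.1),
      ← mul_eq_zero, ← e, mul_eq_zero]
    simp [hc.ne']

theorem parabolicAt_of_eq_zero (hℓ : Function.Bijective ℓ) (hr : RegularAt δ p) (hc : 0 < c)
    (h : ∀ v ≠ 0, HasContact δ p (ℓ v) 3 ↔ a * v.1 ^ 2 + 2 * b * (v.1 * v.2) + c * v.2 ^ 2 = 0)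
    (hd : a * c - b ^ 2 = 0) : ParabolicAt δ p := by
  have hne : ℓ (c, -b) ≠ 0 := fun h0 => by
    have := hℓ.1 (h0.trans (map_zero ℓ).symm)
    exact hc.ne' (congrArg Prod.fst this)
  refine ⟨hr, ℓ (c, -b), hne, fun u hu => ?_⟩
  obtain ⟨v, rfl⟩ := hℓ.2 u
  have hv : v ≠ 0 := fun h => hu (by rw [h, map_zero])
  rw [h v hv, Submodule.mem_span_singleton]
  have e : c * (a * v.1 ^ 2 + 2 * b * (v.1 * v.2) + c * v.2 ^ 2) = (c * v.2 + b * v.1) ^ 2 := by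
    linear_combination v.1 ^ 2 * hd
  constructor
  · intro h0
    rw [h0, mul_zero] at e
    have e1 : c * v.2 + b * v.1 = 0 := by simpa using e.symm
    refine ⟨v.1 / c, ?_⟩
    rw [← map_smul]
    congr 1
    ext
    · simp [hc.ne']
    · simp
      field_simp
      linarith
  · rintro ⟨m, hm⟩
    rw [← map_smul] at hm
    have := hℓ.1 hm
    rw [← this] at e ⊢
    simp at e ⊢
    refine mul_left_cancel₀ hc.ne' (e.trans ?_)
    ring

theorem not_parabolic_of_elliptic (h : EllipticAt δ p) : ¬ ParabolicAt δ p := by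
  rintro ⟨-, v, hv, hv'⟩
  exact h.2 v hv ((hv' v hv).2 (Submodule.mem_span_singleton_self v))

theorem not_hyperbolic_of_elliptic (h : EllipticAt δ p) : ¬ HyperbolicAt δ p := by
  rintro ⟨-, v, w, hvw, hv'⟩
  have hv : v ≠ 0 := hvw.ne_zero 0
  exact h.2 v hv ((hv' v hv).2 (Or.inl (Submodule.mem_span_singleton_self v)))

theorem not_parabolic_of_hyperbolic (h : HyperbolicAt δ p) : ¬ ParabolicAt δ p := by
  rintro ⟨-, z, hz, hz'⟩
  obtain ⟨-, v, w, hvw, hv'⟩ := h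
  have hv : v ≠ 0 := hvw.ne_zero 0
  have hw : w ≠ 0 := hvw.ne_zero 1
  have h1 := (hz' v hv).1 ((hv' v hv).2 (Or.inl (Submodule.mem_span_singleton_self v)))
  have h2 := (hz' w hw).1 ((hv' w hw).2 (Or.inr (Submodule.mem_span_singleton_self w)))
  obtain ⟨a, rfl⟩ := Submodule.mem_span_singleton.1 h1
  obtain ⟨b, rfl⟩ := Submodule.mem_span_singleton.1 h2
  have := (LinearIndependent.pair_iff.1 hvw) b (-a) (by rw [smul_smul, smul_smul, ← add_smul]; simp [mul_comm])
  rw [neg_eq_zero] at this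
  exact hv (by rw [this.2, zero_smul])

/-- The three signs are exhaustive and the three types are mutually exclusive, so the three
implications are equivalences. -/
theorem contact_types (hℓ : Function.Bijective ℓ) (hr : RegularAt δ p) (hc : 0 < c)
    (h : ∀ v ≠ 0, HasContact δ p (ℓ v) 3 ↔ a * v.1 ^ 2 + 2 * b * (v.1 * v.2) + c * v.2 ^ 2 = 0) :
    (EllipticAt δ p ↔ 0 < a * c - b ^ 2) ∧ (HyperbolicAt δ p ↔ a * c - b ^ 2 < 0) ∧
      (ParabolicAt δ p ↔ a * c - b ^ 2 = 0) := by
  have h1 := ellipticAt_of_pos hℓ hr hc h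
  have h2 := hyperbolicAt_of_neg hℓ hr hc h
  have h3 := parabolicAt_of_eq_zero hℓ hr hc h
  have n1 := not_parabolic_of_elliptic (δ := δ) (p := p)
  have n2 := not_hyperbolic_of_elliptic (δ := δ) (p := p)
  have n3 := not_parabolic_of_hyperbolic (δ := δ) (p := p)
  rcases lt_trichotomy (a * c - b ^ 2) 0 with h0 | h0 | h0
  · simp only [h0.not_gt, h0.ne, h0, iff_false, iff_true]
    exact ⟨fun h => n2 h (h2 h0), h2 h0, n3 (h2 h0)⟩
  · simp only [h0, lt_irrefl, iff_false, iff_true]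
    exact ⟨fun h => n1 h (h3 h0), fun h => n3 h (h3 h0), h3 h0⟩
  · simp only [h0.not_gt, h0.ne', h0, iff_false, iff_true]
    exact ⟨h1 h0, n2 (h1 h0), n1 (h1 h0)⟩

end Types

namespace LegendreChart

variable {x n : Par → Space} {s : Par} {f : Par → ℝ}

theorem types_front (c : LegendreChart x n s f) (h : pb (pb f) 0 = 1) :
    ∀ᶠ q in 𝓝 0, (EllipticAt (homog x) (c.σ q) ↔ 0 < hessDet f q) ∧
      (HyperbolicAt (homog x) (c.σ q) ↔ hessDet f q < 0) ∧
      (RegularAt (homog x) (c.σ q) ↔ hessDet f q ≠ 0) := by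
  have hb : ∀ᶠ q in 𝓝 (0 : Par), 0 < pb (pb f) q :=
    (contDiff_pb (contDiff_pb c.contDiff)).continuous.continuousAt.eventually_const_lt
      (by rw [h]; exact one_pos)
  filter_upwards [c.contact_front, c.not_regularAt_front, c.bijective_fderiv_σ, hb]
    with q h1 h2 h3 h4
  by_cases h0 : hessDet f q = 0
  · have hr := h2 h0
    simp only [h0, lt_irrefl, iff_false, ne_eq, not_true_eq_false]
    exact ⟨fun h => hr h.1, fun h => hr h.1, hr⟩
  · obtain ⟨hr, hv⟩ := h1 h0
    have := contact_types h3 hr h4 fun v hv0 => (hv v hv0).1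
    exact ⟨this.1, this.2.1, by simp [hr, h0]⟩

theorem parabolic_dual (c : LegendreChart x n s f) (h : pb (pb f) 0 = 1) :
    ∀ᶠ q in 𝓝 0, (ParabolicAt (dualSurface x n) (c.σ q) ↔ hessDet f q = 0) := by
  have hb : ∀ᶠ q in 𝓝 (0 : Par), 0 < pb (pb f) q :=
    (contDiff_pb (contDiff_pb c.contDiff)).continuous.continuousAt.eventually_const_lt
      (by rw [h]; exact one_pos)
  filter_upwards [c.hasContact_dual, c.regularAt_dual, c.bijective_fderiv_σ, hb]
    with q h1 h2 h3 h4
  exact (contact_types h3 h2 h4 fun v hv0 => (h1 v hv0).1).2.2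

/-! ### Curves of the parameter plane given as graphs in a chart -/

/-- The curve of the parameter plane that is the graph of `g` in the chart. -/
def curve (c : LegendreChart x n s f) (g : ℝ → ℝ) (t : ℝ) : Par := c.σ (t, g t)

variable {g : ℝ → ℝ}

theorem tendsto_graph (hg : Continuous g) (h0 : g 0 = 0) :
    Tendsto (fun t => (t, g t)) (𝓝 0) (𝓝 (0 : Par)) :=
  Continuous.tendsto' (by fun_prop) _ _ (by rw [h0]; rfl)

theorem smooth_curve (c : LegendreChart x n s f) (hg : ContDiff ℝ ∞ g) (h0 : g 0 = 0) :
    SmoothNear (c.curve g) 0 :=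
  SmoothNear.comp (f := fun t => (t, g t)) (g := c.σ)
    (by simp only [h0]; exact c.smooth_σ) ((contDiff_id.prodMk hg).smoothNear 0)

theorem curve_zero (c : LegendreChart x n s f) (h0 : g 0 = 0) : c.curve g 0 = s := by
  rw [curve, h0]; exact c.σ_zero

theorem deriv_curve (c : LegendreChart x n s f) (hg : ContDiff ℝ ∞ g) (h0 : g 0 = 0) :
    deriv (c.curve g) 0 = fderiv ℝ c.σ 0 (1, deriv g 0) := by
  have h1 : HasDerivAt (fun t => (t, g t)) (1, deriv g 0) 0 :=
    (hasDerivAt_id _).prodMk (hg.differentiable (by simp) 0).hasDerivAt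
  have h2 : HasFDerivAt c.σ (fderiv ℝ c.σ 0) ((fun t => (t, g t)) 0) := by
    simp only [h0]
    exact c.smooth_σ.differentiableAt.hasFDerivAt
  exact (h2.comp_hasDerivAt 0 h1).deriv

theorem deriv_curve_ne_zero (c : LegendreChart x n s f) (hg : ContDiff ℝ ∞ g) (h0 : g 0 = 0) :
    deriv (c.curve g) 0 ≠ 0 := by
  rw [c.deriv_curve hg h0]
  intro h
  have := c.bijective_fderiv_σ.self_of_nhds.1 (h.trans (map_zero _).symm)
  exact one_ne_zero (congrArg Prod.fst this)

theorem eventually_mem_image (c : LegendreChart x n s f) (hg : Continuous g) (h0 : g 0 = 0) :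
    ∀ᶠ ε in 𝓝[>] (0 : ℝ), ∀ᶠ q in 𝓝 0, (c.σ q ∈ c.curve g '' Ioo (-ε) ε ↔ q.2 = g q.1) := by
  -- The arc is taken so short that `τ` inverts `σ` along all of it; otherwise a far piece of the
  -- curve could return to the same parameters.
  obtain ⟨r, hr, hball⟩ := Metric.eventually_nhds_iff_ball.1
    ((tendsto_graph hg h0).eventually c.left_inv)
  filter_upwards [Ioo_mem_nhdsGT hr] with ε hε
  have h1 : ∀ᶠ q : Par in 𝓝 0, q.1 ∈ Ioo (-ε) ε :=
    continuous_fst.continuousAt.eventually_mem (Ioo_mem_nhds (by simpa using hε.1) hε.1)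
  filter_upwards [h1, c.left_inv] with q hq1 hq2
  constructor
  · rintro ⟨t, ht, htq⟩
    have h2 : c.τ (c.curve g t) = (t, g t) := hball t (by
      rw [Metric.mem_ball, Real.dist_eq, sub_zero]
      exact (abs_lt.2 ht).trans hε.2)
    rw [htq, hq2] at h2
    rw [h2]
  · intro h
    refine ⟨q.1, hq1, ?_⟩
    rw [curve, ← h]

theorem parametrizesGerm (c : LegendreChart x n s f) (hg : ContDiff ℝ ∞ g) (h0 : g 0 = 0)
    {S : Set Par → Set Par}
    (h : ∃ V ∈ 𝓝 s, ∀ W ∈ 𝓝 s, W ⊆ V → ∀ᶠ q in 𝓝 0, (c.σ q ∈ S W ↔ q.2 = g q.1)) :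
    ParametrizesGerm (c.curve g) s S := by
  refine ⟨c.smooth_curve hg h0, c.curve_zero h0, c.deriv_curve_ne_zero hg h0, ?_⟩
  obtain ⟨V, hV, hVW⟩ := h
  refine ⟨V, hV, fun W hW hWV => ?_⟩
  filter_upwards [c.eventually_mem_image hg.continuous h0] with ε hε
  rw [c.eventually_iff]
  filter_upwards [hε, hVW W hW hWV] with q h1 h2
  rw [h1, h2]

/-- The flecnodal and double sets are defined as closures. A graph is closed near `s`, so a set
contained in it and containing it off `t = 0` has, as a germ, exactly this graph as closure. -/
theorem mem_closure_iff (c : LegendreChart x n s f) (hg : Continuous g) (h0 : g 0 = 0)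
    {S : Set Par} (h1 : ∀ᶠ q in 𝓝 0, c.σ q ∈ S → q.2 = g q.1)
    (h2 : ∀ᶠ t in 𝓝[≠] (0 : ℝ), c.curve g t ∈ S) :
    ∀ᶠ q in 𝓝 0, (c.σ q ∈ closure S ↔ q.2 = g q.1) := by
  have h3 : ∀ᶠ p in 𝓝 s, p ∈ S → (c.τ p).2 = g (c.τ p).1 := by
    rw [c.eventually_iff]
    filter_upwards [h1, c.left_inv] with q hq hq' hS
    rw [hq']
    exact hq hS
  have h4 : ∀ᶠ q : Par in 𝓝 0, q.1 ≠ 0 → c.curve g q.1 ∈ S :=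
    (continuous_fst.tendsto' (0 : Par) 0 rfl).eventually (eventually_nhdsWithin_iff.1 h2)
  have hs : s ∈ closure S := by
    have := ((c.tendsto_σ.comp (tendsto_graph hg h0)).mono_left
      (nhdsWithin_le_nhds (s := {(0 : ℝ)}ᶜ)))
    exact mem_closure_of_tendsto this h2
  filter_upwards [c.tendsto_σ.eventually h3.eventually_nhds, c.smooth_τ_σ, c.left_inv, h4]
    with q hq hτ hl hq4
  constructor
  · intro hcl
    have hfr := (mem_closure_iff_frequently.1 hcl).and_eventually hq
    have hcont : ContinuousAt (fun p => (c.τ p).2 - g (c.τ p).1) (c.σ q) :=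
      (continuous_snd.continuousAt.comp hτ.continuousAt).sub
        (hg.continuousAt.comp (continuous_fst.continuousAt.comp hτ.continuousAt))
    have hmem : (fun p => (c.τ p).2 - g (c.τ p).1) (c.σ q) ∈ ({0} : Set ℝ) :=
      isClosed_singleton.mem_of_frequently_of_tendsto
        (hfr.mono fun p hp => sub_eq_zero.2 (hp.2 hp.1)) hcont
    rw [mem_singleton_iff, sub_eq_zero, hl] at hmem
    exact hmem
  · intro h
    by_cases hq0 : q.1 = 0
    · have : q = 0 := Prod.ext hq0 (by rw [h, hq0, h0]; rfl)
      rw [this, c.σ_zero]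
      exact hs
    · have := hq4 hq0
      rw [curve, ← h] at this
      exact subset_closure this

end LegendreChart

/-! ### Separation on the front -/

theorem SeparatesLocally.symm {x : Par → Space} {s : Par} {c a b : ℝ → Par}
    (h : SeparatesLocally x s c a b) : SeparatesLocally x s c b a := by
  filter_upwards [h] with ε ⟨h1, W, hW, h2⟩
  exact ⟨fun t τ ht h h' => (h1 t τ ht h h').symm, W, hW, fun K hK hK' ha hb => h2 K hK hK' hb ha⟩

/-- The double points of the front of support function `f` near `0` lie on the graph of `gD`. -/
structure DoublePointsOn (f : Par → ℝ) (gD : ℝ → ℝ) : Prop where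
  eq_or : ∀ᶠ z in 𝓝 (0 : Par × Par), legendreFront f z.1 = legendreFront f z.2 → z.1 = z.2 ∨
    (z.1.2 = gD z.1.1 ∧ z.2.2 = gD z.2.1)
  eq_zero : ∀ᶠ q in 𝓝 (0 : Par), legendreFront f q = legendreFront f 0 → q = 0

/-- In the parameter plane the graph of `gc` has a side below and a side above. These sides descend
to the image: two distinct parameters with the same image lie on the graph of `gD`, which off the
origin is on a single side of the graph of `gc` or coincides with it. A connected piece of the image
is covered by the images of the closed lower and upper sides, both closed by compactness. If it
meets both, it contains a common point, and such a point must come from the graph of `gc`. -/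
theorem separatesLocally_curve {x n : Par → Space} {s : Par} {f : Par → ℝ}
    (c : LegendreChart x n s f) {ga gb gc gD : ℝ → ℝ} (hD : DoublePointsOn f gD)
    (ha : Continuous ga) (hb : Continuous gb) (hc : Continuous gc)
    (ha0 : ga 0 = 0) (hb0 : gb 0 = 0) (hc0 : gc 0 = 0) (hD0 : gD 0 = 0)
    (hac : ∀ᶠ t in 𝓝[≠] (0 : ℝ), ga t < gc t) (hcb : ∀ᶠ t in 𝓝[≠] (0 : ℝ), gc t < gb t)
    (hcD : gD = gc ∨ (∀ᶠ t in 𝓝[≠] (0 : ℝ), gD t < gc t) ∨ ∀ᶠ t in 𝓝[≠] (0 : ℝ), gc t < gD t) :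
    SeparatesLocally x s (c.curve gc) (c.curve ga) (c.curve gb) := by
  have hf := c.contDiff
  let X : Par → Space := fun q => x s + c.A (legendreFront f q)
  have hX : Continuous X :=
    continuous_const.add (c.A.continuous.comp (contDiff_legendreFront hf).continuous)
  have hXX : ∀ q q', X q = X q' → legendreFront f q = legendreFront f q' := fun q q' h =>
    c.A.injective (add_left_cancel h)
  obtain ⟨r, hr, hball⟩ := Metric.eventually_nhds_iff_ball.1 (c.x_eq.and hD.eq_zero)
  obtain ⟨r', hr', hball'⟩ := Metric.eventually_nhds_iff_ball.1 hD.eq_or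
  have hcD' : gD = gc ∨ (∀ᶠ q : Par in 𝓝 0, q.1 ≠ 0 → gD q.1 < gc q.1) ∨
      ∀ᶠ q : Par in 𝓝 0, q.1 ≠ 0 → gc q.1 < gD q.1 := by
    have ht := continuous_fst.tendsto' (0 : Par) 0 rfl
    rcases hcD with h | h | h
    · exact Or.inl h
    · exact Or.inr (Or.inl (ht.eventually (eventually_nhdsWithin_iff.1 h)))
    · exact Or.inr (Or.inr (ht.eventually (eventually_nhdsWithin_iff.1 h)))
  obtain ⟨r'', hr'', hball''⟩ : ∃ r'' > 0, gD = gc ∨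
      (∀ q ∈ Metric.ball (0 : Par) r'', q.1 ≠ 0 → gD q.1 < gc q.1) ∨
      ∀ q ∈ Metric.ball (0 : Par) r'', q.1 ≠ 0 → gc q.1 < gD q.1 := by
    rcases hcD' with h | h | h
    · exact ⟨1, one_pos, Or.inl h⟩
    · obtain ⟨r'', h1, h2⟩ := Metric.eventually_nhds_iff_ball.1 h
      exact ⟨r'', h1, Or.inr (Or.inl h2)⟩
    · obtain ⟨r'', h1, h2⟩ := Metric.eventually_nhds_iff_ball.1 h
      exact ⟨r'', h1, Or.inr (Or.inr h2)⟩
  set R := min r (min r' r'') with hR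
  have hR0 : 0 < R := by positivity
  have bx : ∀ q ∈ Metric.ball (0 : Par) R, x (c.σ q) = X q := fun q hq =>
    (hball q (Metric.ball_subset_ball (min_le_left _ _) hq)).1
  have bz : ∀ q ∈ Metric.ball (0 : Par) R, X q = X 0 → q = 0 := fun q hq h =>
    (hball q (Metric.ball_subset_ball (min_le_left _ _) hq)).2 (hXX _ _ h)
  have bd : ∀ q ∈ Metric.ball (0 : Par) R, ∀ q' ∈ Metric.ball (0 : Par) R, X q = X q' →
      q = q' ∨ (q.2 = gD q.1 ∧ q'.2 = gD q'.1) := by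
    intro q hq q' hq' h
    refine hball' (q, q') ?_ (hXX _ _ h)
    have hRr : R ≤ r' := (min_le_right _ _).trans (min_le_left _ _)
    rw [← Prod.mk_zero_zero, ← ball_prod_same]
    exact ⟨Metric.ball_subset_ball hRr hq, Metric.ball_subset_ball hRr hq'⟩
  have bs : gD = gc ∨
      (∀ q ∈ Metric.ball (0 : Par) R, q.1 ≠ 0 → gD q.1 < gc q.1) ∨
      ∀ q ∈ Metric.ball (0 : Par) R, q.1 ≠ 0 → gc q.1 < gD q.1 := by
    have hRr : R ≤ r'' := (min_le_right _ _).trans (min_le_right _ _)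
    rcases hball'' with h | h | h
    · exact Or.inl h
    · exact Or.inr (Or.inl fun q hq => h q (Metric.ball_subset_ball hRr hq))
    · exact Or.inr (Or.inr fun q hq => h q (Metric.ball_subset_ball hRr hq))
  have zero_of : ∀ q : Par, q.1 = 0 → q.2 = gD q.1 → q = 0 := fun q h1 h2 =>
    Prod.ext h1 (by rw [h2, h1, hD0]; rfl)
  -- Being strictly below the graph depends only on the image point. The origin, where `gD` and `gc`
  -- meet, is handled by `bz`: no other parameter has its image.
  have sm : ∀ q ∈ Metric.ball (0 : Par) R, ∀ q' ∈ Metric.ball (0 : Par) R, X q = X q' →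
      q.2 < gc q.1 → q'.2 < gc q'.1 := by
    intro q hq q' hq' h hlt
    rcases bd q hq q' hq' h with e | ⟨e1, e2⟩
    · rwa [← e]
    · rcases bs with b | b | b
      · rw [e1, b] at hlt
        exact absurd hlt (lt_irrefl _)
      · by_cases h0 : q'.1 = 0
        · have h1 := zero_of q' h0 e2
          rw [h1] at h
          rw [bz q hq h] at hlt
          simp [hc0] at hlt
        · rw [e2]; exact b q' hq' h0
      · by_cases h0 : q.1 = 0
        · rw [e1, h0, hD0, hc0] at hlt
          exact absurd hlt (lt_irrefl _)
        · rw [e1] at hlt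
          exact absurd hlt (b q hq h0).not_gt
  have sp : ∀ q ∈ Metric.ball (0 : Par) R, ∀ q' ∈ Metric.ball (0 : Par) R, X q = X q' →
      gc q.1 < q.2 → gc q'.1 < q'.2 := by
    intro q hq q' hq' h hlt
    rcases bd q hq q' hq' h with e | ⟨e1, e2⟩
    · rwa [← e]
    · rcases bs with b | b | b
      · rw [e1, b] at hlt
        exact absurd hlt (lt_irrefl _)
      · by_cases h0 : q.1 = 0
        · rw [e1, h0, hD0, hc0] at hlt
          exact absurd hlt (lt_irrefl _)
        · rw [e1] at hlt
          exact absurd hlt (b q hq h0).not_gt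
      · by_cases h0 : q'.1 = 0
        · have h1 := zero_of q' h0 e2
          rw [h1] at h
          rw [bz q hq h] at hlt
          simp [hc0] at hlt
        · rw [e2]; exact b q' hq' h0
  have hgr : ∀ {g : ℝ → ℝ}, Continuous g → g 0 = 0 →
      ∀ᶠ t in 𝓝 (0 : ℝ), (t, g t) ∈ Metric.ball (0 : Par) R := fun hg h0 =>
    (LegendreChart.tendsto_graph hg h0).eventually (Metric.ball_mem_nhds _ hR0)
  obtain ⟨e, he, hee⟩ := Metric.eventually_nhds_iff_ball.1
    (((hgr ha ha0).and (hgr hb hb0)).and ((hgr hc hc0).and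
      ((eventually_nhdsWithin_iff.1 hac).and (eventually_nhdsWithin_iff.1 hcb))))
  filter_upwards [Ioo_mem_nhdsGT he] with ε hε
  have hε' : ∀ t : ℝ, |t| < ε → t ∈ Metric.ball (0 : ℝ) e := fun t ht => by
    rw [Metric.mem_ball, Real.dist_eq, sub_zero]; exact ht.trans hε.2
  have cA : ∀ t, |t| < ε → x (c.curve ga t) = X (t, ga t) := fun t ht =>
    bx _ (hee t (hε' t ht)).1.1
  have cB : ∀ t, |t| < ε → x (c.curve gb t) = X (t, gb t) := fun t ht =>
    bx _ (hee t (hε' t ht)).1.2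
  have cC : ∀ t, |t| < ε → x (c.curve gc t) = X (t, gc t) := fun t ht =>
    bx _ (hee t (hε' t ht)).2.1
  refine ⟨fun t τ ht0 ht hτ => ?_, ?_⟩
  · obtain ⟨⟨h1, h2⟩, h3, h4, h5⟩ := hee t (hε' t ht)
    rw [cA t ht, cB t ht, cC τ hτ]
    have h6 := (hee τ (hε' τ hτ)).2.1
    exact ⟨fun h => lt_irrefl _ (sm _ h1 _ h6 h (h4 ht0)),
      fun h => lt_irrefl _ (sp _ h2 _ h6 h (h5 ht0))⟩
  -- A closed ball is used for compactness; its radius is less than `ε` so that the crossing found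
  -- in it has an admissible parameter.
  · set ρ := min (ε / 2) (R / 2) with hρ
    have hρ0 : 0 < ρ := by have := hε.1; positivity
    have hρε : ρ < ε := (min_le_left _ _).trans_lt (half_lt_self hε.1)
    have hρR : ∀ q ∈ Metric.closedBall (0 : Par) ρ, q ∈ Metric.ball (0 : Par) R := fun q hq =>
      Metric.closedBall_subset_ball ((min_le_right _ _).trans_lt (half_lt_self hR0)) hq
    refine ⟨c.σ '' Metric.closedBall 0 ρ, ?_, fun K hK hKc => ?_⟩
    · rw [← eventually_mem_set, c.eventually_iff]
      filter_upwards [Metric.closedBall_mem_nhds (0 : Par) hρ0] with q hq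
      exact ⟨q, hq, rfl⟩
    · have hKX : ∀ z ∈ K, ∃ q ∈ Metric.closedBall (0 : Par) ρ, X q = z := by
        intro z hz
        obtain ⟨_, ⟨q, hq, rfl⟩, rfl⟩ := hK hz
        exact ⟨q, hq, (bx q (hρR q hq)).symm⟩
      rintro ⟨t, ht0, ht, htK⟩ ⟨t', ht0', ht', htK'⟩
      have hcl : ∀ {S : Set Par}, IsClosed S → IsClosed (X '' (Metric.closedBall 0 ρ ∩ S)) :=
        fun hS => (((isCompact_closedBall (0 : Par) ρ).inter_right hS).image hX).isClosed
      have hm := hcl (isClosed_le continuous_snd (hc.comp continuous_fst))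
      have hp := hcl (isClosed_le (hc.comp continuous_fst) continuous_snd)
      have key := isPreconnected_closed_iff.1 hKc _ _ hm hp ?_ ?_ ?_
      · obtain ⟨z, hzK, ⟨q, ⟨hq, hq1⟩, rfl⟩, q', ⟨hq', hq2⟩, hqq⟩ := key
        have hq3 : q.2 = gc q.1 := by
          refine le_antisymm hq1 (not_lt.1 fun hlt => ?_)
          exact absurd (sm q (hρR q hq) q' (hρR q' hq') hqq.symm hlt) (not_lt.2 hq2)
        have hq4 : |q.1| < ε := by
          have h1 : ‖q‖ ≤ ρ := by simpa using hq
          exact ((norm_fst_le q).trans h1).trans_lt hρε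
        refine ⟨q.1, hq4, ?_⟩
        rw [cC _ hq4, ← hq3]
        exact hzK
      · intro z hz
        obtain ⟨q, hq, rfl⟩ := hKX z hz
        rcases le_total q.2 (gc q.1) with h | h
        · exact Or.inl ⟨q, ⟨hq, h⟩, rfl⟩
        · exact Or.inr ⟨q, ⟨hq, h⟩, rfl⟩
      · obtain ⟨q, hq, hqz⟩ := hKX _ htK
        obtain ⟨⟨h1, h2⟩, h3, h4, h5⟩ := hee t (hε' t ht)
        rw [cA t ht] at hqz
        exact ⟨_, htK, q, ⟨hq, (sm _ h1 q (hρR q hq) hqz.symm (h4 ht0)).le⟩, by rw [cA t ht, hqz]⟩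
      · obtain ⟨q, hq, hqz⟩ := hKX _ htK'
        obtain ⟨⟨h1, h2⟩, h3, h4, h5⟩ := hee t' (hε' t' ht')
        rw [cB t' ht'] at hqz
        exact ⟨_, htK', q, ⟨hq, (sp _ h2 q (hρR q hq) hqz.symm (h5 ht0')).le⟩,
          by rw [cB t' ht', hqz]⟩

/-! ### The normal form of the support function at a godron -/

/-- The Taylor coefficients of the support function at a godron with invariant `ρ`; its
quasi-homogeneous part is `b ^ 2 / 2 - a ^ 2 * b + ρ * a ^ 4 / 2`. -/
structure GodronForm (f : Par → ℝ) (ρ : ℝ) : Prop where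
  contDiff : ContDiff ℝ ∞ f
  zero : f 0 = 0
  a : pa f 0 = 0
  b : pb f 0 = 0
  aa : pa (pa f) 0 = 0
  ab : pa (pb f) 0 = 0
  bb : pb (pb f) 0 = 1
  aaa : pa (pa (pa f)) 0 = 0
  aab : pa (pa (pb f)) 0 = -2
  aaaa : pa (pa (pa (pa f))) 0 = 12 * ρ

/-- The function `g` defines a smooth curve `b = κ * a ^ 2 + O(a ^ 3)`. -/
def CurveJet (g : ℝ → ℝ) (κ : ℝ) : Prop :=
  ∃ θ : ℝ → ℝ, ContDiff ℝ ∞ θ ∧ (∀ t, g t = t ^ 2 * θ t) ∧ θ 0 = κ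

namespace CurveJet

variable {g : ℝ → ℝ} {κ : ℝ}

theorem contDiff (h : CurveJet g κ) : ContDiff ℝ ∞ g := by
  obtain ⟨θ, h1, h2, -⟩ := h
  rw [funext h2]
  fun_prop

theorem zero (h : CurveJet g κ) : g 0 = 0 := by
  obtain ⟨θ, -, h2, -⟩ := h
  simp [h2]

theorem hasDerivAt (h : CurveJet g κ) :
    HasDerivAt g 0 0 ∧ HasDerivAt (deriv g) (2 * κ) 0 := by
  obtain ⟨θ, h1, h2, rfl⟩ := h
  have hθ : ∀ t, HasDerivAt θ (deriv θ t) t := fun t => (h1.differentiable (by simp) t).hasDerivAt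
  have hθ' : HasDerivAt (deriv θ) (deriv (deriv θ) 0) 0 :=
    (((contDiff_infty_iff_deriv).1 h1).2.differentiable (by simp) 0).hasDerivAt
  have hg : ∀ t, HasDerivAt g (2 * t * θ t + t ^ 2 * deriv θ t) t := by
    intro t
    rw [funext h2]
    have := (hasDerivAt_pow 2 t).mul (hθ t)
    exact this.congr_deriv (by simp)
  have hd : deriv g = fun t => 2 * t * θ t + t ^ 2 * deriv θ t := funext fun t => (hg t).deriv
  refine ⟨by simpa using hg 0, ?_⟩
  rw [hd]
  have := ((((hasDerivAt_id (0 : ℝ)).const_mul 2).mul (hθ 0))).add ((hasDerivAt_pow 2 0).mul hθ')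
  exact this.congr_deriv (by simp)

end CurveJet

theorem exists_curveJet {g : ℝ → ℝ} (hg : ContDiff ℝ ∞ g) (h0 : g 0 = 0) (h1 : deriv g 0 = 0) :
    ∃ κ, CurveJet g κ := by
  obtain ⟨θ, h2, h3, -⟩ := exists_eq_pow_mul_one hg 2 fun i hi => by
    interval_cases i
    · exact h0
    · exact h1
  exact ⟨θ 0, θ, h2, h3, rfl⟩

/-- A smooth curve with equation `G = 0` tangent to the first axis. -/
theorem exists_curve_of_eq_zero {G : Par → ℝ} (hG : ContDiff ℝ ∞ G) (h0 : G 0 = 0)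
    (ha : pa G 0 = 0) (hb : pb G 0 ≠ 0) :
    ∃ (g : ℝ → ℝ) (κ : ℝ), CurveJet g κ ∧ ∀ᶠ q in 𝓝 (0 : Par), G q = 0 ↔ q.2 = g q.1 := by
  have hd : HasDerivAt (fun z : ℝ => G (0, z)) (pb G 0) 0 := by
    have := hasDerivAt_comp_curve (F := G) (q := 0) (a := fun _ => 0) (b := fun z => z) (t := 0)
      (differentiableAt_of_smooth hG 0) rfl (hasDerivAt_const _ _) (hasDerivAt_id _)
    simpa using this
  obtain ⟨g, hg, hg0, hg1⟩ := exists_implicit (G := G) (a := (0 : ℝ)) (w := 0)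
    (hG.smoothNear _) h0 hd hb
  have hev : (fun t => G (t, g t)) =ᶠ[𝓝 0] fun _ => 0 := by
    filter_upwards [(LegendreChart.tendsto_graph hg.continuous hg0).eventually hg1] with t ht
    exact ht.2 rfl
  have h1 : deriv g 0 = 0 := by
    have e := (hasDerivAt_comp_curve (F := G) (q := 0) (a := fun t => t) (b := g) (t := 0)
      (differentiableAt_of_smooth hG 0) (by rw [hg0]; rfl) (hasDerivAt_id _)
      (hg.differentiable (by simp) 0).hasDerivAt).unique
        ((hasDerivAt_const 0 (0 : ℝ)).congr_of_eventuallyEq hev)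
    rw [ha] at e
    simpa [hb] using e
  obtain ⟨κ, hκ⟩ := exists_curveJet hg hg0 h1
  exact ⟨g, κ, hκ, hg1⟩

/-- This extracts the leading coefficient of an equation that holds identically along a curve. -/
theorem eq_zero_of_eventually_mul_eq_zero {F : ℝ → ℝ} (hF : ContinuousAt F 0) (n : ℕ)
    (h : ∀ᶠ t in 𝓝 (0 : ℝ), t ^ n * F t = 0) : F 0 = 0 := by
  have h1 : Tendsto F (𝓝[≠] 0) (𝓝 (F 0)) := hF.tendsto.mono_left nhdsWithin_le_nhds
  refine tendsto_nhds_unique h1 (tendsto_const_nhds.congr' ?_)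
  filter_upwards [h.filter_mono nhdsWithin_le_nhds, self_mem_nhdsWithin] with t ht ht0
  exact ((mul_eq_zero.1 ht).resolve_left (pow_ne_zero n ht0)).symm

namespace GodronForm

variable {f : Par → ℝ} {ρ : ℝ}

/-- In this and the following lemmas the value at `t = 0` is the corresponding derivative of `b² / 2
- a² b + ρ a⁴ / 2`, evaluated at `(1, w)`. -/
theorem blow_a (h : GodronForm f ρ) : ∃ Φ : Par → ℝ, ContDiff ℝ ∞ Φ ∧
    (∀ t w, pa f (t, t ^ 2 * w) = t ^ 3 * Φ (t, w)) ∧ ∀ w, Φ (0, w) = 2 * ρ - 2 * w := by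
  obtain ⟨Φ, h1, h2, h3⟩ := exists_blow_three (contDiff_pa h.contDiff) h.a h.aa
    (by rw [pb_pa h.contDiff, h.ab]) h.aaa
  refine ⟨Φ, h1, h2, fun w => ?_⟩
  rw [h3, h.aaaa, pb_pa h.contDiff, h.aab]
  ring

theorem blow_b (h : GodronForm f ρ) : ∃ Φ : Par → ℝ, ContDiff ℝ ∞ Φ ∧
    (∀ t w, pb f (t, t ^ 2 * w) = t ^ 2 * Φ (t, w)) ∧ ∀ w, Φ (0, w) = w - 1 := by
  obtain ⟨Φ, h1, h2, h3⟩ := exists_blow_two (contDiff_pb h.contDiff) h.b h.ab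
  refine ⟨Φ, h1, h2, fun w => ?_⟩
  rw [h3, h.aab, h.bb]
  ring

theorem blow_aa (h : GodronForm f ρ) : ∃ Φ : Par → ℝ, ContDiff ℝ ∞ Φ ∧
    (∀ t w, pa (pa f) (t, t ^ 2 * w) = t ^ 2 * Φ (t, w)) ∧ ∀ w, Φ (0, w) = 6 * ρ - 2 * w := by
  obtain ⟨Φ, h1, h2, h3⟩ := exists_blow_two (contDiff_pa (contDiff_pa h.contDiff)) h.aa h.aaa
  refine ⟨Φ, h1, h2, fun w => ?_⟩
  rw [h3, h.aaaa, pb_pa (contDiff_pa h.contDiff), pb_pa h.contDiff, h.aab]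
  ring

theorem blow_ab (h : GodronForm f ρ) : ∃ Φ : Par → ℝ, ContDiff ℝ ∞ Φ ∧
    (∀ t w, pa (pb f) (t, t ^ 2 * w) = t * Φ (t, w)) ∧ ∀ w, Φ (0, w) = -2 := by
  obtain ⟨Φ, h1, h2, h3⟩ := exists_blow_one (contDiff_pa (contDiff_pb h.contDiff)) h.ab
  exact ⟨Φ, h1, h2, fun w => by rw [h3, h.aab]⟩

theorem blow_aaa (h : GodronForm f ρ) : ∃ Φ : Par → ℝ, ContDiff ℝ ∞ Φ ∧
    (∀ t w, pa (pa (pa f)) (t, t ^ 2 * w) = t * Φ (t, w)) ∧ ∀ w, Φ (0, w) = 12 * ρ := by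
  obtain ⟨Φ, h1, h2, h3⟩ :=
    exists_blow_one (contDiff_pa (contDiff_pa (contDiff_pa h.contDiff))) h.aaa
  exact ⟨Φ, h1, h2, fun w => by rw [h3, h.aaaa]⟩

theorem blow_height (h : GodronForm f ρ) : ∃ Φ : Par → ℝ, ContDiff ℝ ∞ Φ ∧
    (∀ t w, legendreHeight f (t, t ^ 2 * w) = t ^ 4 * Φ (t, w)) ∧
      ∀ w, Φ (0, w) = -(w ^ 2 - 4 * w + 3 * ρ) / 2 := by
  obtain ⟨Φ, h1, h2, h3⟩ := exists_blow_four h.contDiff h.zero h.a h.b h.aa h.ab h.aaa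
  obtain ⟨Φa, a1, a2, a3⟩ := h.blow_a
  obtain ⟨Φb, b1, b2, b3⟩ := h.blow_b
  refine ⟨fun q => Φ q - Φa q - q.2 * Φb q, by fun_prop, fun t w => ?_, fun w => ?_⟩
  · rw [legendreHeight, h2, a2, b2]
    ring
  · simp only
    rw [h3, a3, b3, h.aaaa, h.aab, h.bb]
    ring

theorem blow_hessDet (h : GodronForm f ρ) : ∃ Φ : Par → ℝ, ContDiff ℝ ∞ Φ ∧
    (∀ t w, hessDet f (t, t ^ 2 * w) = t ^ 2 * Φ (t, w)) ∧
      ∀ w, Φ (0, w) = 6 * ρ - 4 - 2 * w := by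
  obtain ⟨Φa, a1, a2, a3⟩ := h.blow_aa
  obtain ⟨Φb, b1, b2, b3⟩ := h.blow_ab
  have hbb := contDiff_blow (contDiff_pb (contDiff_pb h.contDiff))
  refine ⟨fun q => Φa q * blow (pb (pb f)) q - Φb q ^ 2, by fun_prop, fun t w => ?_, fun w => ?_⟩
  · rw [hessDet, a2, b2]
    simp only [blow]
    ring
  · simp only
    rw [a3, b3, blow_zero_left, h.bb]
    ring

/-! #### The parabolic curve -/

/-- The derivative of the Hessian determinant in `b` at the origin is `f_aab = -2`, so its zero set
is a smooth curve; its leading term `6ρ - 4 - 2κ` must vanish. -/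
theorem exists_parabolic (h : GodronForm f ρ) : ∃ g : ℝ → ℝ, CurveJet g (3 * ρ - 2) ∧
    ∀ᶠ q in 𝓝 (0 : Par), hessDet f q = 0 ↔ q.2 = g q.1 := by
  have hf := h.contDiff
  have ca := contDiff_pa hf
  have cb := contDiff_pb hf
  have haa := hasFDerivAt_of_smooth (contDiff_pa ca) 0
  have hab := hasFDerivAt_of_smooth (contDiff_pa cb) 0
  have hbb := hasFDerivAt_of_smooth (contDiff_pb cb) 0
  have hd : HasFDerivAt (hessDet f) _ 0 := (haa.mul hbb).sub (hab.pow 2)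
  obtain ⟨g, κ, hκ, hg⟩ := exists_curve_of_eq_zero (contDiff_hessDet hf)
    (by rw [hessDet, h.aa, h.ab]; ring)
    (by rw [pa_eq_of_hasFDerivAt hd]; simp [fderiv_eq_partials, h.aa, h.ab, h.bb, h.aaa])
    (by
      rw [pb_eq_of_hasFDerivAt hd]
      simp [fderiv_eq_partials, h.aa, h.ab, h.bb, pb_pa ca, pb_pa hf, h.aab])
  obtain ⟨Φ, p1, p2, p3⟩ := h.blow_hessDet
  obtain ⟨θ, w1, w2, w3⟩ := id hκ
  have e := eq_zero_of_eventually_mul_eq_zero (F := fun t => Φ (t, θ t))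
    (p1.continuous.comp (continuous_id.prodMk w1.continuous)).continuousAt 2 (by
      filter_upwards [(LegendreChart.tendsto_graph hκ.contDiff.continuous hκ.zero).eventually hg]
        with t ht
      rw [← p2, ← w2]
      exact ht.2 rfl)
  simp only [p3, w3] at e
  have : κ = 3 * ρ - 2 := by linarith
  exact ⟨g, this ▸ hκ, hg⟩

/-! #### The flecnodal curve -/

/-- For a direction `(1, m)` the equation `cub = 0` is solved first: its derivative in `m` at the
origin is `3 f_aab = -6`, which gives a smooth slope `M q`. Substituting it into `hess = 0` leaves
one equation for the curve. The function `R` records the second entry of the Hessian applied to the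
flecnodal direction; its sign later tells left from right. -/
theorem exists_flecnodal (h : GodronForm f ρ) : ∃ g : ℝ → ℝ, CurveJet g (2 * ρ ^ 2 - ρ) ∧
    (∀ᶠ q in 𝓝 (0 : Par), (∃ v ≠ 0, hess f q v = 0 ∧ cub f q v = 0) ↔ q.2 = g q.1) ∧
    ∃ R : ℝ → ℝ, Continuous R ∧ R 0 = 2 * ρ - 2 ∧ ∀ᶠ t in 𝓝 (0 : ℝ), ∀ v : Par, v ≠ 0 →
      hess f (t, g t) v = 0 → cub f (t, g t) v = 0 → v.1 ≠ 0 ∧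
        pa (pb f) (t, g t) * v.1 + pb (pb f) (t, g t) * v.2 = t * R t * v.1 := by
  have hf := h.contDiff
  have ca := contDiff_pa hf
  have cb := contDiff_pb hf
  have caa := contDiff_pa ca
  have cab := contDiff_pa cb
  have cbb := contDiff_pb cb
  have caaa := contDiff_pa caa
  have caab := contDiff_pa cab
  have cabb := contDiff_pa cbb
  have cbbb := contDiff_pb cbb
  let G2 : Par × ℝ → ℝ := fun z => pa (pa (pa f)) z.1 + 3 * z.2 * pa (pa (pb f)) z.1 +
    3 * z.2 ^ 2 * pa (pb (pb f)) z.1 + z.2 ^ 3 * pb (pb (pb f)) z.1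
  have hG2 : ContDiff ℝ ∞ G2 := by fun_prop
  have hG2d : HasDerivAt (fun m => G2 (0, m)) (-6) 0 := by
    have h1 := ((((hasDerivAt_id (0 : ℝ)).const_mul 3).mul_const (pa (pa (pb f)) 0)).const_add
      (pa (pa (pa f)) 0)).add ((((hasDerivAt_pow 2 (0 : ℝ)).const_mul 3).mul_const
      (pa (pb (pb f)) 0)))
    have h2 := h1.add ((hasDerivAt_pow 3 (0 : ℝ)).mul_const (pb (pb (pb f)) 0))
    convert! h2 using 1
    simp [h.aab]
    norm_num
  obtain ⟨M, hM, hM0, hM1⟩ := exists_implicit (G := G2) (a := (0 : Par)) (w := 0)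
    (hG2.smoothNear _) (by simp [G2, h.aaa]) hG2d (by norm_num)
  let G : Par → ℝ := fun q => pa (pa f) q + 2 * M q * pa (pb f) q + M q ^ 2 * pb (pb f) q
  have hG : ContDiff ℝ ∞ G := by fun_prop
  have hGd : HasFDerivAt G _ 0 := ((hasFDerivAt_of_smooth caa 0).add
    (((hasFDerivAt_of_smooth hM 0).const_mul 2).mul (hasFDerivAt_of_smooth cab 0))).add
      (((hasFDerivAt_of_smooth hM 0).pow 2).mul (hasFDerivAt_of_smooth cbb 0))
  obtain ⟨g, κ, hκ, hg⟩ := exists_curve_of_eq_zero hG (by simp [G, h.aa, hM0])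
    (by rw [pa_eq_of_hasFDerivAt hGd]; simp [fderiv_eq_partials, hM0, h.ab, h.aaa])
    (by
      rw [pb_eq_of_hasFDerivAt hGd]
      simp [fderiv_eq_partials, hM0, h.ab, pb_pa ca, pb_pa hf, h.aab])
  obtain ⟨θ, w1, w2, w3⟩ := id hκ
  have hgt := LegendreChart.tendsto_graph hκ.contDiff.continuous hκ.zero
  -- directions with four-point contact
  have hdir : ∀ᶠ q in 𝓝 (0 : Par), ∀ v : Par, v ≠ 0 → hess f q v = 0 → cub f q v = 0 →
      v.1 ≠ 0 ∧ v.2 = M q * v.1 ∧ G q = 0 := by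
    obtain ⟨⟨r, r'⟩, ⟨hr, hr'⟩, hrr⟩ : ∃ r : ℝ × ℝ, (0 < r.1 ∧ 0 < r.2) ∧
        ∀ q ∈ Metric.ball (0 : Par) r.1, ∀ m ∈ Metric.ball (0 : ℝ) r.2,
          G2 (q, m) = 0 ↔ m = M q := by
      obtain ⟨r, hr, hball⟩ := Metric.eventually_nhds_iff_ball.1 hM1
      refine ⟨(r, r), ⟨hr, hr⟩, fun q hq m hm => hball (q, m) ?_⟩
      rw [← ball_prod_same]
      exact ⟨hq, hm⟩
    have e1 : ∀ᶠ q in 𝓝 (0 : Par), 1 / 2 < pb (pb f) q :=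
      cbb.continuous.continuousAt.eventually_const_lt (by rw [h.bb]; norm_num)
    have e2 : ∀ᶠ q in 𝓝 (0 : Par), |pa (pa f) q| + 2 * |pa (pb f) q| * r' < r' ^ 2 / 4 := by
      refine Tendsto.eventually_lt_const ?_
        (((caa.continuous.abs).add ((continuous_const.mul cab.continuous.abs).mul
          continuous_const)).continuousAt)
      simp [h.aa, h.ab]
      positivity
    have e3 : ∀ᶠ q in 𝓝 (0 : Par), 2 * |pa (pb f) q| < r' / 4 := by
      refine Tendsto.eventually_lt_const ?_
        ((continuous_const.mul cab.continuous.abs).continuousAt)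
      simp [h.ab]
      positivity
    filter_upwards [e1, e2, e3, Metric.ball_mem_nhds (0 : Par) hr] with q q1 q2 q3 q4 v hv hh hc
    have hv1 : v.1 ≠ 0 := by
      intro h0
      rw [hess, h0] at hh
      have : v.2 = 0 := by
        have h3 : pb (pb f) q * v.2 ^ 2 = 0 := by linear_combination hh
        simpa [(by linarith : pb (pb f) q ≠ 0)] using h3
      exact hv (Prod.ext h0 this)
    obtain ⟨m, hm⟩ : ∃ m, v.2 = m * v.1 := ⟨v.2 / v.1, by field_simp⟩
    have hh' : pa (pa f) q + 2 * m * pa (pb f) q + m ^ 2 * pb (pb f) q = 0 := by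
      rw [hess, hm] at hh
      refine mul_left_cancel₀ (pow_ne_zero 2 hv1) ?_
      linear_combination hh
    have hc' : G2 (q, m) = 0 := by
      rw [cub, hm] at hc
      refine mul_left_cancel₀ (pow_ne_zero 3 hv1) ?_
      simp only [G2]
      linear_combination hc
    -- Near the origin the Hessian is close to the form `v₂²`, so every asymptotic direction has
    -- small slope and falls in the range of uniqueness of `M`.
    have hmr : |m| < r' := by
      by_contra hcon
      push Not at hcon
      have h1 : m ^ 2 * pb (pb f) q ≤ |pa (pa f) q| + 2 * |pa (pb f) q| * |m| := by
        have a1 := neg_abs_le (pa (pa f) q)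
        have a2 := neg_abs_le (pa (pb f) q * m)
        rw [abs_mul] at a2
        nlinarith
      have h2 : m ^ 2 = |m| ^ 2 := (sq_abs m).symm
      have h3 := abs_nonneg (pa (pb f) q)
      have h4 : 0 < |m| := hr'.trans_le hcon
      have h5 : m ^ 2 * (1 / 2) ≤ m ^ 2 * pb (pb f) q := by gcongr
      have h6 : 2 * |pa (pb f) q| * |m| ≤ r' / 4 * |m| := by gcongr
      have h7 : |pa (pa f) q| < r' ^ 2 / 4 := by nlinarith
      nlinarith
    have hmM := (hrr q q4 m (by simpa using hmr)).1 hc'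
    exact ⟨hv1, by rw [hm, hmM], by simp only [G]; rw [← hmM]; exact hh'⟩
  have hM1' : ∀ᶠ q in 𝓝 (0 : Par), G2 (q, M q) = 0 := by
    have ht : Tendsto (fun q => (q, M q)) (𝓝 (0 : Par)) (𝓝 ((0 : Par), (0 : ℝ))) :=
      (continuous_id.prodMk hM.continuous).tendsto' _ _ (by simp [hM0])
    filter_upwards [ht.eventually hM1] with q hq
    exact hq.2 rfl
  have hiff : ∀ᶠ q in 𝓝 (0 : Par), (∃ v ≠ 0, hess f q v = 0 ∧ cub f q v = 0) ↔ q.2 = g q.1 := by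
    filter_upwards [hdir, hM1', hg] with q h1 h2 h3
    rw [← h3]
    constructor
    · rintro ⟨v, hv, hh, hc⟩
      exact (h1 v hv hh hc).2.2
    · intro h0
      refine ⟨(1, M q), fun h => one_ne_zero (congrArg Prod.fst h), ?_, ?_⟩
      · simp only [hess]
        simp only [G] at h0
        linear_combination h0
      · simp only [cub]
        simp only [G2] at h2
        linear_combination h2
  -- the jet of the curve
  obtain ⟨m1, hm1, hm2, -⟩ := exists_eq_pow_mul_one (ψ := fun t => M (t, g t))
    (hM.comp (contDiff_id.prodMk hκ.contDiff)) 1 fun i hi => by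
      obtain rfl : i = 0 := by omega
      change M (0, g 0) = 0
      rw [hκ.zero]; exact hM0
  simp only [pow_one] at hm2
  obtain ⟨Φaaa, c1, c2, c3⟩ := h.blow_aaa
  obtain ⟨Φaa, a1, a2, a3⟩ := h.blow_aa
  obtain ⟨Φab, b1, b2, b3⟩ := h.blow_ab
  have hθc := w1.continuous
  have hgc := hκ.contDiff.continuous
  have hm1c := hm1.continuous
  have cont : ∀ {F : Par → ℝ}, ContDiff ℝ ∞ F → Continuous fun t => F (t, θ t) := fun hF =>
    hF.continuous.comp (continuous_id.prodMk hθc)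
  have cont' : ∀ {F : Par → ℝ}, ContDiff ℝ ∞ F → Continuous fun t => F (t, g t) := fun hF =>
    hF.continuous.comp (continuous_id.prodMk hgc)
  have k1 := cont c1
  have k2 := cont a1
  have k3 := cont b1
  have k4 := cont' caab
  have k5 := cont' cabb
  have k6 := cont' cbbb
  have k7 := cont' cbb
  have g0 : ((0 : ℝ), g 0) = (0 : Par) := by rw [hκ.zero]; rfl
  -- The terms of lowest order of the cubic equation along the curve are `12ρ - 6 m1 0`.
  have em : m1 0 = 2 * ρ := by
    have e := eq_zero_of_eventually_mul_eq_zero (F := fun t => Φaaa (t, θ t) +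
      3 * m1 t * pa (pa (pb f)) (t, g t) + 3 * t * m1 t ^ 2 * pa (pb (pb f)) (t, g t) +
      t ^ 2 * m1 t ^ 3 * pb (pb (pb f)) (t, g t)) (Continuous.continuousAt (by fun_prop)) 1 (by
        filter_upwards [hgt.eventually hM1'] with t ht
        simp only [G2] at ht
        rw [hm2] at ht
        have e2 := c2 t (θ t)
        rw [← w2] at e2
        rw [e2] at ht
        linear_combination ht)
    simp only [c3, g0, h.aab] at e
    linarith
  -- The terms of lowest order of the quadratic equation are `6ρ - 2κ - 4 m1 0 + (m1 0)²`.
  have eκ : κ = 2 * ρ ^ 2 - ρ := by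
    have e := eq_zero_of_eventually_mul_eq_zero (F := fun t => Φaa (t, θ t) +
      2 * m1 t * Φab (t, θ t) + m1 t ^ 2 * pb (pb f) (t, g t)) (Continuous.continuousAt (by fun_prop)) 2 (by
        filter_upwards [hgt.eventually hg] with t ht
        have ht' := ht.2 rfl
        simp only [G] at ht'
        rw [hm2] at ht'
        have e2 := a2 t (θ t)
        have e3 := b2 t (θ t)
        rw [← w2] at e2 e3
        rw [e2, e3] at ht'
        linear_combination ht')
    simp only [a3, b3, g0, h.bb, em, w3] at e
    linarith
  refine ⟨g, eκ ▸ hκ, hiff, fun t => Φab (t, θ t) + m1 t * pb (pb f) (t, g t), by fun_prop, ?_, ?_⟩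
  · simp only [b3, g0, h.bb, em]
    ring
  · filter_upwards [hgt.eventually hdir] with t ht v hv hh hc
    obtain ⟨h1, h2, -⟩ := ht v hv hh hc
    refine ⟨h1, ?_⟩
    have e3 := b2 t (θ t)
    rw [← w2] at e3
    rw [h2, hm2, e3]
    ring

end GodronForm

/-! ### Double points -/

/-- Both nontrivial equations are divisible by `u - u'`. The quotients give `v + 2(u² + u u' + u'²)
= 0` and `(u + u')(3(u² + u'²) + v) = 0`. The second factor differs from the first equation by `(u -
u')²`, so only `u' = -u` remains. -/
theorem standardSwallowtail_eq_iff {q q' : Par} (h : standardSwallowtail q = standardSwallowtail q') :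
    q = q' ∨ (q.2 + 2 * q.1 ^ 2 = 0 ∧ q'.2 + 2 * q'.1 ^ 2 = 0) := by
  obtain ⟨u, v⟩ := q
  obtain ⟨u', v'⟩ := q'
  have h0 := congrFun h 0
  have h1 := congrFun h 1
  have h2 := congrFun h 2
  simp [standardSwallowtail] at h0 h1 h2
  subst h2
  by_cases hu : u = u'
  · exact Or.inl (by rw [hu])
  · right
    have hu' : u - u' ≠ 0 := sub_ne_zero.2 hu
    have e1 : v + 2 * (u ^ 2 + u * u' + u' ^ 2) = 0 := by
      refine mul_left_cancel₀ hu' ?_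
      linear_combination h1 / 2
    have e2 : (u + u') * (3 * (u ^ 2 + u' ^ 2) + v) = 0 := by
      refine mul_left_cancel₀ hu' ?_
      linear_combination h0
    have e3 : u + u' = 0 := by
      refine (mul_eq_zero.1 e2).resolve_right fun h => ?_
      have : (u - u') ^ 2 = 0 := by linear_combination h - e1
      exact hu' (by simpa using this)
    have e4 : u' = -u := by linarith
    subst e4
    simp only
    constructor <;> linear_combination e1

theorem standardSwallowtail_eq_zero {q : Par} (h : standardSwallowtail q = standardSwallowtail 0) :
    q = 0 := by
  obtain ⟨u, v⟩ := q
  have h1 := congrFun h 1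
  have h2 := congrFun h 2
  simp [standardSwallowtail] at h1 h2
  subst h2
  simp at h1
  rw [h1]
  rfl

theorem standardSwallowtail_neg (t : ℝ) :
    standardSwallowtail (-t, -2 * t ^ 2) = standardSwallowtail (t, -2 * t ^ 2) := by
  ext i
  fin_cases i <;> simp [standardSwallowtail] <;> ring

theorem contDiff_standardSwallowtail : ContDiff ℝ ∞ standardSwallowtail := by
  rw [contDiff_pi]
  intro i
  fin_cases i
  · change ContDiff ℝ ∞ fun q : Par => 3 * q.1 ^ 4 + q.1 ^ 2 * q.2
    fun_prop
  · change ContDiff ℝ ∞ fun q : Par => 4 * q.1 ^ 3 + 2 * q.1 * q.2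
    fun_prop
  · exact contDiff_snd

theorem standardSwallowtail_zero : standardSwallowtail 0 = 0 := by
  ext i
  fin_cases i <;> simp [standardSwallowtail]

theorem fderiv_standardSwallowtail_zero (v : Par) :
    fderiv ℝ standardSwallowtail 0 v = ![0, 0, v.2] := by
  have h1 : HasDerivAt (fun t : ℝ => t • v) v 0 := by
    simpa using (hasDerivAt_id (0 : ℝ)).smul_const v
  have h2 : HasFDerivAt standardSwallowtail (fderiv ℝ standardSwallowtail 0) ((0 : ℝ) • v) := by
    rw [zero_smul]
    exact (contDiff_standardSwallowtail.differentiable (by simp) _).hasFDerivAt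
  refine (h2.comp_hasDerivAt 0 h1).unique ?_
  rw [hasDerivAt_pi]
  have hl : ∀ c : ℝ, HasDerivAt (fun t : ℝ => t * c) c 0 := fun c => by
    simpa using (hasDerivAt_id (0 : ℝ)).mul_const c
  intro i
  fin_cases i
  · have := (((hl v.1).pow 4).const_mul 3).add (((hl v.1).pow 2).mul (hl v.2))
    exact this.congr_deriv (by simp)
  · have := (((hl v.1).pow 3).const_mul 4).add (((hl v.1).const_mul 2).mul (hl v.2))
    exact this.congr_deriv (by simp)
  · exact hl v.2

/-- A front of support function `f` equivalent to the standard swallowtail. -/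
def IsSwallowtailForm (f : Par → ℝ) : Prop :=
  ∃ (θ : Par → Par) (Ψ : Space → Space),
    SmoothNear θ 0 ∧ θ 0 = 0 ∧ Function.Bijective (fderiv ℝ θ 0) ∧
    SmoothNear Ψ 0 ∧ Function.Bijective (fderiv ℝ Ψ 0) ∧
    ∀ᶠ q in 𝓝 (0 : Par), legendreFront f (θ q) = Ψ (standardSwallowtail q)

theorem exists_continuousLinearEquiv {E : Type} [NormedAddCommGroup E] [NormedSpace ℝ E]
    [FiniteDimensional ℝ E] {T : E →L[ℝ] E} (h : Function.Bijective T) :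
    ∃ T' : E ≃L[ℝ] E, (T' : E →L[ℝ] E) = T :=
  ⟨(LinearEquiv.ofBijective (T : E →ₗ[ℝ] E) h).toContinuousLinearEquiv, by ext; rfl⟩

/-- The double curve is the image under `θ` of the parabola `v = -2u²` of the standard swallowtail.
It is tangent to the first axis because `θ` carries the kernel direction of one differential to that
of the other. -/
theorem GodronForm.exists_double {f : Par → ℝ} {ρ : ℝ} (h : GodronForm f ρ)
    (hs : IsSwallowtailForm f) : ∃ g : ℝ → ℝ, CurveJet g ρ ∧ DoublePointsOn f g ∧
      ∃ ι : ℝ → ℝ, Tendsto ι (𝓝 0) (𝓝 0) ∧ ∀ᶠ t in 𝓝[≠] (0 : ℝ), ι t ≠ t ∧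
        legendreFront f (ι t, g (ι t)) = legendreFront f (t, g t) := by
  have hf := h.contDiff
  obtain ⟨θ, Ψ, hθ, hθ0, hθb, hΨ, hΨb, hθΨ⟩ := hs
  obtain ⟨θ', hθ'⟩ := exists_continuousLinearEquiv hθb
  obtain ⟨Ψ', hΨ'⟩ := exists_continuousLinearEquiv hΨb
  have hθd : HasFDerivAt θ (θ' : Par →L[ℝ] Par) 0 := hθ' ▸ hθ.differentiableAt.hasFDerivAt
  have hΨd : HasFDerivAt Ψ (Ψ' : Space →L[ℝ] Space) 0 := hΨ' ▸ hΨ.differentiableAt.hasFDerivAt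
  obtain ⟨χ, hχ, hχ0, hχθ, hθχ⟩ := hθ.exists_local_inverse hθd
  obtain ⟨Ξ, -, -, hΞΨ, -⟩ := hΨ.exists_local_inverse hΨd
  rw [hθ0] at hχ hχ0 hθχ
  have tθ : Tendsto θ (𝓝 0) (𝓝 0) := by simpa only [ContinuousAt, hθ0] using hθ.continuousAt
  have tχ : Tendsto χ (𝓝 0) (𝓝 0) := by simpa only [ContinuousAt, hχ0] using hχ.continuousAt
  have tst : Tendsto standardSwallowtail (𝓝 0) (𝓝 0) :=
    contDiff_standardSwallowtail.continuous.tendsto' _ _ standardSwallowtail_zero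
  -- the tangent direction
  have hdir : (θ' (1, 0)).2 = 0 := by
    have e1 : HasFDerivAt (legendreFront f) (fderiv ℝ (legendreFront f) 0) (θ 0) := by
      rw [hθ0]
      exact ((contDiff_legendreFront hf).differentiable (by simp) _).hasFDerivAt
    have e2 : HasFDerivAt Ψ (Ψ' : Space →L[ℝ] Space) (standardSwallowtail 0) := by
      rwa [standardSwallowtail_zero]
    have e3 : HasFDerivAt standardSwallowtail (fderiv ℝ standardSwallowtail 0) 0 :=
      (contDiff_standardSwallowtail.differentiable (by simp) _).hasFDerivAt
    have e4 := (e1.comp 0 hθd).unique ((e2.comp 0 e3).congr_of_eventuallyEq hθΨ)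
    have e5 := congrArg (fun T : Par →L[ℝ] Space => T (1, 0) 1) e4
    simp only [ContinuousLinearMap.comp_apply, fderiv_legendreFront hf,
      fderiv_standardSwallowtail_zero, h.ab, h.bb] at e5
    have e6 : (![0, 0, (1, (0 : ℝ)).2] : Space) = 0 := by
      ext i; fin_cases i <;> rfl
    rw [e6] at e5
    simpa using e5
  set p := (θ' (1, 0)).1 with hp
  have hθ1 : θ' (1, 0) = (p, 0) := Prod.ext rfl hdir
  have hp0 : p ≠ 0 := by
    intro h0
    have : θ' (1, 0) = θ' 0 := by rw [hθ1, h0, map_zero]; rfl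
    exact one_ne_zero (congrArg Prod.fst (θ'.injective this))
  have hχd : HasFDerivAt χ (fderiv ℝ χ 0) 0 := hχ.differentiableAt.hasFDerivAt
  have hχθ' : ∀ v, fderiv ℝ χ 0 (θ' v) = v := by
    intro v
    have e1 : HasFDerivAt χ (fderiv ℝ χ 0) (θ 0) := by rwa [hθ0]
    have e2 := (e1.comp 0 hθd).unique ((hasFDerivAt_id _).congr_of_eventuallyEq hχθ)
    exact congrArg (fun T : Par →L[ℝ] Par => T v) e2
  have hχθ'' : ∀ v, θ' (fderiv ℝ χ 0 v) = v := by
    intro v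
    obtain ⟨w, rfl⟩ := θ'.surjective v
    rw [hχθ']
  -- the equation of the double curve
  have hG0 : SmoothNear (fun q => (χ q).2 + 2 * (χ q).1 ^ 2) 0 := by
    filter_upwards [hχ] with q hq
    exact (contDiffAt_snd.comp q hq).add
      (contDiffAt_const.mul ((contDiffAt_fst.comp q hq).pow 2))
  obtain ⟨G, hG, hGe⟩ := hG0.exists_contDiff
  have hGd : HasFDerivAt G ((ContinuousLinearMap.snd ℝ ℝ ℝ).comp (fderiv ℝ χ 0)) 0 := by
    refine HasFDerivAt.congr_of_eventuallyEq ?_ hGe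
    have e1 := (hasFDerivAt_snd (𝕜 := ℝ) (E := ℝ) (F := ℝ) (p := χ 0)).comp 0 hχd
    have e2 := (hasFDerivAt_fst (𝕜 := ℝ) (E := ℝ) (F := ℝ) (p := χ 0)).comp 0 hχd
    refine (e1.add ((e2.pow 2).const_mul 2)).congr_fderiv ?_
    simp [hχ0]
  have hpa : pa G 0 = 0 := by
    rw [pa_eq_of_hasFDerivAt hGd]
    have e : ((1 : ℝ), (0 : ℝ)) = p⁻¹ • θ' (1, 0) := by rw [hθ1]; simp [hp0]
    simp only [ContinuousLinearMap.comp_apply]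
    rw [e, map_smul, hχθ']
    simp
  have hpb : pb G 0 ≠ 0 := by
    rw [pb_eq_of_hasFDerivAt hGd]
    intro h0
    simp only [ContinuousLinearMap.comp_apply, ContinuousLinearMap.coe_snd'] at h0
    have e : fderiv ℝ χ 0 (0, 1) = (fderiv ℝ χ 0 (0, 1)).1 • (1, 0) := by
      ext
      · simp
      · rw [h0]; simp
    have e1 := hχθ'' (0, 1)
    rw [e, map_smul, hθ1] at e1
    exact zero_ne_one ((by simp : _ = (0 : ℝ)).symm.trans (congrArg Prod.snd e1))
  obtain ⟨g, κ, hκ, hg⟩ := exists_curve_of_eq_zero hG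
    (by rw [hGe.self_of_nhds]; simp [hχ0]) hpa hpb
  obtain ⟨w, w1, w2, w3⟩ := id hκ
  have hgc := hκ.contDiff.continuous
  have hgt := LegendreChart.tendsto_graph hgc hκ.zero
  -- the parametrization of the double curve
  have hpar : Tendsto (fun t : ℝ => (t, -2 * t ^ 2)) (𝓝 0) (𝓝 (0 : Par)) :=
    Continuous.tendsto' (by fun_prop) _ _ (by simp)
  let A : ℝ → ℝ := fun t => (θ (t, -2 * t ^ 2)).1
  have hA0 : A 0 = 0 := by
    have : ((0 : ℝ), -2 * (0 : ℝ) ^ 2) = (0 : Par) := by simp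
    simp only [A, this, hθ0]
    rfl
  have hAd : HasDerivAt A p 0 := by
    have e1 : HasDerivAt (fun t : ℝ => (t, -2 * t ^ 2)) (1, 0) 0 := by
      refine (hasDerivAt_id _).prodMk ?_
      exact ((hasDerivAt_pow 2 (0 : ℝ)).const_mul (-2)).congr_deriv (by simp)
    have e2 : HasFDerivAt θ (θ' : Par →L[ℝ] Par) ((0 : ℝ), -2 * (0 : ℝ) ^ 2) := by
      have : ((0 : ℝ), -2 * (0 : ℝ) ^ 2) = (0 : Par) := by simp
      rwa [this]
    have e3 := (hasFDerivAt_fst (𝕜 := ℝ) (E := ℝ) (F := ℝ)).comp_hasDerivAt 0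
      (e2.comp_hasDerivAt 0 e1)
    exact e3.congr_deriv (by simp [hp])
  have tA : Tendsto A (𝓝 0) (𝓝 0) := by simpa only [ContinuousAt, hA0] using hAd.continuousAt
  have hcurve : ∀ᶠ t in 𝓝 (0 : ℝ), θ (t, -2 * t ^ 2) = (A t, g (A t)) := by
    filter_upwards [hpar.eventually (tθ.eventually hg), hpar.eventually (tθ.eventually hGe),
      hpar.eventually hχθ] with t e1 e2 e3
    refine Prod.ext rfl (e1.1 ?_)
    rw [e2, e3]
    simp
  have hfront : ∀ᶠ t in 𝓝 (0 : ℝ), legendreFront f (A t, g (A t)) =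
      Ψ (standardSwallowtail (t, -2 * t ^ 2)) := by
    filter_upwards [hcurve, hpar.eventually hθΨ] with t e1 e2
    rw [← e1, e2]
  have tneg : Tendsto (fun t : ℝ => -t) (𝓝 0) (𝓝 0) := by
    simpa using (continuous_neg (G := ℝ)).tendsto 0
  have hsym : ∀ᶠ t in 𝓝 (0 : ℝ), legendreFront f (A (-t), g (A (-t))) =
      legendreFront f (A t, g (A t)) := by
    filter_upwards [hfront, tneg.eventually hfront] with t e1 e2
    rw [e1, e2, neg_sq, standardSwallowtail_neg]
  -- The first coordinate of the front along the double curve is `p³ (2ρ - 2κ) t³ + o(t³)`, odd to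
  -- leading order, and it takes the same value at `t` and `-t`; the coefficient therefore vanishes.
  have hκρ : κ = ρ := by
    obtain ⟨Φ, p1, p2, p3⟩ := h.blow_a
    have hE : Tendsto (fun t => (A t / t) ^ 3 * Φ (A t, w (A t))) (𝓝[≠] 0)
        (𝓝 (p ^ 3 * Φ (0, κ))) := by
      have e1 : Tendsto (fun t => A t / t) (𝓝[≠] 0) (𝓝 p) := by
        refine (hasDerivAt_iff_tendsto_slope.1 hAd).congr fun t => ?_
        rw [slope_def_field, hA0, sub_zero, sub_zero]
      have e2 : Tendsto (fun t => Φ (A t, w (A t))) (𝓝 0) (𝓝 (Φ (0, κ))) := by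
        have e3 : Tendsto (fun t => Φ (t, w t)) (𝓝 0) (𝓝 (Φ (0, κ))) :=
          (p1.continuous.comp (continuous_id.prodMk w1.continuous)).tendsto' _ _ (by simp [w3])
        exact e3.comp tA
      exact (e1.pow 3).mul (e2.mono_left nhdsWithin_le_nhds)
    have tneg' : Tendsto (fun t : ℝ => -t) (𝓝[≠] 0) (𝓝[≠] 0) := by
      refine tendsto_nhdsWithin_iff.2 ⟨tneg.mono_left nhdsWithin_le_nhds, ?_⟩
      filter_upwards [self_mem_nhdsWithin] with t ht
      exact neg_ne_zero.2 ht
    have hE' := (hE.comp tneg').congr' (f₂ := fun t => -((A t / t) ^ 3 * Φ (A t, w (A t)))) (by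
      filter_upwards [hsym.filter_mono nhdsWithin_le_nhds] with t ht
      have e1 : pa f (A (-t), g (A (-t))) = pa f (A t, g (A t)) := congrFun ht 0
      rw [w2, w2, p2, p2] at e1
      simp only [Function.comp_apply, div_pow]
      rw [div_mul_eq_mul_div, e1]
      ring)
    have e := tendsto_nhds_unique hE' hE.neg
    rw [p3] at e
    have e2 : p ^ 3 * (2 * ρ - 2 * κ) = 0 := by linarith
    have := (mul_eq_zero.1 e2).resolve_left (pow_ne_zero 3 hp0)
    linarith
  -- The partner of the parameter `t` is found by returning to the standard swallowtail, changing
  -- the sign of `u`, and coming back.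
  refine ⟨g, hκρ ▸ hκ, ⟨?_, ?_⟩, fun t => A (-(χ (t, g t)).1), ?_, ?_⟩
  · have h1 : ∀ᶠ q in 𝓝 (0 : Par), legendreFront f q = Ψ (standardSwallowtail (χ q)) ∧
        Ξ (Ψ (standardSwallowtail (χ q))) = standardSwallowtail (χ q) ∧ θ (χ q) = q ∧
        ((χ q).2 + 2 * (χ q).1 ^ 2 = 0 → q.2 = g q.1) := by
      filter_upwards [tχ.eventually hθΨ, tχ.eventually (tst.eventually hΞΨ), hθχ, hGe, hg]
        with q e1 e2 e3 e4 e5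
      rw [e3] at e1
      exact ⟨e1, e2, e3, fun e => e5.1 (e4.trans e)⟩
    have t1 : Tendsto Prod.fst (𝓝 (0 : Par × Par)) (𝓝 0) := continuous_fst.tendsto' _ _ rfl
    have t2 : Tendsto Prod.snd (𝓝 (0 : Par × Par)) (𝓝 0) := continuous_snd.tendsto' _ _ rfl
    filter_upwards [t1.eventually h1, t2.eventually h1] with z ⟨a1, a2, a3, a4⟩ ⟨b1, b2, b3, b4⟩ hz
    rw [a1, b1] at hz
    have hst : standardSwallowtail (χ z.1) = standardSwallowtail (χ z.2) := by
      rw [← a2, ← b2, hz]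
    rcases standardSwallowtail_eq_iff hst with e | ⟨e1, e2⟩
    · left; rw [← a3, ← b3, e]
    · exact Or.inr ⟨a4 e1, b4 e2⟩
  · have h00 : legendreFront f 0 = Ψ (standardSwallowtail 0) := by
      rw [← hθΨ.self_of_nhds, hθ0]
    filter_upwards [tχ.eventually hθΨ, tχ.eventually (tst.eventually hΞΨ), hθχ] with q e1 e2 e3 hq
    rw [e3] at e1
    have e4 : standardSwallowtail (χ q) = standardSwallowtail 0 := by
      have e5 : Ξ (Ψ (standardSwallowtail 0)) = standardSwallowtail 0 :=
        (tst.eventually hΞΨ).self_of_nhds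
      rw [← e2, ← e1, hq, h00, e5]
    rw [← e3, standardSwallowtail_eq_zero e4, hθ0]
  · have e1 : Tendsto (fun t => -(χ (t, g t)).1) (𝓝 0) (𝓝 0) := by
      have := ((continuous_fst.tendsto (0 : Par)).comp (tχ.comp hgt)).neg
      simpa using this
    exact tA.comp e1
  · have t1 : Tendsto (fun t => (χ (t, g t)).1) (𝓝 0) (𝓝 0) := by
      have := ((continuous_fst.tendsto (0 : Par)).comp (tχ.comp hgt))
      simpa [Function.comp_def] using this
    have hχg : ∀ᶠ t in 𝓝 (0 : ℝ), χ (t, g t) = ((χ (t, g t)).1, -2 * (χ (t, g t)).1 ^ 2) := by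
      filter_upwards [hgt.eventually hg, hgt.eventually hGe] with t e1 e2
      have e3 := e1.2 rfl
      rw [e2] at e3
      exact Prod.ext rfl (by linarith)
    have hAu : ∀ᶠ t in 𝓝 (0 : ℝ), A (χ (t, g t)).1 = t := by
      filter_upwards [hgt.eventually hθχ, hχg] with t e1 e2
      simp only [A]
      rw [← e2, e1]
    have hinj : ∀ᶠ u in 𝓝 (0 : ℝ), A (-u) = A u → u = 0 := by
      filter_upwards [hcurve, tneg.eventually hcurve, hpar.eventually hχθ,
        tneg.eventually (hpar.eventually hχθ)] with u e1 e2 e3 e4 he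
      rw [he, ← e1] at e2
      rw [e2, e3] at e4
      have := congrArg Prod.fst e4
      simp only at this
      linarith
    filter_upwards [(t1.eventually hsym).filter_mono nhdsWithin_le_nhds,
      hAu.filter_mono nhdsWithin_le_nhds, (t1.eventually hinj).filter_mono nhdsWithin_le_nhds,
      self_mem_nhdsWithin] with t e1 e2 e3 e4
    rw [e2] at e1
    refine ⟨fun he => e4 ?_, e1⟩
    have e5 := e3 (by rw [he, e2])
    rw [← e2, e5, hA0]
    rfl

/-! ### The tangent section -/

namespace GodronForm

variable {f : Par → ℝ} {ρ : ℝ}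

/-- Blowing up controls the height only where `b` is bounded by a multiple of `a²`. Near the
`b`-axis a uniform estimate is needed; it comes from an expansion `a⁴ φ₀(a) + a² b φ₁(a) + b² γ(b,
a)` with smooth coefficients of values `-3ρ/2`, `2`, `-1/2` at the origin. -/
theorem height_approx (h : GodronForm f ρ) {ε : ℝ} (hε : 0 < ε) : ∀ᶠ q in 𝓝 (0 : Par),
    |legendreHeight f q + (q.2 ^ 2 - 4 * q.1 ^ 2 * q.2 + 3 * ρ * q.1 ^ 4) / 2| ≤
      ε * (q.1 ^ 4 + q.2 ^ 2) := by
  obtain ⟨Φ, p1, p2, p3⟩ := h.blow_height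
  have hh := contDiff_legendreHeight h.contDiff
  have hΦ := contDiff_pb p1
  have e1 : ∀ t : ℝ, t ≠ 0 → pb (legendreHeight f) (t, 0) = t ^ 2 * pb Φ (t, 0) := by
    intro t ht
    have d1 := hasDerivAt_comp_curve (F := legendreHeight f) (q := (t, 0)) (a := fun _ => t)
      (b := fun w => t ^ 2 * w) (t := (0 : ℝ)) (b' := t ^ 2) (differentiableAt_of_smooth hh _)
      (by simp) (hasDerivAt_const _ _) (by simpa using (hasDerivAt_id (0 : ℝ)).const_mul (t ^ 2))
    have d2 := (hasDerivAt_comp_curve (F := Φ) (q := (t, 0)) (a := fun _ => t)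
      (b := fun w => w) (t := (0 : ℝ)) (b' := 1) (differentiableAt_of_smooth p1 _)
      (by simp) (hasDerivAt_const _ _) (hasDerivAt_id (0 : ℝ))).const_mul (t ^ 4)
    simp only [p2] at d1
    have d3 := d1.unique d2
    refine mul_left_cancel₀ (pow_ne_zero 2 ht) ?_
    linear_combination d3
  have e1' : ∀ t : ℝ, pb (legendreHeight f) (t, 0) = t ^ 2 * pb Φ (t, 0) := by
    have c1 : Continuous fun t : ℝ => pb (legendreHeight f) (t, 0) :=
      (contDiff_pb hh).continuous.comp (Continuous.prodMk_left 0)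
    have c2 : Continuous fun t : ℝ => t ^ 2 * pb Φ (t, 0) :=
      (continuous_pow 2).mul (hΦ.continuous.comp (Continuous.prodMk_left 0))
    have := Continuous.ext_on (dense_compl_singleton (0 : ℝ)) c1 c2 fun t ht => e1 t ht
    exact fun t => congrFun this t
  -- The height minus its terms of degree 0 and 1 in `b`, with the variables exchanged so that
  -- Hadamard's lemma divides by `b²`.
  let F : ℝ × ℝ → ℝ := fun z => legendreHeight f (z.2, z.1) - z.2 ^ 4 * Φ (z.2, 0) -
    z.2 ^ 2 * z.1 * pb Φ (z.2, 0)
  have hF : ContDiff ℝ ∞ F := by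
    have := hh.comp (f := fun z : ℝ × ℝ => (z.2, z.1)) (by fun_prop)
    have := p1.comp (f := fun z : ℝ × ℝ => (z.2, (0 : ℝ))) (by fun_prop)
    have := hΦ.comp (f := fun z : ℝ × ℝ => (z.2, (0 : ℝ))) (by fun_prop)
    simp only [Function.comp_def] at *
    fun_prop
  have hF0 : ∀ a, F (0, a) = 0 := by
    intro a
    have := p2 a 0
    rw [mul_zero] at this
    simp only [F, this]
    ring
  have hF1 : ∀ a, pa F (0, a) = 0 := by
    intro a
    have d1 := hasDerivAt_comp_curve (F := F) (q := (0, a)) (a := fun b => b) (b := fun _ => a)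
      (t := (0 : ℝ)) (differentiableAt_of_smooth hF _) rfl (hasDerivAt_id _) (hasDerivAt_const _ _)
    have d2 := hasDerivAt_comp_curve (F := legendreHeight f) (q := (a, 0)) (a := fun _ => a)
      (b := fun b => b) (t := (0 : ℝ)) (differentiableAt_of_smooth hh _) rfl
      (hasDerivAt_const _ _) (hasDerivAt_id _)
    have d3 := (d2.sub_const (a ^ 4 * Φ (a, 0))).sub
      (((hasDerivAt_id (0 : ℝ)).const_mul (a ^ 2)).mul_const (pb Φ (a, 0)))
    have := d1.unique d3
    rw [e1'] at this
    simpa using this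
  obtain ⟨γ, g1, g2, -⟩ := exists_eq_pow_mul 2 hF fun i hi w => by
    interval_cases i
    · exact hF0 w
    · exact hF1 w
  have hrep : ∀ a b, legendreHeight f (a, b) =
      a ^ 4 * Φ (a, 0) + a ^ 2 * b * pb Φ (a, 0) + b ^ 2 * γ (b, a) := by
    intro a b
    have := g2 b a
    simp only [F] at this
    linarith
  have hΦ0 : Φ (0, 0) = -(3 * ρ) / 2 := by rw [p3]; ring
  have hΦ1 : pb Φ (0, 0) = 2 := by
    have d2 := hasDerivAt_comp_curve (F := Φ) (q := (0, 0)) (a := fun _ => 0)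
      (b := fun b => b) (t := (0 : ℝ)) (differentiableAt_of_smooth p1 _) rfl
      (hasDerivAt_const _ _) (hasDerivAt_id _)
    simp only [p3] at d2
    have d3 := (((((hasDerivAt_pow 2 (0 : ℝ)).sub ((hasDerivAt_id (0 : ℝ)).const_mul 4)).add_const
      (3 * ρ)).neg).div_const 2)
    have := d2.unique d3
    norm_num at this
    linarith
  -- The expansion is compared with the blown-up height at `w = 1`.
  have hγ0 : γ (0, 0) = -1 / 2 := by
    have c : Continuous fun t : ℝ => Φ (t, 1) - Φ (t, 0) - pb Φ (t, 0) - γ (t ^ 2, t) := by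
      have := p1.continuous
      have := hΦ.continuous
      have := g1.continuous
      fun_prop
    have e := eq_zero_of_eventually_mul_eq_zero c.continuousAt 4 (Eventually.of_forall fun t => by
      have r1 := hrep t (t ^ 2 * 1)
      rw [p2, mul_one] at r1
      linear_combination r1)
    simp only [p3, hΦ1, ne_eq, OfNat.ofNat_ne_zero, not_false_eq_true, zero_pow] at e
    linarith
  have c1 : Tendsto (fun q : Par => Φ (q.1, 0)) (𝓝 0) (𝓝 (-(3 * ρ) / 2)) :=
    Continuous.tendsto' (p1.continuous.comp (by fun_prop)) _ _ hΦ0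
  have c2 : Tendsto (fun q : Par => pb Φ (q.1, 0)) (𝓝 0) (𝓝 2) :=
    Continuous.tendsto' (hΦ.continuous.comp (by fun_prop)) _ _ hΦ1
  have c3 : Tendsto (fun q : Par => γ (q.2, q.1)) (𝓝 0) (𝓝 (-1 / 2)) :=
    Continuous.tendsto' (g1.continuous.comp (by fun_prop)) _ _ hγ0
  have hε2 : 0 < ε / 2 := by positivity
  filter_upwards [Metric.tendsto_nhds.1 c1 _ hε2, Metric.tendsto_nhds.1 c2 _ hε2,
    Metric.tendsto_nhds.1 c3 _ hε2] with q q1 q2 q3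
  rw [Real.dist_eq] at q1 q2 q3
  have hr := hrep q.1 q.2
  rw [Prod.mk.eta] at hr
  have e : legendreHeight f q + (q.2 ^ 2 - 4 * q.1 ^ 2 * q.2 + 3 * ρ * q.1 ^ 4) / 2 =
      q.1 ^ 4 * (Φ (q.1, 0) - -(3 * ρ) / 2) + q.1 ^ 2 * q.2 * (pb Φ (q.1, 0) - 2) +
        q.2 ^ 2 * (γ (q.2, q.1) - -1 / 2) := by
    rw [hr]; ring
  rw [e]
  have a1 : |q.1 ^ 4 * (Φ (q.1, 0) - -(3 * ρ) / 2)| ≤ q.1 ^ 4 * (ε / 2) := by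
    rw [abs_mul, abs_of_nonneg (by positivity)]
    gcongr
  have a2 : |q.1 ^ 2 * q.2 * (pb Φ (q.1, 0) - 2)| ≤ (q.1 ^ 4 + q.2 ^ 2) / 2 * (ε / 2) := by
    rw [abs_mul]
    gcongr
    rw [abs_le]
    constructor <;> nlinarith [sq_nonneg (q.1 ^ 2 + q.2), sq_nonneg (q.1 ^ 2 - q.2)]
  have a3 : |q.2 ^ 2 * (γ (q.2, q.1) - -1 / 2)| ≤ q.2 ^ 2 * (ε / 2) := by
    rw [abs_mul, abs_of_nonneg (by positivity)]
    gcongr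
  refine (abs_add_le _ _).trans ((add_le_add ((abs_add_le _ _).trans (add_le_add a1 a2)) a3).trans ?_)
  nlinarith [sq_nonneg q.2, pow_nonneg (sq_nonneg q.1) 2]

theorem height_neg (h : GodronForm f ρ) (hρ : 4 / 3 < ρ) :
    ∀ᶠ q in 𝓝[≠] (0 : Par), legendreHeight f q < 0 := by
  -- In `X = a²`, `Y = b` the form `Y² - 4XY + 3ρX²` is positive definite for `ρ > 4/3`. This `c` is
  -- a margin: it satisfies `(1 - c)(3ρ - c) = 4 + c²`, so the form still dominates `c (X² + Y²)`.
  set c := (3 * ρ - 4) / (3 * ρ + 1) with hc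
  have hc0 : 0 < c := div_pos (by linarith) (by linarith)
  have hc1 : c < 1 := by rw [hc, div_lt_one (by linarith)]; linarith
  have hc2 : (1 - c) * (3 * ρ - c) = 4 + c ^ 2 := by
    have : c * (3 * ρ + 1) = 3 * ρ - 4 := by
      rw [hc]; exact div_mul_cancel₀ _ (by linarith)
    linear_combination -this
  have h1 := h.height_approx (ε := c / 4) (by positivity)
  filter_upwards [h1.filter_mono nhdsWithin_le_nhds, self_mem_nhdsWithin] with q hq hq0
  have hpos : 0 < q.1 ^ 4 + q.2 ^ 2 := by
    by_contra hcon
    have e1 : q.2 ^ 2 = 0 := by nlinarith [sq_nonneg q.2, pow_nonneg (sq_nonneg q.1) 2]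
    have e2 : q.1 ^ 4 = 0 := by nlinarith [sq_nonneg q.2, pow_nonneg (sq_nonneg q.1) 2]
    exact hq0 (Prod.ext (by simpa using e2) (by simpa using e1))
  have h2 : c * (q.1 ^ 4 + q.2 ^ 2) ≤ q.2 ^ 2 - 4 * q.1 ^ 2 * q.2 + 3 * ρ * q.1 ^ 4 := by
    have e : 0 ≤ (1 - c) * (q.2 ^ 2 - 4 * q.1 ^ 2 * q.2 + 3 * ρ * q.1 ^ 4 -
        c * (q.1 ^ 4 + q.2 ^ 2)) := by
      have : (1 - c) * (q.2 ^ 2 - 4 * q.1 ^ 2 * q.2 + 3 * ρ * q.1 ^ 4 - c * (q.1 ^ 4 + q.2 ^ 2)) =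
          ((1 - c) * q.2 - 2 * q.1 ^ 2) ^ 2 + c ^ 2 * q.1 ^ 4 := by
        linear_combination q.1 ^ 4 * hc2
      rw [this]
      positivity
    have := nonneg_of_mul_nonneg_right e (by linarith)
    linarith
  have h3 := (abs_le.1 hq).2
  nlinarith

/-- The condition `κ ≠ 2` makes `κ` a simple root of `w² - 4w + 3ρ`, which continues to a smooth
root `w (t)` of the blown-up height, unique near `κ`. -/
theorem exists_height_zero {κ : ℝ} (hκ : κ ^ 2 - 4 * κ + 3 * ρ = 0)
    (hκ2 : κ ≠ 2) {Φ : Par → ℝ} (p1 : ContDiff ℝ ∞ Φ)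
    (p2 : ∀ t w, legendreHeight f (t, t ^ 2 * w) = t ^ 4 * Φ (t, w))
    (p3 : ∀ w, Φ (0, w) = -(w ^ 2 - 4 * w + 3 * ρ) / 2) :
    ∃ g : ℝ → ℝ, CurveJet g κ ∧ (∀ᶠ t in 𝓝 (0 : ℝ), legendreHeight f (t, g t) = 0) ∧
      ∃ η > 0, ∀ t w : ℝ, |t| < η → |w - κ| < η → Φ (t, w) = 0 → t ^ 2 * w = g t := by
  have hd : HasDerivAt (fun w => Φ (0, w)) (2 - κ) κ := by
    rw [funext p3]
    refine (((((hasDerivAt_pow 2 κ).sub ((hasDerivAt_id κ).const_mul 4)).add_const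
      (3 * ρ)).neg).div_const 2).congr_deriv ?_
    simp
    ring
  obtain ⟨w, w1, w2, w3⟩ := exists_implicit (G := Φ) (a := (0 : ℝ)) (w := κ) (p1.smoothNear _)
    (by rw [p3, hκ]; simp) hd (fun h0 => hκ2 (by linarith))
  refine ⟨fun t => t ^ 2 * w t, ⟨w, w1, fun _ => rfl, w2⟩, ?_, ?_⟩
  · have ht : Tendsto (fun t => (t, w t)) (𝓝 0) (𝓝 ((0 : ℝ), κ)) :=
      (continuous_id.prodMk w1.continuous).tendsto' _ _ (by simp [w2])
    filter_upwards [ht.eventually w3] with t ht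
    rw [p2, ht.2 rfl, mul_zero]
  · obtain ⟨η, hη, hball⟩ := Metric.eventually_nhds_iff_ball.1 w3
    refine ⟨η, hη, fun t v ht hv h0 => ?_⟩
    have := (hball (t, v) (by
      rw [← ball_prod_same]
      exact ⟨by simpa using ht, by simpa [Real.dist_eq] using hv⟩)).1 h0
    simp only at this
    rw [this]

/-- Near the two roots the zeros are the two smooth curves. For `w` away from both, and up to
infinity, the quadratic factor exceeds the error allowed by `height_approx`, so there is no other
zero. -/
theorem exists_tangent_section (h : GodronForm f ρ) (hρ : ρ < 4 / 3) : ∃ gm gp : ℝ → ℝ,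
    CurveJet gm (2 - √(4 - 3 * ρ)) ∧ CurveJet gp (2 + √(4 - 3 * ρ)) ∧
      ∀ᶠ q in 𝓝 (0 : Par), legendreHeight f q = 0 ↔ q.2 = gm q.1 ∨ q.2 = gp q.1 := by
  set r := √(4 - 3 * ρ) with hr
  have hr2 : r ^ 2 = 4 - 3 * ρ := Real.sq_sqrt (by linarith)
  have hr0 : 0 < r := Real.sqrt_pos.2 (by linarith)
  obtain ⟨Φ, p1, p2, p3⟩ := h.blow_height
  obtain ⟨gm, hm, zm, ηm, hηm, um⟩ := exists_height_zero (κ := 2 - r)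
    (by linear_combination hr2) (by linarith) p1 p2 p3
  obtain ⟨gp, hp, zp, ηp, hηp, up⟩ := exists_height_zero (κ := 2 + r)
    (by linear_combination hr2) (by linarith) p1 p2 p3
  refine ⟨gm, gp, hm, hp, ?_⟩
  set η := min ηm ηp with hη
  have hη0 : 0 < η := lt_min hηm hηp
  -- Chosen so that `1 + w² ≤ D |w - w₁| |w - w₂|` whenever `w` is at distance at least `η` from
  -- both roots. The bound `ε ≤ 1/4` below serves the points with `a = 0`.
  set D := 1 / η ^ 2 + (1 + |2 - r| / η) * (1 + |2 + r| / η) with hD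
  have hD0 : 0 < D := by positivity
  set ε := min (1 / 4) (1 / (4 * D)) with hε
  have hε0 : 0 < ε := by positivity
  have t1 : Tendsto (fun q : Par => q.1) (𝓝 0) (𝓝 0) := continuous_fst.tendsto' _ _ rfl
  have habs : ∀ᶠ q in 𝓝 (0 : Par), |q.1| < η := by
    filter_upwards [t1.eventually (Metric.ball_mem_nhds (0 : ℝ) hη0)] with q hq
    simpa using hq
  filter_upwards [h.height_approx hε0, habs, t1.eventually zm, t1.eventually zp] with q q1 q2 q3 q4
  constructor
  · intro h0
    rw [h0, zero_add] at q1
    by_cases ha : q.1 = 0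
    · have e1 : q.2 = 0 := by
        rw [ha] at q1
        have e2 := (abs_le.1 q1).2
        have e3 : ε ≤ 1 / 4 := min_le_left _ _
        have : q.2 ^ 2 = 0 := by nlinarith [sq_nonneg q.2]
        simpa using this
      left
      rw [ha, e1, hm.zero]
    · set w := q.2 / q.1 ^ 2 with hw
      have hqw : q.2 = q.1 ^ 2 * w := by rw [hw]; field_simp
      have hq : q = (q.1, q.1 ^ 2 * w) := Prod.ext rfl hqw
      have hΦ : Φ (q.1, w) = 0 := by
        have := p2 q.1 w
        rw [← hq, h0] at this
        exact (mul_eq_zero.1 this.symm).resolve_left (pow_ne_zero 4 ha)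
      have hX : |w - (2 - r)| * |w - (2 + r)| ≤ 2 * ε * (1 + w ^ 2) := by
        rw [← abs_mul]
        have e1 : (q.2 ^ 2 - 4 * q.1 ^ 2 * q.2 + 3 * ρ * q.1 ^ 4) / 2 =
            q.1 ^ 4 * (((w - (2 - r)) * (w - (2 + r))) / 2) := by
          rw [hqw]
          linear_combination q.1 ^ 4 / 2 * hr2
        have e2 : q.1 ^ 4 + q.2 ^ 2 = q.1 ^ 4 * (1 + w ^ 2) := by rw [hqw]; ring
        have hpos : 0 < q.1 ^ 4 := by positivity
        rw [e1, e2, abs_mul, abs_of_pos hpos, abs_div, abs_two] at q1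
        have : |(w - (2 - r)) * (w - (2 + r))| / 2 ≤ ε * (1 + w ^ 2) := by
          refine le_of_mul_le_mul_left ?_ hpos
          linarith
        linarith
      by_cases hwm : |w - (2 - r)| < η
      · left
        have := um q.1 w (q2.trans_le (min_le_left _ _)) (hwm.trans_le (min_le_left _ _)) hΦ
        rw [hqw, this]
      · by_cases hwp : |w - (2 + r)| < η
        · right
          have := up q.1 w (q2.trans_le (min_le_right _ _)) (hwp.trans_le (min_le_right _ _)) hΦ
          rw [hqw, this]
        · exfalso
          push Not at hwm hwp
          set X := |w - (2 - r)| with hXd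
          set Y := |w - (2 + r)| with hYd
          have hX0 : 0 < X := hη0.trans_le hwm
          have hY0 : 0 < Y := hη0.trans_le hwp
          have a1 : |w| ≤ X * (1 + |2 - r| / η) := by
            have e1 : |w| ≤ X + |2 - r| := by
              have := abs_add_le (w - (2 - r)) (2 - r)
              rwa [sub_add_cancel] at this
            have e2 : |2 - r| ≤ X * (|2 - r| / η) := by
              rw [mul_div_assoc', le_div_iff₀ hη0, mul_comm]
              gcongr
            linarith
          have a2 : |w| ≤ Y * (1 + |2 + r| / η) := by
            have e1 : |w| ≤ Y + |2 + r| := by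
              have := abs_add_le (w - (2 + r)) (2 + r)
              rwa [sub_add_cancel] at this
            have e2 : |2 + r| ≤ Y * (|2 + r| / η) := by
              rw [mul_div_assoc', le_div_iff₀ hη0, mul_comm]
              gcongr
            linarith
          have a3 : w ^ 2 ≤ (X * (1 + |2 - r| / η)) * (Y * (1 + |2 + r| / η)) := by
            rw [← sq_abs, sq]
            gcongr
          have a4 : 1 ≤ X * Y * (1 / η ^ 2) := by
            rw [mul_one_div, le_div_iff₀ (by positivity), one_mul, sq]
            gcongr
          have a5 : 1 + w ^ 2 ≤ X * Y * D := by
            rw [hD]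
            linarith
          have a6 : ε * D ≤ 1 / 4 := by
            have : ε ≤ 1 / (4 * D) := min_le_right _ _
            calc ε * D ≤ 1 / (4 * D) * D := by gcongr
              _ = 1 / 4 := by field_simp
          have a7 : 2 * ε * (1 + w ^ 2) ≤ 2 * ε * (X * Y * D) := by gcongr
          have a8 : 2 * ε * (X * Y * D) ≤ X * Y / 2 := by
            have := mul_le_mul_of_nonneg_left a6 (by positivity : 0 ≤ 2 * (X * Y))
            linarith
          have : 0 < X * Y := by positivity
          linarith
  · rintro (e | e)
    · rw [← q3, ← e]
    · rw [← q4, ← e]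

end GodronForm

/-! ### Order of curves and sign of the Hessian along curves with given coefficient `κ`. -/

theorem CurveJet.exists_factor {g : ℝ → ℝ} {κ : ℝ} (hκ : CurveJet g κ) {F Φ : Par → ℝ} {m : ℕ}
    (hΦ : ContDiff ℝ ∞ Φ) (h : ∀ t w, F (t, t ^ 2 * w) = t ^ m * Φ (t, w)) :
    ∃ φ : ℝ → ℝ, ContDiff ℝ ∞ φ ∧ (∀ t, F (t, g t) = t ^ m * φ t) ∧ φ 0 = Φ (0, κ) := by
  obtain ⟨θ, h1, h2, rfl⟩ := hκ
  exact ⟨fun t => Φ (t, θ t), hΦ.comp (contDiff_id.prodMk h1), fun t => by rw [h2, h], rfl⟩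

theorem CurveJet.eventually_graph {g : ℝ → ℝ} {κ : ℝ} (hκ : CurveJet g κ) {P : Par → Prop}
    (h : ∀ᶠ q in 𝓝 0, P q) : ∀ᶠ t in 𝓝 (0 : ℝ), P (t, g t) :=
  (LegendreChart.tendsto_graph hκ.contDiff.continuous hκ.zero).eventually h

theorem CurveJet.eventually_lt {g g' : ℝ → ℝ} {κ κ' : ℝ} (h : CurveJet g κ) (h' : CurveJet g' κ')
    (hlt : κ < κ') : ∀ᶠ t in 𝓝[≠] (0 : ℝ), g t < g' t := by
  obtain ⟨θ, h1, h2, rfl⟩ := h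
  obtain ⟨θ', h1', h2', rfl⟩ := h'
  filter_upwards [(h1.continuous.continuousAt.eventually_lt h1'.continuous.continuousAt
    hlt).filter_mono nhdsWithin_le_nhds, self_mem_nhdsWithin] with t ht ht0
  rw [h2, h2']
  have : 0 < t ^ 2 := by have : t ≠ 0 := ht0; positivity
  gcongr

theorem GodronForm.hessDet_pos {f : Par → ℝ} {ρ κ : ℝ} {g : ℝ → ℝ} (h : GodronForm f ρ)
    (hκ : CurveJet g κ) (hpos : 0 < 6 * ρ - 4 - 2 * κ) :
    ∀ᶠ t in 𝓝[≠] (0 : ℝ), 0 < hessDet f (t, g t) := by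
  obtain ⟨Φ, p1, p2, p3⟩ := h.blow_hessDet
  obtain ⟨φ, q1, q2, q3⟩ := hκ.exists_factor p1 p2
  filter_upwards [(q1.continuous.continuousAt.eventually_const_lt
    (by rw [q3, p3]; exact hpos)).filter_mono nhdsWithin_le_nhds, self_mem_nhdsWithin] with t ht ht0
  rw [q2]
  have : t ≠ 0 := ht0
  positivity

theorem GodronForm.hessDet_neg {f : Par → ℝ} {ρ κ : ℝ} {g : ℝ → ℝ} (h : GodronForm f ρ)
    (hκ : CurveJet g κ) (hneg : 6 * ρ - 4 - 2 * κ < 0) :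
    ∀ᶠ t in 𝓝[≠] (0 : ℝ), hessDet f (t, g t) < 0 := by
  obtain ⟨Φ, p1, p2, p3⟩ := h.blow_hessDet
  obtain ⟨φ, q1, q2, q3⟩ := hκ.exists_factor p1 p2
  filter_upwards [(q1.continuous.continuousAt.eventually_lt_const
    (by rw [q3, p3]; exact hneg)).filter_mono nhdsWithin_le_nhds, self_mem_nhdsWithin] with t ht ht0
  rw [q2]
  have : t ≠ 0 := ht0
  exact mul_neg_of_pos_of_neg (by positivity) ht

/-! ### The tangent planes of the dual surface -/

/-- The plane of the dual space consisting of the planes through `X`. -/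
def planesThrough (X : Space) : Submodule ℝ Hom where
  carrier := {Y | Y.1 ⬝ᵥ X + Y.2 = 0}
  add_mem' := fun {Y Z} hY hZ => by
    simp only [mem_ofPred_eq, Prod.fst_add, Prod.snd_add, add_dotProduct] at *
    linarith
  zero_mem' := by simp
  smul_mem' := fun r Y hY => by
    simp only [mem_ofPred_eq, Prod.smul_fst, Prod.smul_snd, smul_dotProduct, smul_eq_mul] at *
    rw [← mul_add, hY, mul_zero]

theorem mem_planesThrough {X : Space} {Y : Hom} : Y ∈ planesThrough X ↔ Y.1 ⬝ᵥ X + Y.2 = 0 :=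
  Iff.rfl

theorem planesThrough_injective : Function.Injective planesThrough := by
  intro X X' h
  ext i
  have h1 : ((Pi.single i 1 : Space), -X i) ∈ planesThrough X := by simp [mem_planesThrough]
  rw [h, mem_planesThrough] at h1
  simp at h1
  linarith

theorem finrank_planesThrough_le (X : Space) : Module.finrank ℝ (planesThrough X) ≤ 3 := by
  let T : planesThrough X →ₗ[ℝ] Space := (LinearMap.fst ℝ Space ℝ).comp (planesThrough X).subtype
  have hT : Function.Injective T := by
    rw [injective_iff_map_eq_zero]
    rintro ⟨Y, hY⟩ h0
    have h1 : Y.1 = 0 := h0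
    rw [mem_planesThrough, h1, zero_dotProduct, zero_add] at hY
    exact Subtype.ext (Prod.ext h1 hY)
  simpa using LinearMap.finrank_le_finrank_of_injective hT

theorem RegularAt.three_le_finrank_tangentPlane {δ : Par → Hom} {p : Par} (h : RegularAt δ p) :
    3 ≤ Module.finrank ℝ (tangentPlane δ p) := by
  let T : ℝ × Par →ₗ[ℝ] Hom :=
    (LinearMap.toSpanSingleton ℝ Hom (δ p)).coprod (fderiv ℝ δ p).toLinearMap
  have hT : Function.Injective T := by
    rw [injective_iff_map_eq_zero]
    rintro ⟨r, v⟩ h0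
    have h1 : r • δ p + fderiv ℝ δ p v = 0 := h0
    have hv : v = 0 := h.2 v (Submodule.mem_span_singleton.2 ⟨-r, by
      rw [neg_smul]; exact (eq_neg_of_add_eq_zero_right h1).symm⟩)
    rw [hv, map_zero, add_zero] at h1
    exact Prod.ext ((smul_eq_zero.1 h1).resolve_right h.1) hv
  have h1 : LinearMap.range T = tangentPlane δ p := by
    rw [LinearMap.range_coprod, LinearMap.range_toSpanSingleton, tangentPlane]
  have h2 := LinearMap.finrank_range_of_inj hT
  rw [h1] at h2
  simp [h2]

theorem fderiv_dualSurface {x n : Par → Space} {p : Par} (hx : DifferentiableAt ℝ x p)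
    (hn : DifferentiableAt ℝ n p) (v : Par) : fderiv ℝ (dualSurface x n) p v =
      (fderiv ℝ n p v, -(fderiv ℝ n p v ⬝ᵥ x p + n p ⬝ᵥ fderiv ℝ x p v)) := by
  have hl : HasDerivAt (fun t : ℝ => p + t • v) v 0 := by
    simpa using ((hasDerivAt_id (0 : ℝ)).smul_const v).const_add p
  have hp : p + (0 : ℝ) • v = p := by simp
  have hx1 : HasDerivAt (fun t : ℝ => x (p + t • v)) (fderiv ℝ x p v) 0 :=
    (HasFDerivAt.comp_hasDerivAt 0 (by rw [hp]; exact hx.hasFDerivAt) hl)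
  have hn1 : HasDerivAt (fun t : ℝ => n (p + t • v)) (fderiv ℝ n p v) 0 :=
    (HasFDerivAt.comp_hasDerivAt 0 (by rw [hp]; exact hn.hasFDerivAt) hl)
  have hd : DifferentiableAt ℝ (dualSurface x n) p := by
    have e1 := differentiableAt_pi.1 hx
    have e2 := differentiableAt_pi.1 hn
    refine hn.prodMk ?_
    simp only [dotProduct]
    fun_prop
  have h1 : HasDerivAt (fun t : ℝ => dualSurface x n (p + t • v))
      (fderiv ℝ (dualSurface x n) p v) 0 :=
    (HasFDerivAt.comp_hasDerivAt (l := dualSurface x n) 0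
      (by rw [hp]; exact hd.hasFDerivAt) hl)
  have h2 : HasDerivAt (fun t : ℝ => n (p + t • v) ⬝ᵥ x (p + t • v))
      (fderiv ℝ n p v ⬝ᵥ x p + n p ⬝ᵥ fderiv ℝ x p v) 0 := by
    have e1 := hasDerivAt_pi.1 hx1
    have e2 := hasDerivAt_pi.1 hn1
    have := HasDerivAt.fun_sum fun i (_ : i ∈ Finset.univ) => (e2 i).mul (e1 i)
    refine this.congr_deriv ?_
    simp only [dotProduct, hp, Finset.sum_add_distrib]
  exact h1.unique (hn1.prodMk h2.neg)

/-- Biduality: the conormal condition puts the tangent plane of the dual surface inside the space of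
planes through `x p`, and both have dimension 3. Planes bitangent to the dual surface are thus
double points of the front. -/
theorem tangentPlane_dualSurface {x n : Par → Space} {p : Par}
    (hr : RegularAt (dualSurface x n) p) (hx : DifferentiableAt ℝ x p)
    (hn : DifferentiableAt ℝ n p) (h : ∀ v : Par, n p ⬝ᵥ fderiv ℝ x p v = 0) :
    tangentPlane (dualSurface x n) p = planesThrough (x p) := by
  refine Submodule.eq_of_le_of_finrank_le ?_
    ((finrank_planesThrough_le _).trans hr.three_le_finrank_tangentPlane)
  rw [tangentPlane, sup_le_iff]
  constructor
  · rw [Submodule.span_singleton_le_iff_mem, mem_planesThrough]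
    simp [dualSurface]
  · rintro _ ⟨v, rfl⟩
    rw [mem_planesThrough]
    change (fderiv ℝ (dualSurface x n) p v).1 ⬝ᵥ x p + (fderiv ℝ (dualSurface x n) p v).2 = 0
    rw [fderiv_dualSurface hx hn, h v]
    simp

namespace LegendreChart

variable {x n : Par → Space} {s : Par} {f : Par → ℝ} {g : ℝ → ℝ} {κ : ℝ}

theorem exists_nhds_tangentPlane (c : LegendreChart x n s f) (hF : IsFront x n s) :
    ∃ V ∈ 𝓝 s, ∀ p ∈ V, ∀ p' ∈ V,
      (tangentPlane (dualSurface x n) p' = tangentPlane (dualSurface x n) p ↔ x p' = x p) := by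
  obtain ⟨h1, h2, h3⟩ := hF
  have h4 : ∀ᶠ p in 𝓝 s, tangentPlane (dualSurface x n) p = planesThrough (x p) := by
    filter_upwards [h1.eventually, h2.eventually, h3, c.eventually_iff.2 c.regularAt_dual]
      with p e1 e2 e3 e4
    exact tangentPlane_dualSurface e4 e1.differentiableAt e2.differentiableAt e3.2.1
  exact ⟨_, h4, fun p hp p' hp' => by
    rw [show _ = _ from hp, show _ = _ from hp', planesThrough_injective.eq_iff]⟩

/-! ### The distinguished curves in a chart -/

theorem germ_cuspidalEdge (c : LegendreChart x n s f) (hbb : pb (pb f) 0 = 1)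
    (hκ : CurveJet g κ) (h : ∀ᶠ q in 𝓝 (0 : Par), hessDet f q = 0 ↔ q.2 = g q.1) :
    ParametrizesGerm (c.curve g) s (fun _ => cuspidalEdge x) :=
  c.parametrizesGerm hκ.contDiff hκ.zero ⟨univ, univ_mem, fun W _ _ => by
    filter_upwards [c.types_front hbb, h] with q h1 h2
    rw [cuspidalEdge, mem_ofPred_eq, h1.2.2, not_not, h2]⟩

theorem germ_parabolic (c : LegendreChart x n s f) (hbb : pb (pb f) 0 = 1)
    (hκ : CurveJet g κ) (h : ∀ᶠ q in 𝓝 (0 : Par), hessDet f q = 0 ↔ q.2 = g q.1) :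
    ParametrizesGerm (c.curve g) s (fun _ => parabolicSet (dualSurface x n)) :=
  c.parametrizesGerm hκ.contDiff hκ.zero ⟨univ, univ_mem, fun W _ _ => by
    filter_upwards [c.parabolic_dual hbb, h] with q h1 h2
    rw [parabolicSet, mem_ofPred_eq, h1, h2]⟩

theorem exists_hasContact_iff {δ : Par → Hom} {p : Par} {ℓ : Par →L[ℝ] Par}
    (hℓ : Function.Bijective ℓ) {P : Par → Prop} {k : ℕ}
    (h : ∀ v ≠ 0, HasContact δ p (ℓ v) k ↔ P v) :
    (∃ v, v ≠ 0 ∧ HasContact δ p v k) ↔ ∃ v ≠ 0, P v := by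
  constructor
  · rintro ⟨u, hu, hc⟩
    obtain ⟨v, rfl⟩ := hℓ.2 u
    have hv : v ≠ 0 := fun h => hu (by rw [h, map_zero])
    exact ⟨v, hv, (h v hv).1 hc⟩
  · rintro ⟨v, hv, hc⟩
    exact ⟨ℓ v, fun h0 => hv (hℓ.1 (h0.trans (map_zero ℓ).symm)), (h v hv).2 hc⟩

theorem germ_flecnodal_dual (c : LegendreChart x n s f) (hκ : CurveJet g κ)
    (h : ∀ᶠ q in 𝓝 (0 : Par), (∃ v ≠ 0, hess f q v = 0 ∧ cub f q v = 0) ↔ q.2 = g q.1) :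
    ParametrizesGerm (c.curve g) s (fun _ => flecnodalSet (dualSurface x n)) := by
  have h0 : ∀ᶠ q in 𝓝 (0 : Par), c.σ q ∈ {p | RegularAt (dualSurface x n) p ∧
      ∃ v, v ≠ 0 ∧ HasContact (dualSurface x n) p v 4} ↔ q.2 = g q.1 := by
    filter_upwards [c.regularAt_dual, c.hasContact_dual, c.bijective_fderiv_σ, h] with q h1 h2 h3 h4
    rw [← h4, exists_hasContact_iff h3 fun v hv => (h2 v hv).2]
    exact and_iff_right h1
  refine c.parametrizesGerm hκ.contDiff hκ.zero ⟨univ, univ_mem, fun W _ _ => ?_⟩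
  refine c.mem_closure_iff hκ.contDiff.continuous hκ.zero (h0.mono fun q hq => hq.1) ?_
  filter_upwards [(hκ.eventually_graph h0).filter_mono nhdsWithin_le_nhds] with t ht
  exact ht.2 rfl

/-- The swallowtail point is not a regular point of the front; it enters the flecnodal curve only
through the closure, which requires the rest of the curve to avoid the cuspidal edge. -/
theorem germ_flecnodal_front (c : LegendreChart x n s f) (hbb : pb (pb f) 0 = 1)
    (hκ : CurveJet g κ)
    (h : ∀ᶠ q in 𝓝 (0 : Par), (∃ v ≠ 0, hess f q v = 0 ∧ cub f q v = 0) ↔ q.2 = g q.1)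
    (hne : ∀ᶠ t in 𝓝[≠] (0 : ℝ), hessDet f (t, g t) ≠ 0) :
    ParametrizesGerm (c.curve g) s (fun _ => flecnodalSet (homog x)) := by
  have h0 : ∀ᶠ q in 𝓝 (0 : Par), c.σ q ∈ {p | RegularAt (homog x) p ∧
      ∃ v, v ≠ 0 ∧ HasContact (homog x) p v 4} ↔ hessDet f q ≠ 0 ∧ q.2 = g q.1 := by
    filter_upwards [c.types_front hbb, c.contact_front, c.bijective_fderiv_σ, h] with q h1 h2 h3 h4
    rw [← h4, h1.2.2]
    exact and_congr_right fun hq => exists_hasContact_iff h3 fun v hv => ((h2 hq).2 v hv).2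
  refine c.parametrizesGerm hκ.contDiff hκ.zero ⟨univ, univ_mem, fun W _ _ => ?_⟩
  refine c.mem_closure_iff hκ.contDiff.continuous hκ.zero (h0.mono fun q hq h => (hq.1 h).2) ?_
  filter_upwards [(hκ.eventually_graph h0).filter_mono nhdsWithin_le_nhds, hne] with t ht ht'
  exact ht.2 ⟨ht', rfl⟩

/-- A property is needed only for `t ≠ 0`, since the swallowtail point has no second preimage near
`s`. -/
theorem exists_nhds_double (c : LegendreChart x n s f) (h0 : g 0 = 0)
    (hD : DoublePointsOn f g) {P : ℝ → Prop} (hP : ∀ᶠ t in 𝓝[≠] (0 : ℝ), P t) :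
    ∃ V ∈ 𝓝 s, ∀ p ∈ V, ∀ p' ∈ V, p' ≠ p → x p' = x p → ∃ t, P t ∧ p = c.curve g t := by
  obtain ⟨r, hr, hball⟩ := Metric.eventually_nhds_iff_ball.1 hD.eq_or
  have hP' : ∀ᶠ q : Par in 𝓝 0, q.1 ≠ 0 → P q.1 :=
    (continuous_fst.tendsto' (0 : Par) 0 rfl).eventually (eventually_nhdsWithin_iff.1 hP)
  have hV : ∀ᶠ p in 𝓝 s, c.σ (c.τ p) = p ∧ x p = x s + c.A (legendreFront f (c.τ p)) ∧
      c.τ p ∈ Metric.ball (0 : Par) r ∧ ((c.τ p).1 ≠ 0 → P (c.τ p).1) ∧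
      (legendreFront f (c.τ p) = legendreFront f 0 → c.τ p = 0) := by
    filter_upwards [c.right_inv, c.tendsto_τ.eventually c.x_eq,
      c.tendsto_τ.eventually (Metric.ball_mem_nhds _ hr), c.tendsto_τ.eventually hP',
      c.tendsto_τ.eventually hD.eq_zero] with p h1 h2 h3 h4 h5
    rw [h1] at h2
    exact ⟨h1, h2, h3, h4, h5⟩
  refine ⟨_, hV, fun p ⟨a1, a2, a3, a4, a5⟩ p' ⟨b1, b2, b3, b4, b5⟩ hne hx => ?_⟩
  have hx' : legendreFront f (c.τ p) = legendreFront f (c.τ p') := by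
    rw [a2, b2] at hx
    exact (c.A.injective (add_left_cancel hx)).symm
  have hne' : c.τ p ≠ c.τ p' := fun h => hne (by rw [← a1, ← b1, h])
  obtain ⟨e1, e2⟩ := (hball (c.τ p, c.τ p') (by
    rw [← Prod.mk_zero_zero, ← ball_prod_same]
    exact ⟨a3, b3⟩) hx').resolve_left hne'
  have ht : (c.τ p).1 ≠ 0 := by
    intro ht
    have e3 : c.τ p = 0 := Prod.ext ht (by rw [e1, ht, h0]; rfl)
    rw [e3] at hx'
    exact hne' (e3.trans (b5 hx'.symm).symm)
  exact ⟨(c.τ p).1, a4 ht, by rw [curve, ← e1, a1]⟩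

/-- The partner `ι t` tends to 0 with `t`, so that each point of the curve close enough to `s` is a
double point of the piece of front over any prescribed neighbourhood `W`. -/
theorem germ_selfIntersection (c : LegendreChart x n s f) (hκ : CurveJet g κ)
    (hD : DoublePointsOn f g) {ι : ℝ → ℝ} (hι : Tendsto ι (𝓝 0) (𝓝 0))
    (hι' : ∀ᶠ t in 𝓝[≠] (0 : ℝ), ι t ≠ t ∧
      legendreFront f (ι t, g (ι t)) = legendreFront f (t, g t)) :
    ParametrizesGerm (c.curve g) s (selfIntersection x) := by
  refine c.parametrizesGerm hκ.contDiff hκ.zero ?_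
  have hgc := hκ.contDiff.continuous
  have hli := hκ.eventually_graph c.left_inv
  obtain ⟨V, hV, hVD⟩ := c.exists_nhds_double hκ.zero hD (hli.filter_mono nhdsWithin_le_nhds)
  refine ⟨V, hV, fun W hW hWV => c.mem_closure_iff hgc hκ.zero ?_ ?_⟩
  · filter_upwards [c.left_inv] with q hq
    rintro ⟨h1, p', h2, h3, h4⟩
    obtain ⟨t, ht, ht'⟩ := hVD _ (hWV h1) _ (hWV h2) h3 h4
    rw [curve] at ht'
    rw [← ht', hq] at ht
    rw [ht]
  · have hcW : ∀ᶠ t in 𝓝 (0 : ℝ), c.curve g t ∈ W :=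
      hκ.eventually_graph (c.tendsto_σ.eventually hW)
    have hx := hκ.eventually_graph c.x_eq
    filter_upwards [hcW.filter_mono nhdsWithin_le_nhds,
      (hι.eventually hcW).filter_mono nhdsWithin_le_nhds,
      hli.filter_mono nhdsWithin_le_nhds, (hι.eventually hli).filter_mono nhdsWithin_le_nhds,
      hx.filter_mono nhdsWithin_le_nhds, (hι.eventually hx).filter_mono nhdsWithin_le_nhds, hι']
      with t h1 h2 h3 h4 h5 h6 h7
    refine ⟨h1, c.curve g (ι t), h2, fun he => h7.1 ?_, ?_⟩
    · rw [curve, curve] at he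
      rw [he, h3] at h4
      exact (congrArg Prod.fst h4).symm
    · rw [curve, curve, h5, h6, h7.2]

theorem germ_conodal (c : LegendreChart x n s f) (hF : IsFront x n s) {d : ℝ → Par}
    (h : ParametrizesGerm d s (selfIntersection x)) :
    ParametrizesGerm d s (conodalSet (dualSurface x n)) := by
  obtain ⟨h1, h2, h3, V, hV, h4⟩ := h
  obtain ⟨V', hV', hVV⟩ := c.exists_nhds_tangentPlane hF
  refine ⟨h1, h2, h3, V ∩ V', inter_mem hV hV', fun W hW hWV => ?_⟩
  have : conodalSet (dualSurface x n) W = selfIntersection x W := by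
    unfold conodalSet selfIntersection
    congr 1
    ext p
    refine and_congr_right fun hp => exists_congr fun q => and_congr_right fun hq =>
      and_congr_right fun _ => hVV p (hWV hp).2 q (hWV hq).2
  rw [this]
  exact h4 W hW fun p hp => (hWV hp).1

theorem elliptic_of_double (c : LegendreChart x n s f) (hκ : CurveJet g κ)
    (hD : DoublePointsOn f g) (h : ∀ᶠ t in 𝓝[≠] (0 : ℝ), EllipticAt (homog x) (c.curve g t)) :
    IsEllipticSwallowtail x s := by
  obtain ⟨V, hV, hVD⟩ := c.exists_nhds_double hκ.zero hD h
  refine ⟨V, hV, fun p hp q hq h1 h2 => ?_⟩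
  obtain ⟨t, ht, rfl⟩ := hVD p hp q hq h1 h2
  exact ht

theorem hyperbolic_of_double (c : LegendreChart x n s f) (hκ : CurveJet g κ)
    (hD : DoublePointsOn f g) (h : ∀ᶠ t in 𝓝[≠] (0 : ℝ), HyperbolicAt (homog x) (c.curve g t)) :
    IsHyperbolicSwallowtail x s := by
  obtain ⟨V, hV, hVD⟩ := c.exists_nhds_double hκ.zero hD h
  refine ⟨V, hV, fun p hp q hq h1 h2 => ?_⟩
  obtain ⟨t, ht, rfl⟩ := hVD p hp q hq h1 h2
  exact ht

end LegendreChart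

/-- Every neighbourhood of a point of the self-intersection line contains double points. -/
theorem ParametrizesGerm.exists_double {x : Par → Space} {d : ℝ → Par} {s : Par}
    (h : ParametrizesGerm d s (selfIntersection x)) {V : Set Par} (hV : V ∈ 𝓝 s) :
    ∃ p ∈ V, ∃ q ∈ V, q ≠ p ∧ x q = x p := by
  obtain ⟨h1, h2, h3, U, hU, h4⟩ := h
  obtain ⟨ε, h5, h6⟩ := ((h4 (V ∩ U) (inter_mem hV hU) inter_subset_right).and
    self_mem_nhdsWithin).exists
  have h7 : s ∈ selfIntersection x (V ∩ U) :=
    (h5.self_of_nhds).2 ⟨0, by simpa using h6, h2⟩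
  obtain ⟨p, hp, q, hq, hne, hx⟩ := (closure_nonempty_iff.1 ⟨s, h7⟩)
  exact ⟨p, hp.1, q, hq.1, hne, hx⟩

/-- Double points accumulate at `s`, so the two definitions are not vacuous, and no point is of both
types. -/
theorem not_elliptic_and_hyperbolic {x : Par → Space} {d : ℝ → Par} {s : Par}
    (h : ParametrizesGerm d s (selfIntersection x)) (he : IsEllipticSwallowtail x s)
    (hh : IsHyperbolicSwallowtail x s) : False := by
  obtain ⟨V, hV, h1⟩ := he
  obtain ⟨V', hV', h2⟩ := hh
  obtain ⟨p, hp, q, hq, hne, hx⟩ := h.exists_double (inter_mem hV hV')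
  exact not_hyperbolic_of_elliptic (h1 p hp.1 q hq.1 hne hx) (h2 p hp.2 q hq.2 hne hx)

theorem cusp_derivs {U γ : ℝ → Space} {X : Space} (hU : ContDiff ℝ ∞ U)
    (h : ∀ᶠ t in 𝓝 0, γ t = X + t ^ 2 • U t) :
    SmoothNear γ 0 ∧ deriv γ 0 = 0 ∧ iteratedDeriv 2 γ 0 = (2 : ℝ) • U 0 ∧
      iteratedDeriv 3 γ 0 = (6 : ℝ) • deriv U 0 := by
  have hU1 := ((contDiff_infty_iff_deriv).1 hU).2
  have hU2 := ((contDiff_infty_iff_deriv).1 hU1).2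
  have d0 : ∀ t, HasDerivAt U (deriv U t) t := fun t =>
    (hU.differentiable (by simp) t).hasDerivAt
  have d1 : ∀ t, HasDerivAt (deriv U) (deriv (deriv U) t) t := fun t =>
    (hU1.differentiable (by simp) t).hasDerivAt
  have d2 : ∀ t, HasDerivAt (deriv (deriv U)) (deriv (deriv (deriv U)) t) t := fun t =>
    (hU2.differentiable (by simp) t).hasDerivAt
  have s1 : ∀ t : ℝ, HasDerivAt (fun t : ℝ => t ^ 2) (2 * t) t := fun t => by
    simpa using hasDerivAt_pow 2 t
  have l1 : ∀ m t : ℝ, HasDerivAt (fun t : ℝ => m * t) m t := fun m t => by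
    simpa using (hasDerivAt_id t).const_mul m
  have hγ : γ =ᶠ[𝓝 0] fun t => X + t ^ 2 • U t := h
  have e1 : deriv (fun t => X + t ^ 2 • U t) = fun t => t ^ 2 • deriv U t + (2 * t) • U t :=
    funext fun t => (((s1 t).smul (d0 t)).const_add X).deriv
  have e2 : deriv (fun t => t ^ 2 • deriv U t + (2 * t) • U t) =
      fun t => (t ^ 2 • deriv (deriv U) t + (4 * t) • deriv U t) + (2 : ℝ) • U t := by
    funext t
    refine (((s1 t).smul (d1 t)).add ((l1 2 t).smul (d0 t))).deriv.trans ?_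
    module
  have e3 : deriv (fun t => (t ^ 2 • deriv (deriv U) t + (4 * t) • deriv U t) + (2 : ℝ) • U t) 0 =
      (6 : ℝ) • deriv U 0 := by
    refine ((((s1 0).smul (d2 0)).add ((l1 4 0).smul (d1 0))).add
      ((d0 0).const_smul (2 : ℝ))).deriv.trans ?_
    module
  refine ⟨SmoothNear.congr (ContDiff.smoothNear (by fun_prop) 0) hγ, ?_, ?_, ?_⟩
  · rw [hγ.deriv_eq, e1]
    simp
  · rw [iteratedDeriv_succ, iteratedDeriv_one, hγ.deriv.deriv_eq, e1, e2]
    simp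
  · rw [iteratedDeriv_succ, iteratedDeriv_succ, iteratedDeriv_one, hγ.deriv.deriv.deriv_eq,
      e1, e2, e3]

namespace LegendreChart

variable {x n : Par → Space} {s : Par} {f : Par → ℝ} {ρ : ℝ} {g g₁ g₂ : ℝ → ℝ} {κ κ₁ κ₂ : ℝ}

/-! ### Sides of the tangent plane -/

/-- The conormal at `s` is a multiple of the image of `(0, 0, 1)` under the contragredient map, so
it selects the third coordinate of the Legendre front. -/
theorem height_eq (c : LegendreChart x n s f) :
    ∀ᶠ q in 𝓝 0, height x n s (c.σ q) = c.μ 0 * legendreHeight f q := by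
  have h0 : n s = c.μ 0 • c.B ![0, 0, 1] := by
    have := c.n_eq.self_of_nhds
    rwa [c.σ_zero] at this
  filter_upwards [c.x_eq] with q hq
  rw [height, hq, add_sub_cancel_left, h0, smul_dotProduct, c.dual]
  simp [legendreFront, dotProduct, Fin.sum_univ_three]

theorem exists_factor_height (c : LegendreChart x n s f) (h : GodronForm f ρ)
    (hκ : CurveJet g κ) : ∃ ψ : ℝ → ℝ, Continuous ψ ∧
      (∀ᶠ t in 𝓝 0, height x n s (c.curve g t) = t ^ 4 * ψ t) ∧
      ψ 0 = -(c.μ 0 / 2) * (κ ^ 2 - 4 * κ + 3 * ρ) := by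
  obtain ⟨Φ, p1, p2, p3⟩ := h.blow_height
  obtain ⟨φ, q1, q2, q3⟩ := hκ.exists_factor p1 p2
  refine ⟨fun t => c.μ 0 * φ t, continuous_const.mul q1.continuous, ?_, ?_⟩
  · filter_upwards [hκ.eventually_graph c.height_eq] with t ht
    rw [curve, ht, q2]
    ring
  · simp only [q3, p3]
    ring

/-- The heights along the curves have even order 4, so their signs are those of the leading
coefficients for both signs of the parameters. The factor `e = ±1` treats equal and opposite sides
together. -/
theorem exists_sides (c : LegendreChart x n s f) (h : GodronForm f ρ)
    (h₁ : CurveJet g₁ κ₁) (h₂ : CurveJet g₂ κ₂) {e : ℝ}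
    (hpos : 0 < e * ((κ₁ ^ 2 - 4 * κ₁ + 3 * ρ) * (κ₂ ^ 2 - 4 * κ₂ + 3 * ρ))) :
    ∃ ε > 0, ∀ t₁ t₂ : ℝ, t₁ ≠ 0 → |t₁| < ε → t₂ ≠ 0 → |t₂| < ε →
      0 < e * (height x n s (c.curve g₁ t₁) * height x n s (c.curve g₂ t₂)) := by
  obtain ⟨ψ₁, a1, a2, a3⟩ := c.exists_factor_height h h₁
  obtain ⟨ψ₂, b1, b2, b3⟩ := c.exists_factor_height h h₂
  have hμ := c.μ_zero
  have h0 : 0 < e * (ψ₁ 0 * ψ₂ 0) := by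
    rw [a3, b3]
    have : 0 < c.μ 0 ^ 2 / 4 := by positivity
    have := mul_pos this hpos
    calc _ < _ := this
      _ = _ := by ring
  have hc : ContinuousAt (fun z : ℝ × ℝ => e * (ψ₁ z.1 * ψ₂ z.2)) (0, 0) := by fun_prop
  have h1 : ∀ᶠ z in 𝓝 ((0 : ℝ), (0 : ℝ)), 0 < e * (ψ₁ z.1 * ψ₂ z.2) :=
    hc.eventually_const_lt h0
  obtain ⟨ε, hε, hball⟩ := Metric.eventually_nhds_iff_ball.1
    (h1.and ((continuous_fst.tendsto' ((0 : ℝ), (0 : ℝ)) 0 rfl).eventually a2 |>.and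
      ((continuous_snd.tendsto' ((0 : ℝ), (0 : ℝ)) 0 rfl).eventually b2)))
  refine ⟨ε, hε, fun t₁ t₂ h1 h2 h3 h4 => ?_⟩
  obtain ⟨k1, k2, k3⟩ := hball (t₁, t₂) (by
    rw [← ball_prod_same]
    exact ⟨by simpa using h2, by simpa using h4⟩)
  simp only at k1 k2 k3
  rw [k2, k3]
  have : 0 < t₁ ^ 4 * t₂ ^ 4 := by positivity
  have := mul_pos this k1
  calc _ < _ := this
    _ = _ := by ring

theorem sameSide (c : LegendreChart x n s f) (h : GodronForm f ρ)
    (h₁ : CurveJet g₁ κ₁) (h₂ : CurveJet g₂ κ₂)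
    (hpos : 0 < (κ₁ ^ 2 - 4 * κ₁ + 3 * ρ) * (κ₂ ^ 2 - 4 * κ₂ + 3 * ρ)) :
    SameSide x n s (c.curve g₁) (c.curve g₂) := by
  have := c.exists_sides h h₁ h₂ (e := 1) (by linarith)
  simpa [SameSide] using this

theorem oppositeSides (c : LegendreChart x n s f) (h : GodronForm f ρ)
    (h₁ : CurveJet g₁ κ₁) (h₂ : CurveJet g₂ κ₂)
    (hneg : (κ₁ ^ 2 - 4 * κ₁ + 3 * ρ) * (κ₂ ^ 2 - 4 * κ₂ + 3 * ρ) < 0) :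
    OppositeSides x n s (c.curve g₁) (c.curve g₂) := by
  have := c.exists_sides h h₁ h₂ (e := -1) (by linarith)
  simpa [OppositeSides] using this

theorem one_side (c : LegendreChart x n s f) (h : GodronForm f ρ) (hρ : 4 / 3 < ρ) :
    (∀ᶠ p in 𝓝[≠] s, 0 < height x n s p) ∨ ∀ᶠ p in 𝓝[≠] s, height x n s p < 0 := by
  have key : ∀ᶠ p in 𝓝 s, p ≠ s → 0 < -c.μ 0 * height x n s p := by
    rw [c.eventually_iff]
    filter_upwards [c.height_eq, eventually_nhdsWithin_iff.1 (h.height_neg hρ)] with q h1 h2 hq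
    have h3 := h2 fun h0 => hq (by rw [h0, c.σ_zero])
    have : 0 < c.μ 0 ^ 2 := pow_pos (abs_pos.2 c.μ_zero) 2 |>.trans_eq (sq_abs _)
    rw [h1]
    nlinarith
  rcases lt_or_gt_of_ne c.μ_zero with hμ | hμ
  · left
    rw [eventually_nhdsWithin_iff]
    filter_upwards [key] with p hp hps
    exact pos_of_mul_pos_right (hp hps) (by linarith)
  · right
    rw [eventually_nhdsWithin_iff]
    filter_upwards [key] with p hp hps
    have := hp hps
    by_contra! hn
    nlinarith [mul_nonneg hμ.le hn]

/-! ### Cusps -/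

/-- The three coordinates have weights 3, 2, 4. The second derivative at 0 is thus governed by `κ -
1`, and the component of the third one transverse to it by `ρ - κ`. -/
theorem exists_cusp (c : LegendreChart x n s f) (h : GodronForm f ρ) (hκ : CurveJet g κ) :
    ∃ P Q S : ℝ → ℝ, ContDiff ℝ ∞ P ∧ ContDiff ℝ ∞ Q ∧ ContDiff ℝ ∞ S ∧
      (∀ᶠ t in 𝓝 0, x (c.curve g t) = x s + c.A ![t ^ 3 * P t, t ^ 2 * Q t, t ^ 4 * S t]) ∧
      P 0 = 2 * ρ - 2 * κ ∧ Q 0 = κ - 1 := by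
  obtain ⟨Φ, p1, p2, p3⟩ := h.blow_a
  obtain ⟨P, q1, q2, q3⟩ := hκ.exists_factor p1 p2
  obtain ⟨Φ', p1', p2', p3'⟩ := h.blow_b
  obtain ⟨Q, q1', q2', q3'⟩ := hκ.exists_factor p1' p2'
  obtain ⟨Φ'', p1'', p2'', -⟩ := h.blow_height
  obtain ⟨S, q1'', q2'', -⟩ := hκ.exists_factor p1'' p2''
  refine ⟨P, Q, S, q1, q1', q1'', ?_, by rw [q3, p3], by rw [q3', p3']⟩
  filter_upwards [hκ.eventually_graph c.x_eq] with t ht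
  rw [curve, ht, legendreFront, q2, q2', q2'']

theorem cusp (c : LegendreChart x n s f) (h : GodronForm f ρ) (hκ : CurveJet g κ) :
    SmoothNear (x ∘ c.curve g) 0 ∧ deriv (x ∘ c.curve g) 0 = 0 ∧
      iteratedDeriv 2 (x ∘ c.curve g) 0 = (2 * (κ - 1)) • c.A ![0, 1, 0] ∧
      ∃ r : ℝ, iteratedDeriv 3 (x ∘ c.curve g) 0 = c.A ![12 * (ρ - κ), r, 0] := by
  obtain ⟨P, Q, S, hP, hQ, hS, he, hP0, hQ0⟩ := c.exists_cusp h hκ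
  have hV : ContDiff ℝ ∞ fun t : ℝ => (![t * P t, Q t, t ^ 2 * S t] : Space) := by
    rw [contDiff_pi]
    intro i
    fin_cases i
    · exact contDiff_id.mul hP
    · exact hQ
    · exact (contDiff_id.pow 2).mul hS
  have hV' : HasDerivAt (fun t : ℝ => (![t * P t, Q t, t ^ 2 * S t] : Space))
      ![2 * ρ - 2 * κ, deriv Q 0, 0] 0 := by
    rw [hasDerivAt_pi]
    intro i
    fin_cases i
    · exact ((hasDerivAt_id (0 : ℝ)).mul (hP.differentiable (by simp) 0).hasDerivAt).congr_deriv
        (by simp [hP0])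
    · exact (hQ.differentiable (by simp) 0).hasDerivAt
    · exact ((hasDerivAt_pow 2 (0 : ℝ)).mul
        (hS.differentiable (by simp) 0).hasDerivAt).congr_deriv (by simp)
  have hU := c.A.contDiff.comp hV
  obtain ⟨a1, a2, a3, a4⟩ := cusp_derivs (γ := x ∘ c.curve g) (X := x s) hU (by
    filter_upwards [he] with t ht
    rw [Function.comp_apply, Function.comp_apply, ht, ← map_smul]
    congr 2
    ext i
    fin_cases i <;> simp <;> ring)
  refine ⟨a1, a2, ?_, 6 * deriv Q 0, ?_⟩
  · rw [a3, Function.comp_apply, ← map_smul, ← map_smul]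
    congr 1
    ext i
    fin_cases i <;> simp [hQ0]
  · have : HasDerivAt (c.A ∘ fun t : ℝ => (![t * P t, Q t, t ^ 2 * S t] : Space))
        (c.A ![2 * ρ - 2 * κ, deriv Q 0, 0]) 0 := c.A.hasFDerivAt.comp_hasDerivAt 0 hV'
    rw [a4, this.deriv, ← map_smul]
    congr 1
    ext i
    fin_cases i <;> simp
    ring

/-- For `κ = 1` the second derivative vanishes, and for `κ = ρ` the third one is collinear with it;
these are the only exceptions. -/
theorem isSemicubicCusp (c : LegendreChart x n s f) (h : GodronForm f ρ) (hκ : CurveJet g κ)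
    (h1 : κ ≠ 1) (h2 : κ ≠ ρ) : IsSemicubicCusp (x ∘ c.curve g) := by
  obtain ⟨a1, a2, a3, r, a4⟩ := c.cusp h hκ
  refine ⟨a1, a2, ?_⟩
  rw [a3, a4, LinearIndependent.pair_iff]
  intro m k hmk
  rw [← map_smul, ← map_smul, ← map_smul, ← map_add, ← map_zero c.A] at hmk
  have h3 := c.A.injective hmk
  have e0 := congrFun h3 0
  have e1 := congrFun h3 1
  simp at e0 e1
  have hk : k = 0 := by
    rcases e0 with e0 | e0
    · exact e0
    · exact absurd (by linarith) h2
  rw [hk] at e1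
  simp at e1
  rcases e1 with e1 | e1
  · exact ⟨e1, hk⟩
  · exact absurd (by linarith) h1

theorem sameDirection (c : LegendreChart x n s f) (h : GodronForm f ρ) (h₁ : CurveJet g₁ κ₁)
    (h₂ : CurveJet g₂ κ₂) (hpos : 0 < (κ₁ - 1) * (κ₂ - 1)) :
    SameDirection (x ∘ c.curve g₁) (x ∘ c.curve g₂) := by
  have h0 : κ₂ - 1 ≠ 0 := right_ne_zero_of_mul hpos.ne'
  refine ⟨(κ₁ - 1) / (κ₂ - 1), ?_, ?_⟩
  · have h4 := pow_pos (abs_pos.2 h0) 2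
    rw [sq_abs] at h4
    have := div_pos hpos h4
    calc _ < _ := this
      _ = _ := by field_simp
  · rw [(c.cusp h h₁).2.2.1, (c.cusp h h₂).2.2.1, smul_smul]
    congr 1
    field_simp

theorem oppositeDirection (c : LegendreChart x n s f) (h : GodronForm f ρ) (h₁ : CurveJet g₁ κ₁)
    (h₂ : CurveJet g₂ κ₂) (hneg : (κ₁ - 1) * (κ₂ - 1) < 0) :
    OppositeDirection (x ∘ c.curve g₁) (x ∘ c.curve g₂) := by
  have h0 : κ₂ - 1 ≠ 0 := right_ne_zero_of_mul hneg.ne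
  refine ⟨(κ₁ - 1) / (κ₂ - 1), ?_, ?_⟩
  · have h4 := pow_pos (abs_pos.2 h0) 2
    rw [sq_abs] at h4
    have := div_neg_of_neg_of_pos hneg h4
    calc _ = _ := by field_simp
      _ < _ := this
  · rw [(c.cusp h h₁).2.2.1, (c.cusp h h₂).2.2.1, smul_smul]
    congr 1
    field_simp

/-! ### Domains and separation -/

theorem elliptic_curve (c : LegendreChart x n s f) (h : GodronForm f ρ) (hκ : CurveJet g κ)
    (hpos : 0 < 6 * ρ - 4 - 2 * κ) :
    ∀ᶠ t in 𝓝[≠] (0 : ℝ), EllipticAt (homog x) (c.curve g t) := by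
  filter_upwards [h.hessDet_pos hκ hpos,
    (hκ.eventually_graph (c.types_front h.bb)).filter_mono nhdsWithin_le_nhds] with t h1 h2
  exact h2.1.2 h1

theorem hyperbolic_curve (c : LegendreChart x n s f) (h : GodronForm f ρ) (hκ : CurveJet g κ)
    (hneg : 6 * ρ - 4 - 2 * κ < 0) :
    ∀ᶠ t in 𝓝[≠] (0 : ℝ), HyperbolicAt (homog x) (c.curve g t) := by
  filter_upwards [h.hessDet_neg hκ hneg,
    (hκ.eventually_graph (c.types_front h.bb)).filter_mono nhdsWithin_le_nhds] with t h1 h2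
  exact h2.2.1.2 h1

theorem separatesLocally (c : LegendreChart x n s f) {gD : ℝ → ℝ} {κD : ℝ}
    (hD : DoublePointsOn f gD) (hκD : CurveJet gD κD) (hκ : CurveJet g κ) (h₁ : CurveJet g₁ κ₁)
    (h₂ : CurveJet g₂ κ₂) (h1 : κ₁ < κ) (h2 : κ < κ₂) (h : gD = g ∨ κ ≠ κD) :
    SeparatesLocally x s (c.curve g) (c.curve g₁) (c.curve g₂) := by
  refine separatesLocally_curve c hD h₁.contDiff.continuous h₂.contDiff.continuous
    hκ.contDiff.continuous h₁.zero h₂.zero hκ.zero hκD.zero (h₁.eventually_lt hκ h1)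
    (hκ.eventually_lt h₂ h2) ?_
  rcases h with h | h
  · exact Or.inl h
  · rcases lt_or_gt_of_ne h with h | h
    · exact Or.inr (Or.inr (hκ.eventually_lt hκD h))
    · exact Or.inr (Or.inl (hκD.eventually_lt hκ h))

theorem eq_zero_of_eventually_ne {g₁ g₂ : ℝ → ℝ} {κ₁ κ₂ : ℝ} (h₁ : CurveJet g₁ κ₁)
    (h₂ : CurveJet g₂ κ₂) (h : κ₁ ≠ κ₂) : ∀ᶠ t in 𝓝 (0 : ℝ), g₁ t = g₂ t → t = 0 := by
  have : ∀ᶠ t in 𝓝[≠] (0 : ℝ), g₁ t ≠ g₂ t := by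
    rcases lt_or_gt_of_ne h with h | h
    · exact (h₁.eventually_lt h₂ h).mono fun t ht => ht.ne
    · exact (h₂.eventually_lt h₁ h).mono fun t ht => ht.ne'
  filter_upwards [eventually_nhdsWithin_iff.1 this] with t ht h0
  by_contra hne
  exact ht hne h0

/-- If the two curves had a common image point off `s`, it would come either from a common
parameter, excluded by `κ₁ ≠ κ₂`, or from two points of the double curve, excluded because both
coefficients differ from `ρ`. -/
theorem tangentSectionIsTwoCusps (c : LegendreChart x n s f) (h : GodronForm f ρ) {gD : ℝ → ℝ}
    (hD : DoublePointsOn f gD) (hρ : CurveJet gD ρ) (h₁ : CurveJet g₁ κ₁) (h₂ : CurveJet g₂ κ₂)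
    (h12 : κ₁ ≠ κ₂) (h1 : κ₁ ≠ 1) (h2 : κ₂ ≠ 1) (h1ρ : κ₁ ≠ ρ) (h2ρ : κ₂ ≠ ρ)
    (hs : ∀ᶠ q in 𝓝 (0 : Par), legendreHeight f q = 0 ↔ q.2 = g₁ q.1 ∨ q.2 = g₂ q.1) :
    TangentSectionIsTwoCusps x n s (c.curve g₁) (c.curve g₂) := by
  refine ⟨⟨c.smooth_curve h₁.contDiff h₁.zero, c.curve_zero h₁.zero,
    c.deriv_curve_ne_zero h₁.contDiff h₁.zero⟩, ⟨c.smooth_curve h₂.contDiff h₂.zero,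
    c.curve_zero h₂.zero, c.deriv_curve_ne_zero h₂.contDiff h₂.zero⟩, ?_, ?_,
    c.isSemicubicCusp h h₁ h1 h1ρ, c.isSemicubicCusp h h₂ h2 h2ρ⟩
  · filter_upwards [c.eventually_mem_image h₁.contDiff.continuous h₁.zero,
      c.eventually_mem_image h₂.contDiff.continuous h₂.zero] with ε e1 e2
    rw [c.eventually_iff]
    filter_upwards [e1, e2, c.height_eq, hs] with q q1 q2 q3 q4
    rw [mem_union, q1, q2, q3, ← q4]
    simp [c.μ_zero]
  · obtain ⟨r, hr, hball⟩ := Metric.eventually_nhds_iff_ball.1 hD.eq_or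
    have hb := Metric.ball_mem_nhds (0 : Par) hr
    obtain ⟨ε, hε, hee⟩ := Metric.eventually_nhds_iff_ball.1
      ((((h₁.eventually_graph hb).and (h₂.eventually_graph hb)).and
        ((h₁.eventually_graph c.x_eq).and (h₂.eventually_graph c.x_eq))).and
        ((eq_zero_of_eventually_ne h₁ h₂ h12).and ((eq_zero_of_eventually_ne h₁ hρ h1ρ).and
          (eq_zero_of_eventually_ne h₂ hρ h2ρ))))
    refine ⟨ε, hε, fun t τ ht hτ he => ?_⟩
    obtain ⟨⟨⟨a1, -⟩, a3, -⟩, a5, a6, -⟩ := hee t (by simpa using ht)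
    obtain ⟨⟨⟨-, b2⟩, -, b4⟩, -, -, b7⟩ := hee τ (by simpa using hτ)
    rw [curve, curve, a3, b4] at he
    rcases hball ((t, g₁ t), (τ, g₂ τ)) (by
      rw [← Prod.mk_zero_zero, ← ball_prod_same]
      exact ⟨a1, b2⟩) (c.A.injective (add_left_cancel he)) with e | ⟨e1, e2⟩
    · have e1 : t = τ := congrArg Prod.fst e
      have e2 : g₁ t = g₂ τ := congrArg Prod.snd e
      rw [← e1] at e2 ⊢
      exact ⟨a5 e2, a5 e2⟩
    · exact ⟨a6 e1, b7 e2⟩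

end LegendreChart

/-! ### Twisting of the tangent plane and the two branches of the flecnodal curve. -/

theorem det_rows_map (B : Space ≃L[ℝ] Space) (u v w : Space) :
    Matrix.det (Matrix.of ![B u, B v, B w]) =
      LinearMap.det (B : Space →ₗ[ℝ] Space) * Matrix.det (Matrix.of ![u, v, w]) := by
  have h : (Matrix.of ![B u, B v, B w] : Matrix (Fin 3) (Fin 3) ℝ) =
      Matrix.of ![u, v, w] * (LinearMap.toMatrix' (B : Space →ₗ[ℝ] Space))ᵀ := by
    have e : ∀ y : Space, B y = y ᵥ* (LinearMap.toMatrix' (B : Space →ₗ[ℝ] Space))ᵀ := fun y => by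
      rw [Matrix.vecMul_transpose, LinearMap.toMatrix'_mulVec]
      rfl
    ext i j
    fin_cases i
    · exact congrFun (e u) j
    · exact congrFun (e v) j
    · exact congrFun (e w) j
  rw [h, Matrix.det_mul, Matrix.det_transpose, LinearMap.det_toMatrix', mul_comm]

namespace LegendreChart

variable {x n : Par → Space} {s : Par} {f : Par → ℝ} {ρ : ℝ} {g gD : ℝ → ℝ} {κ : ℝ}

/-- The twisting of the tangent plane along an asymptotic direction. -/
theorem twist_eq (c : LegendreChart x n s f) (hF : IsFront x n s) :
    ∀ᶠ q in 𝓝 0, ∀ (v : Par) (r : ℝ),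
      fderiv ℝ (legendreFront f) q v = r • ![-v.2, v.1, q.1 * v.2 - q.2 * v.1] →
      twist x n (c.σ q) (fderiv ℝ c.σ q v) =
        LinearMap.det (c.B : Space →ₗ[ℝ] Space) * (c.μ q ^ 2 * r *
          (c.A ![-v.2, v.1, q.1 * v.2 - q.2 * v.1] ⬝ᵥ
            c.A ![-v.2, v.1, q.1 * v.2 - q.2 * v.1])) := by
  filter_upwards [c.smooth_σ.eventually, c.tendsto_σ.eventually hF.1.eventually,
    c.tendsto_σ.eventually hF.2.1.eventually, c.x_eq.eventually_nhds, c.n_eq.eventually_nhds,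
    c.smooth_μ.eventually] with q h1 h2 h3 h4 h5 h6 v r hv
  -- This is the cross product of the conormal `(q.1, q.2, 1)` and its derivative along `v`. The
  -- velocity of an asymptotic curve is orthogonal to both, hence a multiple `r` of it, and the sign
  -- of `r` decides the twisting.
  set z : Space := ![-v.2, v.1, q.1 * v.2 - q.2 * v.1] with hz
  have hl : HasDerivAt (fun t : ℝ => q + t • v) v 0 := by
    simpa using ((hasDerivAt_id (0 : ℝ)).smul_const v).const_add q
  have hq : q + (0 : ℝ) • v = q := by simp
  have hlc : Tendsto (fun t : ℝ => q + t • v) (𝓝 0) (𝓝 q) := by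
    have := hl.continuousAt.tendsto
    rwa [hq] at this
  have hσ : HasDerivAt (fun t : ℝ => c.σ (q + t • v)) (fderiv ℝ c.σ q v) 0 :=
    HasFDerivAt.comp_hasDerivAt (l := c.σ) 0 (by rw [hq]; exact h1.differentiableAt.hasFDerivAt) hl
  have hx : HasDerivAt (fun t : ℝ => x (c.σ (q + t • v)))
      (fderiv ℝ x (c.σ q) (fderiv ℝ c.σ q v)) 0 :=
    HasFDerivAt.comp_hasDerivAt (l := x) 0 (by rw [hq]; exact h2.differentiableAt.hasFDerivAt) hσ
  have hn : HasDerivAt (fun t : ℝ => n (c.σ (q + t • v)))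
      (fderiv ℝ n (c.σ q) (fderiv ℝ c.σ q v)) 0 :=
    HasFDerivAt.comp_hasDerivAt (l := n) 0 (by rw [hq]; exact h3.differentiableAt.hasFDerivAt) hσ
  have hf : HasDerivAt (fun t : ℝ => legendreFront f (q + t • v)) (r • z) 0 := by
    rw [← hv]
    refine HasFDerivAt.comp_hasDerivAt (l := legendreFront f) 0 ?_ hl
    rw [hq]
    exact ((contDiff_legendreFront c.contDiff).differentiable (by simp) q).hasFDerivAt
  have hx' : fderiv ℝ x (c.σ q) (fderiv ℝ c.σ q v) = r • c.A z := by
    rw [← map_smul]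
    refine hx.unique (((c.A.hasFDerivAt.comp_hasDerivAt 0 hf).const_add (x s)).congr_of_eventuallyEq ?_)
    filter_upwards [hlc.eventually h4] with t ht
    rw [ht]
    rfl
  have hμ : HasDerivAt (fun t : ℝ => c.μ (q + t • v)) (fderiv ℝ c.μ q v) 0 :=
    HasFDerivAt.comp_hasDerivAt (l := c.μ) 0 (by rw [hq]; exact h6.differentiableAt.hasFDerivAt) hl
  have hν : HasDerivAt (fun t : ℝ => (![(q + t • v).1, (q + t • v).2, 1] : Space))
      ![v.1, v.2, 0] 0 := by
    rw [hasDerivAt_pi]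
    intro i
    fin_cases i
    · exact (hasFDerivAt_fst (𝕜 := ℝ) (E := ℝ) (F := ℝ)).comp_hasDerivAt 0 hl
    · exact (hasFDerivAt_snd (𝕜 := ℝ) (E := ℝ) (F := ℝ)).comp_hasDerivAt 0 hl
    · exact hasDerivAt_const _ _
  have hn' : fderiv ℝ n (c.σ q) (fderiv ℝ c.σ q v) =
      c.B (c.μ q • ![v.1, v.2, 0] + fderiv ℝ c.μ q v • ![q.1, q.2, 1]) := by
    have h7 := hμ.smul (c.B.hasFDerivAt.comp_hasDerivAt 0 hν)
    have h8 := hn.unique (h7.congr_of_eventuallyEq (by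
      filter_upwards [hlc.eventually h5] with t ht
      rw [ht]
      rfl))
    rw [h8, map_add, map_smul, map_smul]
    simp
  have hn0 : n (c.σ q) = c.B (c.μ q • ![q.1, q.2, 1]) := by
    rw [h5.self_of_nhds, map_smul]
  -- The first row of the determinant is rewritten as an image under `B`, like the other two, so
  -- that the determinant of `B` factors out.
  set Y := c.B.symm (c.A z) with hY
  have hBY : c.B Y = c.A z := by simp [hY]
  have hYz : Y ⬝ᵥ z = c.A z ⬝ᵥ c.A z := by rw [← c.dual, hBY]
  rw [twist, hx', hn', hn0, ← hBY, ← map_smul, det_rows_map, hBY, ← hYz]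
  congr 1
  rw [Matrix.det_fin_three]
  simp [hz, dotProduct, Fin.sum_univ_three]
  ring

theorem det_B_ne_zero (c : LegendreChart x n s f) :
    LinearMap.det (c.B : Space →ₗ[ℝ] Space) ≠ 0 :=
  (LinearEquiv.isUnit_det' c.B.toLinearEquiv).ne_zero

/-- Along the flecnodal curve the multiplier `r` of `twist_eq` is `t * R t` with `R 0 = 2ρ - 2 ≠ 0`,
so the twisting along every direction of four-point contact changes sign with `t`. -/
theorem separatesLeftRight (c : LegendreChart x n s f) (hF : IsFront x n s)
    (h : GodronForm f ρ) (hρ : ρ ≠ 1) (hκ : CurveJet g κ)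
    (hg : ∀ᶠ q in 𝓝 (0 : Par), (∃ v ≠ 0, hess f q v = 0 ∧ cub f q v = 0) ↔ q.2 = g q.1)
    {R : ℝ → ℝ} (hR : Continuous R) (hR0 : R 0 = 2 * ρ - 2)
    (hgR : ∀ᶠ t in 𝓝 (0 : ℝ), ∀ v : Par, v ≠ 0 →
      hess f (t, g t) v = 0 → cub f (t, g t) v = 0 → v.1 ≠ 0 ∧
        pa (pb f) (t, g t) * v.1 + pb (pb f) (t, g t) * v.2 = t * R t * v.1)
    (hne : ∀ᶠ t in 𝓝[≠] (0 : ℝ), hessDet f (t, g t) ≠ 0) :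
    SeparatesLeftRight x n (c.curve g) := by
  set d := LinearMap.det (c.B : Space →ₗ[ℝ] Space) with hd
  have hd0 : d * (2 * ρ - 2) ≠ 0 := mul_ne_zero c.det_B_ne_zero (by
    intro h0
    exact hρ (by linarith))
  have hR1 : ∀ᶠ t in 𝓝 (0 : ℝ), 0 < (d * (2 * ρ - 2)) * (d * R t) := by
    have hc : ContinuousAt (fun t => (d * (2 * ρ - 2)) * (d * R t)) 0 := by fun_prop
    refine hc.eventually_const_lt ?_
    simp only [hR0]
    exact mul_self_pos.2 hd0
  have key : ∀ᶠ t in 𝓝[≠] (0 : ℝ), RegularAt (homog x) (c.curve g t) ∧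
      (∃ v, v ≠ 0 ∧ HasContact (homog x) (c.curve g t) v 4) ∧
      ∀ v, v ≠ 0 → HasContact (homog x) (c.curve g t) v 4 →
        0 < (t * (d * (2 * ρ - 2))) * twist x n (c.curve g t) v := by
    have hev := ((hκ.eventually_graph c.contact_front).and
      ((hκ.eventually_graph c.bijective_fderiv_σ).and ((hκ.eventually_graph hg).and
      ((hκ.eventually_graph (c.twist_eq hF)).and (hgR.and (hR1.and
      (hκ.eventually_graph (c.smooth_μ.continuousAt.eventually_ne c.μ_zero))))))))
    filter_upwards [hev.filter_mono nhdsWithin_le_nhds, hne, self_mem_nhdsWithin]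
      with t ⟨h1, h2, h3, h4, h5, h6, h7⟩ hne ht0
    obtain ⟨hr, hv⟩ := h1 hne
    refine ⟨hr, ?_, fun u hu hu4 => ?_⟩
    · exact (exists_hasContact_iff h2 fun v hv0 => (hv v hv0).2).2 (h3.2 rfl)
    · obtain ⟨v, rfl⟩ := h2.2 u
      have hv0 : v ≠ 0 := fun h => hu (by rw [h, map_zero])
      obtain ⟨e1, e2⟩ := (hv v hv0).2.1 hu4
      obtain ⟨k1, k2⟩ := h5 v hv0 e1 e2
      -- For an asymptotic `v` the Hessian applied to `v` is orthogonal to `v`, so its known second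
      -- entry determines the first.
      have k3 : pa (pa f) (t, g t) * v.1 + pa (pb f) (t, g t) * v.2 = t * R t * -v.2 := by
        refine mul_right_cancel₀ k1 ?_
        rw [hess] at e1
        linear_combination e1 - v.2 * k2
      rw [curve, h4 v (t * R t) (by
        rw [fderiv_legendreFront h.contDiff, k2, k3]
        ext i
        fin_cases i <;> simp
        ring)]
      set z : Space := ![-v.2, v.1, (t, g t).1 * v.2 - (t, g t).2 * v.1] with hz
      have hz0 : c.A z ≠ 0 := fun h0 => k1 (by
        have : z = 0 := c.A.injective (h0.trans (map_zero _).symm)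
        exact congrFun this 1)
      have hz1 : 0 < c.A z ⬝ᵥ c.A z := by
        refine lt_of_le_of_ne ?_ (Ne.symm ?_)
        · exact Finset.sum_nonneg fun i _ => mul_self_nonneg _
        · rwa [Ne, dotProduct_self_eq_zero]
      have h8 : 0 < t ^ 2 := by have : t ≠ 0 := ht0; positivity
      have h9 : 0 < c.μ (t, g t) ^ 2 := by positivity
      have := mul_pos (mul_pos (mul_pos h8 h9) hz1) h6
      calc _ < _ := this
        _ = _ := by ring
  rw [eventually_nhdsWithin_iff] at key
  have hn : ∀ᶠ t in 𝓝[<] (0 : ℝ), t < 0 := self_mem_nhdsWithin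
  have hp : ∀ᶠ t in 𝓝[>] (0 : ℝ), 0 < t := self_mem_nhdsWithin
  rcases lt_or_gt_of_ne hd0 with hneg | hpos
  · right
    constructor
    · filter_upwards [hn, key.filter_mono nhdsWithin_le_nhds] with t ht h1
      obtain ⟨a1, ⟨v, a2, a3⟩, a4⟩ := h1 ht.ne
      have hm := mul_pos_of_neg_of_neg ht hneg
      refine ⟨⟨a1, v, a2, a3, pos_of_mul_pos_right (a4 v a2 a3) hm.le⟩, ?_⟩
      rintro ⟨-, w, w1, w2, w3⟩
      have := a4 w w1 w2
      exact absurd (pos_of_mul_pos_right this hm.le) w3.not_gt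
    · filter_upwards [hp, key.filter_mono nhdsWithin_le_nhds] with t ht h1
      obtain ⟨a1, ⟨v, a2, a3⟩, a4⟩ := h1 ht.ne'
      have hm := mul_neg_of_pos_of_neg ht hneg
      refine ⟨⟨a1, v, a2, a3, neg_of_mul_pos_right (a4 v a2 a3) hm.le⟩, ?_⟩
      rintro ⟨-, w, w1, w2, w3⟩
      exact absurd (neg_of_mul_pos_right (a4 w w1 w2) hm.le) w3.not_gt
  · left
    constructor
    · filter_upwards [hn, key.filter_mono nhdsWithin_le_nhds] with t ht h1
      obtain ⟨a1, ⟨v, a2, a3⟩, a4⟩ := h1 ht.ne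
      have hm := mul_neg_of_neg_of_pos ht hpos
      refine ⟨⟨a1, v, a2, a3, neg_of_mul_pos_right (a4 v a2 a3) hm.le⟩, ?_⟩
      rintro ⟨-, w, w1, w2, w3⟩
      exact absurd (neg_of_mul_pos_right (a4 w w1 w2) hm.le) w3.not_gt
    · filter_upwards [hp, key.filter_mono nhdsWithin_le_nhds] with t ht h1
      obtain ⟨a1, ⟨v, a2, a3⟩, a4⟩ := h1 ht.ne'
      have hm := mul_pos ht hpos
      refine ⟨⟨a1, v, a2, a3, pos_of_mul_pos_right (a4 v a2 a3) hm.le⟩, ?_⟩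
      rintro ⟨-, w, w1, w2, w3⟩
      exact absurd (pos_of_mul_pos_right (a4 w w1 w2) hm.le) w3.not_gt

end LegendreChart

/-! ### Curves between the branches of a cusp. -/

/-- The numerical core of the position of a curve between the branches of a cusp. -/
theorem between_branches {N M G E : ℝ → ℝ} (hN : Continuous N) (hM : Continuous M)
    (hG : Continuous G) (hE : Continuous E) (hN0 : 0 < N 0) (hM0 : 0 < M 0) (hG0 : 0 < G 0)
    (hE0 : E 0 = 0) :
    ∀ᶠ ε in 𝓝[>] (0 : ℝ), ∀ᶠ t in 𝓝[≠] (0 : ℝ),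
      (∃ τ ∈ Ioo (-ε) 0, τ ^ 2 * N τ = t ^ 2 * M t) ∧
      (∃ τ ∈ Ioo 0 ε, τ ^ 2 * N τ = t ^ 2 * M t) ∧
      ∀ τ, |τ| < ε → τ ≠ 0 → τ ^ 2 * N τ = t ^ 2 * M t →
        0 < τ * (τ ^ 3 * G τ - t ^ 3 * E t) := by
  have e1 : ∀ᶠ τ in 𝓝 (0 : ℝ), 0 < N τ ∧ N τ < N 0 + 1 ∧ G 0 / 2 < G τ :=
    (hN.continuousAt.eventually_const_lt hN0).and
      ((hN.continuousAt.eventually_lt_const (by linarith)).and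
        (hG.continuousAt.eventually_const_lt (by linarith)))
  obtain ⟨ε₀, hε₀, hball⟩ := Metric.eventually_nhds_iff_ball.1 e1
  filter_upwards [Ioo_mem_nhdsGT hε₀] with ε hε
  have hb : ∀ τ, |τ| < ε → 0 < N τ ∧ N τ < N 0 + 1 ∧ G 0 / 2 < G τ := fun τ hτ =>
    hball τ (by rw [Metric.mem_ball, Real.dist_eq, sub_zero]; exact hτ.trans hε.2)
  -- On a common level the bounds on `N` and `M` give `t² ≤ (L - 1) τ² ≤ (L τ)²`, hence `|t| ≤ L
  -- |τ|`. Since `E 0 = 0`, the term `t³ E t` is then negligible against `τ³ G τ`.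
  set L := 2 * (N 0 + 1) / M 0 + 1 with hL
  have hL1 : 1 ≤ L := by
    have : 0 ≤ 2 * (N 0 + 1) / M 0 := by positivity
    linarith
  have hε2 : 0 < ε / 2 := by have := hε.1; linarith
  have hp := (hb (ε / 2) (by rw [abs_of_pos hε2]; linarith)).1
  have hm := (hb (-(ε / 2)) (by rw [abs_neg, abs_of_pos hε2]; linarith)).1
  have c1 : ContinuousAt (fun t => t ^ 2 * M t) 0 := by fun_prop
  have c2 : ContinuousAt (fun t => L ^ 3 * |E t|) 0 := by fun_prop
  have e2 : ∀ᶠ t in 𝓝 (0 : ℝ), M 0 / 2 < M t ∧ L ^ 3 * |E t| < G 0 / 4 ∧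
      t ^ 2 * M t < (ε / 2) ^ 2 * N (ε / 2) ∧ t ^ 2 * M t < (-(ε / 2)) ^ 2 * N (-(ε / 2)) := by
    refine (hM.continuousAt.eventually_const_lt (by linarith)).and
      ((c2.eventually_lt_const (by simp [hE0]; linarith)).and
        ((c1.eventually_lt_const ?_).and (c1.eventually_lt_const ?_)))
    · simp only [ne_eq, OfNat.ofNat_ne_zero, not_false_eq_true, zero_pow, zero_mul]
      positivity
    · simp only [ne_eq, OfNat.ofNat_ne_zero, not_false_eq_true, zero_pow, zero_mul]
      have : 0 < (-(ε / 2)) ^ 2 := by rw [neg_sq]; positivity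
      positivity
  filter_upwards [e2.filter_mono nhdsWithin_le_nhds, self_mem_nhdsWithin]
    with t ⟨h1, h2, h3, h4⟩ ht
  have ht0 : t ≠ 0 := ht
  have hMt : 0 < M t := by linarith
  have htM : 0 < t ^ 2 * M t := by positivity
  have hc : Continuous fun τ => τ ^ 2 * N τ := by fun_prop
  refine ⟨?_, ?_, fun τ hτ hτ0 he => ?_⟩
  · obtain ⟨τ, hτ, hτ'⟩ := intermediate_value_Ioo' (a := -(ε / 2)) (b := 0) (by linarith)
      hc.continuousOn (show t ^ 2 * M t ∈ _ from ⟨by simpa using htM, h4⟩)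
    exact ⟨τ, ⟨by linarith [hτ.1], hτ.2⟩, hτ'⟩
  · obtain ⟨τ, hτ, hτ'⟩ := intermediate_value_Ioo (a := 0) (b := ε / 2) hε2.le
      hc.continuousOn (show t ^ 2 * M t ∈ _ from ⟨by simpa using htM, h3⟩)
    exact ⟨τ, ⟨hτ.1, by linarith [hτ.2]⟩, hτ'⟩
  · obtain ⟨b1, b2, b3⟩ := hb τ hτ
    have hτ2 : 0 < τ ^ 2 := by positivity
    have k1 : t ^ 2 * (M 0 / 2) ≤ τ ^ 2 * (N 0 + 1) := by
      calc t ^ 2 * (M 0 / 2) ≤ t ^ 2 * M t := by gcongr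
        _ = τ ^ 2 * N τ := he.symm
        _ ≤ _ := by gcongr
    have k2 : t ^ 2 ≤ (L * τ) ^ 2 := by
      have a1 : t ^ 2 ≤ τ ^ 2 * (L - 1) := by
        have : t ^ 2 * (M 0 / 2) ≤ (τ ^ 2 * (L - 1)) * (M 0 / 2) := by
          calc _ ≤ _ := k1
            _ = _ := by rw [hL]; field_simp; ring
        exact le_of_mul_le_mul_right this (by linarith)
      have a2 : L - 1 ≤ L ^ 2 := by nlinarith
      calc t ^ 2 ≤ τ ^ 2 * (L - 1) := a1
        _ ≤ τ ^ 2 * L ^ 2 := by gcongr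
        _ = _ := by ring
    have k3 : |t| ≤ L * |τ| := by
      have := sq_le_sq.1 k2
      rwa [abs_mul, abs_of_pos (by linarith : 0 < L)] at this
    have k4 : |t ^ 3 * E t| ≤ |τ| ^ 3 * (G 0 / 4) := by
      rw [abs_mul, abs_pow]
      calc |t| ^ 3 * |E t| ≤ (L * |τ|) ^ 3 * |E t| := by gcongr
        _ = |τ| ^ 3 * (L ^ 3 * |E t|) := by ring
        _ ≤ _ := by gcongr
    have hτa : 0 < |τ| := abs_pos.2 hτ0
    have k5 : τ * (t ^ 3 * E t) ≤ |τ| * (|τ| ^ 3 * (G 0 / 4)) := by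
      calc τ * (t ^ 3 * E t) ≤ |τ * (t ^ 3 * E t)| := le_abs_self _
        _ = |τ| * |t ^ 3 * E t| := abs_mul _ _
        _ ≤ _ := by gcongr
    have k6 : |τ| * (|τ| ^ 3 * (G 0 / 4)) = (τ ^ 2) ^ 2 * (G 0 / 4) := by
      rw [← sq_abs τ]
      ring
    have k7 : (τ ^ 2) ^ 2 * (G 0 / 2) ≤ (τ ^ 2) ^ 2 * G τ := by gcongr
    have k8 : 0 < (τ ^ 2) ^ 2 * (G 0 / 4) := by positivity
    have k9 : τ * (τ ^ 3 * G τ - t ^ 3 * E t) = (τ ^ 2) ^ 2 * G τ - τ * (t ^ 3 * E t) := by ring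
    rw [k9]
    linarith

/-- Along the cusp `ξ` is of exact order `τ³`, with opposite signs on the two branches. Along the
self-intersection line the cubic coefficient vanishes, its `κ` being `ρ`. Both curves have `η` of
order 2 with coefficients of the same sign, so they share levels with comparable parameters, and
there the two branches lie on different sides. -/
theorem LegendreChart.liesBetweenBranches {x n : Par → Space} {s : Par} {f : Par → ℝ} {ρ κ : ℝ}
    {g gD : ℝ → ℝ} (c : LegendreChart x n s f) (h : GodronForm f ρ) (hκ : CurveJet g κ)
    (hD : CurveJet gD ρ) (h1 : 0 < (κ - 1) * (ρ - 1)) (h2 : κ ≠ ρ) :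
    LiesBetweenBranches (x ∘ c.curve gD) (x ∘ c.curve g) := by
  intro ξ η hξ2 hξ3 hη
  obtain ⟨-, -, a3, r, a4⟩ := c.cusp h hκ
  obtain ⟨P, Q, S, hP, hQ, hS, he, hP0, hQ0⟩ := c.exists_cusp h hκ
  obtain ⟨P', Q', S', hP', hQ', hS', he', hP0', hQ0'⟩ := c.exists_cusp h hD
  rw [a3, map_smul, smul_eq_mul] at hξ2 hη
  rw [a4] at hξ3
  have hκ1 : κ - 1 ≠ 0 := left_ne_zero_of_mul h1.ne'
  have hexp : ∀ (ζ : Space →ₗ[ℝ] ℝ) (a b d : ℝ), ζ (c.A ![a, b, d]) =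
      a * ζ (c.A ![1, 0, 0]) + b * ζ (c.A ![0, 1, 0]) + d * ζ (c.A ![0, 0, 1]) := by
    intro ζ a b d
    have : (![a, b, d] : Space) = a • ![1, 0, 0] + b • ![0, 1, 0] + d • ![0, 0, 1] := by
      ext i
      fin_cases i <;> simp
    rw [this]
    simp only [map_add, map_smul, smul_eq_mul]
  set ξ₁ := ξ (c.A ![1, 0, 0]) with hξ₁
  set ξ₃ := ξ (c.A ![0, 0, 1]) with hξ₃
  set η₁ := η (c.A ![1, 0, 0]) with hη₁
  set η₂ := η (c.A ![0, 1, 0]) with hη₂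
  set η₃ := η (c.A ![0, 0, 1]) with hη₃
  have hξe : ξ (c.A ![0, 1, 0]) = 0 := (mul_eq_zero.1 hξ2).resolve_left (by
    intro h0; exact hκ1 (by linarith))
  have hη0 : η₂ ≠ 0 := right_ne_zero_of_mul hη
  have hξx : ∀ a b d : ℝ, ξ (c.A ![a, b, d]) = a * ξ₁ + d * ξ₃ := fun a b d => by
    rw [hexp, hξe, mul_zero, add_zero]
  have hηx : ∀ a b d : ℝ, η (c.A ![a, b, d]) = a * η₁ + b * η₂ + d * η₃ := hexp η
  have hξ0 : ξ₁ ≠ 0 := by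
    intro h0
    rw [hξx, h0] at hξ3
    simp at hξ3
  -- Multiplying by the limits `m` and `k` makes the leading coefficients positive, whatever the
  -- orientations of `ξ` and `η`.
  set m := (ρ - 1) * η₂ with hm
  set k := (2 * ρ - 2 * κ) * ξ₁ with hk
  have hm0 : m ≠ 0 := mul_ne_zero (right_ne_zero_of_mul h1.ne') hη0
  have hk0 : k ≠ 0 := mul_ne_zero (fun h0 => h2 (by linarith)) hξ0
  have key := between_branches (N := fun τ => m * (τ * P τ * η₁ + Q τ * η₂ + τ ^ 2 * S τ * η₃))
    (M := fun t => m * (t * P' t * η₁ + Q' t * η₂ + t ^ 2 * S' t * η₃))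
    (G := fun τ => k * (P τ * ξ₁ + τ * S τ * ξ₃)) (E := fun t => k * (P' t * ξ₁ + t * S' t * ξ₃))
    (by have := hP.continuous; have := hQ.continuous; have := hS.continuous; fun_prop)
    (by have := hP'.continuous; have := hQ'.continuous; have := hS'.continuous; fun_prop)
    (by have := hP.continuous; have := hS.continuous; fun_prop)
    (by have := hP'.continuous; have := hS'.continuous; fun_prop)
    (by
      simp only [hQ0, hm]
      have : 0 < η₂ ^ 2 := by positivity
      have := mul_pos h1 this
      calc _ < _ := this
        _ = _ := by ring)
    (by
      simp only [hQ0', zero_mul, zero_add, ne_eq, OfNat.ofNat_ne_zero, not_false_eq_true,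
        zero_pow, add_zero]
      exact mul_self_pos.2 hm0)
    (by
      simp only [hP0, zero_mul, add_zero]
      exact mul_self_pos.2 hk0)
    (by simp [hP0'])
  obtain ⟨ε₀, hε₀, hball⟩ := Metric.eventually_nhds_iff_ball.1 he
  filter_upwards [key, Ioo_mem_nhdsGT hε₀] with ε hε hεI
  filter_upwards [hε, he'.filter_mono nhdsWithin_le_nhds] with t ⟨t1, t2, t3⟩ ht
  have hγ : ∀ τ, |τ| < ε → x (c.curve g τ) =
      x s + c.A ![τ ^ 3 * P τ, τ ^ 2 * Q τ, τ ^ 4 * S τ] := fun τ hτ =>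
    hball τ (by rw [Metric.mem_ball, Real.dist_eq, sub_zero]; exact hτ.trans hεI.2)
  have hηγ : ∀ τ, |τ| < ε → (η (x (c.curve g τ)) = η (x (c.curve gD t)) ↔
      τ ^ 2 * (m * (τ * P τ * η₁ + Q τ * η₂ + τ ^ 2 * S τ * η₃)) =
        t ^ 2 * (m * (t * P' t * η₁ + Q' t * η₂ + t ^ 2 * S' t * η₃))) := by
    intro τ hτ
    rw [hγ τ hτ, ht, map_add, map_add, hηx, hηx]
    constructor
    · intro h0
      linear_combination m * h0
    · intro h0
      refine mul_left_cancel₀ hm0 ?_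
      linear_combination h0
  have hξγ : ∀ τ, |τ| < ε → k * (ξ (x (c.curve g τ)) - ξ (x (c.curve gD t))) =
      τ ^ 3 * (k * (P τ * ξ₁ + τ * S τ * ξ₃)) - t ^ 3 * (k * (P' t * ξ₁ + t * S' t * ξ₃)) := by
    intro τ hτ
    rw [hγ τ hτ, ht, map_add, map_add, hξx, hξx]
    ring
  have hn : ∀ τ ∈ Ioo (-ε) 0, |τ| < ε := fun τ hτ => abs_lt.2 ⟨hτ.1, hτ.2.trans hεI.1⟩
  have hp : ∀ τ ∈ Ioo 0 ε, |τ| < ε := fun τ hτ => abs_lt.2 ⟨by linarith [hτ.1, hεI.1], hτ.2⟩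
  simp only [Function.comp_apply]
  refine ⟨?_, ?_, fun τ₁ hτ₁ τ₂ hτ₂ e1 e2 => ?_⟩
  · obtain ⟨τ, hτ, hτ'⟩ := t1
    exact ⟨τ, hτ, (hηγ τ (hn τ hτ)).2 hτ'⟩
  · obtain ⟨τ, hτ, hτ'⟩ := t2
    exact ⟨τ, hτ, (hηγ τ (hp τ hτ)).2 hτ'⟩
  · have k1 := t3 τ₁ (hn τ₁ hτ₁) hτ₁.2.ne ((hηγ τ₁ (hn τ₁ hτ₁)).1 e1)
    have k2 := t3 τ₂ (hp τ₂ hτ₂) hτ₂.1.ne' ((hηγ τ₂ (hp τ₂ hτ₂)).1 e2)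
    rw [← hξγ τ₁ (hn τ₁ hτ₁)] at k1
    rw [← hξγ τ₂ (hp τ₂ hτ₂)] at k2
    have k3 := neg_of_mul_pos_right k1 hτ₁.2.le
    have k4 := pos_of_mul_pos_right k2 hτ₂.1.le
    have k5 := mul_neg_of_neg_of_pos k3 k4
    have k6 : 0 < k ^ 2 := by positivity
    have k7 : k ^ 2 * ((ξ (x (c.curve g τ₁)) - ξ (x (c.curve gD t))) *
        (ξ (x (c.curve g τ₂)) - ξ (x (c.curve gD t)))) < 0 := by
      calc _ = _ := by ring
        _ < _ := k5
    exact neg_of_mul_neg_right k7 k6.le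

/-! ### Legendrian lifts and the cr-invariant in a chart. -/

theorem CurveJet.hasDerivAt_graph {g : ℝ → ℝ} {κ : ℝ} (h : CurveJet g κ) {F : Par → ℝ}
    (hF : ContDiff ℝ ∞ F) :
    HasDerivAt (fun t => F (t, g t)) (pa F 0) 0 ∧
      HasDerivAt (deriv fun t => F (t, g t)) (pa (pa F) 0 + 2 * κ * pb F 0) 0 := by
  have hg : ∀ t, HasDerivAt g (deriv g t) t := fun t =>
    (h.contDiff.differentiable (by simp) t).hasDerivAt
  have hd : ∀ {F : Par → ℝ}, ContDiff ℝ ∞ F → ∀ t, HasDerivAt (fun t => F (t, g t))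
      (pa F (t, g t) * 1 + pb F (t, g t) * deriv g t) t := fun hF t =>
    hasDerivAt_comp_curve (differentiableAt_of_smooth hF _) rfl (hasDerivAt_id t) (hg t)
  have h0 : ((0 : ℝ), g 0) = (0 : Par) := by rw [h.zero]; rfl
  have hg0 : deriv g 0 = 0 := h.hasDerivAt.1.deriv
  constructor
  · have := hd hF 0
    simpa [h0, hg0] using this
  · rw [funext fun t => (hd hF t).deriv]
    have := ((hd (contDiff_pa hF) 0).mul_const 1).add
      ((hd (contDiff_pb hF) 0).mul h.hasDerivAt.2)
    refine this.congr_deriv ?_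
    simp only [h0, hg0]
    ring

namespace LegendreChart

variable {x n : Par → Space} {s : Par} {f : Par → ℝ} {ρ : ℝ} {g : ℝ → ℝ} {κ : ℝ}

/-- The cr-invariant is defined with arbitrary parametrizations of the curves; its uniqueness rests
on the fact that all of them trace the same graph. -/
theorem eventually_graph_of_germ (c : LegendreChart x n s f) (hκ : CurveJet g κ) {d : ℝ → Par}
    {S : Set Par → Set Par} (h1 : ParametrizesGerm d s S)
    (h2 : ParametrizesGerm (c.curve g) s S) :
    ∀ᶠ t in 𝓝 (0 : ℝ), (c.τ (d t)).2 = g (c.τ (d t)).1 := by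
  obtain ⟨a1, a2, -, V, hV, a4⟩ := h1
  obtain ⟨-, -, -, V', hV', b4⟩ := h2
  have hW := inter_mem hV hV'
  obtain ⟨ε, e1, e2⟩ := ((a4 _ hW inter_subset_left).and self_mem_nhdsWithin).exists
  obtain ⟨ε', e1', e2'⟩ := ((b4 _ hW inter_subset_right).and
    (c.eventually_mem_image hκ.contDiff.continuous hκ.zero)).exists
  have hd : Tendsto d (𝓝 0) (𝓝 s) := by simpa only [ContinuousAt, a2] using a1.continuousAt
  filter_upwards [hd.eventually e1, hd.eventually e1', (c.tendsto_τ.comp hd).eventually e2',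
    hd.eventually c.right_inv, Ioo_mem_nhds (neg_lt_zero.2 e2) e2] with t t1 t2 t3 t4 t5
  rw [Function.comp_apply] at t3
  rw [← t3, t4, ← t2, t1]
  exact ⟨t, t5, rfl⟩

/-- Tangency to the first axis gives `Y_a = 0`, so second derivatives of `X` drop out of the
derivative of the slope. The resulting slope of the lift is an affine function of `κ`, with
coefficients that depend on the coordinates but not on the curve. -/
theorem legendrianTangent_eq (c : LegendreChart x n s f) (hκ : CurveJet g κ)
    {e : Par ≃L[ℝ] ℝ × ℝ} {X Y : Par → ℝ} (hX : ContDiff ℝ ∞ X) (hY : ContDiff ℝ ∞ Y)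
    (hXY : ∀ᶠ q in 𝓝 0, e (c.σ q) = (X q, Y q)) {d : ℝ → Par} (hd : SmoothNear d 0)
    (hd0 : d 0 = s) (hd1 : deriv d 0 ≠ 0)
    (hg : ∀ᶠ t in 𝓝 (0 : ℝ), (c.τ (d t)).2 = g (c.τ (d t)).1) (he : (e (deriv d 0)).2 = 0) :
    pa X 0 ≠ 0 ∧ pb Y 0 ≠ 0 ∧ ∃ r ≠ 0, legendrianTangent e d =
      (r * pa X 0, r * ((pa (pa Y) 0 + 2 * κ * pb Y 0) / pa X 0)) := by
  have hτd : SmoothNear (fun t => c.τ (d t)) 0 :=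
    SmoothNear.comp (g := c.τ) (by rw [hd0]; exact c.smooth_τ) hd
  obtain ⟨a, ha, hae⟩ := (SmoothNear.comp (g := fun q : Par => q.1)
    (contDiff_fst.smoothNear _) hτd).exists_contDiff
  have hd' : Tendsto d (𝓝 0) (𝓝 s) := by
    simpa only [ContinuousAt, hd0] using hd.continuousAt
  have hq : ∀ᶠ t in 𝓝 (0 : ℝ), c.τ (d t) = (a t, g (a t)) := by
    filter_upwards [hae, hg] with t h1 h2
    rw [h1]
    exact Prod.ext rfl h2
  have hea : ∀ᶠ t in 𝓝 (0 : ℝ), e (d t) = (X (a t, g (a t)), Y (a t, g (a t))) := by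
    filter_upwards [hq, hd'.eventually c.right_inv, (c.tendsto_τ.comp hd').eventually hXY]
      with t h1 h2 h3
    rw [Function.comp_apply, h2, h1] at h3
    exact h3
  have ha0 : a 0 = 0 := by
    have := hq.self_of_nhds
    rw [hd0, c.τ_s] at this
    exact (congrArg Prod.fst this).symm
  set u : ℝ → ℝ := fun t => X (t, g t) with hu
  set w : ℝ → ℝ := fun t => Y (t, g t) with hw
  have hgr : ContDiff ℝ ∞ fun t => (t, g t) := contDiff_id.prodMk hκ.contDiff
  have hus : ContDiff ℝ ∞ u := hX.comp hgr
  have hws : ContDiff ℝ ∞ w := hY.comp hgr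
  have du : ∀ t, HasDerivAt u (deriv u t) t := fun t =>
    (hus.differentiable (by simp) t).hasDerivAt
  have dw : ∀ t, HasDerivAt w (deriv w t) t := fun t =>
    (hws.differentiable (by simp) t).hasDerivAt
  have da : ∀ t, HasDerivAt a (deriv a t) t := fun t =>
    (ha.differentiable (by simp) t).hasDerivAt
  obtain ⟨u1, -⟩ := hκ.hasDerivAt_graph hX
  obtain ⟨w1, w2⟩ := hκ.hasDerivAt_graph hY
  obtain ⟨-, u2⟩ := hκ.hasDerivAt_graph hX
  have hua : ∀ t, HasDerivAt (fun t => u (a t)) (deriv u (a t) * deriv a t) t := fun t =>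
    (du (a t)).comp t (da t)
  have hwa : ∀ t, HasDerivAt (fun t => w (a t)) (deriv w (a t) * deriv a t) t := fun t =>
    (dw (a t)).comp t (da t)
  -- the velocity of `d`
  have hde : HasDerivAt (fun t => e (d t)) (e (deriv d 0)) 0 :=
    e.hasFDerivAt.comp_hasDerivAt 0 hd.differentiableAt.hasDerivAt
  have hde' := hde.unique (((hua 0).prodMk (hwa 0)).congr_of_eventuallyEq hea)
  rw [ha0, u1.deriv, w1.deriv] at hde'
  have hne : e (deriv d 0) ≠ 0 := fun h => hd1 (e.map_eq_zero_iff.1 h)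
  have ha1 : deriv a 0 ≠ 0 := fun h => hne (by rw [hde', h]; simp)
  have hYa : pa Y 0 = 0 := by
    rw [hde'] at he
    exact (mul_eq_zero.1 he).resolve_right ha1
  have hXa : pa X 0 ≠ 0 := fun h => hne (by rw [hde', h, hYa]; simp)
  have hYb : pb Y 0 ≠ 0 := by
    intro h0
    have h1 : HasFDerivAt (fun q => e (c.σ q)) ((e : Par →L[ℝ] ℝ × ℝ).comp (fderiv ℝ c.σ 0)) 0 :=
      e.hasFDerivAt.comp 0 c.smooth_σ.differentiableAt.hasFDerivAt
    have h2 : HasFDerivAt (fun q => e (c.σ q)) ((fderiv ℝ X 0).prod (fderiv ℝ Y 0)) 0 :=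
      ((hasFDerivAt_of_smooth hX 0).prodMk (hasFDerivAt_of_smooth hY 0)).congr_of_eventuallyEq hXY
    obtain ⟨v, hv⟩ := c.bijective_fderiv_σ.self_of_nhds.2 (e.symm (0, 1))
    have h3 := congrArg (fun T : Par →L[ℝ] ℝ × ℝ => (T v).2) (h1.unique h2)
    simp [hv, fderiv_eq_partials, hYa, h0] at h3
  refine ⟨hXa, hYb, deriv a 0, ha1, ?_⟩
  -- the Legendrian lift
  have hL : legendrianLift e d =ᶠ[𝓝 0] fun t =>
      (u (a t), w (a t), deriv w (a t) / deriv u (a t)) := by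
    have hne : ∀ᶠ t in 𝓝 (0 : ℝ), deriv a t ≠ 0 :=
      ((((contDiff_infty_iff_deriv).1 ha).2.continuous).continuousAt).eventually_ne ha1
    filter_upwards [hea.eventually_nhds, hne] with t h1 h2
    have e1 : (fun τ => (e (d τ)).1) =ᶠ[𝓝 t] fun τ => u (a τ) := by
      filter_upwards [h1] with τ hτ
      rw [hτ]
    have e2 : (fun τ => (e (d τ)).2) =ᶠ[𝓝 t] fun τ => w (a τ) := by
      filter_upwards [h1] with τ hτ
      rw [hτ]
    rw [legendrianLift, e1.deriv_eq, e2.deriv_eq, (hua t).deriv, (hwa t).deriv,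
      mul_div_mul_right _ _ h2, h1.self_of_nhds]
  have hu0 : deriv u 0 = pa X 0 := u1.deriv
  have hw0 : deriv w 0 = 0 := w1.deriv.trans hYa
  have hq1 : HasDerivAt (fun t => deriv w t / deriv u t)
      ((pa (pa Y) 0 + 2 * κ * pb Y 0) / pa X 0) (a 0) := by
    rw [ha0]
    refine (w2.div u2 (by rw [← hu, hu0]; exact hXa)).congr_deriv ?_
    rw [← hu, ← hw, hu0, hw0]
    field_simp
    ring
  have hfin := ((hua 0).prodMk ((hwa 0).prodMk (hq1.comp 0 (da 0)))).congr_of_eventuallyEq hL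
  rw [legendrianTangent, hfin.deriv, ha0, hu0]
  refine Prod.ext (mul_comm _ _) (mul_comm _ _)

/-- An affine change of slope leaves the cross-ratio unchanged, and the parametrization factors
cancel; it remains to compute `(κ_F - κ_D) / (κ_P - κ_D) = 2ρ(ρ - 1) / (2(ρ - 1))`. -/
theorem isCrInvariant_iff (c : LegendreChart x n s f) (hF : IsFront x n s) (h : GodronForm f ρ)
    (hρ : ρ ≠ 1) (hs : IsSwallowtailForm f) {ρ' : ℝ} : IsCrInvariant x n s ρ' ↔ ρ' = ρ := by
  obtain ⟨gP, hP, hP'⟩ := h.exists_parabolic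
  obtain ⟨gF, hF1, hF2, -⟩ := h.exists_flecnodal
  obtain ⟨gD, hD, hDD, ι, hι, hι'⟩ := h.exists_double hs
  have kF := c.germ_flecnodal_dual hF1 hF2
  have kP := c.germ_parabolic h.bb hP hP'
  have kD := c.germ_conodal hF (c.germ_selfIntersection hD hDD hι hι')
  have key : ∀ (e : Par ≃L[ℝ] ℝ × ℝ) (cF cP cD : ℝ → Par),
      ParametrizesGerm cF s (fun _ => flecnodalSet (dualSurface x n)) →
      ParametrizesGerm cP s (fun _ => parabolicSet (dualSurface x n)) →
      ParametrizesGerm cD s (conodalSet (dualSurface x n)) →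
      (e (deriv cF 0)).2 = 0 → (e (deriv cP 0)).2 = 0 → (e (deriv cD 0)).2 = 0 →
      crossRatio (legendrianTangent e cF) (legendrianTangent e cP)
          (legendrianTangent e cD) (0, 1) = ρ := by
    intro e cF cP cD h1 h2 h3 e1 e2 e3
    obtain ⟨Z, hZ, hZe⟩ := (SmoothNear.comp (g := e) (e.contDiff.smoothNear _)
      c.smooth_σ).exists_contDiff
    have hX : ContDiff ℝ ∞ fun q => (Z q).1 := contDiff_fst.comp hZ
    have hY : ContDiff ℝ ∞ fun q => (Z q).2 := contDiff_snd.comp hZ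
    have hXY : ∀ᶠ q in 𝓝 0, e (c.σ q) = ((Z q).1, (Z q).2) := by
      filter_upwards [hZe] with q hq
      rw [hq]
    obtain ⟨hXa, hYb, rF, hrF, hLF⟩ := c.legendrianTangent_eq hF1 hX hY hXY h1.1 h1.2.1 h1.2.2.1
      (c.eventually_graph_of_germ hF1 h1 kF) e1
    obtain ⟨-, -, rP, hrP, hLP⟩ := c.legendrianTangent_eq hP hX hY hXY h2.1 h2.2.1 h2.2.2.1
      (c.eventually_graph_of_germ hP h2 kP) e2
    obtain ⟨-, -, rD, hrD, hLD⟩ := c.legendrianTangent_eq hD hX hY hXY h3.1 h3.2.1 h3.2.2.1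
      (c.eventually_graph_of_germ hD h3 kD) e3
    rw [hLF, hLP, hLD]
    set Xa := pa (fun q => (Z q).1) 0
    set Yb := pb (fun q => (Z q).2) 0
    set Yaa := pa (pa fun q => (Z q).2) 0
    have hρ' : ρ - 1 ≠ 0 := sub_ne_zero.2 hρ
    rw [crossRatio]
    simp only [det2, mul_one, mul_zero, sub_zero]
    have n1 : rF * Xa * (rD * ((Yaa + 2 * ρ * Yb) / Xa)) -
        rF * ((Yaa + 2 * (2 * ρ ^ 2 - ρ) * Yb) / Xa) * (rD * Xa) =
        rF * rD * (ρ * (-4 * (ρ - 1) * Yb)) := by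
      field_simp
      ring
    have n2 : rP * Xa * (rD * ((Yaa + 2 * ρ * Yb) / Xa)) -
        rP * ((Yaa + 2 * (3 * ρ - 2) * Yb) / Xa) * (rD * Xa) =
        rP * rD * (-4 * (ρ - 1) * Yb) := by
      field_simp
      ring
    rw [n1, n2]
    field_simp
  constructor
  · rintro ⟨e, cF, cP, cD, h1, h2, h3, e1, e2, e3, rfl⟩
    exact key e cF cP cD h1 h2 h3 e1 e2 e3
  · rintro rfl
    -- The inverse of the differential of the chart makes all three tangents horizontal, since the
    -- curves are tangent to the first axis in the chart.
    obtain ⟨T, hT⟩ := exists_continuousLinearEquiv c.bijective_fderiv_σ.self_of_nhds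
    have hTe : ∀ {g : ℝ → ℝ} {κ : ℝ}, CurveJet g κ → (T.symm (deriv (c.curve g) 0)).2 = 0 := by
      intro g κ hκ
      rw [c.deriv_curve hκ.contDiff hκ.zero, hκ.hasDerivAt.1.deriv, ← hT]
      simp
    exact ⟨T.symm, _, _, _, kF, kP, kD, hTe hF1, hTe hP, hTe hD,
      (key T.symm _ _ _ kF kP kD (hTe hF1) (hTe hP) (hTe hD)).symm⟩

end LegendreChart

/-! ### Inequalities between the coefficients, and the configurations. -/

theorem four_sq_sub_seven_neg {ρ : ℝ} (h : -√7 / 2 < ρ) (h1 : ρ < √7 / 2) :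
    4 * ρ ^ 2 - 7 < 0 := by
  have h7 : √7 ^ 2 = 7 := Real.sq_sqrt (by norm_num)
  nlinarith

theorem four_sq_sub_seven_pos {ρ : ℝ} (h : ρ < -√7 / 2 ∨ √7 / 2 < ρ) : 0 < 4 * ρ ^ 2 - 7 := by
  have h7 : √7 ^ 2 = 7 := Real.sq_sqrt (by norm_num)
  have h7p : 0 < √7 := Real.sqrt_pos.2 (by norm_num)
  rcases h with h | h <;> nlinarith

theorem two_lt_sqrt_seven : 2 < √7 := Real.lt_sqrt_of_sq_lt (by norm_num)

namespace LegendreChart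

variable {x n : Par → Space} {s : Par} {f : Par → ℝ} {ρ : ℝ}

set_option maxHeartbeats 800000 in
/-- The configuration of the distinguished curves with respect to the tangent plane. -/
theorem tangent_configuration (c : LegendreChart x n s f) (h : GodronForm f ρ) (hρ : ρ ≠ 1)
    {gE gF gD : ℝ → ℝ} (jE : CurveJet gE (3 * ρ - 2)) (jF : CurveJet gF (2 * ρ ^ 2 - ρ))
    (jD : CurveJet gD ρ) (hD : DoublePointsOn f gD) (h1 : ρ < 4 / 3) (h2 : ρ ≠ 0) :
    ∃ Cm Cp : ℝ → Par,
      TangentSectionIsTwoCusps x n s Cm Cp ∧ SameDirection (x ∘ Cm) (x ∘ c.curve gE) ∧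
      (1 < ρ → SameDirection (x ∘ Cp) (x ∘ c.curve gE) ∧
        (∀ᶠ t in 𝓝[≠] (0 : ℝ), EllipticAt (homog x) (Cm t)) ∧
        (∀ᶠ t in 𝓝[≠] (0 : ℝ), HyperbolicAt (homog x) (Cp t))) ∧
      (ρ < 1 → OppositeDirection (x ∘ Cp) (x ∘ c.curve gE) ∧
        (∀ᶠ t in 𝓝[≠] (0 : ℝ), HyperbolicAt (homog x) (Cm t)) ∧
        (∀ᶠ t in 𝓝[≠] (0 : ℝ), HyperbolicAt (homog x) (Cp t))) ∧
      (√7 / 2 < ρ ∧ ρ < 4 / 3 →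
        SeparatesLocally x s Cp (c.curve gE) (c.curve gF) ∧
        SeparatesLocally x s Cm (c.curve gE) (c.curve gD) ∧
        SameSide x n s (c.curve gF) (c.curve gD) ∧
        OppositeSides x n s (c.curve gE) (c.curve gF) ∧
        OppositeSides x n s (c.curve gE) (c.curve gD)) ∧
      (1 < ρ ∧ ρ < √7 / 2 →
        SeparatesLocally x s (c.curve gF) (c.curve gE) Cp ∧
        SeparatesLocally x s Cm (c.curve gE) (c.curve gD) ∧
        SameSide x n s (c.curve gE) (c.curve gF) ∧
        OppositeSides x n s (c.curve gE) (c.curve gD) ∧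
        OppositeSides x n s (c.curve gF) (c.curve gD)) ∧
      (0 < ρ ∧ ρ < 1 → SeparatesLocally x s Cm (c.curve gF) (c.curve gD) ∧
        SameSide x n s (c.curve gE) (c.curve gF) ∧
        OppositeSides x n s (c.curve gE) (c.curve gD) ∧
        OppositeSides x n s (c.curve gF) (c.curve gD)) ∧
      (-1 / 2 < ρ ∧ ρ < 0 → SeparatesLocally x s Cm (c.curve gF) (c.curve gD) ∧
        SameSide x n s (c.curve gE) (c.curve gD) ∧
        OppositeSides x n s (c.curve gF) (c.curve gE) ∧
        OppositeSides x n s (c.curve gF) (c.curve gD)) ∧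
      (-√7 / 2 < ρ ∧ ρ < -1 / 2 →
        SameSide x n s (c.curve gE) (c.curve gD) ∧
        OppositeSides x n s (c.curve gF) (c.curve gE) ∧
        OppositeSides x n s (c.curve gF) (c.curve gD)) ∧
      (ρ < -√7 / 2 →
        SameSide x n s (c.curve gF) (c.curve gE) ∧ SameSide x n s (c.curve gF) (c.curve gD) ∧
        SameSide x n s (c.curve gE) (c.curve gD)) := by
  have hρ1 : ρ - 1 ≠ 0 := sub_ne_zero.2 hρ
  have hρ2 : 0 < (ρ - 1) ^ 2 := by positivity
  have hFE : 2 * ρ ^ 2 - ρ - (3 * ρ - 2) = 2 * (ρ - 1) ^ 2 := by ring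
  have hFD : 2 * ρ ^ 2 - ρ - ρ = 2 * (ρ * (ρ - 1)) := by ring
  -- Factorized values of `κ² - 4κ + 3ρ` for the three curves. They decide the sides of the tangent
  -- plane, and the last factor of `qF` produces the threshold `√7 / 2`.
  have qE : (3 * ρ - 2) ^ 2 - 4 * (3 * ρ - 2) + 3 * ρ = 3 * ((3 * ρ - 4) * (ρ - 1)) := by ring
  have qD : ρ ^ 2 - 4 * ρ + 3 * ρ = ρ * (ρ - 1) := by ring
  have qF : (2 * ρ ^ 2 - ρ) ^ 2 - 4 * (2 * ρ ^ 2 - ρ) + 3 * ρ =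
      ρ * (ρ - 1) * (4 * ρ ^ 2 - 7) := by ring
  have h7 := two_lt_sqrt_seven
  have ell : 1 < ρ → 0 < ρ * (ρ - 1) ∧ 3 * ((3 * ρ - 4) * (ρ - 1)) < 0 := fun h0 =>
    ⟨mul_pos (by linarith) (by linarith), mul_neg_of_pos_of_neg three_pos
      (mul_neg_of_neg_of_pos (by linarith) (by linarith))⟩
  have hyp : ρ < 1 → 0 < 3 * ((3 * ρ - 4) * (ρ - 1)) := fun h0 =>
    mul_pos three_pos (mul_pos_of_neg_of_neg (by linarith) (by linarith))
  obtain ⟨gm, gp, jm, jp, hsec⟩ := h.exists_tangent_section h1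
  set r := √(4 - 3 * ρ) with hr
  have hr2 : r ^ 2 = 4 - 3 * ρ := Real.sq_sqrt (by linarith)
  have hr0 : 0 < r := Real.sqrt_pos.2 (by linarith)
  have hr1 : r - 1 ≠ 0 := fun h0 => hρ (by
    have : r = 1 := by linarith
    rw [this] at hr2
    linarith)
  have r_lt : 1 < ρ → r < 1 := fun h0 => lt_of_pow_lt_pow_left₀ 2 (by norm_num) (by linarith)
  have lt_r : ρ < 1 → 1 < r := fun h0 => lt_of_pow_lt_pow_left₀ 2 hr0.le (by linarith)
  have above : ∀ y : ℝ, 0 ≤ y → r ^ 2 < y ^ 2 → r < y := fun y hy h0 =>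
    lt_of_pow_lt_pow_left₀ 2 hy h0
  have below : ∀ y : ℝ, y ^ 2 < r ^ 2 → y < r := fun y h0 => lt_of_pow_lt_pow_left₀ 2 hr0.le h0
  -- The lower section curve and the self-intersection line have the same coefficient only for `ρ =
  -- 0` or `ρ = 1`.
  have mD : 2 - r ≠ ρ := by
    intro h0
    have h3 : ρ * (ρ - 1) = 0 := by
      have : r = 2 - ρ := by linarith
      rw [this] at hr2
      linarith
    simp [h2, hρ1] at h3
  have pD : 2 + r ≠ ρ := by intro h0; linarith
  have pE : 0 < 2 + r - 1 := by linarith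
  have sepm : 1 < ρ → SeparatesLocally x s (c.curve gm) (c.curve gE) (c.curve gD) := fun h0 => by
    have k1 := r_lt h0
    have k2 : r < 2 - ρ := above _ (by linarith) (by nlinarith)
    have k3 : r ^ 2 < r := by nlinarith
    exact (c.separatesLocally hD jD jm jD jE (by linarith) (by linarith) (Or.inr mD)).symm
  refine ⟨c.curve gm, c.curve gp, c.tangentSectionIsTwoCusps h hD jD jm jp (by linarith)
    (fun h0 => hr1 (by linarith)) (by linarith) mD pD hsec, ?_, fun h0 => ⟨?_, ?_, ?_⟩,
    fun h0 => ⟨?_, ?_, ?_⟩, fun h0 => ⟨?_, ?_, ?_, ?_, ?_⟩, fun h0 => ⟨?_, ?_, ?_, ?_, ?_⟩,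
    fun h0 => ⟨?_, ?_, ?_, ?_⟩, fun h0 => ⟨?_, ?_, ?_, ?_⟩, fun h0 => ⟨?_, ?_, ?_⟩,
    fun h0 => ⟨?_, ?_, ?_⟩⟩
  · refine c.sameDirection h jm jE ?_
    -- Since `3(ρ - 1) = 1 - r²`, the product of the two direction coefficients is `(1 - r)(1 -
    -- r²)`.
    have : 0 < (r - 1) ^ 2 * (r + 1) := by positivity
    calc _ < _ := this
      _ = _ := by linear_combination (r - 1) * hr2
  · exact c.sameDirection h jp jE (mul_pos pE (by linarith))
  -- On this curve the leading coefficient of the Hessian determinant is `2r(1 - r)`.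
  · have := mul_pos hr0 (sub_pos.2 (r_lt h0))
    exact c.elliptic_curve h jm (by linarith)
  · exact c.hyperbolic_curve h jp (by linarith [sq_nonneg r])
  · exact c.oppositeDirection h jp jE (mul_neg_of_pos_of_neg pE (by linarith))
  · have := mul_pos hr0 (sub_pos.2 (lt_r h0))
    exact c.hyperbolic_curve h jm (by linarith)
  · exact c.hyperbolic_curve h jp (by linarith [sq_nonneg r])
  -- the elliptic configurations
  · have k1 : 1 < ρ := by linarith [h0.1]
    have k2 : 0 < ρ * (ρ - 1) * (4 * ρ ^ 2 - 7) :=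
      mul_pos (mul_pos (by linarith) (by linarith)) (four_sq_sub_seven_pos (Or.inr h0.1))
    have k3 : r < 2 * ρ ^ 2 - ρ - 2 := above _ (by nlinarith) (by linarith)
    exact c.separatesLocally hD jD jp jE jF (by linarith [sq_nonneg r]) (by linarith) (Or.inr pD)
  · exact sepm (by linarith [h0.1])
  · have k1 : 1 < ρ := by linarith [h0.1]
    have k2 : 0 < ρ * (ρ - 1) := mul_pos (by linarith) (by linarith)
    have k3 := four_sq_sub_seven_pos (ρ := ρ) (by tauto)
    refine c.sameSide h jF jD ?_
    rw [qF, qD]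
    exact mul_pos (mul_pos k2 k3) k2
  · have k1 : 1 < ρ := by linarith [h0.1]
    have k2 : 0 < ρ * (ρ - 1) := mul_pos (by linarith) (by linarith)
    have k3 := four_sq_sub_seven_pos (ρ := ρ) (by tauto)
    refine c.oppositeSides h jE jF ?_
    rw [qE, qF]
    exact mul_neg_of_neg_of_pos (ell (by linarith)).2 (mul_pos k2 k3)
  · have k1 : 1 < ρ := by linarith [h0.1]
    refine c.oppositeSides h jE jD ?_
    rw [qE, qD]
    exact mul_neg_of_neg_of_pos (ell (by linarith)).2 (mul_pos (by linarith) (by linarith))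
  · have k1 : ρ * (ρ - 1) * (4 * ρ ^ 2 - 7) < 0 :=
      mul_neg_of_pos_of_neg (mul_pos (by linarith) (by linarith))
        (four_sq_sub_seven_neg (by linarith) h0.2)
    have k2 : 2 * ρ ^ 2 - ρ - 2 < r := below _ (by linarith)
    have k3 := mul_pos (by linarith : 0 < ρ) (by linarith : 0 < ρ - 1)
    exact c.separatesLocally hD jD jF jE jp (by linarith) (by linarith)
      (Or.inr (by intro h3; linarith))
  · exact sepm h0.1
  · have k2 : 0 < ρ * (ρ - 1) := mul_pos (by linarith) (by linarith)
    have k3 := four_sq_sub_seven_neg (ρ := ρ) (by linarith) (by linarith)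
    refine c.sameSide h jE jF ?_
    rw [qE, qF]
    exact mul_pos_of_neg_of_neg (ell (by linarith)).2 (mul_neg_of_pos_of_neg k2 k3)
  · refine c.oppositeSides h jE jD ?_
    rw [qE, qD]
    exact mul_neg_of_neg_of_pos (ell (by linarith)).2 (mul_pos (by linarith) (by linarith))
  · have k2 : 0 < ρ * (ρ - 1) := mul_pos (by linarith) (by linarith)
    have k3 := four_sq_sub_seven_neg (ρ := ρ) (by linarith) (by linarith)
    refine c.oppositeSides h jF jD ?_
    rw [qF, qD]
    exact mul_neg_of_neg_of_pos (mul_neg_of_pos_of_neg k2 k3) k2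
  -- the hyperbolic configurations
  · have k2 : ρ * (ρ - 1) < 0 := mul_neg_of_pos_of_neg (by linarith) (by linarith)
    have k3 := four_sq_sub_seven_neg (ρ := ρ) (by linarith) (by linarith)
    have k4 := mul_pos_of_neg_of_neg k2 k3
    have k5 : r < 2 - (2 * ρ ^ 2 - ρ) := above _ (by nlinarith) (by linarith)
    have k6 : 2 - ρ < r := below _ (by linarith)
    exact c.separatesLocally hD jD jm jF jD (by linarith) (by linarith) (Or.inr mD)
  · have k2 : ρ * (ρ - 1) < 0 := mul_neg_of_pos_of_neg (by linarith) (by linarith)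
    have k3 := four_sq_sub_seven_neg (ρ := ρ) (by linarith) (by linarith)
    refine c.sameSide h jE jF ?_
    rw [qE, qF]
    exact mul_pos (hyp (by linarith)) (mul_pos_of_neg_of_neg k2 k3)
  · have k2 : ρ * (ρ - 1) < 0 := mul_neg_of_pos_of_neg (by linarith) (by linarith)
    refine c.oppositeSides h jE jD ?_
    rw [qE, qD]
    exact mul_neg_of_pos_of_neg (hyp (by linarith)) k2
  · have k2 : ρ * (ρ - 1) < 0 := mul_neg_of_pos_of_neg (by linarith) (by linarith)
    have k3 := four_sq_sub_seven_neg (ρ := ρ) (by linarith) (by linarith)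
    refine c.oppositeSides h jF jD ?_
    rw [qF, qD]
    exact mul_neg_of_pos_of_neg (mul_pos_of_neg_of_neg k2 k3) k2
  · have k2 : 0 < ρ * (ρ - 1) := mul_pos_of_neg_of_neg (by linarith) (by linarith)
    have k3 := four_sq_sub_seven_neg (ρ := ρ) (by linarith) (by linarith)
    have k4 := mul_neg_of_pos_of_neg k2 k3
    have k5 : 2 - (2 * ρ ^ 2 - ρ) < r := below _ (by linarith)
    have k6 : r < 2 - ρ := above _ (by linarith) (by linarith)
    exact (c.separatesLocally hD jD jm jD jF (by linarith) (by linarith) (Or.inr mD)).symm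
  · have k2 : 0 < ρ * (ρ - 1) := mul_pos_of_neg_of_neg (by linarith) (by linarith)
    refine c.sameSide h jE jD ?_
    rw [qE, qD]
    exact mul_pos (hyp (by linarith)) k2
  · have k2 : 0 < ρ * (ρ - 1) := mul_pos_of_neg_of_neg (by linarith) (by linarith)
    have k3 := four_sq_sub_seven_neg (ρ := ρ) (by linarith) (by linarith)
    refine c.oppositeSides h jF jE ?_
    rw [qE, qF]
    exact mul_neg_of_neg_of_pos (mul_neg_of_pos_of_neg k2 k3) (hyp (by linarith))
  · have k2 : 0 < ρ * (ρ - 1) := mul_pos_of_neg_of_neg (by linarith) (by linarith)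
    have k3 := four_sq_sub_seven_neg (ρ := ρ) (by linarith) (by linarith)
    refine c.oppositeSides h jF jD ?_
    rw [qF, qD]
    exact mul_neg_of_neg_of_pos (mul_neg_of_pos_of_neg k2 k3) k2
  · have k2 : 0 < ρ * (ρ - 1) := mul_pos_of_neg_of_neg (by linarith) (by linarith)
    refine c.sameSide h jE jD ?_
    rw [qE, qD]
    exact mul_pos (hyp (by linarith)) k2
  · have k2 : 0 < ρ * (ρ - 1) := mul_pos_of_neg_of_neg (by linarith) (by linarith)
    have k3 := four_sq_sub_seven_neg (ρ := ρ) (by linarith) (by linarith)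
    refine c.oppositeSides h jF jE ?_
    rw [qE, qF]
    exact mul_neg_of_neg_of_pos (mul_neg_of_pos_of_neg k2 k3) (hyp (by linarith))
  · have k2 : 0 < ρ * (ρ - 1) := mul_pos_of_neg_of_neg (by linarith) (by linarith)
    have k3 := four_sq_sub_seven_neg (ρ := ρ) (by linarith) (by linarith)
    refine c.oppositeSides h jF jD ?_
    rw [qF, qD]
    exact mul_neg_of_neg_of_pos (mul_neg_of_pos_of_neg k2 k3) k2
  · have k2 : 0 < ρ * (ρ - 1) := mul_pos_of_neg_of_neg (by linarith) (by linarith)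
    have k3 := four_sq_sub_seven_pos (ρ := ρ) (by tauto)
    refine c.sameSide h jF jE ?_
    rw [qE, qF]
    exact mul_pos (mul_pos k2 k3) (hyp (by linarith))
  · have k2 : 0 < ρ * (ρ - 1) := mul_pos_of_neg_of_neg (by linarith) (by linarith)
    have k3 := four_sq_sub_seven_pos (ρ := ρ) (by tauto)
    refine c.sameSide h jF jD ?_
    rw [qF, qD]
    exact mul_pos (mul_pos k2 k3) k2
  · have k2 : 0 < ρ * (ρ - 1) := mul_pos_of_neg_of_neg (by linarith) (by linarith)
    refine c.sameSide h jE jD ?_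
    rw [qE, qD]
    exact mul_pos (hyp (by linarith)) k2

/-- The configuration of the distinguished curves of a front given in a chart. -/
theorem configuration (c : LegendreChart x n s f) (hF : IsFront x n s) (h : GodronForm f ρ)
    (hρ : ρ ≠ 1) (hs : IsSwallowtailForm f) :
    (IsEllipticSwallowtail x s ↔ 1 < ρ) ∧ (IsHyperbolicSwallowtail x s ↔ ρ < 1) ∧
      ∃ F E D : ℝ → Par,
        ParametrizesGerm F s (fun _ => flecnodalSet (homog x)) ∧
        ParametrizesGerm E s (fun _ => cuspidalEdge x) ∧
        ParametrizesGerm D s (selfIntersection x) ∧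
        SeparatesLeftRight x n F ∧
        (ρ ≠ 0 → ρ ≠ -1 / 2 → IsSemicubicCusp (x ∘ F) ∧ IsSemicubicCusp (x ∘ E) ∧
          (SameDirection (x ∘ F) (x ∘ E) ∨ OppositeDirection (x ∘ F) (x ∘ E))) ∧
        (1 < ρ → SeparatesLocally x s E F D ∧ SameDirection (x ∘ F) (x ∘ E)) ∧
        (0 < ρ ∧ ρ < 1 → SeparatesLocally x s F E D) ∧
        (-1 / 2 < ρ ∧ ρ < 0 → LiesBetweenBranches (x ∘ D) (x ∘ F) ∧
          SeparatesLocally x s D F E ∧ SameDirection (x ∘ F) (x ∘ E)) ∧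
        (ρ < -1 / 2 → OppositeDirection (x ∘ F) (x ∘ E)) ∧
        (4 / 3 < ρ → (∀ᶠ p in 𝓝[≠] s, 0 < height x n s p) ∨
          (∀ᶠ p in 𝓝[≠] s, height x n s p < 0)) ∧
        (ρ < 4 / 3 → ρ ≠ 0 → ∃ Cm Cp : ℝ → Par,
          TangentSectionIsTwoCusps x n s Cm Cp ∧ SameDirection (x ∘ Cm) (x ∘ E) ∧
          (1 < ρ → SameDirection (x ∘ Cp) (x ∘ E) ∧
            (∀ᶠ t in 𝓝[≠] (0 : ℝ), EllipticAt (homog x) (Cm t)) ∧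
            (∀ᶠ t in 𝓝[≠] (0 : ℝ), HyperbolicAt (homog x) (Cp t))) ∧
          (ρ < 1 → OppositeDirection (x ∘ Cp) (x ∘ E) ∧
            (∀ᶠ t in 𝓝[≠] (0 : ℝ), HyperbolicAt (homog x) (Cm t)) ∧
            (∀ᶠ t in 𝓝[≠] (0 : ℝ), HyperbolicAt (homog x) (Cp t))) ∧
          (√7 / 2 < ρ ∧ ρ < 4 / 3 →
            SeparatesLocally x s Cp E F ∧ SeparatesLocally x s Cm E D ∧
            SameSide x n s F D ∧ OppositeSides x n s E F ∧ OppositeSides x n s E D) ∧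
          (1 < ρ ∧ ρ < √7 / 2 →
            SeparatesLocally x s F E Cp ∧ SeparatesLocally x s Cm E D ∧
            SameSide x n s E F ∧ OppositeSides x n s E D ∧ OppositeSides x n s F D) ∧
          (0 < ρ ∧ ρ < 1 → SeparatesLocally x s Cm F D ∧
            SameSide x n s E F ∧ OppositeSides x n s E D ∧ OppositeSides x n s F D) ∧
          (-1 / 2 < ρ ∧ ρ < 0 → SeparatesLocally x s Cm F D ∧
            SameSide x n s E D ∧ OppositeSides x n s F E ∧ OppositeSides x n s F D) ∧
          (-√7 / 2 < ρ ∧ ρ < -1 / 2 →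
            SameSide x n s E D ∧ OppositeSides x n s F E ∧ OppositeSides x n s F D) ∧
          (ρ < -√7 / 2 →
            SameSide x n s F E ∧ SameSide x n s F D ∧ SameSide x n s E D)) := by
  obtain ⟨gE, jE, eE⟩ := h.exists_parabolic
  obtain ⟨gF, jF, eF, R, hR, hR0, hgR⟩ := h.exists_flecnodal
  obtain ⟨gD, jD, hD, ι, hι, hι'⟩ := h.exists_double hs
  have kD := c.germ_selfIntersection jD hD hι hι'
  have hρ1 : ρ - 1 ≠ 0 := sub_ne_zero.2 hρ
  have hρ2 : 0 < (ρ - 1) ^ 2 := by positivity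
  -- The leading coefficient along the flecnodal curve is `-4(ρ - 1)²`.
  have hne : ∀ᶠ t in 𝓝[≠] (0 : ℝ), hessDet f (t, gF t) ≠ 0 :=
    (h.hessDet_neg jF (by nlinarith)).mono fun t ht => ht.ne
  have hell : 1 < ρ → IsEllipticSwallowtail x s := fun h1 =>
    c.elliptic_of_double jD hD (c.elliptic_curve h jD (by linarith))
  have hhyp : ρ < 1 → IsHyperbolicSwallowtail x s := fun h1 =>
    c.hyperbolic_of_double jD hD (c.hyperbolic_curve h jD (by linarith))
  -- These differences give the order of the curves and the directions of the cusps. The flecnodal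
  -- curve is always above the cuspidal edge; it crosses the self-intersection line at `ρ = 0` and
  -- its cusp turns round at `ρ = -1/2`.
  have hFE : 2 * ρ ^ 2 - ρ - (3 * ρ - 2) = 2 * (ρ - 1) ^ 2 := by ring
  have hFD : 2 * ρ ^ 2 - ρ - ρ = 2 * (ρ * (ρ - 1)) := by ring
  have hF1 : 2 * ρ ^ 2 - ρ - 1 = (2 * ρ + 1) * (ρ - 1) := by ring
  have hE1 : 3 * ρ - 2 - 1 = 3 * (ρ - 1) := by ring
  have hdirS : -1 / 2 < ρ → SameDirection (x ∘ c.curve gF) (x ∘ c.curve gE) := fun h0 =>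
    c.sameDirection h jF jE (by
      rw [hF1, hE1]
      have : 0 < 3 * (2 * ρ + 1) := by linarith
      have := mul_pos this hρ2
      linarith)
  have hdirO : ρ < -1 / 2 → OppositeDirection (x ∘ c.curve gF) (x ∘ c.curve gE) := fun h0 =>
    c.oppositeDirection h jF jE (by
      rw [hF1, hE1]
      have : 3 * (2 * ρ + 1) < 0 := by linarith
      have := mul_neg_of_neg_of_pos this hρ2
      linarith)
  refine ⟨⟨fun he => ?_, hell⟩, ⟨fun hh => ?_, hhyp⟩, c.curve gF, c.curve gE, c.curve gD,
    c.germ_flecnodal_front h.bb jF eF hne, c.germ_cuspidalEdge h.bb jE eE, kD,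
    c.separatesLeftRight hF h hρ jF eF hR hR0 hgR hne, fun h0 h1 => ⟨?_, ?_, ?_⟩,
    fun h1 => ⟨?_, ?_⟩, fun h1 => ?_, fun h1 => ⟨?_, ?_, ?_⟩, hdirO, c.one_side h, c.tangent_configuration h hρ jE jF jD hD⟩
  · by_contra h1
    exact not_elliptic_and_hyperbolic kD he (hhyp (lt_of_le_of_ne (not_lt.1 h1) hρ))
  · by_contra h1
    exact not_elliptic_and_hyperbolic kD (hell (lt_of_le_of_ne (not_lt.1 h1) hρ.symm)) hh
  · refine c.isSemicubicCusp h jF (fun h2 => ?_) fun h2 => ?_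
    · have h3 := hF1.symm.trans (sub_eq_zero.2 h2)
      rcases mul_eq_zero.1 h3 with h4 | h4
      · exact h1 (by linarith)
      · exact hρ1 h4
    · have h3 := hFD.symm.trans (sub_eq_zero.2 h2)
      simp [h0, hρ1] at h3
  · exact c.isSemicubicCusp h jE (fun h2 => hρ (by linarith)) fun h2 => hρ (by linarith)
  · rcases lt_or_gt_of_ne h1 with h2 | h2
    · exact Or.inr (hdirO h2)
    · exact Or.inl (hdirS h2)
  · exact (c.separatesLocally hD jD jE jD jF (by linarith) (by linarith)
      (Or.inr (by intro h2; linarith))).symm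
  · exact hdirS (by linarith)
  · have := mul_neg_of_pos_of_neg h1.1 (sub_neg.2 h1.2)
    exact c.separatesLocally hD jD jF jE jD (by linarith) (by linarith)
      (Or.inr (by intro h2; linarith))
  · have := mul_pos_of_neg_of_neg h1.2 (by linarith : ρ - 1 < 0)
    refine c.liesBetweenBranches h jF jD ?_ (by intro h2; linarith)
    rw [hF1, mul_assoc, ← sq]
    exact mul_pos (by linarith) hρ2
  · have := mul_pos_of_neg_of_neg h1.2 (by linarith : ρ - 1 < 0)
    exact (c.separatesLocally hD jD jD jE jF (by linarith) (by linarith) (Or.inl rfl)).symm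
  · exact hdirS h1.1

end LegendreChart

/-! ### Construction of charts -/

/-- The map `T` is the transpose of `A`, and its inverse is the contragredient map. -/
theorem exists_contragredient (A : Space ≃L[ℝ] Space) :
    ∃ B : Space ≃L[ℝ] Space, ∀ y z, B y ⬝ᵥ A z = y ⬝ᵥ z := by
  let T : Space →ₗ[ℝ] Space :=
    { toFun := fun y i => y ⬝ᵥ A (Pi.single i 1)
      map_add' := fun y z => by ext i; simp [add_dotProduct]
      map_smul' := fun r y => by ext i; simp [smul_dotProduct] }
  have hT : ∀ y z, T y ⬝ᵥ z = y ⬝ᵥ A z := by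
    intro y z
    have hz : z = ∑ i, z i • (Pi.single i 1 : Space) := by
      ext j
      simp [Finset.sum_apply, Pi.single_apply]
    conv_rhs => rw [hz, map_sum, dotProduct_sum]
    simp only [map_smul, dotProduct_smul, smul_eq_mul]
    exact Finset.sum_congr rfl fun i _ => mul_comm _ _
  have hi : Function.Injective T := by
    rw [injective_iff_map_eq_zero]
    intro y hy
    have := hT y (A.symm y)
    rw [hy, zero_dotProduct, A.apply_symm_apply] at this
    exact dotProduct_self_eq_zero.1 this.symm
  let T' := (LinearEquiv.ofInjectiveEndo T hi).toContinuousLinearEquiv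
  refine ⟨T'.symm, fun y z => ?_⟩
  rw [← hT]
  congr 1
  exact T'.apply_symm_apply y

theorem smoothNear_pi {A : Type*} [NormedAddCommGroup A] [NormedSpace ℝ A] {F : A → Space} {a : A}
    (h : SmoothNear F a) (i : Fin 3) : SmoothNear (fun y => F y i) a := by
  filter_upwards [h] with y hy
  exact contDiffAt_pi.1 hy i

/-- The conormal, normalized to `(a, b, 1)`, defines a map `G` to the plane. If its differential
kills `v`, then `dn v` is a multiple of `n` and, as `n · dx = 0`, the differential of the dual
surface at `v` is a multiple of the point; regularity gives `v = 0`, so `G` is a local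
diffeomorphism. The support function is `f = (a, b, 1) · X`; by conormality `df = X₀ da + X₁ db`, so
`X` is its Legendre front. -/
theorem exists_chart {x n : Par → Space} {s : Par} (hF : IsFront x n s)
    (hr : RegularAt (dualSurface x n) s) (A : Space ≃L[ℝ] Space)
    (h0 : n s ⬝ᵥ A ![1, 0, 0] = 0) (h1 : n s ⬝ᵥ A ![0, 1, 0] = 0) :
    ∃ (f : Par → ℝ) (c : LegendreChart x n s f), c.A = A := by
  obtain ⟨B, hB⟩ := exists_contragredient A
  obtain ⟨hx, hn, hxn⟩ := hF
  set ν : Par → Space := fun p => B.symm (n p) with hν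
  have hBν : ∀ p, n p = B (ν p) := fun p => (B.apply_symm_apply _).symm
  have hνs : SmoothNear ν s := SmoothNear.comp (g := B.symm) (B.symm.contDiff.smoothNear _) hn
  have hνA : ∀ p z, ν p ⬝ᵥ z = n p ⬝ᵥ A z := fun p z => by rw [hBν, hB]
  have e0 : ν s 0 = 0 := by
    rw [← h0, ← hνA]
    simp [dotProduct, Fin.sum_univ_three]
  have e1 : ν s 1 = 0 := by
    rw [← h1, ← hνA]
    simp [dotProduct, Fin.sum_univ_three]
  have e2 : ν s 2 ≠ 0 := by
    intro e2
    have : ν s = 0 := by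
      ext i
      fin_cases i
      · exact e0
      · exact e1
      · exact e2
    exact hxn.self_of_nhds.1 (by rw [hBν, this, map_zero])
  have hν2 : ∀ᶠ p in 𝓝 s, ν p 2 ≠ 0 := (smoothNear_pi hνs 2).continuousAt.eventually_ne e2
  set G : Par → Par := fun p => (ν p 0 / ν p 2, ν p 1 / ν p 2) with hG
  have hGs : SmoothNear G s := by
    filter_upwards [smoothNear_pi hνs 0, smoothNear_pi hνs 1, smoothNear_pi hνs 2, hν2]
      with p p0 p1 p2 p3
    exact (p0.div p2 p3).prodMk (p1.div p2 p3)
  have hG0 : G s = 0 := by simp [hG, e0, e1]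
  have hνG : ∀ᶠ p in 𝓝 s, ν p = ν p 2 • ![(G p).1, (G p).2, 1] := by
    filter_upwards [hν2] with p hp
    ext i
    fin_cases i <;> simp [hG] <;> field_simp
  -- the map `G` is a local diffeomorphism
  have hGi : Function.Injective (fderiv ℝ G s : Par →ₗ[ℝ] Par) := by
    rw [injective_iff_map_eq_zero]
    intro v hv
    have hv' : fderiv ℝ G s v = 0 := hv
    have d1 : HasFDerivAt G (fderiv ℝ G s) s := hGs.differentiableAt.hasFDerivAt
    have d2 : HasFDerivAt (fun p => ν p 2) (fderiv ℝ (fun p => ν p 2) s) s :=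
      (smoothNear_pi hνs 2).differentiableAt.hasFDerivAt
    have d3 : HasFDerivAt n (fderiv ℝ n s) s := hn.differentiableAt.hasFDerivAt
    have hl : HasDerivAt (fun t : ℝ => s + t • v) v 0 := by
      simpa using ((hasDerivAt_id (0 : ℝ)).smul_const v).const_add s
    have hs0 : s + (0 : ℝ) • v = s := by simp
    have l1 : HasDerivAt (fun t : ℝ => G (s + t • v)) 0 0 := by
      rw [← hv']
      exact HasFDerivAt.comp_hasDerivAt (l := G) 0 (by rw [hs0]; exact d1) hl
    have l2 := HasFDerivAt.comp_hasDerivAt (l := fun p => ν p 2) 0 (by rw [hs0]; exact d2) hl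
    have l3 : HasDerivAt (fun t : ℝ => n (s + t • v)) (fderiv ℝ n s v) 0 :=
      HasFDerivAt.comp_hasDerivAt (l := n) 0 (by rw [hs0]; exact d3) hl
    have l4 : HasDerivAt (fun t : ℝ => (![(G (s + t • v)).1, (G (s + t • v)).2, 1] : Space))
        0 0 := by
      rw [hasDerivAt_pi]
      intro i
      fin_cases i
      · exact (hasFDerivAt_fst (𝕜 := ℝ) (E := ℝ) (F := ℝ)).comp_hasDerivAt 0 l1
      · exact (hasFDerivAt_snd (𝕜 := ℝ) (E := ℝ) (F := ℝ)).comp_hasDerivAt 0 l1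
      · exact hasDerivAt_const _ _
    have hlc : Tendsto (fun t : ℝ => s + t • v) (𝓝 0) (𝓝 s) := by
      have := hl.continuousAt.tendsto
      rwa [hs0] at this
    have l5 := l3.unique ((B.hasFDerivAt.comp_hasDerivAt 0 (l2.smul l4)).congr_of_eventuallyEq (by
      filter_upwards [hlc.eventually hνG] with t ht
      rw [hBν, ht]
      rfl))
    set k := fderiv ℝ (fun p => ν p 2) s v
    have l6 : fderiv ℝ n s v = (k / ν s 2) • n s := by
      rw [l5, hBν s, hνG.self_of_nhds, ← map_smul]
      refine congrArg B ?_
      ext i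
      fin_cases i <;> simp [hG0, e2]
    refine hr.2 v (Submodule.mem_span_singleton.2 ⟨k / ν s 2, ?_⟩)
    rw [fderiv_dualSurface hx.differentiableAt hn.differentiableAt, l6, hxn.self_of_nhds.2.1 v]
    refine Prod.ext rfl ?_
    simp [dualSurface, smul_dotProduct]
  let G' : Par ≃L[ℝ] Par := (LinearEquiv.ofInjectiveEndo _ hGi).toContinuousLinearEquiv
  have hGG : (G' : Par →L[ℝ] Par) = fderiv ℝ G s := by ext <;> rfl
  obtain ⟨σ, hσ, hσ0, hσl, hσr⟩ := hGs.exists_local_inverse (f' := G')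
    (by rw [hGG]; exact hGs.differentiableAt.hasFDerivAt)
  rw [hG0] at hσ hσ0 hσr
  have hσt : Tendsto σ (𝓝 0) (𝓝 s) := by
    simpa only [ContinuousAt, hσ0] using hσ.continuousAt
  -- the support function
  set X : Par → Space := fun p => A.symm (x p - x s) with hX
  have hXs : SmoothNear X s := SmoothNear.comp (g := fun y => A.symm (y - x s))
    (ContDiff.smoothNear (A.symm.contDiff.comp (contDiff_id.sub contDiff_const)) _) hx
  have hF0 : SmoothNear
      (fun q : Par => q.1 * X (σ q) 0 + q.2 * X (σ q) 1 + X (σ q) 2) 0 := by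
    have hXσ : SmoothNear (fun q => X (σ q)) 0 := SmoothNear.comp (by rw [hσ0]; exact hXs) hσ
    filter_upwards [smoothNear_pi hXσ 0, smoothNear_pi hXσ 1, smoothNear_pi hXσ 2] with q q0 q1 q2
    exact ((contDiffAt_fst.mul q0).add (contDiffAt_snd.mul q1)).add q2
  obtain ⟨f, hf, hfe⟩ := hF0.exists_contDiff
  have hfd : ∀ᶠ q in 𝓝 (0 : Par), ∀ w : Par,
      fderiv ℝ f q w = w.1 * X (σ q) 0 + w.2 * X (σ q) 1 := by
    filter_upwards [hfe.eventually_nhds, hσ.eventually, hσt.eventually hx.eventually,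
      hσt.eventually hxn, hσr, hσt.eventually hνG, hσt.eventually hν2]
      with q q1 q2 q3 q4 q5 q6 q7 w
    have hl : HasDerivAt (fun t : ℝ => q + t • w) w 0 := by
      simpa using ((hasDerivAt_id (0 : ℝ)).smul_const w).const_add q
    have hq0 : q + (0 : ℝ) • w = q := by simp
    have l1 : HasDerivAt (fun t : ℝ => f (q + t • w)) (fderiv ℝ f q w) 0 :=
      HasFDerivAt.comp_hasDerivAt (l := f) 0 (by rw [hq0]; exact hasFDerivAt_of_smooth hf q) hl
    have l2 : HasDerivAt (fun t : ℝ => σ (q + t • w)) (fderiv ℝ σ q w) 0 :=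
      HasFDerivAt.comp_hasDerivAt (l := σ) 0 (by rw [hq0]; exact q2.differentiableAt.hasFDerivAt) hl
    have l3 : HasDerivAt (fun t : ℝ => x (σ (q + t • w))) (fderiv ℝ x (σ q) (fderiv ℝ σ q w)) 0 :=
      HasFDerivAt.comp_hasDerivAt (l := x) 0 (by rw [hq0]; exact q3.differentiableAt.hasFDerivAt) l2
    set z := A.symm (fderiv ℝ x (σ q) (fderiv ℝ σ q w)) with hz
    have l4 : HasDerivAt (fun t : ℝ => X (σ (q + t • w))) z 0 :=
      A.symm.hasFDerivAt.comp_hasDerivAt 0 (l3.sub_const (x s))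
    have l5 := hasDerivAt_pi.1 l4
    have f1 : HasDerivAt (fun t : ℝ => (q + t • w).1) w.1 0 :=
      (hasFDerivAt_fst (𝕜 := ℝ) (E := ℝ) (F := ℝ)).comp_hasDerivAt 0 hl
    have f2 : HasDerivAt (fun t : ℝ => (q + t • w).2) w.2 0 :=
      (hasFDerivAt_snd (𝕜 := ℝ) (E := ℝ) (F := ℝ)).comp_hasDerivAt 0 hl
    have hlc : Tendsto (fun t : ℝ => q + t • w) (𝓝 0) (𝓝 q) := by
      have := hl.continuousAt.tendsto
      rwa [hq0] at this
    have l6 := l1.unique ((((f1.mul (l5 0)).add (f2.mul (l5 1))).add (l5 2)).congr_of_eventuallyEq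
      (hlc.eventually q1))
    simp only [hq0] at l6
    have l7 : q.1 * z 0 + q.2 * z 1 + z 2 = 0 := by
      have k1 : ν (σ q) ⬝ᵥ z = 0 := by
        rw [hνA, hz, A.apply_symm_apply]
        exact q4.2.1 _
      rw [q6, q5, smul_dotProduct, smul_eq_mul] at k1
      have k2 := (mul_eq_zero.1 k1).resolve_left q7
      simpa [dotProduct, Fin.sum_univ_three] using k2
    rw [l6]
    linear_combination l7
  have hfr : ∀ᶠ q in 𝓝 (0 : Par), legendreFront f q = X (σ q) := by
    filter_upwards [hfd, hfe] with q h1 h2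
    have a1 : pa f q = X (σ q) 0 := by rw [pa, h1]; simp
    have a2 : pb f q = X (σ q) 1 := by rw [pb, h1]; simp
    ext i
    fin_cases i
    · exact a1
    · exact a2
    · simp only [legendreFront, legendreHeight, a1, a2, h2]
      simp
      ring
  refine ⟨f, ⟨σ, G, A, B, fun q => ν (σ q) 2, hf, hσ, hσ0, hGs, hσr, hσl, hB, ?_, ?_, ?_, ?_⟩, rfl⟩
  · exact SmoothNear.comp (g := fun p => ν p 2) (by rw [hσ0]; exact smoothNear_pi hνs 2) hσ
  · simpa only [hσ0] using e2
  · filter_upwards [hfr] with q hq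
    rw [hq, hX]
    simp
  · filter_upwards [hσt.eventually hνG, hσr] with q h1 h2
    rw [hBν, ← map_smul]
    congr 1
    rw [h1, h2]
    simp

/-! ### The support function at a swallowtail -/

/-- On the parabola `v = m u²` the standard swallowtail is `u² z(u)`. Hadamard's lemma in the scalar
factor makes the linear part of `Ψ` dominant, and gives the orders 3 and 2 and the leading
coefficients of the first two coordinates. -/
theorem swallowtail_along {Ψ : Space → Space} (hΨ : ContDiff ℝ ∞ Ψ) (h0 : Ψ 0 = 0)
    (hd : ∀ v, fderiv ℝ Ψ 0 v = ![v 1, v 2, v 0]) (m : ℝ) :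
    ∃ K₀ K₁ : ℝ → ℝ, Continuous K₀ ∧ Continuous K₁ ∧ K₀ 0 = 4 + 2 * m ∧ K₁ 0 = m ∧
      (∀ u, Ψ (standardSwallowtail (u, m * u ^ 2)) 0 = u ^ 3 * K₀ u) ∧
      ∀ u, Ψ (standardSwallowtail (u, m * u ^ 2)) 1 = u ^ 2 * K₁ u := by
  set z : ℝ → Space := fun u => ![(3 + m) * u ^ 2, (4 + 2 * m) * u, m] with hz
  have hzs : ContDiff ℝ ∞ z := by
    rw [contDiff_pi]
    intro i
    fin_cases i
    · exact contDiff_const.mul (contDiff_id.pow 2)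
    · exact contDiff_const.mul contDiff_id
    · exact contDiff_const
  have hst : ∀ u, standardSwallowtail (u, m * u ^ 2) = u ^ 2 • z u := by
    intro u
    ext i
    fin_cases i <;> simp [standardSwallowtail, hz] <;> ring
  have key : ∀ i, ∃ G : ℝ × ℝ → ℝ, ContDiff ℝ ∞ G ∧
      (∀ τ u, Ψ (τ • z u) i = τ * G (τ, u)) ∧ ∀ u, G (0, u) = fderiv ℝ Ψ 0 (z u) i := by
    intro i
    have hH : ContDiff ℝ ∞ fun q : ℝ × ℝ => Ψ (q.1 • z q.2) i :=
      (contDiff_apply ℝ ℝ i).comp (hΨ.comp (contDiff_fst.smul (hzs.comp contDiff_snd)))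
    obtain ⟨G, g1, g2⟩ := exists_eq_mul_of_zero hH fun w => by simp [h0]
    refine ⟨G, g1, g2, fun u => ?_⟩
    have e1 : HasDerivAt (fun τ : ℝ => τ • z u) (z u) 0 := by
      simpa using (hasDerivAt_id (0 : ℝ)).smul_const (z u)
    have e2 : HasDerivAt (fun τ : ℝ => Ψ (τ • z u)) (fderiv ℝ Ψ 0 (z u)) 0 :=
      HasFDerivAt.comp_hasDerivAt (l := Ψ) 0
        (by rw [zero_smul]; exact (hΨ.differentiable (by simp) 0).hasFDerivAt) e1
    have e3 : HasDerivAt (fun τ : ℝ => G (τ, u)) (pa G (0, u)) 0 := by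
      have := hasDerivAt_comp_curve (F := G) (q := (0, u)) (a := fun τ => τ) (b := fun _ => u)
        (t := 0) (differentiableAt_of_smooth g1 _) rfl (hasDerivAt_id _) (hasDerivAt_const _ _)
      simpa using this
    have e4 := (hasDerivAt_pi.1 e2 i).unique (((hasDerivAt_id (0 : ℝ)).mul e3).congr_of_eventuallyEq
      (Eventually.of_forall fun τ => g2 τ u))
    simpa using e4.symm
  obtain ⟨G₀, a1, a2, a3⟩ := key 0
  obtain ⟨G₁, b1, b2, b3⟩ := key 1
  obtain ⟨M, c1, c2⟩ := exists_eq_mul_of_zero (F := fun q => G₀ q - (4 + 2 * m) * q.2)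
    (by fun_prop) fun w => by simp [a3, hd, hz]
  refine ⟨fun u => 4 + 2 * m + u * M (u ^ 2, u), fun u => G₁ (u ^ 2, u), ?_, ?_, by simp, ?_, ?_, ?_⟩
  · have := c1.continuous
    fun_prop
  · have := b1.continuous
    fun_prop
  · simp [b3, hd, hz]
  · intro u
    rw [hst, a2]
    have := c2 (u ^ 2) u
    simp only at this
    linear_combination u ^ 2 * this
  · intro u
    rw [hst, b2]

theorem exists_quadratic_curve {θ : Par → Par} (hθ : ContDiff ℝ ∞ θ) (hθ0 : θ 0 = 0) {p : ℝ}
    (hp : fderiv ℝ θ 0 (1, 0) = (p, 0)) (hp0 : p ≠ 0) (m : ℝ) :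
    ∃ α w : ℝ → ℝ, ContinuousAt α 0 ∧ ContinuousAt w 0 ∧ α 0 = p ∧
      ∀ᶠ u in 𝓝 (0 : ℝ), θ (u, m * u ^ 2) = (u * α u, (u * α u) ^ 2 * w u) := by
  have hc : ContDiff ℝ ∞ fun u : ℝ => θ (u, m * u ^ 2) := hθ.comp (by fun_prop)
  have hz : ((0 : ℝ), m * (0 : ℝ) ^ 2) = (0 : Par) := by simp
  have hc1 : HasDerivAt (fun u : ℝ => θ (u, m * u ^ 2)) (p, 0) 0 := by
    rw [← hp]
    refine HasFDerivAt.comp_hasDerivAt (l := θ) 0 ?_ ?_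
    · rw [hz]
      exact (hθ.differentiable (by simp) 0).hasFDerivAt
    · exact (hasDerivAt_id _).prodMk (((hasDerivAt_pow 2 (0 : ℝ)).const_mul m).congr_deriv (by simp))
  have hb1 : HasDerivAt (fun u : ℝ => (θ (u, m * u ^ 2)).2) 0 0 :=
    (hasFDerivAt_snd (𝕜 := ℝ) (E := ℝ) (F := ℝ)).comp_hasDerivAt 0 hc1
  have ha1 : HasDerivAt (fun u : ℝ => (θ (u, m * u ^ 2)).1) p 0 :=
    (hasFDerivAt_fst (𝕜 := ℝ) (E := ℝ) (F := ℝ)).comp_hasDerivAt 0 hc1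
  obtain ⟨α, α1, α2, -⟩ := exists_eq_pow_mul_one (contDiff_fst.comp hc) 1 fun i hi => by
    obtain rfl : i = 0 := by omega
    simp only [Function.iterate_zero, id_eq, Function.comp_apply, hz, hθ0]
    rfl
  obtain ⟨β, β1, β2, -⟩ := exists_eq_pow_mul_one (contDiff_snd.comp hc) 2 fun i hi => by
    interval_cases i
    · simp only [Function.iterate_zero, id_eq, Function.comp_apply, hz, hθ0]
      rfl
    · exact hb1.deriv
  have hα0 : α 0 = p := by
    have e1 := (hasDerivAt_id (0 : ℝ)).mul (α1.differentiable (by simp) 0).hasDerivAt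
    have e2 := ha1.unique (e1.congr_of_eventuallyEq (Eventually.of_forall fun u => by
      have := α2 u
      simp only [Function.comp_apply, pow_one] at this
      simpa using this))
    simpa using e2.symm
  have hαc := α1.continuous.continuousAt (x := 0)
  refine ⟨α, fun u => β u / α u ^ 2, hαc, ?_, hα0, ?_⟩
  · exact β1.continuous.continuousAt.div (hαc.pow 2) (by rw [hα0]; exact pow_ne_zero 2 hp0)
  · filter_upwards [hαc.eventually_ne (by rw [hα0]; exact hp0)] with u hu
    refine Prod.ext ?_ ?_
    · simpa using α2 u
    · refine (β2 u).trans ?_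
      simp only
      field_simp

/-- The linear parts give the derivatives of `f` up to order two. For the higher ones, the two sides
are compared on the parabolas `v = m u²`, which `θ` carries to curves `b = w₀ a² + ...`. On each of
them the leading coefficients of `f_a` and `f_b` are prescribed. -/
theorem jets_of_swallowtail {f : Par → ℝ} (hf : ContDiff ℝ ∞ f) {θ : Par → Par}
    {Ψ : Space → Space} (hθ : ContDiff ℝ ∞ θ) (hθ0 : θ 0 = 0)
    (hθb : Function.Bijective (fderiv ℝ θ 0)) (hΨ : ContDiff ℝ ∞ Ψ) (hΨ0 : Ψ 0 = 0)
    (hΨd : ∀ v, fderiv ℝ Ψ 0 v = ![v 1, v 2, v 0])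
    (h : ∀ᶠ q in 𝓝 (0 : Par), legendreFront f (θ q) = Ψ (standardSwallowtail q)) :
    f 0 = 0 ∧ pa f 0 = 0 ∧ pb f 0 = 0 ∧ pa (pa f) 0 = 0 ∧ pa (pb f) 0 = 0 ∧ pb (pb f) 0 ≠ 0 ∧
      pa (pa (pa f)) 0 = 0 ∧ pa (pa (pb f)) 0 ≠ 0 ∧
      pa (pa (pa (pa f))) 0 * pb (pb f) 0 ≠ 3 * pa (pa (pb f)) 0 ^ 2 := by
  have ca := contDiff_pa hf
  have cb := contDiff_pb hf
  have hv0 : legendreFront f 0 = 0 := by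
    have := h.self_of_nhds
    rwa [hθ0, standardSwallowtail_zero, hΨ0] at this
  have ja : pa f 0 = 0 := congrFun hv0 0
  have jb : pb f 0 = 0 := congrFun hv0 1
  have j0 : f 0 = 0 := by
    have := congrFun hv0 2
    simpa [legendreFront, legendreHeight, ja, jb] using this
  have hlin : ∀ v : Par, fderiv ℝ (legendreFront f) 0 (fderiv ℝ θ 0 v) = ![0, v.2, 0] := by
    intro v
    have e1 : HasFDerivAt (fun q => legendreFront f (θ q))
        ((fderiv ℝ (legendreFront f) 0).comp (fderiv ℝ θ 0)) 0 := by
      refine HasFDerivAt.comp (g := legendreFront f) 0 ?_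
        (hθ.differentiable (by simp) 0).hasFDerivAt
      rw [hθ0]
      exact ((contDiff_legendreFront hf).differentiable (by simp) 0).hasFDerivAt
    have e2 : HasFDerivAt (fun q => Ψ (standardSwallowtail q))
        ((fderiv ℝ Ψ 0).comp (fderiv ℝ standardSwallowtail 0)) 0 := by
      refine HasFDerivAt.comp (g := Ψ) 0 ?_
        (contDiff_standardSwallowtail.differentiable (by simp) 0).hasFDerivAt
      rw [standardSwallowtail_zero]
      exact (hΨ.differentiable (by simp) 0).hasFDerivAt
    have e3 := congrArg (fun T : Par →L[ℝ] Space => T v)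
      (e1.unique (e2.congr_of_eventuallyEq h))
    refine e3.trans ?_
    simp [fderiv_standardSwallowtail_zero, hΨd]
  have hlin' : ∀ v : Par,
      pa (pa f) 0 * (fderiv ℝ θ 0 v).1 + pa (pb f) 0 * (fderiv ℝ θ 0 v).2 = 0 ∧
      pa (pb f) 0 * (fderiv ℝ θ 0 v).1 + pb (pb f) 0 * (fderiv ℝ θ 0 v).2 = v.2 := by
    intro v
    have e := hlin v
    rw [fderiv_legendreFront hf] at e
    exact ⟨congrFun e 0, congrFun e 1⟩
  obtain ⟨v₁, hv₁⟩ := hθb.2 (1, 0)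
  obtain ⟨v₂, hv₂⟩ := hθb.2 (0, 1)
  have jaa : pa (pa f) 0 = 0 := by simpa [hv₁] using (hlin' v₁).1
  have jab : pa (pb f) 0 = 0 := by simpa [hv₂] using (hlin' v₂).1
  have jbb : pb (pb f) 0 ≠ 0 := by
    intro h0
    have := (hlin' (0, 1)).2
    simp [jab, h0] at this
  set p := (fderiv ℝ θ 0 (1, 0)).1 with hp
  have hpp : fderiv ℝ θ 0 (1, 0) = (p, 0) := by
    refine Prod.ext rfl ?_
    have := (hlin' (1, 0)).2
    simpa [jab, jbb] using this
  have hp0 : p ≠ 0 := by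
    intro h0
    rw [h0] at hpp
    have := hθb.1 (hpp.trans (map_zero _).symm)
    exact one_ne_zero (congrArg Prod.fst this)
  have curve : ∀ m : ℝ, ∃ α w K₀ K₁ : ℝ → ℝ, ContinuousAt α 0 ∧ ContinuousAt w 0 ∧
      Continuous K₀ ∧ Continuous K₁ ∧ α 0 = p ∧ K₀ 0 = 4 + 2 * m ∧ K₁ 0 = m ∧
      ∀ᶠ u in 𝓝 (0 : ℝ), pa f (u * α u, (u * α u) ^ 2 * w u) = u ^ 3 * K₀ u ∧
        pb f (u * α u, (u * α u) ^ 2 * w u) = u ^ 2 * K₁ u := by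
    intro m
    obtain ⟨α, w, h1, h2, h3, h4⟩ := exists_quadratic_curve hθ hθ0 hpp hp0 m
    obtain ⟨K₀, K₁, k1, k2, k3, k4, k5, k6⟩ := swallowtail_along hΨ hΨ0 hΨd m
    refine ⟨α, w, K₀, K₁, h1, h2, k1, k2, h3, k3, k4, ?_⟩
    have ht : Tendsto (fun u : ℝ => (u, m * u ^ 2)) (𝓝 0) (𝓝 (0 : Par)) :=
      Continuous.tendsto' (by fun_prop) _ _ (by simp)
    filter_upwards [h4, ht.eventually h] with u u1 u2
    rw [u1] at u2
    exact ⟨(congrFun u2 0).trans (k5 u), (congrFun u2 1).trans (k6 u)⟩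
  have hcomp : ∀ {Φ : Par → ℝ} {α w : ℝ → ℝ}, ContDiff ℝ ∞ Φ → ContinuousAt α 0 →
      ContinuousAt w 0 → ContinuousAt (fun u => Φ (u * α u, w u)) 0 := by
    intro Φ α w hΦ hα hw
    exact hΦ.continuous.continuousAt.comp ((continuousAt_id.mul hα).prodMk hw)
  have jaaa : pa (pa (pa f)) 0 = 0 := by
    obtain ⟨α, w, K₀, K₁, h1, h2, k1, k2, h3, k3, k4, hev⟩ := curve 0
    obtain ⟨Φ, p1, p2, p3⟩ := exists_blow_two ca ja jaa
    have h5 : ContinuousAt (fun u => α u ^ 2 * Φ (u * α u, w u) - u * K₀ u) 0 :=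
      ((h1.pow 2).mul (hcomp p1 h1 h2)).sub (continuousAt_id.mul k1.continuousAt)
    have h6 := eq_zero_of_eventually_mul_eq_zero h5 2 (by
      filter_upwards [hev] with u hu
      have := hu.1
      rw [p2] at this
      linear_combination this)
    simp only [zero_mul, p3, sub_zero, h3, pb_pa hf, jab, mul_zero, add_zero] at h6
    have := (mul_eq_zero.1 h6).resolve_left (pow_ne_zero 2 hp0)
    linarith
  have rel : ∀ m : ℝ, ∃ w₀ : ℝ,
      p ^ 3 * (pa (pa (pa (pa f))) 0 / 6 + w₀ * pa (pa (pb f)) 0) = 4 + 2 * m ∧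
      p ^ 2 * (pa (pa (pb f)) 0 / 2 + w₀ * pb (pb f) 0) = m := by
    intro m
    obtain ⟨α, w, K₀, K₁, h1, h2, k1, k2, h3, k3, k4, hev⟩ := curve m
    obtain ⟨Φ, p1, p2, p3⟩ := exists_blow_three ca ja jaa (by rw [pb_pa hf, jab]) jaaa
    obtain ⟨Φ', q1, q2, q3⟩ := exists_blow_two cb jb jab
    refine ⟨w 0, ?_, ?_⟩
    · have h5 : ContinuousAt (fun u => α u ^ 3 * Φ (u * α u, w u) - K₀ u) 0 :=
        ((h1.pow 3).mul (hcomp p1 h1 h2)).sub k1.continuousAt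
      have h6 := eq_zero_of_eventually_mul_eq_zero h5 3 (by
        filter_upwards [hev] with u hu
        have := hu.1
        rw [p2] at this
        linear_combination this)
      simp only [zero_mul, p3, h3, k3, pb_pa hf] at h6
      linarith
    · have h5 : ContinuousAt (fun u => α u ^ 2 * Φ' (u * α u, w u) - K₁ u) 0 :=
        ((h1.pow 2).mul (hcomp q1 h1 h2)).sub k2.continuousAt
      have h6 := eq_zero_of_eventually_mul_eq_zero h5 2 (by
        filter_upwards [hev] with u hu
        have := hu.2
        rw [q2] at this
        linear_combination this)
      simp only [zero_mul, q3, h3, k4] at h6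
      linarith
  -- The cases `m = 0` and `m = -2` give `f_a` the coefficients 4 and 0. If `f_aab` vanished, the
  -- coefficient would not depend on `m`; if the last inequality failed, it would be zero at `m =
  -- 0`. That inequality becomes `ρ ≠ 1`.
  obtain ⟨w₀, r1, r2⟩ := rel 0
  obtain ⟨w₁, r3, r4⟩ := rel (-2)
  have r5 : pa (pa (pb f)) 0 / 2 + w₀ * pb (pb f) 0 = 0 :=
    (mul_eq_zero.1 r2).resolve_left (pow_ne_zero 2 hp0)
  refine ⟨j0, ja, jb, jaa, jab, jbb, jaaa, fun h0 => ?_, fun h0 => ?_⟩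
  · rw [h0] at r1 r3
    linarith
  · have e : pb (pb f) 0 * (pa (pa (pa (pa f))) 0 / 6 + w₀ * pa (pa (pb f)) 0) = 0 := by
      linear_combination h0 / 6 + pa (pa (pb f)) 0 * r5
    rw [(mul_eq_zero.1 e).resolve_left jbb] at r1
    linarith

/-! ### Rescaling and existence of the normal form -/

theorem hasFDerivAt_scaleSnd (β : ℝ) (q : Par) :
    HasFDerivAt (fun q : Par => (q.1, β * q.2))
      ((ContinuousLinearMap.fst ℝ ℝ ℝ).prod (β • ContinuousLinearMap.snd ℝ ℝ ℝ)) q :=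
  ((ContinuousLinearMap.fst ℝ ℝ ℝ).prod (β • ContinuousLinearMap.snd ℝ ℝ ℝ)).hasFDerivAt

theorem pa_rescale {F : Par → ℝ} (hF : ContDiff ℝ ∞ F) (r β : ℝ) :
    pa (fun q => r * F (q.1, β * q.2)) = fun q => r * pa F (q.1, β * q.2) := by
  funext q
  have h2 := ((hasFDerivAt_of_smooth hF (q.1, β * q.2)).comp q
    (hasFDerivAt_scaleSnd β q)).const_mul r
  refine (pa_eq_of_hasFDerivAt h2).trans ?_
  simp [fderiv_eq_partials]

theorem pb_rescale {F : Par → ℝ} (hF : ContDiff ℝ ∞ F) (r β : ℝ) :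
    pb (fun q => r * F (q.1, β * q.2)) = fun q => r * β * pb F (q.1, β * q.2) := by
  funext q
  have h2 := ((hasFDerivAt_of_smooth hF (q.1, β * q.2)).comp q
    (hasFDerivAt_scaleSnd β q)).const_mul r
  refine (pb_eq_of_hasFDerivAt h2).trans ?_
  simp [fderiv_eq_partials]
  ring

/-- The diagonal map with entries `r`, `r * β`, `r`. -/
noncomputable def diagScale (r β : ℝ) (hr : r ≠ 0) (hβ : β ≠ 0) : Space ≃L[ℝ] Space :=
  LinearEquiv.toContinuousLinearEquiv
    { toFun := fun y => ![r * y 0, r * β * y 1, r * y 2]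
      invFun := fun y => ![r⁻¹ * y 0, (r * β)⁻¹ * y 1, r⁻¹ * y 2]
      map_add' := fun y z => by ext i; fin_cases i <;> simp <;> ring
      map_smul' := fun k y => by ext i; fin_cases i <;> simp <;> ring
      left_inv := fun y => by ext i; fin_cases i <;> simp <;> field_simp
      right_inv := fun y => by ext i; fin_cases i <;> simp <;> field_simp }

theorem diagScale_apply (r β : ℝ) (hr : r ≠ 0) (hβ : β ≠ 0) (y : Space) :
    diagScale r β hr hβ y = ![r * y 0, r * β * y 1, r * y 2] := rfl

theorem diagScale_symm_apply (r β : ℝ) (hr : r ≠ 0) (hβ : β ≠ 0) (y : Space) :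
    (diagScale r β hr hβ).symm y = ![r⁻¹ * y 0, (r * β)⁻¹ * y 1, r⁻¹ * y 2] := rfl

theorem legendreFront_rescale {f : Par → ℝ} (hf : ContDiff ℝ ∞ f) {r β : ℝ} (hr : r ≠ 0)
    (hβ : β ≠ 0) (q : Par) : legendreFront (fun q => r * f (q.1, β * q.2)) q =
      diagScale r β hr hβ (legendreFront f (q.1, β * q.2)) := by
  rw [diagScale_apply]
  ext i
  fin_cases i
  · simp [legendreFront, pa_rescale hf]
  · simp [legendreFront, pb_rescale hf]
  · simp [legendreFront, legendreHeight, pa_rescale hf, pb_rescale hf]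
    ring

/-- The chart obtained from a chart by a diagonal scaling. -/
noncomputable def LegendreChart.rescale {x n : Par → Space} {s : Par} {f : Par → ℝ}
    (c : LegendreChart x n s f) {r β : ℝ} (hr : r ≠ 0) (hβ : β ≠ 0) :
    LegendreChart x n s (fun q => r * f (q.1, β * q.2)) :=
  have hz : ((0 : Par).1, β * (0 : Par).2) = (0 : Par) := by simp
  have hℓ : Tendsto (fun q : Par => (q.1, β * q.2)) (𝓝 0) (𝓝 0) :=
    Continuous.tendsto' (by fun_prop) _ _ (by simp)
  { σ := fun q => c.σ (q.1, β * q.2)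
    τ := fun p => ((c.τ p).1, β⁻¹ * (c.τ p).2)
    A := (diagScale r β hr hβ).symm.trans c.A
    B := (diagScale r β hr hβ).trans c.B
    μ := fun q => r⁻¹ * c.μ (q.1, β * q.2)
    contDiff := by
      have := c.contDiff
      fun_prop
    smooth_σ := SmoothNear.comp (g := c.σ) (by simpa only [hz] using c.smooth_σ)
      (ContDiff.smoothNear (by fun_prop) 0)
    σ_zero := by simpa only [hz] using c.σ_zero
    smooth_τ := SmoothNear.comp (g := fun q : Par => (q.1, β⁻¹ * q.2))
      (ContDiff.smoothNear (by fun_prop) _) c.smooth_τ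
    left_inv := by
      filter_upwards [hℓ.eventually c.left_inv] with q hq
      rw [hq]
      simp [hβ]
    right_inv := by
      filter_upwards [c.right_inv] with p hp
      simp [hβ, hp]
    dual := fun y z => by
      rw [ContinuousLinearEquiv.trans_apply, ContinuousLinearEquiv.trans_apply, c.dual,
        diagScale_apply, diagScale_symm_apply]
      simp [dotProduct, Fin.sum_univ_three]
      field_simp
    smooth_μ := SmoothNear.comp (g := fun t : ℝ => r⁻¹ * t) (ContDiff.smoothNear (by fun_prop) _)
      (SmoothNear.comp (g := c.μ) (by simpa only [hz] using c.smooth_μ)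
        (ContDiff.smoothNear (f := fun q : Par => (q.1, β * q.2)) (by fun_prop) 0))
    μ_zero := by
      simp only [hz]
      exact mul_ne_zero (inv_ne_zero hr) c.μ_zero
    x_eq := by
      filter_upwards [hℓ.eventually c.x_eq] with q hq
      rw [hq, legendreFront_rescale c.contDiff hr hβ]
      simp
    n_eq := by
      filter_upwards [hℓ.eventually c.n_eq] with q hq
      have e : (![q.1, β * q.2, 1] : Space) =
          r⁻¹ • diagScale r β hr hβ ![q.1, q.2, 1] := by
        rw [diagScale_apply]
        ext i
        fin_cases i <;> simp <;> field_simp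
      rw [hq, ContinuousLinearEquiv.trans_apply, e, map_smul, smul_smul, mul_comm] }

theorem bijective_fderiv_τ {x n : Par → Space} {s : Par} {f : Par → ℝ}
    (c : LegendreChart x n s f) : Function.Bijective (fderiv ℝ c.τ s) := by
  have h1 : HasFDerivAt c.σ (fderiv ℝ c.σ 0) 0 := c.smooth_σ.differentiableAt.hasFDerivAt
  have h2 : HasFDerivAt c.τ (fderiv ℝ c.τ s) (c.σ 0) := by
    rw [c.σ_zero]
    exact c.smooth_τ.differentiableAt.hasFDerivAt
  have h3 := (h2.comp 0 h1).unique ((hasFDerivAt_id (0 : Par)).congr_of_eventuallyEq c.left_inv)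
  have h4 : fderiv ℝ c.τ s ∘ fderiv ℝ c.σ 0 = id :=
    funext fun v => congrArg (fun T : Par →L[ℝ] Par => T v) h3
  refine (Function.Bijective.of_comp_iff _ c.bijective_fderiv_σ.self_of_nhds).1 ?_
  rw [h4]
  exact Function.bijective_id

/-- The cyclic permutation of the coordinates that makes the first one last. -/
noncomputable def rotateCoords : Space ≃L[ℝ] Space :=
  LinearEquiv.toContinuousLinearEquiv
    { toFun := fun y => ![y 1, y 2, y 0]
      invFun := fun y => ![y 2, y 0, y 1]
      map_add' := fun y z => by ext i; fin_cases i <;> simp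
      map_smul' := fun k y => by ext i; fin_cases i <;> simp
      left_inv := fun y => by ext i; fin_cases i <;> simp
      right_inv := fun y => by ext i; fin_cases i <;> simp }

theorem hasDerivAt_standardSwallowtail (t : ℝ) :
    HasDerivAt (fun τ : ℝ => standardSwallowtail (τ, t)) (![0, 2 * t, 0]) 0 := by
  rw [hasDerivAt_pi]
  intro i
  fin_cases i
  · exact (((hasDerivAt_pow 4 (0 : ℝ)).const_mul 3).add
      ((hasDerivAt_pow 2 (0 : ℝ)).mul_const t)).congr_deriv (by simp)
  · exact (((hasDerivAt_pow 3 (0 : ℝ)).const_mul 4).add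
      (((hasDerivAt_id (0 : ℝ)).const_mul 2).mul_const t)).congr_deriv (by simp)
  · exact hasDerivAt_const _ _

/-- The limit tangent plane of a swallowtail. -/
theorem conormal_eq_zero {x n : Par → Space} {s : Par} (hF : IsFront x n s) {φ : Par → Par}
    {Ψ : Space → Space} (hφ : SmoothNear φ 0) (hφ0 : φ 0 = s) (hΨ : SmoothNear Ψ 0)
    (h : ∀ᶠ q in 𝓝 (0 : Par), x (φ q) = Ψ (standardSwallowtail q)) :
    n s ⬝ᵥ fderiv ℝ Ψ 0 ![0, 1, 0] = 0 ∧ n s ⬝ᵥ fderiv ℝ Ψ 0 ![0, 0, 1] = 0 := by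
  obtain ⟨hx, hn, hxn⟩ := hF
  have hφt : Tendsto φ (𝓝 0) (𝓝 s) := by simpa only [ContinuousAt, hφ0] using hφ.continuousAt
  have hst : Tendsto standardSwallowtail (𝓝 0) (𝓝 0) :=
    contDiff_standardSwallowtail.continuous.tendsto' _ _ standardSwallowtail_zero
  have key : ∀ᶠ q in 𝓝 (0 : Par), ∀ v : Par,
      n (φ q) ⬝ᵥ fderiv ℝ Ψ (standardSwallowtail q) (fderiv ℝ standardSwallowtail q v) = 0 := by
    filter_upwards [h.eventually_nhds, hφ.eventually, hφt.eventually hx.eventually,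
      hst.eventually hΨ.eventually, hφt.eventually hxn] with q q1 q2 q3 q4 q5 v
    have e1 : HasFDerivAt (fun q => x (φ q)) ((fderiv ℝ x (φ q)).comp (fderiv ℝ φ q)) q :=
      q3.differentiableAt.hasFDerivAt.comp q q2.differentiableAt.hasFDerivAt
    have e2 : HasFDerivAt (fun q => Ψ (standardSwallowtail q))
        ((fderiv ℝ Ψ (standardSwallowtail q)).comp (fderiv ℝ standardSwallowtail q)) q :=
      q4.differentiableAt.hasFDerivAt.comp q
        (contDiff_standardSwallowtail.differentiable (by simp) q).hasFDerivAt
    have e3 := congrArg (fun T : Par →L[ℝ] Space => T v)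
      (e1.unique (e2.congr_of_eventuallyEq q1))
    have e4 := q5.2.1 (fderiv ℝ φ q v)
    exact (congrArg (fun y => n (φ q) ⬝ᵥ y) e3).symm.trans e4
  constructor
  -- The `u`-derivative of the standard swallowtail at `(0, t)` is `2t` times the second axis
  -- vector; one divides by `t` and lets it tend to 0.
  · have ht : Tendsto (fun t : ℝ => ((0 : ℝ), t)) (𝓝 0) (𝓝 (0 : Par)) :=
      Continuous.tendsto' (by fun_prop) _ _ rfl
    have hcont : ContinuousAt (fun t : ℝ => n (φ (0, t)) ⬝ᵥ
        fderiv ℝ Ψ (standardSwallowtail (0, t)) ![0, 1, 0]) 0 := by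
      have c1 : ContinuousAt (fun q => n (φ q)) 0 :=
        ContinuousAt.comp (by rw [hφ0]; exact hn.continuousAt) hφ.continuousAt
      have c2 : ContinuousAt (fun q => fderiv ℝ Ψ (standardSwallowtail q) ![0, 1, 0]) 0 := by
        have c3 : ContinuousAt (fun q => fderiv ℝ Ψ (standardSwallowtail q)) 0 :=
          ContinuousAt.comp (f := standardSwallowtail)
            (by rw [standardSwallowtail_zero]; exact hΨ.fderiv_right.continuousAt)
            contDiff_standardSwallowtail.continuous.continuousAt
        exact c3.clm_apply continuousAt_const
      have c4 : ContinuousAt (fun q => n (φ q) ⬝ᵥ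
          fderiv ℝ Ψ (standardSwallowtail q) ![0, 1, 0]) 0 := by
        simp only [dotProduct]
        exact tendsto_finsetSum _ fun i _ =>
          (continuousAt_pi.1 c1 i).mul (continuousAt_pi.1 c2 i)
      exact ContinuousAt.comp (f := fun t : ℝ => ((0 : ℝ), t)) c4 (by fun_prop)
    have h0 := eq_zero_of_eventually_mul_eq_zero hcont 1 (by
      filter_upwards [ht.eventually key] with t htk
      have e1 : fderiv ℝ standardSwallowtail (0, t) (1, 0) = ![0, 2 * t, 0] := by
        refine HasDerivAt.unique ?_ (hasDerivAt_standardSwallowtail t)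
        exact HasFDerivAt.comp_hasDerivAt (l := standardSwallowtail) 0
          (contDiff_standardSwallowtail.differentiable (by simp) _).hasFDerivAt
          ((hasDerivAt_id (0 : ℝ)).prodMk (hasDerivAt_const 0 t))
      have e2 := htk (1, 0)
      have e3 : (![0, 2 * t, 0] : Space) = (2 * t) • ![0, 1, 0] := by
        ext i
        fin_cases i <;> simp
      rw [e1, e3, map_smul, dotProduct_smul, smul_eq_mul] at e2
      linarith)
    have hz : ((0 : ℝ), (0 : ℝ)) = (0 : Par) := rfl
    simpa only [hz, hφ0, standardSwallowtail_zero] using h0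
  · have := key.self_of_nhds (0, 1)
    rwa [fderiv_standardSwallowtail_zero, hφ0, standardSwallowtail_zero] at this

/-- The differential of `Ψ` after a cyclic permutation of coordinates serves as the linear part of
the chart, so that its first two axes span the limit tangent plane and `Ψ` in the chart has the
differential required by `jets_of_swallowtail`. A diagonal scaling then normalizes the remaining
coefficients. -/
theorem IsGenericSwallowtail.exists_godronForm {x n : Par → Space} {s : Par}
    (h : IsGenericSwallowtail x n s) : ∃ (ρ : ℝ) (f : Par → ℝ), ρ ≠ 1 ∧ GodronForm f ρ ∧
      IsSwallowtailForm f ∧ Nonempty (LegendreChart x n s f) := by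
  obtain ⟨hF, ⟨φ, Ψ, hφ, hφ0, hφb, hΨ, hΨb, hφΨ⟩, hr⟩ := h
  obtain ⟨T, hT⟩ := exists_continuousLinearEquiv hΨb
  obtain ⟨n1, n2⟩ := conormal_eq_zero hF hφ hφ0 hΨ hφΨ
  set A : Space ≃L[ℝ] Space := rotateCoords.symm.trans T with hA
  have hA' : ∀ y, A y = fderiv ℝ Ψ 0 ![y 2, y 0, y 1] := fun y => by rw [← hT]; rfl
  obtain ⟨f, c, hcA⟩ := exists_chart hF hr A (by rw [hA']; simpa using n1)
    (by rw [hA']; simpa using n2)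
  have hf := c.contDiff
  have hφt : Tendsto φ (𝓝 0) (𝓝 s) := by simpa only [ContinuousAt, hφ0] using hφ.continuousAt
  have hst : Tendsto standardSwallowtail (𝓝 0) (𝓝 0) :=
    contDiff_standardSwallowtail.continuous.tendsto' _ _ standardSwallowtail_zero
  obtain ⟨θ, hθ, hθe⟩ := (SmoothNear.comp (g := c.τ)
    (by rw [hφ0]; exact c.smooth_τ) hφ).exists_contDiff
  have hθ0 : θ 0 = 0 := by
    have := hθe.self_of_nhds
    simpa only [hφ0, c.τ_s] using this
  have hθb : Function.Bijective (fderiv ℝ θ 0) := by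
    have e1 : HasFDerivAt (fun q => c.τ (φ q)) ((fderiv ℝ c.τ s).comp (fderiv ℝ φ 0)) 0 := by
      refine HasFDerivAt.comp 0 ?_ hφ.differentiableAt.hasFDerivAt
      rw [hφ0]
      exact c.smooth_τ.differentiableAt.hasFDerivAt
    rw [(e1.congr_of_eventuallyEq hθe).fderiv]
    exact (bijective_fderiv_τ c).comp hφb
  obtain ⟨Ψ', hΨ', hΨe⟩ := (SmoothNear.comp (g := fun y => A.symm (y - x s)) (f := Ψ)
    (ContDiff.smoothNear (A.symm.contDiff.comp (contDiff_id.sub contDiff_const)) _)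
    hΨ).exists_contDiff
  have hΨ0 : Ψ 0 = x s := by
    have := hφΨ.self_of_nhds
    rw [hφ0, standardSwallowtail_zero] at this
    exact this.symm
  have hΨ'0 : Ψ' 0 = 0 := by
    have := hΨe.self_of_nhds
    simpa only [hΨ0, sub_self, map_zero] using this
  have hΨ'd : ∀ v, fderiv ℝ Ψ' 0 v = ![v 1, v 2, v 0] := by
    intro v
    have e1 : HasFDerivAt (fun y => A.symm (Ψ y - x s))
        ((A.symm : Space →L[ℝ] Space).comp (fderiv ℝ Ψ 0)) 0 :=
      A.symm.hasFDerivAt.comp 0 (hΨ.differentiableAt.hasFDerivAt.sub_const _)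
    rw [(e1.congr_of_eventuallyEq hΨe).fderiv, ← hT]
    change A.symm (T v) = _
    rw [ContinuousLinearEquiv.symm_apply_eq, hA', ← hT]
    refine congrArg (fun y => T y) ?_
    ext i
    fin_cases i <;> simp
  have hfr : ∀ᶠ q in 𝓝 (0 : Par), legendreFront f (θ q) = Ψ' (standardSwallowtail q) := by
    filter_upwards [hθe, hst.eventually hΨe, hφΨ, hφt.eventually c.right_inv,
      (c.tendsto_τ.comp hφt).eventually c.x_eq] with q q1 q2 q3 q4 q5
    rw [Function.comp_apply, q4, hcA] at q5
    rw [q1, q2, ← q3, q5]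
    simp
  obtain ⟨j0, ja, jb, jaa, jab, jbb, jaaa, jaab, jne⟩ :=
    jets_of_swallowtail hf hθ hθ0 hθb hΨ' hΨ'0 hΨ'd hfr
  set k := pb (pb f) 0 with hk
  set d := pa (pa (pb f)) 0 with hd
  set m := pa (pa (pa (pa f))) 0 with hm
  have hβ : -d / (2 * k) ≠ 0 := div_ne_zero (neg_ne_zero.2 jaab) (mul_ne_zero two_ne_zero jbb)
  have hr : 4 * k / d ^ 2 ≠ 0 := div_ne_zero (mul_ne_zero four_ne_zero jbb) (pow_ne_zero 2 jaab)
  -- The scaling multiplies `f_bb`, `f_aab` and `f_aaaa` by `r β²`, `r β` and `r`. Normalizing the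
  -- first two to `1` and `-2` determines `β` and `r`, and the third, written `12ρ`, gives `ρ = m k
  -- / (3 d²)`.
  set β := -d / (2 * k) with hβd
  set r := 4 * k / d ^ 2 with hrd
  have ca := contDiff_pa hf
  have cb := contDiff_pb hf
  have cab := contDiff_pa cb
  have caa := contDiff_pa ca
  have caaa := contDiff_pa caa
  have hz : ((0 : Par).1, β * (0 : Par).2) = (0 : Par) := by simp
  refine ⟨m * k / (3 * d ^ 2), fun q => r * f (q.1, β * q.2), ?_, ?_, ?_, ⟨c.rescale hr hβ⟩⟩
  · rw [Ne, div_eq_one_iff_eq (by positivity)]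
    exact jne
  · constructor
    · fun_prop
    · simp only [hz, j0, mul_zero]
    · simp only [pa_rescale hf, hz, ja, mul_zero]
    · simp only [pb_rescale hf, hz, jb, mul_zero]
    · simp only [pa_rescale hf, pa_rescale ca, hz, jaa, mul_zero]
    · simp only [pb_rescale hf, pa_rescale cb, hz, jab, mul_zero]
    · simp only [pb_rescale hf, pb_rescale cb, hz]
      rw [← hk, hrd, hβd]
      field_simp
      ring
    · simp only [pa_rescale hf, pa_rescale ca, pa_rescale caa, hz, jaaa, mul_zero]
    · simp only [pb_rescale hf, pa_rescale cb, pa_rescale cab, hz]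
      rw [← hd, hrd, hβd]
      field_simp
      ring
    · simp only [pa_rescale hf, pa_rescale ca, pa_rescale caa, pa_rescale caaa, hz]
      rw [← hm, hrd]
      field_simp
      ring
  · have dθ : HasFDerivAt (fun q => ((θ q).1, β⁻¹ * (θ q).2))
        (((ContinuousLinearMap.fst ℝ ℝ ℝ).prod (β⁻¹ • ContinuousLinearMap.snd ℝ ℝ ℝ)).comp
          (fderiv ℝ θ 0)) 0 :=
      (hasFDerivAt_scaleSnd β⁻¹ (θ 0)).comp 0 (hθ.differentiable (by simp) 0).hasFDerivAt
    refine ⟨fun q => ((θ q).1, β⁻¹ * (θ q).2), fun y => diagScale r β hr hβ (Ψ' y),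
      ContDiff.smoothNear (by fun_prop) 0, by simp [hθ0], ?_,
      ContDiff.smoothNear ((diagScale r β hr hβ).contDiff.comp hΨ') 0, ?_, ?_⟩
    · rw [dθ.fderiv]
      refine Function.Bijective.comp (g := fun w : Par => (w.1, β⁻¹ * w.2)) ?_ hθb
      exact Function.bijective_iff_has_inverse.2 ⟨fun w => (w.1, β * w.2),
        fun w => by simp [mul_inv_cancel_left₀ hβ], fun w => by simp [inv_mul_cancel_left₀ hβ]⟩
    · have e1 : HasFDerivAt (fun y => diagScale r β hr hβ (Ψ' y))
          ((diagScale r β hr hβ : Space →L[ℝ] Space).comp (fderiv ℝ Ψ' 0)) 0 :=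
        (diagScale r β hr hβ).hasFDerivAt.comp 0 (hΨ'.differentiable (by simp) 0).hasFDerivAt
      rw [e1.fderiv]
      refine (diagScale r β hr hβ).bijective.comp ?_
      have : (fun v => fderiv ℝ Ψ' 0 v) = rotateCoords := funext hΨ'd
      change Function.Bijective (fun v => fderiv ℝ Ψ' 0 v)
      rw [this]
      exact rotateCoords.bijective
    · filter_upwards [hfr] with q hq
      rw [legendreFront_rescale hf hr hβ, ← hq]
      congr 2
      simp [mul_inv_cancel_left₀ hβ]

/-! ### A front with prescribed cr-invariant -/

/-- The polynomial normal form of a godron with cr-invariant `ρ`. -/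
noncomputable def godronModel (ρ : ℝ) (q : Par) : ℝ :=
  q.2 ^ 2 / 2 - q.1 ^ 2 * q.2 + ρ * q.1 ^ 4 / 2

theorem contDiff_godronModel (ρ : ℝ) : ContDiff ℝ ∞ (godronModel ρ) := by
  unfold godronModel
  fun_prop

theorem hasDerivAt_pa {F : Par → ℝ} (hF : ContDiff ℝ ∞ F) (q : Par) :
    HasDerivAt (fun t : ℝ => F (t, q.2)) (pa F q) q.1 :=
  (hasFDerivAt_of_smooth hF q).comp_hasDerivAt q.1
    ((hasDerivAt_id q.1).prodMk (hasDerivAt_const q.1 q.2))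

theorem hasDerivAt_pb {F : Par → ℝ} (hF : ContDiff ℝ ∞ F) (q : Par) :
    HasDerivAt (fun t : ℝ => F (q.1, t)) (pb F q) q.2 :=
  (hasFDerivAt_of_smooth hF q).comp_hasDerivAt q.2
    ((hasDerivAt_const q.2 q.1).prodMk (hasDerivAt_id q.2))

theorem pa_godronModel (ρ : ℝ) :
    pa (godronModel ρ) = fun q => -2 * q.1 * q.2 + 2 * ρ * q.1 ^ 3 := by
  funext q
  refine (hasDerivAt_pa (contDiff_godronModel ρ) q).unique ?_
  unfold godronModel
  exact ((((hasDerivAt_const q.1 (q.2 ^ 2 / 2)).sub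
    ((hasDerivAt_pow 2 q.1).mul_const q.2))).add
    (((hasDerivAt_pow 4 q.1).const_mul ρ).div_const 2)).congr_deriv (by norm_num; ring)

theorem pb_godronModel (ρ : ℝ) : pb (godronModel ρ) = fun q => q.2 - q.1 ^ 2 := by
  funext q
  refine (hasDerivAt_pb (contDiff_godronModel ρ) q).unique ?_
  unfold godronModel
  exact ((((hasDerivAt_pow 2 q.2).div_const 2).sub
    ((hasDerivAt_id q.2).const_mul (q.1 ^ 2))).add
    (hasDerivAt_const q.2 (ρ * q.1 ^ 4 / 2))).congr_deriv (by norm_num)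

theorem godronForm_godronModel (ρ : ℝ) : GodronForm (godronModel ρ) ρ := by
  have e1 : pa (fun q : Par => -2 * q.1 * q.2 + 2 * ρ * q.1 ^ 3) =
      fun q => -2 * q.2 + 6 * ρ * q.1 ^ 2 := by
    funext q
    refine (hasDerivAt_pa (by fun_prop) q).unique ?_
    exact ((((hasDerivAt_id q.1).const_mul (-2)).mul_const q.2).add
      ((hasDerivAt_pow 3 q.1).const_mul (2 * ρ))).congr_deriv (by norm_num; ring)
  have e2 : pa (fun q : Par => -2 * q.2 + 6 * ρ * q.1 ^ 2) = fun q => 12 * ρ * q.1 := by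
    funext q
    refine (hasDerivAt_pa (by fun_prop) q).unique ?_
    exact ((hasDerivAt_const q.1 (-2 * q.2)).add
      ((hasDerivAt_pow 2 q.1).const_mul (6 * ρ))).congr_deriv (by norm_num; ring)
  have e3 : pa (fun q : Par => 12 * ρ * q.1) = fun _ => 12 * ρ := by
    funext q
    refine (hasDerivAt_pa (by fun_prop) q).unique ?_
    exact ((hasDerivAt_id q.1).const_mul (12 * ρ)).congr_deriv (by norm_num)
  have e4 : pa (fun q : Par => q.2 - q.1 ^ 2) = fun q => -2 * q.1 := by
    funext q
    refine (hasDerivAt_pa (by fun_prop) q).unique ?_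
    exact ((hasDerivAt_const q.1 q.2).sub (hasDerivAt_pow 2 q.1)).congr_deriv (by norm_num)
  have e5 : pb (fun q : Par => q.2 - q.1 ^ 2) = fun _ => 1 := by
    funext q
    refine (hasDerivAt_pb (by fun_prop) q).unique ?_
    exact (hasDerivAt_id q.2).sub_const (q.1 ^ 2)
  have e6 : pa (fun q : Par => -2 * q.1) = fun _ => -2 := by
    funext q
    refine (hasDerivAt_pa (by fun_prop) q).unique ?_
    exact ((hasDerivAt_id q.1).const_mul (-2)).congr_deriv (by norm_num)
  constructor
  · exact contDiff_godronModel ρ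
  · simp [godronModel]
  all_goals simp only [pa_godronModel, pb_godronModel, e1, e2, e3, e4, e5, e6]
  all_goals simp

theorem hasFDerivAt_conormal (q : Par) :
    HasFDerivAt (fun q : Par => (![q.1, q.2, 1] : Space))
      (ContinuousLinearMap.pi ![ContinuousLinearMap.fst ℝ ℝ ℝ, ContinuousLinearMap.snd ℝ ℝ ℝ, 0])
      q := by
  rw [hasFDerivAt_pi']
  intro i
  fin_cases i
  · exact hasFDerivAt_fst
  · exact hasFDerivAt_snd
  · exact hasFDerivAt_const _ _

theorem isFront_legendreFront {f : Par → ℝ} (hf : ContDiff ℝ ∞ f) (s : Par) :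
    IsFront (legendreFront f) (fun q => ![q.1, q.2, 1]) s := by
  refine ⟨ContDiff.smoothNear (contDiff_legendreFront hf) s, ContDiff.smoothNear ?_ s,
    Eventually.of_forall fun p => ⟨fun h => ?_, fun v => ?_, fun v _ hv => ?_⟩⟩
  · rw [contDiff_pi]
    intro i
    fin_cases i
    · exact contDiff_fst
    · exact contDiff_snd
    · exact contDiff_const
  · simpa using congrFun h 2
  · rw [fderiv_legendreFront hf]
    simp [dotProduct, Fin.sum_univ_three]
  · obtain ⟨k, hk⟩ := Submodule.mem_span_singleton.1 hv
    rw [(hasFDerivAt_conormal p).fderiv] at hk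
    have h0 : k = 0 := by simpa using congrFun hk 2
    subst h0
    ext
    · simpa using (congrFun hk 0).symm
    · simpa using (congrFun hk 1).symm

/-- The front of a support function, as its own chart. -/
noncomputable def legendreFrontChart {f : Par → ℝ} (hf : ContDiff ℝ ∞ f)
    (h0 : legendreFront f 0 = 0) :
    LegendreChart (legendreFront f) (fun q => ![q.1, q.2, 1]) 0 f where
  σ := id
  τ := id
  A := ContinuousLinearEquiv.refl ℝ Space
  B := ContinuousLinearEquiv.refl ℝ Space
  μ := fun _ => 1
  contDiff := hf
  smooth_σ := ContDiff.smoothNear contDiff_id 0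
  σ_zero := rfl
  smooth_τ := ContDiff.smoothNear contDiff_id 0
  left_inv := Eventually.of_forall fun _ => rfl
  right_inv := Eventually.of_forall fun _ => rfl
  dual := fun _ _ => rfl
  smooth_μ := ContDiff.smoothNear contDiff_const 0
  μ_zero := one_ne_zero
  x_eq := Eventually.of_forall fun q => by simp [h0]
  n_eq := Eventually.of_forall fun q => by simp

/-- The new parameter `v` is chosen so that `f_b = b - a²` becomes `(1 - ρ)/2 * v`. The front is
then the standard swallowtail followed by a polynomial map, a local diffeomorphism when `ρ ≠ 1`. -/
theorem legendreFront_godronModel (ρ : ℝ) (q : Par) :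
    legendreFront (godronModel ρ) (q.1, (1 - ρ) / 2 * q.2 + q.1 ^ 2) =
      ![-((1 - ρ) / 2) * standardSwallowtail q 1, (1 - ρ) / 2 * standardSwallowtail q 2,
        (1 - ρ) / 2 * standardSwallowtail q 0 -
          ((1 - ρ) / 2 * standardSwallowtail q 2) ^ 2 / 2] := by
  ext i
  fin_cases i
  · simp [legendreFront, pa_godronModel, standardSwallowtail]
    ring
  · simp [legendreFront, pb_godronModel, standardSwallowtail]
  · simp [legendreFront, legendreHeight, pa_godronModel, pb_godronModel, standardSwallowtail,
      godronModel]
    ring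

theorem isSwallowtailForm_godronModel {ρ : ℝ} (hρ : ρ ≠ 1) :
    IsSwallowtailForm (godronModel ρ) := by
  have hm : (1 - ρ) / 2 ≠ 0 := div_ne_zero (sub_ne_zero.2 hρ.symm) two_ne_zero
  set m := (1 - ρ) / 2 with hmd
  have d1 : HasFDerivAt (fun q : Par => (q.1, m * q.2 + q.1 ^ 2))
      ((ContinuousLinearMap.fst ℝ ℝ ℝ).prod (m • ContinuousLinearMap.snd ℝ ℝ ℝ)) 0 :=
    (hasFDerivAt_fst.prodMk (((ContinuousLinearMap.snd ℝ ℝ ℝ).hasFDerivAt.const_mul m).add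
      ((ContinuousLinearMap.fst ℝ ℝ ℝ).hasFDerivAt.pow 2))).congr_fderiv (by ext <;> simp)
  have d2 : HasFDerivAt (fun y : Space => (![-m * y 1, m * y 2, m * y 0 - (m * y 2) ^ 2 / 2] : Space))
      (ContinuousLinearMap.pi ![-m • ContinuousLinearMap.proj (R := ℝ) (φ := fun _ : Fin 3 => ℝ) 1,
        m • ContinuousLinearMap.proj 2, m • ContinuousLinearMap.proj 0]) 0 := by
    rw [hasFDerivAt_pi']
    intro i
    fin_cases i
    · exact (hasFDerivAt_apply (1 : Fin 3) (0 : Space)).const_mul (-m)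
    · exact (hasFDerivAt_apply (2 : Fin 3) (0 : Space)).const_mul m
    · refine (((hasFDerivAt_apply (0 : Fin 3) (0 : Space)).const_mul m).sub
        ((((hasFDerivAt_apply (2 : Fin 3) (0 : Space)).const_mul m).pow 2).mul_const
          (2⁻¹ : ℝ))).congr_fderiv ?_
      ext v
      simp
  refine ⟨fun q => (q.1, m * q.2 + q.1 ^ 2),
    fun y => ![-m * y 1, m * y 2, m * y 0 - (m * y 2) ^ 2 / 2],
    ContDiff.smoothNear (by fun_prop) 0, by simp, ?_, ContDiff.smoothNear ?_ 0, ?_,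
    Eventually.of_forall (legendreFront_godronModel ρ)⟩
  · rw [d1.fderiv]
    exact Function.bijective_iff_has_inverse.2 ⟨fun w => (w.1, m⁻¹ * w.2),
      fun w => by simp [inv_mul_cancel_left₀ hm], fun w => by simp [mul_inv_cancel_left₀ hm]⟩
  · rw [contDiff_pi]
    intro i
    fin_cases i <;> simp <;> fun_prop
  · rw [d2.fderiv]
    refine Function.bijective_iff_has_inverse.2
      ⟨fun w => ![m⁻¹ * w 2, -m⁻¹ * w 0, m⁻¹ * w 1], fun w => ?_, fun w => ?_⟩ <;>
    · ext i
      fin_cases i <;> simp [hm]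

theorem exists_swallowtail_of_crInvariant {ρ : ℝ} (hρ : ρ ≠ 1) :
    ∃ (x n : Par → Space) (s : Par), IsGenericSwallowtail x n s ∧ IsCrInvariant x n s ρ := by
  have hG := godronForm_godronModel ρ
  have hs := isSwallowtailForm_godronModel hρ
  have hF := isFront_legendreFront hG.contDiff 0
  have h0 : legendreFront (godronModel ρ) 0 = 0 := by
    ext i
    fin_cases i <;> simp [legendreFront, legendreHeight, hG.zero, hG.a, hG.b]
  let c := legendreFrontChart hG.contDiff h0
  exact ⟨_, _, 0, ⟨hF, hs, c.regularAt_dual.self_of_nhds⟩,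
    (c.isCrInvariant_iff hF hG hρ hs).2 rfl⟩

end Swallowtail

open Swallowtail in
theorem theorem14 :
    -- every swallowtail point of a front in general position
    (∀ (x n : Par → Space) (s : Par), IsGenericSwallowtail x n s →
      ∃ ρ : ℝ, IsCrInvariant x n s ρ ∧ (∀ ρ' : ℝ, IsCrInvariant x n s ρ' → ρ' = ρ) ∧
        ρ ≠ 1 ∧ (IsEllipticSwallowtail x s ↔ 1 < ρ) ∧ (IsHyperbolicSwallowtail x s ↔ ρ < 1) ∧
        -- `F`: flecnodal curve, `E`: cuspidal edge, `D`: self-intersection line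
        ∃ F E D : ℝ → Par,
          ParametrizesGerm F s (fun _ => flecnodalSet (homog x)) ∧
          ParametrizesGerm E s (fun _ => cuspidalEdge x) ∧
          ParametrizesGerm D s (selfIntersection x) ∧
          -- position of `F` with respect to `E` and `D`
          SeparatesLeftRight x n F ∧
          (ρ ≠ 0 → ρ ≠ -1 / 2 → IsSemicubicCusp (x ∘ F) ∧ IsSemicubicCusp (x ∘ E) ∧
            (SameDirection (x ∘ F) (x ∘ E) ∨ OppositeDirection (x ∘ F) (x ∘ E))) ∧
          (1 < ρ → SeparatesLocally x s E F D ∧ SameDirection (x ∘ F) (x ∘ E)) ∧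
          (0 < ρ ∧ ρ < 1 → SeparatesLocally x s F E D) ∧
          (-1 / 2 < ρ ∧ ρ < 0 → LiesBetweenBranches (x ∘ D) (x ∘ F) ∧
            SeparatesLocally x s D F E ∧ SameDirection (x ∘ F) (x ∘ E)) ∧
          (ρ < -1 / 2 → OppositeDirection (x ∘ F) (x ∘ E)) ∧
          -- position with respect to the tangent plane at the swallowtail point: (e₁)
          (4 / 3 < ρ → (∀ᶠ p in 𝓝[≠] s, 0 < height x n s p) ∨
            (∀ᶠ p in 𝓝[≠] s, height x n s p < 0)) ∧
          (ρ < 4 / 3 → ρ ≠ 0 → ∃ Cm Cp : ℝ → Par,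
            TangentSectionIsTwoCusps x n s Cm Cp ∧ SameDirection (x ∘ Cm) (x ∘ E) ∧
            (1 < ρ → SameDirection (x ∘ Cp) (x ∘ E) ∧
              (∀ᶠ t in 𝓝[≠] (0 : ℝ), EllipticAt (homog x) (Cm t)) ∧
              (∀ᶠ t in 𝓝[≠] (0 : ℝ), HyperbolicAt (homog x) (Cp t))) ∧
            (ρ < 1 → OppositeDirection (x ∘ Cp) (x ∘ E) ∧
              (∀ᶠ t in 𝓝[≠] (0 : ℝ), HyperbolicAt (homog x) (Cm t)) ∧
              (∀ᶠ t in 𝓝[≠] (0 : ℝ), HyperbolicAt (homog x) (Cp t))) ∧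
            -- (e₂)
            (√7 / 2 < ρ ∧ ρ < 4 / 3 →
              SeparatesLocally x s Cp E F ∧ SeparatesLocally x s Cm E D ∧
              SameSide x n s F D ∧ OppositeSides x n s E F ∧ OppositeSides x n s E D) ∧
            -- (e₃)
            (1 < ρ ∧ ρ < √7 / 2 →
              SeparatesLocally x s F E Cp ∧ SeparatesLocally x s Cm E D ∧
              SameSide x n s E F ∧ OppositeSides x n s E D ∧ OppositeSides x n s F D) ∧
            -- (h₁)
            (0 < ρ ∧ ρ < 1 → SeparatesLocally x s Cm F D ∧
              SameSide x n s E F ∧ OppositeSides x n s E D ∧ OppositeSides x n s F D) ∧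
            -- (h₂)
            (-1 / 2 < ρ ∧ ρ < 0 → SeparatesLocally x s Cm F D ∧
              SameSide x n s E D ∧ OppositeSides x n s F E ∧ OppositeSides x n s F D) ∧
            -- (h₃,₁)
            (-√7 / 2 < ρ ∧ ρ < -1 / 2 →
              SameSide x n s E D ∧ OppositeSides x n s F E ∧ OppositeSides x n s F D) ∧
            -- (h₃,₂)
            (ρ < -√7 / 2 →
              SameSide x n s F E ∧ SameSide x n s F D ∧ SameSide x n s E D))) ∧
    -- every value of the cr-invariant other than `1` occurs, hence all seven configurations do
    (∀ ρ : ℝ, ρ ≠ 1 → ∃ (x n : Par → Space) (s : Par),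
      IsGenericSwallowtail x n s ∧ IsCrInvariant x n s ρ) := by
  refine ⟨fun x n s h => ?_, fun ρ hρ => exists_swallowtail_of_crInvariant hρ⟩
  obtain ⟨ρ, f, hρ, hG, hs, ⟨c⟩⟩ := h.exists_godronForm
  exact ⟨ρ, (c.isCrInvariant_iff h.1 hG hρ hs).2 rfl,
    fun _ h' => (c.isCrInvariant_iff h.1 hG hρ hs).1 h', hρ, c.configuration h.1 hG hρ hs⟩
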